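/- A branch decomposition $(T,\delta)$ of a finite simple graph $G$ consists of a tree $T$ of maximum degree at most $3$ and a bijection $\delta$ from the leaves of $T$ to $V(G)$ (the node of a one-node tree counts as a leaf). Every edge $e$ of $T$ induces a cut $(A,V(G)\setminus A)$ of $G$, given by the leaves in the two components of $T-e$. A cut $(A,V(G)\setminus A)$ is a split if both sides have at least two vertices and all vertices of $A$ that have a neighbour outside $A$ have the same neighbours outside $A$. Put $\operatorname{sm}(A)=1$ if $(A,V(G)\setminus A)$ is a split, and otherwise let $\operatorname{sm}(A)$ be the maximum size of a matching of the bipartite graph formed by the edges of $G$ between $A$ and $V(G)\setminus A$. The sm-width of $(T,\delta)$ is the maximum of $\operatorname{sm}(A)$ over all cuts induced by edges of $T$ (and $0$ if $T$ has no edge). An edge dominating set of $G$ is a set $E'\subseteq E(G)$ such that every edge of $G$ belongs to $E'$ or shares an endpoint with an edge in $E'$. **Theorem.** Edge Dominating Set can be solved in time $\mathcal{O}^*(3^{5k})$ on graphs given with a branch decomposition of sm-width $k$. Precisely: there are an algorithm (a random access machine program with logarithmic cost) and a polynomial $p$ such that, for every finite graph $G$ and every branch decomposition $(T,\delta)$ of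 $G$, of sm-width $k$ say, the algorithm on input $(G,T,\delta)$ computes the minimum size of an edge dominating set of $G$ in time at most $3^{5k}\cdot p(|V(G)|+|V(T)|)$. -/

import Mathlib

/-! ### Edge dominating sets -/

namespace EDS

variable {V : Type*}

/-- `E'` is an edge dominating set of `G`: a set of edges of `G` such that every edge of `G` is in
`E'` or shares an endpoint with an edge in `E'`. -/
def IsEdgeDominating (G : SimpleGraph V) (E' : Finset (Sym2 V)) : Prop :=
  (∀ e ∈ E', e ∈ G.edgeSet) ∧
    ∀ e ∈ G.edgeSet, e ∈ E' ∨ ∃ e' ∈ E', ∃ v, v ∈ e ∧ v ∈ e'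

/-- The yes-instances `(G, t)` of `t`-Edge Dominating Set. -/
def HasEdgeDominatingSet (G : SimpleGraph V) (t : ℕ) : Prop :=
  ∃ E' : Finset (Sym2 V), IsEdgeDominating G E' ∧ E'.card ≤ t

/-! ### Split-matching-width -/

/-- The cut `(A, Aᶜ)` is a split of `G`: both sides have at least two vertices, and any two
vertices of `A` that have a neighbour in `Aᶜ` have the same neighbourhood in `Aᶜ`. -/
def IsSplit (G : SimpleGraph V) (A : Set V) : Prop :=
  2 ≤ A.ncard ∧ 2 ≤ Aᶜ.ncard ∧
    ∀ u ∈ A, ∀ v ∈ A, (G.neighborSet u ∩ Aᶜ).Nonempty → (G.neighborSet v ∩ Aᶜ).Nonempty →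
      G.neighborSet u ∩ Aᶜ = G.neighborSet v ∩ Aᶜ

/-- `M` is a matching of `G`: a set of edges of `G`, no two of which have a common endpoint. -/
def IsMatching (G : SimpleGraph V) (M : Finset (Sym2 V)) : Prop :=
  (∀ e ∈ M, e ∈ G.edgeSet) ∧ ∀ e ∈ M, ∀ f ∈ M, ∀ v, v ∈ e → v ∈ f → e = f

/-- `mm(A)`: the maximum size of a matching of the bipartite graph `G[A, Aᶜ]`. -/
noncomputable def mm (G : SimpleGraph V) (A : Set V) : ℕ :=
  sSup {k | ∃ M : Finset (Sym2 V), IsMatching (G.between A Aᶜ) M ∧ M.card = k}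

open Classical in
/-- The cut function `sm`. -/
noncomputable def sm (G : SimpleGraph V) (A : Set V) : ℕ :=
  if IsSplit G A then 1 else mm G A

/-- A leaf of a tree: a node of degree at most one. The only node of a one-node tree is a leaf. -/
def IsLeaf {W : Type*} (T : SimpleGraph W) (w : W) : Prop :=
  (T.neighborSet w).ncard ≤ 1

/-- A branch decomposition of a graph with vertex set `V`: a tree (on `W`) of maximum degree at
most three together with a bijection from its leaves to `V`. -/
structure BranchDecomposition (V W : Type*) where
  tree : SimpleGraph W
  isTree : tree.IsTree
  subcubic : ∀ w, (tree.neighborSet w).ncard ≤ 3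
  leafEquiv : {w : W // IsLeaf tree w} ≃ V

namespace BranchDecomposition

variable {W : Type*}

/-- For an edge `uv` of the tree, the vertices mapped from the leaves of that component of
`T - uv` which contains `u`. -/
def side (D : BranchDecomposition V W) (u v : W) : Set V :=
  {x | (D.tree.deleteEdges {s(u, v)}).Reachable u (D.leafEquiv.symm x).1}

/-- The sm-width of a branch decomposition of `G`: the maximum of `sm` over all cuts induced by
the edges of the tree (`0` if the tree has no edges). -/
noncomputable def smWidth (D : BranchDecomposition V W) (G : SimpleGraph V) : ℕ :=
  sSup {k | ∃ u v, D.tree.Adj u v ∧ k = sm G (D.side u v)}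

end BranchDecomposition

/-! ### A random access machine with logarithmic cost

Programs work on registers `0, 1, 2, …` and on arrays `0, 1, 2, …`, whose cells hold natural
numbers. Registers and arrays are named in the program text, so that a program uses only finitely
many of them; the position inside an array is computed at run time. Every operation is charged
the bit lengths of the numbers involved. -/

/-- The contents of the registers and of the arrays. -/
structure Store where
  reg : ℕ → ℕ
  arr : ℕ → ℕ → ℕ

/-- Overwrite register `x` by `c`. -/
def Store.setReg (s : Store) (x c : ℕ) : Store :=
  ⟨Function.update s.reg x c, s.arr⟩

/-- Overwrite position `i` of array `a` by `c`. -/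
def Store.setCell (s : Store) (a i c : ℕ) : Store :=
  ⟨s.reg, Function.update s.arr a (Function.update (s.arr a) i c)⟩

/-- Arithmetic operations: truncated subtraction, division with remainder, comparisons. -/
inductive Op
  | plus | minus | times | quot | rem | less | equal

/-- The value of an operation; a comparison returns `1` if it holds and `0` otherwise. -/
def Op.eval : Op → ℕ → ℕ → ℕ
  | .plus, a, b => a + b
  | .minus, a, b => a - b
  | .times, a, b => a * b
  | .quot, a, b => a / b
  | .rem, a, b => a % b
  | .less, a, b => if a < b then 1 else 0
  | .equal, a, b => if a = b then 1 else 0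

/-- Expressions: constants, registers, array cells, operations. -/
inductive Expr
  | const (c : ℕ)
  | reg (x : ℕ)
  | cell (a : ℕ) (i : Expr)
  | op (o : Op) (e f : Expr)

/-- The value of an expression. -/
def Expr.eval (s : Store) : Expr → ℕ
  | .const c => c
  | .reg x => s.reg x
  | .cell a i => s.arr a (i.eval s)
  | .op o e f => o.eval (e.eval s) (f.eval s)

/-- The cost of evaluating an expression: one plus the bit length of the value, for each of its
subexpressions. -/
def Expr.cost (s : Store) : Expr → ℕ
  | .const c => 1 + Nat.size c
  | .reg x => 1 + Nat.size (s.reg x)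
  | .cell a i => i.cost s + 1 + Nat.size (s.arr a (i.eval s))
  | .op o e f => e.cost s + f.cost s + 1 + Nat.size (o.eval (e.eval s) (f.eval s))

/-- Programs. -/
inductive Prog
  | skip
  | assign (x : ℕ) (e : Expr)
  | write (a : ℕ) (i e : Expr)
  | seq (p q : Prog)
  | cond (e : Expr) (p q : Prog)
  | loop (e : Expr) (p : Prog)

/-- `Runs p s r t`: started on the store `s`, the program `p` halts with store `r` after a
computation of total cost `t`. A condition counts as true if its value is not `0`. -/
inductive Runs : Prog → Store → Store → ℕ → Prop
  | skip (s) : Runs .skip s s 1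
  | assign (s x e) : Runs (.assign x e) s (s.setReg x (e.eval s)) (1 + e.cost s)
  | write (s a i e) :
      Runs (.write a i e) s (s.setCell a (i.eval s) (e.eval s)) (1 + i.cost s + e.cost s)
  | seq {p q s r w t₁ t₂} : Runs p s r t₁ → Runs q r w t₂ → Runs (.seq p q) s w (t₁ + t₂)
  | cond_true {e p q s r t} : e.eval s ≠ 0 → Runs p s r t →
      Runs (.cond e p q) s r (1 + e.cost s + t)
  | cond_false {e p q s r t} : e.eval s = 0 → Runs q s r t →
      Runs (.cond e p q) s r (1 + e.cost s + t)
  | loop_stop {e p s} : e.eval s = 0 → Runs (.loop e p) s s (1 + e.cost s)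
  | loop_step {e p s r w t₁ t₂} : e.eval s ≠ 0 → Runs p s r t₁ → Runs (.loop e p) r w t₂ →
      Runs (.loop e p) s w (1 + e.cost s + t₁ + t₂)

/-- Computations are deterministic: the final store and the cost depend only on the program and
on the initial store. -/
theorem Runs.deterministic {p : Prog} {s r₁ r₂ : Store} {t₁ t₂ : ℕ}
    (h₁ : Runs p s r₁ t₁) (h₂ : Runs p s r₂ t₂) : r₁ = r₂ ∧ t₁ = t₂ := by
  induction h₁ generalizing r₂ t₂ with
  | skip => cases h₂; exact ⟨rfl, rfl⟩
  | assign => cases h₂; exact ⟨rfl, rfl⟩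
  | write => cases h₂; exact ⟨rfl, rfl⟩
  | seq _ _ ih₁ ih₂ =>
    cases h₂ with
    | seq a b =>
      obtain ⟨rfl, rfl⟩ := ih₁ a
      obtain ⟨rfl, rfl⟩ := ih₂ b
      exact ⟨rfl, rfl⟩
  | cond_true h _ ih =>
    cases h₂ with
    | cond_true _ a => obtain ⟨rfl, rfl⟩ := ih a; exact ⟨rfl, rfl⟩
    | cond_false g _ => exact absurd g h
  | cond_false h _ ih =>
    cases h₂ with
    | cond_true g _ => exact absurd h g
    | cond_false _ a => obtain ⟨rfl, rfl⟩ := ih a; exact ⟨rfl, rfl⟩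
  | loop_stop h =>
    cases h₂ with
    | loop_stop _ => exact ⟨rfl, rfl⟩
    | loop_step g _ _ => exact absurd h g
  | loop_step h _ _ ih₁ ih₂ =>
    cases h₂ with
    | loop_stop g => exact absurd g h
    | loop_step _ a b =>
      obtain ⟨rfl, rfl⟩ := ih₁ a
      obtain ⟨rfl, rfl⟩ := ih₂ b
      exact ⟨rfl, rfl⟩

/-! ### The input -/

open Classical in
/-- The adjacency matrix of a graph on `{0, …, n - 1}`, stored row by row in an array. -/
noncomputable def adjacencyArray {n : ℕ} (G : SimpleGraph (Fin n)) (c : ℕ) : ℕ :=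
  if ∃ i j : Fin n, c = i.1 * n + j.1 ∧ G.Adj i j then 1 else 0

open Classical in
/-- The array that holds at every leaf of the decomposition tree the vertex it is mapped to, and
`0` elsewhere. -/
noncomputable def leafArray {n m : ℕ} (D : BranchDecomposition (Fin n) (Fin m)) (c : ℕ) : ℕ :=
  if h : ∃ hc : c < m, IsLeaf D.tree ⟨c, hc⟩ then (D.leafEquiv ⟨⟨c, h.fst⟩, h.snd⟩).1 else 0

/-- The initial store for a graph `G` on `n` vertices with a branch decomposition whose tree has
`m` nodes: registers `0` and `1` hold `n` and `m`, arrays `0`, `1` and `2` hold the graph, the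
tree and the map from its leaves to the vertices; everything else is `0`. -/
noncomputable def inputStore {n m : ℕ} (G : SimpleGraph (Fin n))
    (D : BranchDecomposition (Fin n) (Fin m)) : Store where
  reg x := if x = 0 then n else if x = 1 then m else 0
  arr a := if a = 0 then adjacencyArray G else if a = 1 then adjacencyArray D.tree
    else if a = 2 then leafArray D else fun _ => 0

end EDS

/-! An edge dominating set acts through its endpoints, which form a vertex cover. Label a vertex `1`
if it is matched to another vertex of label `1`, `2` if it pays for an edge alone, and `0` if it
lies in no chosen edge. A set of edges yields a labelling of weight (sum of the labels) at most
twice its size, and a labelling of weight `w` yields an edge dominating set with at most `w / 2`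
edges (`HasEdgeDominatingSet.exists_isPartial`, `IsPartial.hasEdgeDominatingSet`). So the task is to
minimize the weight, by dynamic programming over the cuts of the tree.

Let `A` be a side of a cut. A vertex of label `2` in `A` is open: it can still be matched to an open
vertex elsewhere, and both labels then drop to `1`. The rest of the graph makes two demands on a
partial solution on `A`: the `A`-neighbours of a set `O` of unlabelled outer vertices must have
labels, and a set `Q` of outer vertices must be matched into the open vertices of `A`. By
`Cut.exists_sat`, a demand that is met is already enforced by one of few signatures. At a split all
boundary vertices have the same outer neighbours, so a bit and a count suffice. At another cut, take
a vertex cover of the crossing edges; a signature has one ternary digit for every cover vertex, and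
demands on vertices outside the cover are expressed by Hall's condition. By König's theorem
(`exists_covers`) the cover has at most `k` vertices. With `κ` the maximum size of the covers, there
are `S = 3 ^ κ * (2 * n + 2)` signatures, and a table that keeps one lightest partial solution per
signature loses nothing.

The join of the tables for disjoint sides `A` and `B` is the costly part. A solution on `A ∪ B` is
cut into two parts, the matched pairs across becoming pairs of open vertices, and the parts are
replaced by table entries (`IsPartial.exists_pending`). A set `M` of vertices of `A` then still has
to be matched into `B`. The vertices of `A` are processed one by one, each being left alone or
matched to a vertex of `B` (`Pending.step`). After every step, candidates with the same key are
merged and the lightest survives. A key consists of the table entry for `A` from which the candidate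
started, which determines the labels of the unprocessed vertices of `A`; a signature at `A`, where
unprocessed open vertices count as closed; and a signature at `B`. `Pending.exists_sat` shows that
merging is safe. There are `S ^ 3` keys, and only `S ^ 2 * (n + 1)` candidates compete for a key
because the entry for `A` is shared. This gives `S ^ 5` up to polynomial factors, hence `3 ^ (5 *
k)`.

The covers are found by exhaustive search: a greedy maximal matching across the cut has at most `k`
edges, and a cover of size at most `mm` can be decoded from one ternary digit per matched edge
(`Pairs.exists_decode`).

For the running time, the algorithm is written in a small language of terms and statements. Its
compiled programs have a cost bounded by a constant, a bit length and one factor per nested loop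
(`Tm.tm_le`, `Stm.tm_le`). The power of `H = 3 ^ min k n` can thus be read off the syntax, and
`solver_hd` finds that it is at most five. -/

namespace EDS

/-! ### Terms with bounded operators -/

/-- Terms: expressions with case distinction, local variables, bounded sums, bounded search and
powers of three. Variables are registers. -/
inductive Tm
  | const (c : ℕ)
  | reg (x : ℕ)
  | cell (a : ℕ) (i : Tm)
  | op (o : Op) (e f : Tm)
  | ite (c e f : Tm)
  | bind (v : ℕ) (e f : Tm)
  | sum (v x : ℕ) (e : Tm)
  | least (v x : ℕ) (e : Tm)
  | pow (v x : ℕ)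

/-- The least `i < N` with `f i ≠ 0`, and `N` if there is none. -/
def leastBelow (f : ℕ → ℕ) : ℕ → ℕ
  | 0 => 0
  | N + 1 => leastBelow f N + if leastBelow f N = N ∧ f N = 0 then 1 else 0

theorem leastBelow_le (f : ℕ → ℕ) (N : ℕ) : leastBelow f N ≤ N := by
  induction N with
  | zero => simp [leastBelow]
  | succ N ih => simp only [leastBelow]; split_ifs <;> omega

theorem leastBelow_spec (f : ℕ → ℕ) (N : ℕ) (h : leastBelow f N < N) : f (leastBelow f N) ≠ 0 := by
  induction N with
  | zero => simp at h
  | succ N ih =>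
    have h1 := leastBelow_le f N
    simp only [leastBelow] at h ⊢
    split_ifs at h ⊢ with h2
    · omega
    · rcases Nat.lt_or_ge (leastBelow f N) N with h3 | h3
      · simpa using ih h3
      · have h4 : leastBelow f N = N := le_antisymm h1 h3
        simp only [h4, true_and] at h2
        simpa [h4] using h2

theorem leastBelow_min (f : ℕ → ℕ) (N j : ℕ) (hj : j < leastBelow f N) : f j = 0 := by
  induction N with
  | zero => simp [leastBelow] at hj
  | succ N ih =>
    simp only [leastBelow] at hj
    split_ifs at hj with h2
    · rcases Nat.lt_or_ge j (leastBelow f N) with h3 | h3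
      · exact ih h3
      · have : j = N := by omega
        rw [this]; exact h2.2
    · exact ih (by omega)

theorem leastBelow_lt_iff (f : ℕ → ℕ) (N : ℕ) : leastBelow f N < N ↔ ∃ i < N, f i ≠ 0 := by
  constructor
  · intro h; exact ⟨_, h, leastBelow_spec f N h⟩
  · rintro ⟨i, hi, h⟩
    by_contra hc
    exact h (leastBelow_min f N i (by omega))

theorem leastBelow_le_of (f : ℕ → ℕ) (N i : ℕ) (h : f i ≠ 0) : leastBelow f N ≤ i := by
  by_contra hc
  exact h (leastBelow_min f N i (by omega))

/-- The value of a term. -/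
def Tm.eval (s : Store) : Tm → ℕ
  | .const c => c
  | .reg x => s.reg x
  | .cell a i => s.arr a (i.eval s)
  | .op o e f => o.eval (e.eval s) (f.eval s)
  | .ite c e f => if c.eval s ≠ 0 then e.eval s else f.eval s
  | .bind v e f => f.eval (s.setReg v (e.eval s))
  | .sum v x e => ∑ i ∈ Finset.range (s.reg x), e.eval (s.setReg v i)
  | .least v x e => leastBelow (fun i => e.eval (s.setReg v i)) (s.reg x)
  | .pow v x => 3 ^ min (s.reg v) (s.reg x)

/-- The program that evaluates a term into register `d`; it uses the registers from `d` on and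
restores all smaller ones. -/
def Tm.compile : ℕ → Tm → Prog
  | d, .const c => .assign d (.const c)
  | d, .reg x => .assign d (.reg x)
  | d, .cell a i => .seq (i.compile d) (.assign d (.cell a (.reg d)))
  | d, .op o e f => .seq (e.compile d) (.seq (f.compile (d + 1))
      (.assign d (.op o (.reg d) (.reg (d + 1)))))
  | d, .ite c e f => .seq (c.compile d) (.cond (.reg d) (e.compile d) (f.compile d))
  | d, .bind v e f => .seq (e.compile d) (.seq (.assign (d + 1) (.reg v)) (.seq (.assign v (.reg d))
      (.seq (f.compile (d + 2)) (.seq (.assign v (.reg (d + 1))) (.assign d (.reg (d + 2)))))))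
  | d, .sum v x e => .seq (.assign d (.const 0)) (.seq (.assign (d + 1) (.reg v))
      (.seq (.assign v (.const 0)) (.seq (.loop (.op .less (.reg v) (.reg x))
        (.seq (e.compile (d + 2)) (.seq (.assign d (.op .plus (.reg d) (.reg (d + 2))))
          (.assign v (.op .plus (.reg v) (.const 1))))))
        (.assign v (.reg (d + 1))))))
  | d, .least v x e => .seq (.assign d (.const 0)) (.seq (.assign (d + 1) (.reg v))
      (.seq (.assign v (.const 0)) (.seq (.loop (.op .less (.reg v) (.reg x))
        (.seq (e.compile (d + 2)) (.seq (.assign d (.op .plus (.reg d)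
            (.op .times (.op .equal (.reg d) (.reg v)) (.op .equal (.reg (d + 2)) (.const 0)))))
          (.assign v (.op .plus (.reg v) (.const 1))))))
        (.assign v (.reg (d + 1))))))
  | d, .pow v x => .seq (.assign d (.const 1)) (.seq (.assign (d + 1) (.const 0))
      (.loop (.op .times (.op .less (.reg (d + 1)) (.reg v)) (.op .less (.reg (d + 1)) (.reg x)))
        (.seq (.assign d (.op .times (.const 3) (.reg d)))
          (.assign (d + 1) (.op .plus (.reg (d + 1)) (.const 1))))))

/-- Loops are bounded by the registers below `25`; register `x` is at most `Q * H ^ cls x`. -/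
def cls (x : ℕ) : ℕ :=
  if x ≤ 8 then 0 else if x ≤ 13 then 1 else if x = 14 then 2 else
  if x = 17 then 4 else if x ≤ 19 then 3 else 0

theorem cls_le (x : ℕ) : cls x ≤ 4 := by unfold cls; split_ifs <;> simp

/-- The values of a term are at most `M ^ deg` if all registers and cells are at most `M`. -/
def Tm.deg : Tm → ℕ
  | .const c => if c ≤ 2 then 1 else c
  | .reg _ => 1
  | .cell _ _ => 1
  | .op .plus e f => max e.deg f.deg + 1
  | .op .times e f => e.deg + f.deg
  | .op .minus e _ => e.deg
  | .op .quot e _ => e.deg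
  | .op .rem e _ => e.deg
  | .op .less _ _ => 0
  | .op .equal _ _ => 0
  | .ite _ e f => max e.deg f.deg
  | .bind _ _ f => f.deg
  | .sum _ _ e => e.deg + 1
  | .least _ _ _ => 1
  | .pow _ _ => 1

/-- Well-formed terms: loops are bounded by registers below `25`, variables are registers from `25`
to `59`, local variables get small values. -/
def Tm.wf : Tm → Bool
  | .const _ => true
  | .reg x => x < 60
  | .cell _ i => i.wf
  | .op _ e f => e.wf && f.wf
  | .ite c e f => c.wf && e.wf && f.wf
  | .bind v e f => 25 ≤ v && v < 60 && e.deg ≤ 1 && e.wf && f.wf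
  | .sum v x e => 25 ≤ v && v < 60 && x < 25 && e.wf
  | .least v x e => 25 ≤ v && v < 60 && x < 25 && e.wf
  | .pow v x => v < 60 && x < 25 && cls x == 0

/-- The arrays that a term reads. -/
def Tm.reads : Tm → List ℕ
  | .const _ => []
  | .reg _ => []
  | .cell a i => a :: i.reads
  | .op _ e f => e.reads ++ f.reads
  | .ite c e f => c.reads ++ e.reads ++ f.reads
  | .bind _ e f => e.reads ++ f.reads
  | .sum _ _ e => e.reads
  | .least _ _ e => e.reads
  | .pow _ _ => []

/-- A bound for the cost of evaluating a term. -/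
def Tm.tm (Q H B : ℕ) : Tm → ℕ
  | .const c => (c + 3) * B
  | .reg _ => 4 * B
  | .cell _ i => i.tm Q H B + (i.deg + 6) * B
  | .op o e f => e.tm Q H B + f.tm Q H B + (e.deg + f.deg + (Tm.op o e f).deg + 7) * B
  | .ite c e f => c.tm Q H B + e.tm Q H B + f.tm Q H B + (c.deg + 3) * B
  | .bind _ e f => e.tm Q H B + f.tm Q H B + (f.deg + 15) * B
  | .sum _ x e => Q * H ^ cls x * (e.tm Q H B + (3 * e.deg + 40) * B) + 25 * B
  | .least _ x e => Q * H ^ cls x * (e.tm Q H B + (3 * e.deg + 60) * B) + 25 * B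
  | .pow _ _ => Q * (50 * B) + 40 * B

/-- The store satisfies the bounds on loop registers and values. -/
structure Good (Q H M : ℕ) (s : Store) : Prop where
  bound : ∀ x < 25, s.reg x ≤ Q * H ^ cls x
  reg_le : ∀ x < 60, s.reg x ≤ M
  arr_le : ∀ a i, s.arr a i ≤ M

/-- The parameters of the bounds are sensible. -/
structure Param (Q H M B : ℕ) : Prop where
  two_le : 2 ≤ M
  pow_le : 3 ^ Q ≤ M
  size_lt : Nat.size M < B

theorem Good.congr {Q H M : ℕ} {s r : Store} (h : Good Q H M s) (hr : ∀ x < 60, r.reg x = s.reg x)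
    (ha : r.arr = s.arr) : Good Q H M r :=
  ⟨fun x hx => by rw [hr x (by omega)]; exact h.bound x hx,
    fun x hx => by rw [hr x hx]; exact h.reg_le x hx, fun a i => by rw [ha]; exact h.arr_le a i⟩

theorem Good.setReg {Q H M : ℕ} {s : Store} (h : Good Q H M s) {v i : ℕ} (hv : 25 ≤ v)
    (hi : i ≤ M) : Good Q H M (s.setReg v i) := by
  refine ⟨fun x hx => ?_, fun x hx => ?_, fun a j => h.arr_le a j⟩
  · simpa [Store.setReg, Function.update_of_ne (show x ≠ v by omega)] using h.bound x hx
  · by_cases hxv : x = v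
    · simpa [Store.setReg, hxv] using hi
    · simpa [Store.setReg, Function.update_of_ne hxv] using h.reg_le x hx

/-- Well-formed terms mention only registers below `60`, so the scratch registers of a compiled
program cannot influence a value. Listing the arrays that are read allows evaluation while another
array is being overwritten. -/
theorem Tm.eval_congr (e : Tm) : ∀ (s r : Store), e.wf → (∀ x < 60, r.reg x = s.reg x) →
    (∀ a ∈ e.reads, r.arr a = s.arr a) → e.eval r = e.eval s := by
  have key : ∀ (s r : Store) (v i : ℕ), (∀ x < 60, r.reg x = s.reg x) →
      ∀ x < 60, (r.setReg v i).reg x = (s.setReg v i).reg x := by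
    intro s r v i h x hx
    by_cases hxv : x = v
    · simp [Store.setReg, hxv]
    · simp [Store.setReg, Function.update_of_ne hxv, h x hx]
  induction e with
  | const c => intros; rfl
  | reg x => intro s r hw h _; exact h x (by simpa [Tm.wf] using hw)
  | cell a i ih =>
    intro s r hw h ha
    simp only [Tm.eval]
    rw [ih s r hw h fun b hb => ha b (by simp [Tm.reads, hb]), ha a (by simp [Tm.reads])]
  | op o e f ihe ihf =>
    intro s r hw h ha
    simp only [Tm.wf, Bool.and_eq_true] at hw
    simp only [Tm.eval]
    rw [ihe s r hw.1 h fun b hb => ha b (by simp [Tm.reads, hb]),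
      ihf s r hw.2 h fun b hb => ha b (by simp [Tm.reads, hb])]
  | ite c e f ihc ihe ihf =>
    intro s r hw h ha
    simp only [Tm.wf, Bool.and_eq_true] at hw
    simp only [Tm.eval]
    rw [ihc s r hw.1.1 h fun b hb => ha b (by simp [Tm.reads, hb]),
      ihe s r hw.1.2 h fun b hb => ha b (by simp [Tm.reads, hb]),
      ihf s r hw.2 h fun b hb => ha b (by simp [Tm.reads, hb])]
  | bind v e f ihe ihf =>
    intro s r hw h ha
    simp only [Tm.wf, Bool.and_eq_true] at hw
    simp only [Tm.eval]
    rw [ihe s r hw.1.2 h fun b hb => ha b (by simp [Tm.reads, hb])]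
    exact ihf _ _ hw.2 (key s r v _ h) fun b hb => ha b (by simp [Tm.reads, hb])
  | sum v x e ih =>
    intro s r hw h ha
    simp only [Tm.wf, Bool.and_eq_true, decide_eq_true_eq] at hw
    simp only [Tm.eval]
    rw [h x (by omega)]
    exact Finset.sum_congr rfl fun i _ => ih _ _ hw.2 (key s r v i h) ha
  | least v x e ih =>
    intro s r hw h ha
    simp only [Tm.wf, Bool.and_eq_true, decide_eq_true_eq] at hw
    simp only [Tm.eval]
    rw [h x (by omega)]
    congr 1
    funext i
    exact ih _ _ hw.2 (key s r v i h) ha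
  | pow v x =>
    intro s r hw h ha
    simp only [Tm.wf, Bool.and_eq_true, decide_eq_true_eq] at hw
    simp only [Tm.eval]
    rw [h x (by omega), h v (by omega)]

/-- Every operation at most adds degrees. The restriction to degree at most one in `bind` keeps the
variable register below `M`, so the store stays within its bounds inside the body. -/
theorem Tm.eval_le {Q H M B : ℕ} (hp : Param Q H M B) (e : Tm) : ∀ s : Store, e.wf →
    Good Q H M s → e.eval s ≤ M ^ e.deg := by
  have h1 : 1 ≤ M := by have := hp.two_le; omega
  have mono : ∀ {i j}, i ≤ j → M ^ i ≤ M ^ j := fun h => Nat.pow_le_pow_right h1 h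
  have one : ∀ i, 1 ≤ M ^ i := fun i => Nat.one_le_pow _ _ h1
  induction e with
  | const c =>
    intro s _ _
    simp only [Tm.eval, Tm.deg]
    split_ifs with hc
    · rw [pow_one]; exact hc.trans hp.two_le
    · exact (Nat.lt_two_pow_self).le.trans (Nat.pow_le_pow_left hp.two_le c)
  | reg x => intro s hw h; simpa [Tm.eval, Tm.deg] using h.reg_le x (by simpa [Tm.wf] using hw)
  | cell a i ih => intro s hw h; simpa [Tm.eval, Tm.deg] using h.arr_le _ _
  | op o e f ihe ihf =>
    intro s hw h
    simp only [Tm.wf, Bool.and_eq_true] at hw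
    have he := ihe s hw.1 h
    have hf := ihf s hw.2 h
    cases o <;> simp only [Tm.eval, Tm.deg, Op.eval]
    · calc _ ≤ M ^ max e.deg f.deg + M ^ max e.deg f.deg :=
            add_le_add (he.trans (mono (le_max_left _ _))) (hf.trans (mono (le_max_right _ _)))
        _ = M ^ max e.deg f.deg * 2 := by ring
        _ ≤ _ := by rw [pow_succ]; exact Nat.mul_le_mul_left _ hp.two_le
    · exact (Nat.sub_le _ _).trans he
    · rw [pow_add]; exact Nat.mul_le_mul he hf
    · exact (Nat.div_le_self _ _).trans he
    · exact (Nat.mod_le _ _).trans he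
    · split_ifs <;> simp
    · split_ifs <;> simp
  | ite c e f ihc ihe ihf =>
    intro s hw h
    simp only [Tm.wf, Bool.and_eq_true] at hw
    simp only [Tm.eval, Tm.deg]
    split_ifs
    · exact (ihe s hw.1.2 h).trans (mono (le_max_left _ _))
    · exact (ihf s hw.2 h).trans (mono (le_max_right _ _))
  | bind v e f ihe ihf =>
    intro s hw h
    simp only [Tm.wf, Bool.and_eq_true, decide_eq_true_eq] at hw
    refine ihf _ hw.2 (h.setReg hw.1.1.1.1 ?_)
    exact (ihe s hw.1.2 h).trans ((mono hw.1.1.2).trans (by simp))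
  | sum v x e ih =>
    intro s hw h
    simp only [Tm.wf, Bool.and_eq_true, decide_eq_true_eq] at hw
    simp only [Tm.eval, Tm.deg]
    calc _ ≤ ∑ i ∈ Finset.range (s.reg x), M ^ e.deg := by
          refine Finset.sum_le_sum fun i hi => ih _ hw.2 (h.setReg hw.1.1.1 ?_)
          exact (Finset.mem_range.1 hi).le.trans (h.reg_le x (by omega))
      _ = s.reg x * M ^ e.deg := by simp
      _ ≤ M * M ^ e.deg := Nat.mul_le_mul_right _ (h.reg_le x (by omega))
      _ = _ := by ring
  | least v x e ih =>
    intro s hw h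
    simp only [Tm.wf, Bool.and_eq_true, decide_eq_true_eq] at hw
    simp only [Tm.eval, Tm.deg, pow_one]
    exact (leastBelow_le _ _).trans (h.reg_le x (by omega))
  | pow v x =>
    intro s hw h
    simp only [Tm.wf, Bool.and_eq_true, decide_eq_true_eq, beq_iff_eq] at hw
    simp only [Tm.eval, Tm.deg, pow_one]
    refine le_trans (Nat.pow_le_pow_right (by norm_num) ?_) hp.pow_le
    have := h.bound x (by omega)
    rw [hw.2] at this
    simp only [pow_zero, mul_one] at this
    exact (min_le_right _ _).trans this

/-- Logarithmic cost: a value of degree `D` has about `D` times as many bits as `M`, and degrees are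
fixed by the program text, so bit lengths contribute only the factor `B` and constants. -/
theorem Param.size_le {Q H M B : ℕ} (hp : Param Q H M B) {D v : ℕ} (hv : v ≤ M ^ D) :
    Nat.size v ≤ (D + 1) * B := by
  have hB := hp.size_lt
  have h1 : M ^ D ≤ (2 ^ Nat.size M) ^ D := Nat.pow_le_pow_left (Nat.lt_size_self M).le D
  have h2 : v < 2 ^ (Nat.size M * D + 1) := by
    rw [← pow_mul] at h1
    rw [pow_succ]
    have : 0 < 2 ^ (Nat.size M * D) := by positivity
    omega
  have h3 := Nat.size_le.2 h2
  nlinarith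

theorem Param.one_le {Q H M B : ℕ} (hp : Param Q H M B) : 1 ≤ B := by have := hp.size_lt; omega

theorem Param.size_le_two {Q H M B : ℕ} (hp : Param Q H M B) {v : ℕ} (hv : v ≤ M) :
    Nat.size v ≤ 2 * B := hp.size_le (D := 1) (by simpa using hv)

/-- A loop whose number of rounds is known. -/
theorem Runs.loop_count {c : Expr} {p : Prog} (N T C : ℕ) (I : ℕ → Store → Prop)
    (hstep : ∀ i < N, ∀ s, I i s → c.eval s ≠ 0 ∧ c.cost s ≤ C ∧
      ∃ r t, Runs p s r t ∧ t ≤ T ∧ I (i + 1) r)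
    (hexit : ∀ s, I N s → c.eval s = 0 ∧ c.cost s ≤ C) (s : Store) (hs : I 0 s) :
    ∃ r t, Runs (.loop c p) s r t ∧ t ≤ N * (T + C + 1) + (C + 1) ∧ I N r := by
  have key : ∀ j i, i + j = N → ∀ s, I i s →
      ∃ r t, Runs (.loop c p) s r t ∧ t ≤ j * (T + C + 1) + (C + 1) ∧ I N r := by
    intro j
    induction j with
    | zero =>
      intro i hi s hs
      rw [Nat.add_zero] at hi
      subst hi
      obtain ⟨h1, h2⟩ := hexit s hs
      exact ⟨s, _, Runs.loop_stop h1, by omega, hs⟩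
    | succ j ih =>
      intro i hi s hs
      obtain ⟨h1, h2, r, t, h3, h4, h5⟩ := hstep i (by omega) s hs
      obtain ⟨w, u, h6, h7, h8⟩ := ih (i + 1) (by omega) r h5
      exact ⟨w, _, .loop_step h1 h3 h6, by rw [Nat.succ_mul]; omega, h8⟩
  exact key N 0 (by omega) s hs

end EDS

/-! ### Correctness and cost of compiled terms. -/

namespace EDS

theorem Store.setReg_reg_self (s : Store) (x c : ℕ) : (s.setReg x c).reg x = c := by
  simp [Store.setReg]

theorem Store.setReg_reg_ne (s : Store) {x y : ℕ} (c : ℕ) (h : y ≠ x) :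
    (s.setReg x c).reg y = s.reg y := by
  simp [Store.setReg, Function.update_of_ne h]

theorem Store.setReg_arr (s : Store) (x c : ℕ) : (s.setReg x c).arr = s.arr := rfl

theorem Param.size_nat_le {Q H M B : ℕ} (hp : Param Q H M B) (c : ℕ) : Nat.size c ≤ c * B := by
  have h1 : Nat.size c ≤ c := Nat.size_le.2 Nat.lt_two_pow_self
  have := hp.one_le
  nlinarith

theorem size_le_one_of_le_one {c : ℕ} (h : c ≤ 1) : Nat.size c ≤ 1 :=
  Nat.size_le.2 (by omega)

theorem Op.eval_less_le (a b : ℕ) : Op.eval .less a b ≤ 1 := by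
  simp only [Op.eval]; split_ifs <;> simp

theorem Op.eval_equal_le (a b : ℕ) : Op.eval .equal a b ≤ 1 := by
  simp only [Op.eval]; split_ifs <;> simp

/-- The claim of `Tm.runs` for one term. -/
def Tm.Runs (Q H M B : ℕ) (e : Tm) : Prop :=
  ∀ d s, 60 ≤ d → e.wf → Good Q H M s → ∃ r t, EDS.Runs (e.compile d) s r t ∧
    r.reg d = e.eval s ∧ (∀ x < d, r.reg x = s.reg x) ∧ r.arr = s.arr ∧ t ≤ e.tm Q H B

/-- The body of the loops for sums and searches: `g` updates the accumulator in register `d`. -/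
theorem Tm.Runs.accumulate {Q H M B : ℕ} (hp : Param Q H M B) {e : Tm} (he : e.Runs Q H M B)
    {v x d : ℕ} (hv : 25 ≤ v) (hv' : v < 60) (hx : x < 25) (hd : 60 ≤ d) (hw : e.wf) (g : Expr)
    (C : ℕ) (s : Store) (hs : Good Q H M s) (acc : ℕ → ℕ) (h0 : acc 0 = 0)
    (hg : ∀ i < s.reg x, ∀ r : Store, r.reg v = i → r.reg d = acc i →
      r.reg (d + 2) = e.eval (s.setReg v i) →
      g.eval r = acc (i + 1) ∧ g.cost r ≤ C * B) :
    ∃ r t, EDS.Runs (.seq (.assign d (.const 0)) (.seq (.assign (d + 1) (.reg v))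
      (.seq (.assign v (.const 0)) (.seq (.loop (.op .less (.reg v) (.reg x))
        (.seq (e.compile (d + 2)) (.seq (.assign d g)
          (.assign v (.op .plus (.reg v) (.const 1))))))
        (.assign v (.reg (d + 1))))))) s r t ∧
      r.reg d = acc (s.reg x) ∧ (∀ y < d, r.reg y = s.reg y) ∧ r.arr = s.arr ∧
      t ≤ Q * H ^ cls x * (e.tm Q H B + (C + 25) * B) + 25 * B := by
  have hB := hp.one_le
  have hN : s.reg x ≤ M := hs.reg_le x (by omega)
  set N := s.reg x with hNdef
  -- Register `v` is exempt from the frame condition: it counts the rounds, and its old value waits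
  -- in register `d + 1`.
  let I : ℕ → Store → Prop := fun i r => r.reg v = i ∧ r.reg d = acc i ∧
    r.reg (d + 1) = s.reg v ∧ (∀ y < d, y ≠ v → r.reg y = s.reg y) ∧ r.arr = s.arr
  have sz : ∀ {c}, c ≤ M → Nat.size c ≤ 2 * B := fun h => hp.size_le_two h
  have s1 : Nat.size 1 = 1 := Nat.size_one
  have cond : ∀ i ≤ N, ∀ r, I i r →
      (Expr.op .less (.reg v) (.reg x)).cost r ≤ 9 * B := by
    intro i hi r hr
    have h2 := hr.2.2.2.1 x (by omega) (by omega)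
    simp only [Expr.cost, Expr.eval]
    rw [hr.1, h2, ← hNdef]
    have a1 := sz (hi.trans hN)
    have a2 := sz hN
    have a3 := size_le_one_of_le_one (Op.eval_less_le i N)
    omega
  obtain ⟨r, t, h1, h2, h3⟩ := Runs.loop_count (c := .op .less (.reg v) (.reg x))
    (p := .seq (e.compile (d + 2)) (.seq (.assign d g)
          (.assign v (.op .plus (.reg v) (.const 1))))) N
    (e.tm Q H B + (C + 15) * B) (9 * B) I (by
      intro i hi r hr
      refine ⟨?_, cond i hi.le r hr, ?_⟩
      · have h2 := hr.2.2.2.1 x (by omega) (by omega)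
        simp only [Expr.eval]
        rw [hr.1, h2]
        simp [Op.eval, hi, ← hNdef]
      · have hgood : Good Q H M (s.setReg v i) := hs.setReg hv (hi.le.trans hN)
        have hreg : ∀ y < 60, r.reg y = (s.setReg v i).reg y := by
          intro y hy
          by_cases hyv : y = v
          · rw [hyv, hr.1, Store.setReg_reg_self]
          · rw [Store.setReg_reg_ne _ _ hyv, hr.2.2.2.1 y (by omega) hyv]
        have harr : r.arr = (s.setReg v i).arr := hr.2.2.2.2
        obtain ⟨r1, t1, k1, k2, k3, k4, k5⟩ := he (d + 2) r (by omega) hw (hgood.congr hreg harr)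
        have hev : e.eval r = e.eval (s.setReg v i) :=
          e.eval_congr _ _ hw hreg fun a _ => by rw [harr]
        rw [hev] at k2
        have hgi := hg i hi r1 (by rw [k3 v (by omega), hr.1]) (by rw [k3 d (by omega), hr.2.1]) k2
        refine ⟨_, _, .seq k1 (.seq (.assign _ _ _) (.assign _ _ _)), ?_, ?_, ?_, ?_, ?_, ?_⟩
        · have e1 : (r1.setReg d (g.eval r1)).reg v = i := by
            rw [Store.setReg_reg_ne _ _ (by omega), k3 v (by omega), hr.1]
          simp only [Expr.cost, Expr.eval, Op.eval, e1, s1]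
          have a1 := sz (hi.le.trans hN)
          have a2 : Nat.size (i + 1) ≤ 2 * B := sz (by omega)
          have := hgi.2
          rw [add_mul]
          omega
        · rw [Store.setReg_reg_self]
          simp only [Expr.eval, Op.eval]
          rw [Store.setReg_reg_ne _ _ (by omega), k3 v (by omega), hr.1]
        · rw [Store.setReg_reg_ne _ _ (by omega), Store.setReg_reg_self, hgi.1]
        · rw [Store.setReg_reg_ne _ _ (by omega), Store.setReg_reg_ne _ _ (by omega),
            k3 _ (by omega), hr.2.2.1]
        · intro y hy hyv
          rw [Store.setReg_reg_ne _ _ hyv, Store.setReg_reg_ne _ _ (by omega), k3 y (by omega),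
            hr.2.2.2.1 y hy hyv]
        · rw [Store.setReg_arr, Store.setReg_arr, k4, hr.2.2.2.2])
    (by
      intro r hr
      refine ⟨?_, cond N le_rfl r hr⟩
      have h2 := hr.2.2.2.1 x (by omega) (by omega)
      simp only [Expr.eval]
      rw [hr.1, h2]
      simp [Op.eval, hNdef])
    (((s.setReg d 0).setReg (d + 1) (s.reg v)).setReg v 0) (by
      refine ⟨Store.setReg_reg_self _ _ _, ?_, ?_, ?_, rfl⟩
      · rw [Store.setReg_reg_ne _ _ (by omega), Store.setReg_reg_ne _ _ (by omega),
          Store.setReg_reg_self, h0]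
      · rw [Store.setReg_reg_ne _ _ (by omega), Store.setReg_reg_self]
      · intro y hy hyv
        rw [Store.setReg_reg_ne _ _ hyv, Store.setReg_reg_ne _ _ (by omega),
          Store.setReg_reg_ne _ _ (by omega)])
  have hv0 : (s.setReg d 0).reg v = s.reg v := Store.setReg_reg_ne _ _ (by omega)
  refine ⟨_, _, .seq (.assign _ _ _) (.seq (.assign _ _ _) (.seq (.assign _ _ _) (.seq
    (by simpa [Expr.eval, hv0] using h1) (.assign _ _ _)))), ?_, ?_, ?_, ?_⟩
  · rw [Store.setReg_reg_ne _ _ (by omega), h3.2.1]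
  · intro y hy
    by_cases hyv : y = v
    · rw [hyv, Store.setReg_reg_self]; simp only [Expr.eval]; rw [h3.2.2.1]
    · rw [Store.setReg_reg_ne _ _ hyv, h3.2.2.2.1 y hy hyv]
  · rw [Store.setReg_arr, h3.2.2.2.2]
  · simp only [Expr.cost, Expr.eval, hv0, h3.2.2.1, Nat.size_zero]
    have a1 := sz (hs.reg_le v hv')
    have a2 : N ≤ Q * H ^ cls x := hs.bound x hx
    have a3 : N * (e.tm Q H B + (C + 15) * B + 9 * B + 1) ≤
        Q * H ^ cls x * (e.tm Q H B + (C + 25) * B) := by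
      refine Nat.mul_le_mul a2 ?_
      rw [add_mul, add_mul]
      omega
    omega

/-- Every subterm is compiled at a register above the intermediate results that are still needed and
restores all registers below its own, so these results survive. -/
theorem Tm.runs {Q H M B : ℕ} (hp : Param Q H M B) (e : Tm) : e.Runs Q H M B := by
  have hB := hp.one_le
  have sz : ∀ {c}, c ≤ M → Nat.size c ≤ 2 * B := fun h => hp.size_le_two h
  induction e with
  | const c =>
    intro d s hd hw hs
    refine ⟨_, _, .assign _ _ _, Store.setReg_reg_self _ _ _,
      fun x hx => Store.setReg_reg_ne _ _ (by omega), rfl, ?_⟩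
    have := hp.size_nat_le c
    simp only [Expr.cost, Tm.tm, add_mul]
    omega
  | reg x =>
    intro d s hd hw hs
    refine ⟨_, _, .assign _ _ _, Store.setReg_reg_self _ _ _,
      fun x hx => Store.setReg_reg_ne _ _ (by omega), rfl, ?_⟩
    have := sz (hs.reg_le x (by simpa [Tm.wf] using hw))
    simp only [Expr.cost, Tm.tm]
    omega
  | cell a i ih =>
    intro d s hd hw hs
    obtain ⟨r, t, h1, h2, h3, h4, h5⟩ := ih d s hd hw hs
    have e1 : (Expr.cell a (.reg d)).eval r = (Tm.cell a i).eval s := by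
      simp only [Expr.eval, Tm.eval, h2, h4]
    refine ⟨_, _, .seq h1 (.assign _ _ _), by rw [Store.setReg_reg_self, e1],
      fun x hx => by rw [Store.setReg_reg_ne _ _ (by omega), h3 x hx], h4, ?_⟩
    have a1 := hp.size_le (Tm.eval_le hp i s hw hs)
    have a2 := sz (hs.arr_le a (i.eval s))
    simp only [Expr.cost, Expr.eval, Tm.tm, h2, h4]
    have : (i.deg + 6) * B = (i.deg + 1) * B + 5 * B := by ring
    omega
  | op o e f ihe ihf =>
    intro d s hd hw hs
    have hw' := hw
    simp only [Tm.wf, Bool.and_eq_true] at hw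
    obtain ⟨r, t, h1, h2, h3, h4, h5⟩ := ihe d s hd hw.1 hs
    have hreg : ∀ x < 60, r.reg x = s.reg x := fun x hx => h3 x (by omega)
    obtain ⟨r', t', k1, k2, k3, k4, k5⟩ := ihf (d + 1) r (by omega) hw.2 (hs.congr hreg h4)
    rw [f.eval_congr s r hw.2 hreg fun a _ => by rw [h4]] at k2
    have e1 : r'.reg d = e.eval s := by rw [k3 d (by omega), h2]
    refine ⟨_, _, .seq h1 (.seq k1 (.assign _ _ _)), ?_, ?_, ?_, ?_⟩
    · rw [Store.setReg_reg_self]; simp only [Expr.eval, Tm.eval, e1, k2]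
    · intro x hx
      rw [Store.setReg_reg_ne _ _ (by omega), k3 x (by omega), h3 x hx]
    · rw [Store.setReg_arr, k4, h4]
    · have a1 := hp.size_le (Tm.eval_le hp e s hw.1 hs)
      have a2 := hp.size_le (Tm.eval_le hp f s hw.2 hs)
      have a3 := hp.size_le (Tm.eval_le hp (.op o e f) s hw' hs)
      simp only [Expr.cost, Expr.eval, Tm.tm, e1, k2]
      simp only [Tm.eval] at a3
      have : (e.deg + f.deg + (Tm.op o e f).deg + 7) * B = (e.deg + 1) * B + (f.deg + 1) * B +
        ((Tm.op o e f).deg + 1) * B + 4 * B := by ring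
      omega
  | ite c e f ihc ihe ihf =>
    intro d s hd hw hs
    simp only [Tm.wf, Bool.and_eq_true] at hw
    obtain ⟨r, t, h1, h2, h3, h4, h5⟩ := ihc d s hd hw.1.1 hs
    have hreg : ∀ x < 60, r.reg x = s.reg x := fun x hx => h3 x (by omega)
    have a1 := hp.size_le (Tm.eval_le hp c s hw.1.1 hs)
    have a2 : (c.deg + 3) * B = (c.deg + 1) * B + 2 * B := by ring
    by_cases hc : c.eval s = 0
    · obtain ⟨r', t', k1, k2, k3, k4, k5⟩ := ihf d r hd hw.2 (hs.congr hreg h4)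
      rw [f.eval_congr s r hw.2 hreg fun a _ => by rw [h4]] at k2
      refine ⟨_, _, .seq h1 (.cond_false (by simp only [Expr.eval]; rw [h2, hc]) k1), ?_, ?_, ?_, ?_⟩
      · simp only [k2, Tm.eval, hc, ne_eq, not_true_eq_false, if_false]
      · intro x hx; rw [k3 x hx, h3 x hx]
      · rw [k4, h4]
      · simp only [Expr.cost, Tm.tm, h2]; omega
    · obtain ⟨r', t', k1, k2, k3, k4, k5⟩ := ihe d r hd hw.1.2 (hs.congr hreg h4)
      rw [e.eval_congr s r hw.1.2 hreg fun a _ => by rw [h4]] at k2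
      refine ⟨_, _, .seq h1 (.cond_true (by simp only [Expr.eval]; rw [h2]; exact hc) k1),
        ?_, ?_, ?_, ?_⟩
      · simp only [k2, Tm.eval, ne_eq, hc, not_false_eq_true, if_true]
      · intro x hx; rw [k3 x hx, h3 x hx]
      · rw [k4, h4]
      · simp only [Expr.cost, Tm.tm, h2]; omega
  | bind v e f ihe ihf =>
    intro d s hd hw hs
    simp only [Tm.wf, Bool.and_eq_true, decide_eq_true_eq] at hw
    obtain ⟨⟨⟨⟨hv, hv'⟩, hdeg⟩, hwe⟩, hwf⟩ := hw
    obtain ⟨r, t, h1, h2, h3, h4, h5⟩ := ihe d s hd hwe hs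
    have hle : e.eval s ≤ M := by
      refine (Tm.eval_le hp e s hwe hs).trans ?_
      calc _ ≤ M ^ 1 := Nat.pow_le_pow_right (by have := hp.two_le; omega) hdeg
        _ = M := pow_one M
    have hgood := hs.setReg hv hle
    set r1 := (r.setReg (d + 1) (r.reg v)).setReg v (e.eval s) with hr1
    have hreg : ∀ x < d, r1.reg x = (s.setReg v (e.eval s)).reg x := by
      intro x hx
      by_cases hxv : x = v
      · rw [hxv, hr1, Store.setReg_reg_self, Store.setReg_reg_self]
      · rw [hr1, Store.setReg_reg_ne _ _ hxv, Store.setReg_reg_ne _ _ (by omega),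
          Store.setReg_reg_ne _ _ hxv, h3 x hx]
    obtain ⟨r', t', k1, k2, k3, k4, k5⟩ := ihf (d + 2) r1 (by omega) hwf
      (hgood.congr (fun x hx => hreg x (by omega)) h4)
    rw [f.eval_congr (s.setReg v (e.eval s)) r1 hwf (fun x hx => hreg x (by omega))
      fun a _ => by rw [show r1.arr = s.arr from h4]; rfl] at k2
    have e1 : (r.setReg (d + 1) (r.reg v)).reg d = e.eval s := by
      rw [Store.setReg_reg_ne _ _ (by omega), h2]
    have e2 : r'.reg (d + 1) = s.reg v := by
      rw [k3 _ (by omega), hr1, Store.setReg_reg_ne _ _ (by omega), Store.setReg_reg_self,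
        h3 v (by omega)]
    have e3 : (r'.setReg v (s.reg v)).reg (d + 2) = f.eval (s.setReg v (e.eval s)) := by
      rw [Store.setReg_reg_ne _ _ (by omega), k2]
    refine ⟨_, _, .seq h1 (.seq (.assign _ _ _) (.seq (.assign _ _ _) (.seq
      (by simpa only [Expr.eval, e1, ← hr1] using k1) (.seq (.assign _ _ _) (.assign _ _ _))))),
      ?_, ?_, ?_, ?_⟩
    · rw [Store.setReg_reg_self]; simp only [Expr.eval, e2, e3, Tm.eval]
    · intro x hx
      rw [Store.setReg_reg_ne _ _ (by omega)]
      by_cases hxv : x = v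
      · rw [hxv, Store.setReg_reg_self]; exact e2
      · rw [Store.setReg_reg_ne _ _ hxv, k3 x (by omega), hreg x hx, Store.setReg_reg_ne _ _ hxv]
    · rw [Store.setReg_arr, Store.setReg_arr, k4]; exact h4
    · simp only [Expr.cost, Expr.eval, Tm.tm, e1, e2, e3]
      have a1 := sz (hs.reg_le v hv')
      have a2 := sz hle
      have a3 := hp.size_le (Tm.eval_le hp f _ hwf hgood)
      rw [h3 v (by omega)]
      have : (f.deg + 15) * B = (f.deg + 1) * B + 14 * B := by ring
      omega
  | sum v x e ih =>
    intro d s hd hw hs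
    simp only [Tm.wf, Bool.and_eq_true, decide_eq_true_eq] at hw
    obtain ⟨⟨⟨hv, hv'⟩, hx⟩, hwe⟩ := hw
    obtain ⟨r, t, h1, h2, h3, h4, h5⟩ := Tm.Runs.accumulate hp ih hv hv' hx hd hwe
      (.op .plus (.reg d) (.reg (d + 2))) (3 * e.deg + 15) s hs
      (fun j => ∑ i ∈ Finset.range j, e.eval (s.setReg v i)) (by simp) (by
        intro i hi r hr1 hr2 hr3
        have hval : ∀ j ≤ s.reg x,
            ∑ i ∈ Finset.range j, e.eval (s.setReg v i) ≤ M ^ (e.deg + 1) := by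
          intro j hj
          refine le_trans ?_ (Tm.eval_le hp (.sum v x e) s (by simp [Tm.wf, *]) hs)
          exact Finset.sum_le_sum_of_subset (by simpa using hj)
        refine ⟨?_, ?_⟩
        · simp only [Expr.eval, Op.eval, hr2, hr3, Finset.sum_range_succ]
        · simp only [Expr.cost, Expr.eval, Op.eval, hr2, hr3, ← Finset.sum_range_succ]
          have a1 := hp.size_le (hval i hi.le)
          have a2 := hp.size_le (hval (i + 1) hi)
          have a3 := hp.size_le (Tm.eval_le hp e _ hwe
            (hs.setReg hv (hi.le.trans (hs.reg_le x (by omega)))))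
          have : (3 * e.deg + 15) * B = (e.deg + 1 + 1) * B + (e.deg + 1 + 1) * B +
            (e.deg + 1) * B + 10 * B := by ring
          omega)
    exact ⟨r, t, h1, h2, h3, h4, by rw [Tm.tm]; exact h5⟩
  | least v x e ih =>
    intro d s hd hw hs
    simp only [Tm.wf, Bool.and_eq_true, decide_eq_true_eq] at hw
    obtain ⟨⟨⟨hv, hv'⟩, hx⟩, hwe⟩ := hw
    obtain ⟨r, t, h1, h2, h3, h4, h5⟩ := Tm.Runs.accumulate hp ih hv hv' hx hd hwe
      (.op .plus (.reg d) (.op .times (.op .equal (.reg d) (.reg v))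
        (.op .equal (.reg (d + 2)) (.const 0)))) (3 * e.deg + 35) s hs
      (leastBelow fun i => e.eval (s.setReg v i)) rfl (by
        intro i hi r hr1 hr2 hr3
        have hM : s.reg x ≤ M := hs.reg_le x (by omega)
        have hval := fun j => leastBelow_le (fun i => e.eval (s.setReg v i)) j
        have e1 : Op.eval .times (Op.eval .equal (leastBelow (fun i => e.eval (s.setReg v i)) i) i)
            (Op.eval .equal (e.eval (s.setReg v i)) 0) =
            if leastBelow (fun i => e.eval (s.setReg v i)) i = i ∧ e.eval (s.setReg v i) = 0
            then 1 else 0 := by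
          simp only [Op.eval]
          split_ifs <;> simp_all
        refine ⟨?_, ?_⟩
        · simp only [Expr.eval, hr1, hr2, hr3, e1]; rfl
        · simp only [Expr.cost, Expr.eval, hr1, hr2, hr3, e1]
          have a1 := sz ((hval i).trans (hi.le.trans hM))
          have a2 : Nat.size (leastBelow (fun i => e.eval (s.setReg v i)) (i + 1)) ≤ 2 * B :=
            sz ((hval (i + 1)).trans (show i + 1 ≤ M by omega))
          have a3 := hp.size_le (Tm.eval_le hp e _ hwe (hs.setReg hv (hi.le.trans hM)))
          have a4 : Nat.size i ≤ 2 * B := sz (hi.le.trans hM)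
          have a5 := size_le_one_of_le_one
            (Op.eval_equal_le (leastBelow (fun i => e.eval (s.setReg v i)) i) i)
          have a6 := size_le_one_of_le_one (Op.eval_equal_le (e.eval (s.setReg v i)) 0)
          have a7 : Nat.size (if leastBelow (fun i => e.eval (s.setReg v i)) i = i ∧
              e.eval (s.setReg v i) = 0 then 1 else 0) ≤ 1 :=
            size_le_one_of_le_one (by split_ifs <;> simp)
          simp only [Op.eval] at a5 a6 ⊢
          simp only [leastBelow] at a2
          have : (3 * e.deg + 35) * B = (e.deg + 1) * B + 2 * e.deg * B + 34 * B := by ring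
          rw [Nat.size_zero]
          omega)
    exact ⟨r, t, h1, h2, h3, h4, by rw [Tm.tm]; exact h5⟩
  | pow v x =>
    intro d s hd hw hs
    have hw' := hw
    simp only [Tm.wf, Bool.and_eq_true, decide_eq_true_eq, beq_iff_eq] at hw
    obtain ⟨⟨hv, hx⟩, hc⟩ := hw
    have hQ : s.reg x ≤ Q := by have := hs.bound x hx; simpa [hc] using this
    have hM := Tm.eval_le hp (.pow v x) s hw' hs
    simp only [Tm.eval, Tm.deg, pow_one] at hM
    set N := min (s.reg v) (s.reg x) with hN
    have hNM : ∀ i ≤ N, 3 ^ i ≤ M := fun i hi => (Nat.pow_le_pow_right (by norm_num) hi).trans hM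
    have hiM : ∀ i ≤ N, i ≤ M := fun i hi => hi.trans ((min_le_left _ _).trans (hs.reg_le v hv))
    have s1 : Nat.size 1 = 1 := Nat.size_one
    let I : ℕ → Store → Prop := fun i r => r.reg (d + 1) = i ∧ r.reg d = 3 ^ i ∧
      (∀ y < d, r.reg y = s.reg y) ∧ r.arr = s.arr
    have hcost : ∀ i ≤ N, ∀ r, I i r → (Expr.op .times (.op .less (.reg (d + 1)) (.reg v))
        (.op .less (.reg (d + 1)) (.reg x))).cost r ≤ 20 * B := by
      intro i hi r hr
      simp only [Expr.cost, Expr.eval]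
      rw [hr.1, hr.2.2.1 v (by omega), hr.2.2.1 x (by omega)]
      have a1 := sz (hiM i hi)
      have a2 := sz (hs.reg_le v hv)
      have a3 := sz (hs.reg_le x (by omega))
      have a4 := size_le_one_of_le_one (Op.eval_less_le i (s.reg v))
      have a5 := size_le_one_of_le_one (Op.eval_less_le i (s.reg x))
      have a6 : Nat.size (Op.eval .times (Op.eval .less i (s.reg v)) (Op.eval .less i (s.reg x)))
          ≤ 1 := size_le_one_of_le_one
            (Nat.mul_le_mul (Op.eval_less_le i (s.reg v)) (Op.eval_less_le i (s.reg x)))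
      omega
    obtain ⟨r, t, h1, h2, h3⟩ := Runs.loop_count
      (c := .op .times (.op .less (.reg (d + 1)) (.reg v)) (.op .less (.reg (d + 1)) (.reg x)))
      (p := .seq (.assign d (.op .times (.const 3) (.reg d)))
          (.assign (d + 1) (.op .plus (.reg (d + 1)) (.const 1)))) N (20 * B) (20 * B) I (by
        intro i hi r hr
        refine ⟨?_, hcost i hi.le r hr, _, _, .seq (.assign _ _ _) (.assign _ _ _), ?_, ?_, ?_, ?_, ?_⟩
        · simp only [Expr.eval]
          rw [hr.1, hr.2.2.1 v (by omega), hr.2.2.1 x (by omega)]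
          simp only [Op.eval]
          rw [if_pos (by omega), if_pos (by omega)]
          simp
        · simp only [Expr.cost, Expr.eval, Op.eval]
          rw [Store.setReg_reg_ne _ _ (by omega), hr.1, hr.2.1]
          have a1 := sz (hNM i hi.le)
          have a2 : Nat.size (3 * 3 ^ i) ≤ 2 * B := sz (by rw [← pow_succ']; exact hNM (i + 1) hi)
          have a3 := sz (hiM i hi.le)
          have a4 : Nat.size (i + 1) ≤ 2 * B := sz (hiM (i + 1) hi)
          have a5 : Nat.size 3 = 2 := by decide
          omega
        · rw [Store.setReg_reg_self]
          simp only [Expr.eval, Op.eval]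
          rw [Store.setReg_reg_ne _ _ (by omega), hr.1]
        · rw [Store.setReg_reg_ne _ _ (by omega), Store.setReg_reg_self]
          simp only [Expr.eval, Op.eval]
          rw [hr.2.1, pow_succ']
        · intro y hy
          rw [Store.setReg_reg_ne _ _ (by omega), Store.setReg_reg_ne _ _ (by omega),
            hr.2.2.1 y hy]
        · exact hr.2.2.2)
      (by
        intro r hr
        refine ⟨?_, hcost N le_rfl r hr⟩
        simp only [Expr.eval]
        rw [hr.1, hr.2.2.1 v (by omega), hr.2.2.1 x (by omega)]
        simp only [Op.eval]
        by_cases h : N < s.reg v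
        · rw [if_neg (show ¬ N < s.reg x by omega), mul_zero]
        · rw [if_neg h, zero_mul])
      ((s.setReg d 1).setReg (d + 1) 0) (by
        refine ⟨Store.setReg_reg_self _ _ _, ?_, ?_, rfl⟩
        · rw [Store.setReg_reg_ne _ _ (by omega), Store.setReg_reg_self, pow_zero]
        · intro y hy
          rw [Store.setReg_reg_ne _ _ (by omega), Store.setReg_reg_ne _ _ (by omega)])
    refine ⟨r, _, .seq (.assign _ _ _) (.seq (.assign _ _ _) h1), h3.2.1, h3.2.2.1, h3.2.2.2, ?_⟩
    simp only [Expr.cost, Tm.tm, s1, Nat.size_zero]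
    have a1 : N * (20 * B + 20 * B + 1) ≤ Q * (50 * B) :=
      Nat.mul_le_mul ((min_le_right _ _).trans hQ) (by omega)
    omega

end EDS

/-! ### Statements: array comprehensions and loops with a fixed number of rounds. -/

namespace EDS

/-- Statements: array comprehensions, composition, loops with a fixed number of rounds. -/
inductive Stm
  | comp (a v x : ℕ) (e : Tm)
  | seq (p q : Stm)
  | rep (v x : ℕ) (p : Stm)

/-- Replace the first `N` cells of array `a`. -/
def Store.fill (s : Store) (a N : ℕ) (f : ℕ → ℕ) : Store :=
  ⟨s.reg, Function.update s.arr a fun i => if i < N then f i else s.arr a i⟩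

/-- The store after the execution of a statement. -/
def Stm.den : Stm → Store → Store
  | .comp a v x e, s => s.fill a (s.reg x) fun i => e.eval (s.setReg v i)
  | .seq p q, s => q.den (p.den s)
  | .rep v x p, s => (s.reg x).rec s fun i r => p.den (r.setReg v i)

/-- The program for a statement; it uses the registers from `d` on as scratch registers. -/
def Stm.compile : ℕ → Stm → Prog
  | d, .comp a v x e => .seq (.assign d (.reg v)) (.seq (.assign v (.const 0))
      (.seq (.loop (.op .less (.reg v) (.reg x)) (.seq (e.compile (d + 1))
        (.seq (.write a (.reg v) (.reg (d + 1))) (.assign v (.op .plus (.reg v) (.const 1))))))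
        (.assign v (.reg d))))
  | d, .seq p q => .seq (p.compile d) (q.compile d)
  | d, .rep v x p => .seq (.assign d (.const 0)) (.loop (.op .less (.reg d) (.reg x))
      (.seq (.assign v (.reg d)) (.seq (p.compile (d + 1))
        (.assign d (.op .plus (.reg d) (.const 1))))))

/-- Well-formed statements. -/
def Stm.wf : Stm → Bool
  | .comp a v x e => 25 ≤ v && v < 60 && x < 25 && e.wf && e.deg ≤ 1 && !e.reads.contains a
  | .seq p q => p.wf && q.wf
  | .rep v x p => 25 ≤ v && v < 60 && x < 25 && p.wf

/-- A bound for the cost of a statement. -/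
def Stm.tm (Q H B : ℕ) : Stm → ℕ
  | .comp _ _ x e => Q * H ^ cls x * (e.tm Q H B + 40 * B) + 25 * B
  | .seq p q => p.tm Q H B + q.tm Q H B
  | .rep _ x p => Q * H ^ cls x * (p.tm Q H B + 40 * B) + 25 * B

/-- The stores agree on the arrays and on the registers below `d`. -/
structure Agree (d : ℕ) (r s : Store) : Prop where
  reg : ∀ x < d, r.reg x = s.reg x
  arr : r.arr = s.arr

theorem Agree.refl (d : ℕ) (s : Store) : Agree d s s := ⟨fun _ _ => rfl, rfl⟩

theorem Agree.trans {d : ℕ} {r s w : Store} (h : Agree d r s) (h' : Agree d s w) : Agree d r w :=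
  ⟨fun x hx => (h.reg x hx).trans (h'.reg x hx), h.arr.trans h'.arr⟩

theorem Agree.mono {d d' : ℕ} {r s : Store} (h : Agree d r s) (hd : d' ≤ d) : Agree d' r s :=
  ⟨fun x hx => h.reg x (by omega), h.arr⟩

theorem Agree.setReg {d : ℕ} {r s : Store} (h : Agree d r s) (v i : ℕ) :
    Agree d (r.setReg v i) (s.setReg v i) := by
  refine ⟨fun x hx => ?_, h.arr⟩
  by_cases hxv : x = v
  · rw [hxv, Store.setReg_reg_self, Store.setReg_reg_self]
  · rw [Store.setReg_reg_ne _ _ hxv, Store.setReg_reg_ne _ _ hxv, h.reg x hx]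

theorem Agree.setReg_left {d : ℕ} {r s : Store} (h : Agree d r s) {v i : ℕ} (hv : d ≤ v) :
    Agree d (r.setReg v i) s :=
  ⟨fun x hx => by rw [Store.setReg_reg_ne _ _ (by omega), h.reg x hx], h.arr⟩

theorem Good.agree {Q H M d : ℕ} {r s : Store} (h : Good Q H M s) (ha : Agree d r s)
    (hd : 60 ≤ d) : Good Q H M r :=
  h.congr (fun x hx => ha.reg x (by omega)) ha.arr

theorem Tm.eval_agree {e : Tm} {d : ℕ} {r s : Store} (hw : e.wf) (ha : Agree d r s)
    (hd : 60 ≤ d) : e.eval r = e.eval s :=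
  e.eval_congr _ _ hw (fun x hx => ha.reg x (by omega)) fun a _ => by rw [ha.arr]

theorem Stm.den_agree (p : Stm) : ∀ {d : ℕ} {r s : Store}, p.wf → Agree d r s → 60 ≤ d →
    Agree d (p.den r) (p.den s) := by
  induction p with
  | comp a v x e =>
    intro d r s hw h hd
    simp only [Stm.wf, Bool.and_eq_true, decide_eq_true_eq] at hw
    refine ⟨h.reg, ?_⟩
    simp only [Stm.den, Store.fill, h.arr, h.reg x (by omega)]
    congr 1
    funext i
    split_ifs
    · exact Tm.eval_agree hw.1.1.2 (h.setReg v i) hd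
    · rfl
  | seq p q ihp ihq =>
    intro d r s hw h hd
    simp only [Stm.wf, Bool.and_eq_true] at hw
    exact ihq hw.2 (ihp hw.1 h hd) hd
  | rep v x p ih =>
    intro d r s hw h hd
    simp only [Stm.wf, Bool.and_eq_true, decide_eq_true_eq] at hw
    simp only [Stm.den, h.reg x (by omega)]
    induction s.reg x with
    | zero => exact h
    | succ i ih' => exact ih hw.2 (ih'.setReg v i) hd

/-- Comprehensions store only values of degree at most one, so cells stay below `M`; loop variables
are registers from `25` on, so loop bounds never change. -/
theorem Stm.den_good {Q H M B : ℕ} (hp : Param Q H M B) (p : Stm) : ∀ s, p.wf → Good Q H M s →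
    Good Q H M (p.den s) ∧ ∀ x < 25, (p.den s).reg x = s.reg x := by
  induction p with
  | comp a v x e =>
    intro s hw hs
    simp only [Stm.wf, Bool.and_eq_true, decide_eq_true_eq] at hw
    refine ⟨⟨hs.bound, hs.reg_le, fun b i => ?_⟩, fun _ _ => rfl⟩
    simp only [Stm.den, Store.fill]
    by_cases hb : b = a
    · subst hb
      simp only [Function.update_self]
      split_ifs with hi
      · refine (Tm.eval_le hp e _ hw.1.1.2
          (hs.setReg hw.1.1.1.1.1 (hi.le.trans (hs.reg_le x (by omega))))).trans ?_
        calc _ ≤ M ^ 1 := Nat.pow_le_pow_right (by have := hp.two_le; omega) hw.1.2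
          _ = M := pow_one M
      · exact hs.arr_le _ _
    · rw [Function.update_of_ne hb]; exact hs.arr_le _ _
  | seq p q ihp ihq =>
    intro s hw hs
    simp only [Stm.wf, Bool.and_eq_true] at hw
    obtain ⟨h1, h2⟩ := ihp s hw.1 hs
    obtain ⟨h3, h4⟩ := ihq _ hw.2 h1
    exact ⟨h3, fun x hx => (h4 x hx).trans (h2 x hx)⟩
  | rep v x p ih =>
    intro s hw hs
    simp only [Stm.wf, Bool.and_eq_true, decide_eq_true_eq] at hw
    simp only [Stm.den]
    have hN : s.reg x ≤ M := hs.reg_le x (by omega)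
    generalize s.reg x = N at hN
    induction N with
    | zero => exact ⟨hs, fun _ _ => rfl⟩
    | succ i ih' =>
      obtain ⟨h1, h2⟩ := ih' (by omega)
      obtain ⟨h3, h4⟩ := ih _ hw.2 (h1.setReg (v := v) (i := i) hw.1.1.1 (by omega))
      refine ⟨h3, fun y hy => ?_⟩
      rw [← h2 y hy]
      exact (h4 y hy).trans (Store.setReg_reg_ne _ _ (by omega))

theorem Stm.runs {Q H M B : ℕ} (hp : Param Q H M B) (p : Stm) : ∀ d s, 60 ≤ d → p.wf →
    Good Q H M s → ∃ r t, EDS.Runs (p.compile d) s r t ∧ Agree d r (p.den s) ∧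
      t ≤ p.tm Q H B := by
  have hB := hp.one_le
  have sz : ∀ {c}, c ≤ M → Nat.size c ≤ 2 * B := fun h => hp.size_le_two h
  have s1 : Nat.size 1 = 1 := Nat.size_one
  have less_cost : ∀ {x y : ℕ} {r : Store}, r.reg x ≤ M → r.reg y ≤ M →
      (Expr.op .less (.reg x) (.reg y)).cost r ≤ 9 * B := by
    intro x y r h1 h2
    simp only [Expr.cost, Expr.eval]
    have a1 := sz h1
    have a2 := sz h2
    have a3 := size_le_one_of_le_one (Op.eval_less_le (r.reg x) (r.reg y))
    omega
  induction p with
  | comp a v x e =>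
    intro d s hd hw hs
    simp only [Stm.wf, Bool.and_eq_true, decide_eq_true_eq] at hw
    obtain ⟨⟨⟨⟨⟨hv, hv'⟩, hx⟩, hwe⟩, hdeg⟩, hread⟩ := hw
    have hM : s.reg x ≤ M := hs.reg_le x (by omega)
    set f : ℕ → ℕ := fun i => e.eval (s.setReg v i) with hf
    have hfM : ∀ i < s.reg x, f i ≤ M := by
      intro i hi
      refine (Tm.eval_le hp e _ hwe (hs.setReg hv (hi.le.trans hM))).trans ?_
      calc _ ≤ M ^ 1 := Nat.pow_le_pow_right (by have := hp.two_le; omega) hdeg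
        _ = M := pow_one M
    let I : ℕ → Store → Prop := fun i r => r.reg v = i ∧ r.reg d = s.reg v ∧
      (∀ y < d, y ≠ v → r.reg y = s.reg y) ∧ r.arr = (s.fill a i f).arr
    obtain ⟨r, t, h1, h2, h3⟩ := Runs.loop_count (c := .op .less (.reg v) (.reg x))
      (p := .seq (e.compile (d + 1))
        (.seq (.write a (.reg v) (.reg (d + 1))) (.assign v (.op .plus (.reg v) (.const 1)))))
      (s.reg x) (e.tm Q H B + 16 * B) (9 * B) I (by
        intro i hi r hr
        have e2 := hr.2.2.1 x (by omega) (by omega)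
        refine ⟨?_, less_cost (by rw [hr.1]; omega) (by rw [e2]; exact hM), ?_⟩
        · simp only [Expr.eval]; rw [hr.1, e2]; simp [Op.eval, hi]
        · have hreg : ∀ y < d, r.reg y = (s.setReg v i).reg y := by
            intro y hy
            by_cases hyv : y = v
            · rw [hyv, hr.1, Store.setReg_reg_self]
            · rw [Store.setReg_reg_ne _ _ hyv, hr.2.2.1 y hy hyv]
          have hgood : Good Q H M r := by
            refine ⟨fun y hy => ?_, fun y hy => ?_, fun b j => ?_⟩
            · rw [hr.2.2.1 y (by omega) (by omega)]; exact hs.bound y hy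
            · by_cases hyv : y = v
              · rw [hyv, hr.1]; omega
              · rw [hr.2.2.1 y (by omega) hyv]; exact hs.reg_le y hy
            · rw [hr.2.2.2]
              simp only [Store.fill]
              by_cases hb : b = a
              · subst hb
                simp only [Function.update_self]
                split_ifs with hj
                · exact hfM j (by omega)
                · exact hs.arr_le _ _
              · rw [Function.update_of_ne hb]; exact hs.arr_le _ _
          obtain ⟨r1, t1, k1, k2, k3, k4, k5⟩ := Tm.runs hp e (d + 1) r (by omega) hwe hgood
          -- The array `a` is partly overwritten at this point, but `e` does not read it.
          have hev : e.eval r = f i := by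
            refine e.eval_congr _ _ hwe (fun y hy => hreg y (by omega)) fun b hb => ?_
            have hba : b ≠ a := by
              rintro rfl
              simp [hb] at hread
            rw [hr.2.2.2]
            simp only [Store.fill, Store.setReg]
            rw [Function.update_of_ne hba]
          rw [hev] at k2
          have e3 : r1.reg v = i := by rw [k3 v (by omega), hr.1]
          have e4 : (r1.setCell a i (f i)).reg v = i := e3
          refine ⟨_, _, .seq k1 (.seq (.write _ _ _ _) (.assign _ _ _)), ?_, ?_, ?_, ?_, ?_⟩
          · simp only [Expr.cost, Expr.eval, e3, e4, k2, Op.eval, s1]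
            have a1 := sz (hi.le.trans hM)
            have a2 : Nat.size (i + 1) ≤ 2 * B := sz (by omega)
            have a3 := sz (hfM i hi)
            omega
          · rw [Store.setReg_reg_self]
            simp only [Expr.eval, e3, k2, e4, Op.eval]
          · rw [Store.setReg_reg_ne _ _ (by omega)]
            exact (k3 d (by omega)).trans hr.2.1
          · intro y hy hyv
            rw [Store.setReg_reg_ne _ _ hyv]
            exact (k3 y (by omega)).trans (hr.2.2.1 y hy hyv)
          · simp only [Store.setReg, Store.setCell, Expr.eval, e3, k2, k4, hr.2.2.2, Store.fill]
            funext b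
            by_cases hb : b = a
            · subst hb
              simp only [Function.update_self]
              funext j
              by_cases hj : j = i
              · subst hj; simp
              · simp only [Function.update_of_ne hj, show (j < i + 1) = (j < i) by
                  rw [eq_iff_iff]; omega]
            · simp only [Function.update_of_ne hb])
      (by
        intro r hr
        have e2 := hr.2.2.1 x (by omega) (by omega)
        refine ⟨?_, less_cost (by rw [hr.1]; exact hM) (by rw [e2]; exact hM)⟩
        simp only [Expr.eval]; rw [hr.1, e2]; simp [Op.eval])
      ((s.setReg d (s.reg v)).setReg v 0) (by
        refine ⟨Store.setReg_reg_self _ _ _, ?_, ?_, ?_⟩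
        · rw [Store.setReg_reg_ne _ _ (by omega), Store.setReg_reg_self]
        · intro y hy hyv
          rw [Store.setReg_reg_ne _ _ hyv, Store.setReg_reg_ne _ _ (by omega)]
        · simp [Store.setReg, Store.fill])
    refine ⟨_, _, .seq (.assign _ _ _) (.seq (.assign _ _ _) (.seq h1 (.assign _ _ _))), ⟨?_, ?_⟩, ?_⟩
    · intro y hy
      by_cases hyv : y = v
      · rw [hyv, Store.setReg_reg_self]; exact h3.2.1
      · rw [Store.setReg_reg_ne _ _ hyv]; exact h3.2.2.1 y hy hyv
    · rw [Store.setReg_arr, h3.2.2.2]; rfl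
    · simp only [Expr.cost, Stm.tm, h3.2.1, Nat.size_zero]
      have a1 := sz (hs.reg_le v hv')
      have a2 : s.reg x * (e.tm Q H B + 16 * B + 9 * B + 1) ≤
          Q * H ^ cls x * (e.tm Q H B + 40 * B) := Nat.mul_le_mul (hs.bound x hx) (by omega)
      omega
  | seq p q ihp ihq =>
    intro d s hd hw hs
    simp only [Stm.wf, Bool.and_eq_true] at hw
    obtain ⟨r, t, h1, h2, h3⟩ := ihp d s hd hw.1 hs
    have h4 := (Stm.den_good hp p s hw.1 hs).1
    obtain ⟨r', t', k1, k2, k3⟩ := ihq d r hd hw.2 (h4.agree h2 hd)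
    exact ⟨r', _, .seq h1 k1, k2.trans (q.den_agree hw.2 h2 hd), add_le_add h3 k3⟩
  | rep v x p ih =>
    intro d s hd hw hs
    have hw' := hw
    simp only [Stm.wf, Bool.and_eq_true, decide_eq_true_eq] at hw
    obtain ⟨⟨⟨hv, hv'⟩, hx⟩, hwp⟩ := hw
    have hM : s.reg x ≤ M := hs.reg_le x (by omega)
    let D : ℕ → Store := fun i => i.rec s fun i r => p.den (r.setReg v i)
    have hD : ∀ i ≤ s.reg x, Good Q H M (D i) ∧ ∀ y < 25, (D i).reg y = s.reg y := by
      intro i hi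
      induction i with
      | zero => exact ⟨hs, fun _ _ => rfl⟩
      | succ i ih' =>
        obtain ⟨h1, h2⟩ := ih' (by omega)
        obtain ⟨h3, h4⟩ := p.den_good hp _ hwp (h1.setReg (v := v) (i := i) hv (by omega))
        refine ⟨h3, fun y hy => ?_⟩
        rw [← h2 y hy]
        exact (h4 y hy).trans (Store.setReg_reg_ne _ _ (by omega))
    let I : ℕ → Store → Prop := fun i r => r.reg d = i ∧ Agree d r (D i)
    obtain ⟨r, t, h1, h2, h3⟩ := Runs.loop_count (c := .op .less (.reg d) (.reg x))
      (p := .seq (.assign v (.reg d)) (.seq (p.compile (d + 1))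
        (.assign d (.op .plus (.reg d) (.const 1))))) (s.reg x) (p.tm Q H B + 20 * B) (9 * B) I (by
        intro i hi r hr
        have e2 : r.reg x = s.reg x := by
          rw [hr.2.reg x (by omega), (hD i hi.le).2 x hx]
        refine ⟨?_, less_cost (by rw [hr.1]; omega) (by rw [e2]; exact hM), ?_⟩
        · simp only [Expr.eval]; rw [hr.1, e2]; simp [Op.eval, hi]
        · have hag : Agree d (r.setReg v i) ((D i).setReg v i) := hr.2.setReg v i
          have hgood := ((hD i hi.le).1.setReg (v := v) (i := i) hv (by omega)).agree hag hd
          obtain ⟨r1, t1, k1, k2, k3⟩ := ih (d + 1) (r.setReg v i) (by omega) hwp hgood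
          have e3 : r1.reg d = i := by
            rw [k2.reg d (by omega)]
            -- The loop counter sits in the scratch register `d`. The compiled body agrees with its
            -- meaning on the registers up to `d`, so it remains to see that the meaning leaves
            -- registers from `60` on alone.
            have hfr : ∀ (p : Stm) (s : Store), p.wf → ∀ y, 60 ≤ y → (p.den s).reg y = s.reg y := by
              intro p
              induction p with
              | comp => intros; rfl
              | seq p q ihp ihq =>
                intro s hw y hy
                simp only [Stm.wf, Bool.and_eq_true] at hw
                exact (ihq _ hw.2 y hy).trans (ihp _ hw.1 y hy)
              | rep v x p ih =>
                intro s hw y hy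
                simp only [Stm.wf, Bool.and_eq_true, decide_eq_true_eq] at hw
                simp only [Stm.den]
                induction s.reg x with
                | zero => rfl
                | succ i ih' =>
                  rw [← ih']
                  exact (ih _ hw.2 y hy).trans (Store.setReg_reg_ne _ _ (by omega))
            rw [hfr p _ hwp d hd, Store.setReg_reg_ne _ _ (by omega), hr.1]
          refine ⟨_, _, .seq (.assign _ _ _) (.seq (by simpa only [Expr.eval, hr.1] using k1)
            (.assign _ _ _)), ?_, ?_, ?_⟩
          · simp only [Expr.cost, Expr.eval, e3, hr.1, Op.eval, s1]
            have a1 := sz (hi.le.trans hM)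
            have a2 : Nat.size (i + 1) ≤ 2 * B := sz (by omega)
            omega
          · rw [Store.setReg_reg_self]; simp only [Expr.eval, e3, Op.eval]
          · exact ((k2.mono (Nat.le_succ d)).trans (p.den_agree hwp hag hd)).setReg_left le_rfl)
      (by
        intro r hr
        have e2 : r.reg x = s.reg x := by
          rw [hr.2.reg x (by omega), (hD _ le_rfl).2 x hx]
        refine ⟨?_, less_cost (by rw [hr.1]; exact hM) (by rw [e2]; exact hM)⟩
        simp only [Expr.eval]; rw [hr.1, e2]; simp [Op.eval])
      (s.setReg d 0) ⟨Store.setReg_reg_self _ _ _, (Agree.refl d s).setReg_left le_rfl⟩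
    refine ⟨r, _, .seq (.assign _ _ _) h1, h3.2, ?_⟩
    simp only [Expr.cost, Stm.tm, Nat.size_zero]
    have a2 : s.reg x * (p.tm Q H B + 20 * B + 9 * B + 1) ≤
        Q * H ^ cls x * (p.tm Q H B + 40 * B) := Nat.mul_le_mul (hs.bound x hx) (by omega)
    omega

/-! ### Closed bounds for the cost -/

/-- The constant factor in the cost. -/
def Tm.co : Tm → ℕ
  | .const c => c + 3
  | .reg _ => 4
  | .cell _ i => i.co + (i.deg + 6)
  | .op o e f => e.co + f.co + (e.deg + f.deg + (Tm.op o e f).deg + 7)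
  | .ite c e f => c.co + e.co + f.co + (c.deg + 3)
  | .bind _ e f => e.co + f.co + (f.deg + 15)
  | .sum _ _ e => e.co + (3 * e.deg + 40) + 25
  | .least _ _ e => e.co + (3 * e.deg + 60) + 25
  | .pow _ _ => 90

/-- The nesting depth of the loops. -/
def Tm.qd : Tm → ℕ
  | .const _ => 0
  | .reg _ => 0
  | .cell _ i => i.qd
  | .op _ e f => max e.qd f.qd
  | .ite c e f => max (max c.qd e.qd) f.qd
  | .bind _ e f => max e.qd f.qd
  | .sum _ _ e => e.qd + 1
  | .least _ _ e => e.qd + 1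
  | .pow _ _ => 1

/-- The exponent of `H` in the number of rounds of nested loops. -/
def Tm.hd : Tm → ℕ
  | .const _ => 0
  | .reg _ => 0
  | .cell _ i => i.hd
  | .op _ e f => max e.hd f.hd
  | .ite c e f => max (max c.hd e.hd) f.hd
  | .bind _ e f => max e.hd f.hd
  | .sum _ x e => cls x + e.hd
  | .least _ x e => cls x + e.hd
  | .pow _ _ => 0

/-- A loop over register `x` multiplies the cost by `Q * H ^ cls x`, and parts that run one after
another contribute the maximum of their exponents. The exponents depend on the term only and can be
computed. -/
theorem Tm.tm_le {Q H : ℕ} (hQ : 1 ≤ Q) (hH : 1 ≤ H) (B : ℕ) (e : Tm) :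
    e.tm Q H B ≤ e.co * B * Q ^ e.qd * H ^ e.hd := by
  have mono : ∀ {c q q' h h' : ℕ}, q ≤ q' → h ≤ h' →
      c * B * Q ^ q * H ^ h ≤ c * B * Q ^ q' * H ^ h' := fun hq hh =>
    Nat.mul_le_mul (Nat.mul_le_mul_left _ (Nat.pow_le_pow_right hQ hq))
      (Nat.pow_le_pow_right hH hh)
  have zero : ∀ (c q h : ℕ), c * B ≤ c * B * Q ^ q * H ^ h := fun c q h => by
    simpa using mono (c := c) (Nat.zero_le q) (Nat.zero_le h)
  have add : ∀ {c c' q h x y : ℕ}, x ≤ c * B * Q ^ q * H ^ h → y ≤ c' * B * Q ^ q * H ^ h →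
      x + y ≤ (c + c') * B * Q ^ q * H ^ h := fun h1 h2 => by
    rw [add_mul, add_mul, add_mul]; exact add_le_add h1 h2
  have loop : ∀ {c q h x a b l : ℕ}, x ≤ c * B * Q ^ q * H ^ h →
      Q * H ^ l * (x + a * B) + b * B ≤ (c + a + b) * B * Q ^ (q + 1) * H ^ (l + h) := by
    intro c q h x a b l hx
    refine add ?_ (zero _ _ _)
    calc _ ≤ Q * H ^ l * ((c + a) * B * Q ^ q * H ^ h) := Nat.mul_le_mul_left _ (add hx (zero _ _ _))
      _ = _ := by ring
  induction e with
  | const c => exact zero _ _ _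
  | reg x => exact zero _ _ _
  | cell a i ih => exact add ih (zero _ _ _)
  | op o e f ihe ihf =>
    exact add (add (ihe.trans (mono (le_max_left _ _) (le_max_left _ _)))
      (ihf.trans (mono (le_max_right _ _) (le_max_right _ _)))) (zero _ _ _)
  | ite c e f ihc ihe ihf =>
    exact add (add (add (ihc.trans (mono (by simp [Tm.qd]) (by simp [Tm.hd])))
      (ihe.trans (mono (by simp [Tm.qd]) (by simp [Tm.hd]))))
      (ihf.trans (mono (by simp [Tm.qd]) (by simp [Tm.hd])))) (zero _ _ _)
  | bind v e f ihe ihf =>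
    exact add (add (ihe.trans (mono (le_max_left _ _) (le_max_left _ _)))
      (ihf.trans (mono (le_max_right _ _) (le_max_right _ _)))) (zero _ _ _)
  | sum v x e ih => exact loop ih
  | least v x e ih => exact loop ih
  | pow v x =>
    simp only [Tm.tm, Tm.co, Tm.qd, Tm.hd, pow_one, pow_zero, mul_one]
    nlinarith [Nat.mul_le_mul_left (40 * B) hQ]

/-- The constant factor in the cost. -/
def Stm.co : Stm → ℕ
  | .comp _ _ _ e => e.co + 40 + 25
  | .seq p q => p.co + q.co
  | .rep _ _ p => p.co + 40 + 25

/-- The nesting depth of the loops. -/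
def Stm.qd : Stm → ℕ
  | .comp _ _ _ e => e.qd + 1
  | .seq p q => max p.qd q.qd
  | .rep _ _ p => p.qd + 1

/-- The exponent of `H` in the number of rounds of nested loops. -/
def Stm.hd : Stm → ℕ
  | .comp _ _ x e => cls x + e.hd
  | .seq p q => max p.hd q.hd
  | .rep _ x p => cls x + p.hd

theorem Stm.tm_le {Q H : ℕ} (hQ : 1 ≤ Q) (hH : 1 ≤ H) (B : ℕ) (p : Stm) :
    p.tm Q H B ≤ p.co * B * Q ^ p.qd * H ^ p.hd := by
  have mono : ∀ {c q q' h h' : ℕ}, q ≤ q' → h ≤ h' →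
      c * B * Q ^ q * H ^ h ≤ c * B * Q ^ q' * H ^ h' := fun hq hh =>
    Nat.mul_le_mul (Nat.mul_le_mul_left _ (Nat.pow_le_pow_right hQ hq))
      (Nat.pow_le_pow_right hH hh)
  have loop : ∀ {c q h x a b l : ℕ}, x ≤ c * B * Q ^ q * H ^ h →
      Q * H ^ l * (x + a * B) + b * B ≤ (c + a + b) * B * Q ^ (q + 1) * H ^ (l + h) := by
    intro c q h x a b l hx
    have e1 : a * B ≤ a * B * Q ^ q * H ^ h := by
      simpa using mono (c := a) (Nat.zero_le q) (Nat.zero_le h)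
    have e2 : b * B ≤ b * B * Q ^ (q + 1) * H ^ (l + h) := by
      simpa using mono (c := b) (Nat.zero_le (q + 1)) (Nat.zero_le (l + h))
    calc _ ≤ Q * H ^ l * (c * B * Q ^ q * H ^ h + a * B * Q ^ q * H ^ h) +
          b * B * Q ^ (q + 1) * H ^ (l + h) :=
          add_le_add (Nat.mul_le_mul_left _ (add_le_add hx e1)) e2
      _ = _ := by ring
  induction p with
  | comp a v x e => exact loop (e.tm_le hQ hH B)
  | seq p q ihp ihq =>
    simp only [Stm.tm, Stm.co, add_mul]
    exact add_le_add (ihp.trans (mono (le_max_left _ _) (le_max_left _ _)))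
      (ihq.trans (mono (le_max_right _ _) (le_max_right _ _)))
  | rep v x p ih => exact loop ih

end EDS

namespace EDS

/-! ### Logical connectives and arithmetic for terms -/

namespace Tm

def no (e : Tm) : Tm := .op .equal e (.const 0)
def yes (e : Tm) : Tm := e.no.no
def and (e f : Tm) : Tm := .op .times e f
def or (e f : Tm) : Tm := (e.no.and f.no).no
def imp (e f : Tm) : Tm := e.no.or f
def eq (e f : Tm) : Tm := .op .equal e f
def lt (e f : Tm) : Tm := .op .less e f
def le (e f : Tm) : Tm := (f.lt e).no
def add (e f : Tm) : Tm := .op .plus e f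
def mul (e f : Tm) : Tm := .op .times e f
def div (e f : Tm) : Tm := .op .quot e f
def mod (e f : Tm) : Tm := .op .rem e f
-- Truth means being nonzero, so a sum acts as a disjunction: a sum of natural numbers vanishes only
-- if all its terms do.
def all (v x : ℕ) (e : Tm) : Tm := (Tm.sum v x e.no).no
def ex (v x : ℕ) (e : Tm) : Tm := (Tm.sum v x e).yes
def cnt (v x : ℕ) (e : Tm) : Tm := Tm.sum v x e.yes

/-- The term is true, that is, its value is not `0`. -/
def T (e : Tm) (s : Store) : Prop := e.eval s ≠ 0

variable (s : Store) (e f : Tm) (v x : ℕ)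

theorem T_no : e.no.T s ↔ ¬ e.T s := by
  simp only [T, no, eval, Op.eval]; split_ifs <;> simp_all
theorem T_yes : e.yes.T s ↔ e.T s := by simp only [yes, T_no, not_not]
theorem T_and : (e.and f).T s ↔ e.T s ∧ f.T s := by simp [T, and, eval, Op.eval]
theorem T_or : (e.or f).T s ↔ e.T s ∨ f.T s := by simp only [or, T_no, T_and]; tauto
theorem T_imp : (e.imp f).T s ↔ (e.T s → f.T s) := by simp only [imp, T_no, T_or]; tauto
theorem T_eq : (e.eq f).T s ↔ e.eval s = f.eval s := by
  simp only [T, eq, eval, Op.eval]; split_ifs <;> simp_all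
theorem T_lt : (e.lt f).T s ↔ e.eval s < f.eval s := by
  simp only [T, lt, eval, Op.eval]; split_ifs <;> simp_all
theorem T_le : (e.le f).T s ↔ e.eval s ≤ f.eval s := by simp only [le, T_no, T_lt, not_lt]
theorem T_const (c : ℕ) : (Tm.const c).T s ↔ c ≠ 0 := Iff.rfl
theorem T_cell (a : ℕ) : (Tm.cell a e).T s ↔ s.arr a (e.eval s) ≠ 0 := Iff.rfl
theorem T_bind : (Tm.bind v e f).T s ↔ f.T (s.setReg v (e.eval s)) := Iff.rfl
theorem T_sum : (Tm.sum v x e).T s ↔ ∃ i < s.reg x, e.T (s.setReg v i) := by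
  simp only [T, eval, ne_eq, Finset.sum_eq_zero_iff, Finset.mem_range, not_forall, exists_prop]
theorem T_all : (Tm.all v x e).T s ↔ ∀ i < s.reg x, e.T (s.setReg v i) := by
  rw [all, T_no, T_sum]
  simp only [T_no]
  push Not
  rfl
theorem T_ex : (Tm.ex v x e).T s ↔ ∃ i < s.reg x, e.T (s.setReg v i) := by
  rw [ex, T_yes, T_sum]
theorem T_ite (c : Tm) : (Tm.ite c e f).T s ↔ (c.T s → e.T s) ∧ (¬ c.T s → f.T s) := by
  simp only [T, eval, ne_eq]; split_ifs <;> simp_all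

open Classical in
theorem eval_no : e.no.eval s = if e.T s then 0 else 1 := by
  simp only [T, no, eval, Op.eval]; split_ifs <;> simp_all
open Classical in
theorem eval_yes : e.yes.eval s = if e.T s then 1 else 0 := by
  rw [yes, eval_no, T_no]; split_ifs <;> simp_all
open Classical in
theorem eval_or : (e.or f).eval s = if e.T s ∨ f.T s then 1 else 0 := by
  rw [or, eval_no, T_and, T_no, T_no]; split_ifs <;> tauto
theorem eval_add : (e.add f).eval s = e.eval s + f.eval s := rfl
theorem eval_mul : (e.mul f).eval s = e.eval s * f.eval s := rfl
theorem eval_div : (e.div f).eval s = e.eval s / f.eval s := rfl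
theorem eval_mod : (e.mod f).eval s = e.eval s % f.eval s := rfl
theorem eval_const (c : ℕ) : (Tm.const c).eval s = c := rfl
theorem eval_reg : (Tm.reg x).eval s = s.reg x := rfl
theorem eval_cell (a : ℕ) : (Tm.cell a e).eval s = s.arr a (e.eval s) := rfl
theorem eval_bind : (Tm.bind v e f).eval s = f.eval (s.setReg v (e.eval s)) := rfl
theorem eval_sum : (Tm.sum v x e).eval s = ∑ i ∈ Finset.range (s.reg x), e.eval (s.setReg v i) :=
  rfl
open Classical in
theorem eval_cnt : (Tm.cnt v x e).eval s =
    ((Finset.range (s.reg x)).filter fun i => e.T (s.setReg v i)).card := by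
  simp only [cnt, eval, eval_yes, Finset.card_filter]
theorem eval_least : (Tm.least v x e).eval s =
    leastBelow (fun i => e.eval (s.setReg v i)) (s.reg x) := rfl
open Classical in
theorem eval_ite (c : Tm) : (Tm.ite c e f).eval s = if c.T s then e.eval s else f.eval s := by
  by_cases h : c.T s
  · rw [if_pos h]; exact if_pos h
  · rw [if_neg h]; exact if_neg h
theorem eval_pow : (Tm.pow v x).eval s = 3 ^ min (s.reg v) (s.reg x) := rfl

end Tm

/-! ### The program

Registers: `0` to `6` hold `n`, `m`, `m * m`, the number `m * m + 1` of cuts, `n + 1`, `2 * n + 1`,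
`m * m * m`; the registers from `7` to `20` hold further loop bounds. A cut `c < m * m` is that of
the pair `(c / m, c % m)` of nodes; the cut `m * m` has all vertices on its inner side. -/

namespace Code

open Tm

/-- The cell `(c, x)` of a two-dimensional array with rows of length `n`. -/
def row (a : ℕ) (c x : Tm) : Tm := .cell a ((c.mul (.reg 0)).add x)

def adj (a b : Tm) : Tm := row 0 a b
def side (c x : Tm) : Tm := row 6 c x
def outer (c x : Tm) : Tm := row 7 c x
def split (c : Tm) : Tm := .cell 8 c
def marked (c x : Tm) : Tm := row 9 c x
def inCover (c x : Tm) : Tm := row 15 c x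
def cross (c a b : Tm) : Tm := (side c a).and ((side c b).no.and (adj a b))

/-- The digit of `t` that belongs to the vertex `x` of the cover for the cut `c`. -/
def digit (t c x : Tm) : Tm := (t.div (.cell 3 (row 16 c x))).mod (.const 3)

/-- Run through the two-dimensional index of a cell. -/
def unpack (e : Tm) : Tm := .bind 26 ((Tm.reg 25).div (.reg 0)) (.bind 27 ((Tm.reg 25).mod (.reg 0)) e)

def powers : Stm := .comp 3 25 4 (.pow 25 0)

def reachInit : Stm :=
  .comp 4 25 6 (((Tm.reg 25).mod (.reg 1)).eq (((Tm.reg 25).div (.reg 1)).div (.reg 1)))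

/-- Cells are indexed by `(u * m + v) * m + w`. The negated disjunct forbids the tree edge `uv` as
the last step of a walk. Array `5` is a shadow of array `4`, since a comprehension must not read the
array that it writes. -/
def reachStep : Stm :=
  .seq (.comp 5 25 6 (.bind 26 ((Tm.reg 25).div (.reg 1)) (.bind 27 ((Tm.reg 25).mod (.reg 1))
    (.bind 28 ((Tm.reg 26).div (.reg 1)) (.bind 29 ((Tm.reg 26).mod (.reg 1))
      ((Tm.cell 4 (.reg 25)).or (.ex 34 1
        ((Tm.cell 4 (((Tm.reg 26).mul (.reg 1)).add (.reg 34))).and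
          ((Tm.cell 1 (((Tm.reg 34).mul (.reg 1)).add (.reg 27))).and
            ((((Tm.reg 34).eq (.reg 28)).and ((Tm.reg 27).eq (.reg 29))).or
              (((Tm.reg 34).eq (.reg 29)).and ((Tm.reg 27).eq (.reg 28)))).no)))))))))
    (.comp 4 25 6 (.cell 5 (.reg 25)))

/-- The values are normalized to `0` and `1`, because `fitting` compares vertex sets cell by cell. A
pair of nonadjacent nodes gets the empty side. -/
def sides : Stm :=
  .comp 6 25 7 (unpack (.ite ((Tm.reg 26).lt (.reg 2))
    ((Tm.cell 1 (.reg 26)).and (.ex 34 1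
      (((Tm.sum 35 1 (.cell 1 (((Tm.reg 34).mul (.reg 1)).add (.reg 35)))).lt (.const 2)).and
        (((Tm.cell 2 (.reg 34)).eq (.reg 27)).and
          (.cell 4 (((Tm.reg 26).mul (.reg 1)).add (.reg 34))))))).yes (.const 1)))

def outers : Stm :=
  .comp 7 25 7 (unpack (.ex 34 0 (cross (.reg 26) (.reg 27) (.reg 34))))

def splits : Stm :=
  .comp 8 25 3 (((Tm.const 2).le (.cnt 34 0 (side (.reg 25) (.reg 34)))).and
    (((Tm.const 2).le (.cnt 34 0 (side (.reg 25) (.reg 34)).no)).and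
      (.all 34 0 (.all 35 0 (.all 36 0 (((outer (.reg 25) (.reg 34)).and
        ((outer (.reg 25) (.reg 35)).and (cross (.reg 25) (.reg 34) (.reg 36)))).imp
        (cross (.reg 25) (.reg 35) (.reg 36))))))))

/-- The pair number `t` (register `33`) is added to the matching of the cut in register `26`, and
the vertex in register `27` belongs to it. -/
def newPair : Tm :=
  (((cross (.reg 26) ((Tm.reg 33).div (.reg 0)) ((Tm.reg 33).mod (.reg 0))).and
    ((marked (.reg 26) ((Tm.reg 33).div (.reg 0))).no.and
      (marked (.reg 26) ((Tm.reg 33).mod (.reg 0))).no))).and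
    (((Tm.reg 27).eq ((Tm.reg 33).div (.reg 0))).or ((Tm.reg 27).eq ((Tm.reg 33).mod (.reg 0))))

/-- All cuts are treated in the same step. Half the number of vertices matched so far is the number
of the new pair; it is computed while array `9` is still the old one. -/
def greedyStep : Stm :=
  .seq (.comp 10 25 7 (unpack (.ite newPair (.const 1) (.cell 9 (.reg 25)))))
  (.seq (.comp 12 25 7 (unpack (.ite newPair
    ((Tm.cnt 34 0 (marked (.reg 26) (.reg 34))).div (.const 2)) (.cell 11 (.reg 25)))))
  (.seq (.comp 9 25 7 (.cell 10 (.reg 25))) (.comp 11 25 7 (.cell 12 (.reg 25)))))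

/-- The cuts and greedy matchings of the edges that cross them. -/
def cuts : Stm :=
  .seq powers (.seq reachInit (.seq (.rep 33 1 reachStep) (.seq sides (.seq outers (.seq splits
    (.rep 33 8 greedyStep))))))

/-- `3 ^ z` for the maximum size `z` of the greedy matchings at cuts that are no splits. -/
def codeBound : Tm :=
  .bind 37 (.least 38 4 (.all 34 3 ((split (.reg 34)).or
    ((Tm.cnt 35 0 (marked (.reg 34) (.reg 35))).le ((Tm.const 2).mul (.reg 38))))))
    (.cell 3 (.reg 37))

/-- The matched vertex `y` belongs to the cover with the code in register `36`. -/
def chosen (c y : Tm) : Tm :=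
  .ite (side c y) (((((Tm.reg 36).div (.cell 3 (row 11 c y))).mod (.const 3)).eq (.const 1)).no)
    (((((Tm.reg 36).div (.cell 3 (row 11 c y))).mod (.const 3)).eq (.const 0)).no)

/-- The vertex `x` belongs to the cover with the code in register `36`. -/
def decode (c x : Tm) : Tm :=
  .ite (marked c x) (chosen c x) (.ex 38 0 (((cross c x (.reg 38)).or (cross c (.reg 38) x)).and
    ((marked c (.reg 38)).and (chosen c (.reg 38)).no)))

def isCover (c : Tm) : Tm :=
  .all 34 0 (.all 35 0 ((cross c (.reg 34) (.reg 35)).imp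
    ((decode c (.reg 34)).or (decode c (.reg 35)))))

def coverSize (c : Tm) : Tm := .cnt 34 0 (decode c (.reg 34))

/-- Minimum covers of the edges that cross a cut. -/
def covers : Stm :=
  .seq (.comp 13 25 3 (.ite (split (.reg 25)) (.const 0) (.least 37 4 (.ex 36 9
    ((isCover (.reg 25)).and ((coverSize (.reg 25)).eq (.reg 37)))))))
  (.seq (.comp 14 25 3 (.least 36 9
    ((isCover (.reg 25)).and ((coverSize (.reg 25)).eq (.cell 13 (.reg 25))))))
  (.seq (.comp 15 25 7 (unpack (.bind 36 (.cell 14 (.reg 26)) (decode (.reg 26) (.reg 27)).yes)))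
  (.comp 16 25 7 (unpack (.cnt 34 0 (((Tm.reg 34).lt (.reg 27)).and
    (inCover (.reg 26) (.reg 34))))))))

/-- `3 ^ z` for the maximum size `z` of the covers at cuts that are no splits. -/
def coverBound : Tm :=
  .bind 37 (.least 38 4 (.all 34 3 ((split (.reg 34)).or ((Tm.cell 13 (.reg 34)).le (.reg 38)))))
    (.cell 3 (.reg 37))

/-- The label of the vertex `x` in the item in register `28` of the array `L`. -/
def label (L : ℕ) (x : Tm) : Tm := row L (.reg 28) x

/-- At the split in register `26`, the item has the signature in register `27`. -/
def satSplit (L : ℕ) : Tm :=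
  ((((Tm.reg 27).mod (.const 2)).eq (.const 1)).imp
    (.all 34 0 ((outer (.reg 26) (.reg 34)).imp (label L (.reg 34))))).and
  (((Tm.reg 27).div (.const 2)).le (.cnt 34 0 ((outer (.reg 26) (.reg 34)).and
    ((label L (.reg 34)).eq (.const 2)))))

/-- The vertex `x` of the cover lies outside, and has digit `2` in registers `27` and `36`. -/
def demands (x : Tm) : Tm :=
  (inCover (.reg 26) x).and ((side (.reg 26) x).no.and
    (((digit (.reg 27) (.reg 26) x).eq (.const 2)).and
      ((digit (.reg 36) (.reg 26) x).eq (.const 2))))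

/-- At the cut in register `26`, the item has the signature in register `27`. -/
def satCover (L : ℕ) : Tm :=
  (Tm.all 34 0 ((inCover (.reg 26) (.reg 34)).imp (.ite (side (.reg 26) (.reg 34))
    ((((digit (.reg 27) (.reg 26) (.reg 34)).eq (.const 1)).imp (label L (.reg 34))).and
      (((digit (.reg 27) (.reg 26) (.reg 34)).eq (.const 2)).imp
        ((label L (.reg 34)).eq (.const 2))))
    (((digit (.reg 27) (.reg 26) (.reg 34)).eq (.const 0)).imp
      (.all 35 0 ((cross (.reg 26) (.reg 35) (.reg 34)).imp (label L (.reg 35)))))))).and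
  (.all 36 10 ((Tm.cnt 34 0 (demands (.reg 34))).le (.cnt 35 0 ((side (.reg 26) (.reg 35)).and
    ((inCover (.reg 26) (.reg 35)).no.and (((label L (.reg 35)).eq (.const 2)).and
      (.ex 34 0 ((demands (.reg 34)).and (adj (.reg 35) (.reg 34))))))))))

def sat (L : ℕ) : Tm := .ite (split (.reg 26)) (satSplit L) (satCover L)

/-- The slot in register `28` has the vertex set and the signature of the entry in registers `26`
and `27`. -/
def fitting : Tm :=
  (Tm.cell 19 (.reg 28)).and
    ((Tm.all 34 0 ((row 21 (.reg 28) (.reg 34)).eq (side (.reg 26) (.reg 34)))).and (sat 20))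

def slotWeight : Tm := .sum 34 0 (label 20 (.reg 34))

def unpackEntry (e : Tm) : Tm :=
  .bind 26 ((Tm.reg 25).div (.reg 11)) (.bind 27 ((Tm.reg 25).mod (.reg 11)) e)

/-- Improve the entries of the table by the slots. -/
def collect : Stm :=
  .seq (.comp 29 25 12 (unpackEntry (.least 37 5 (.ex 28 18 (fitting.and (slotWeight.eq (.reg 37)))))))
  (.seq (.comp 30 25 12 (unpackEntry (.least 28 18
    (fitting.and (slotWeight.eq (.cell 29 (.reg 25)))))))
  (.seq (.comp 31 25 12 (((Tm.cell 30 (.reg 25)).lt (.reg 18)).and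
    ((Tm.cell 17 (.reg 25)).no.or ((Tm.cell 29 (.reg 25)).lt (.sum 34 0 (row 18 (.reg 25) (.reg 34)))))))
  (.seq (.comp 32 25 12 ((Tm.cell 17 (.reg 25)).or (.cell 31 (.reg 25))))
  (.seq (.comp 33 25 13 (unpack (.ite (.cell 31 (.reg 26))
    (row 20 (.cell 30 (.reg 26)) (.reg 27)) (.cell 18 (.reg 25)))))
  (.seq (.comp 17 25 12 (.cell 32 (.reg 25))) (.comp 18 25 13 (.cell 33 (.reg 25))))))))

/-- Slots for the cut in register `30` if its inner side has at most one vertex. -/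
def base : Stm :=
  .seq (.comp 19 25 18 (((Tm.reg 25).lt (.const 2)).and
    ((Tm.cnt 34 0 (side (.reg 30) (.reg 34))).lt (.const 2))))
  (.seq (.comp 21 25 19 (side (.reg 30) ((Tm.reg 25).mod (.reg 0))))
  (.comp 20 25 19 (unpack (.ite (((Tm.reg 26).eq (.const 1)).and (side (.reg 30) (.reg 27)))
    (.const 2) (.const 0)))))

/-- The entry `t` of the table for the cut `c`. -/
def entry (c t : Tm) : Tm := (c.mul (.reg 11)).add t

/-- Candidates from the tables for the cuts in registers `30` and `31`. -/
def initial : Stm :=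
  .seq (.comp 22 25 15 (.bind 26 ((Tm.reg 25).div (.reg 14)) (.bind 27 ((Tm.reg 25).mod (.reg 14))
    (((Tm.reg 27).lt (.reg 11)).and ((Tm.cell 17 (entry (.reg 30) (.reg 26))).and
      ((Tm.cell 17 (entry (.reg 31) (.reg 27))).and
        ((Tm.all 34 0 ((side (.reg 30) (.reg 34)).and (side (.reg 31) (.reg 34))).no).and
          (.all 34 0 (.all 35 0 (((side (.reg 30) (.reg 34)).and ((side (.reg 31) (.reg 35)).and
            (adj (.reg 34) (.reg 35)))).imp ((row 18 (entry (.reg 30) (.reg 26)) (.reg 34)).or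
              (row 18 (entry (.reg 31) (.reg 27)) (.reg 35)))))))))).yes)))
  (.seq (.comp 23 25 16 (unpack (.bind 28 ((Tm.reg 26).div (.reg 14))
    (.bind 29 ((Tm.reg 26).mod (.reg 14))
      (.ite (row 18 (entry (.reg 30) (.reg 28)) (.reg 27))
        (row 18 (entry (.reg 30) (.reg 28)) (.reg 27))
        (row 18 (entry (.reg 31) (.reg 29)) (.reg 27)))))))
  (.comp 24 25 16 (unpack (.ite ((side (.reg 30) (.reg 27)).and
    ((Tm.cell 23 (.reg 25)).eq (.const 2))) (.const 1) (.cell 23 (.reg 25))))))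

/-- Candidates from the slots: the vertex in register `32` is matched, or not. -/
def step : Stm :=
  .seq (.comp 22 25 15 (.bind 26 ((Tm.reg 25).div (.reg 4)) (.bind 27 ((Tm.reg 25).mod (.reg 4))
    ((Tm.cell 19 (.reg 26)).and (((Tm.reg 27).eq (.reg 0)).or
      ((side (.reg 30) (.reg 32)).and ((side (.reg 31) (.reg 27)).and
        ((adj (.reg 32) (.reg 27)).and (((row 20 (.reg 26) (.reg 32)).eq (.const 2)).and
          ((row 20 (.reg 26) (.reg 27)).eq (.const 2)))))))).yes)))
  (.seq (.comp 23 25 16 (unpack (.bind 28 ((Tm.reg 26).div (.reg 4))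
    (.bind 29 ((Tm.reg 26).mod (.reg 4))
      (.ite (((Tm.reg 29).lt (.reg 0)).and (((Tm.reg 27).eq (.reg 32)).or ((Tm.reg 27).eq (.reg 29))))
        (.const 1) (row 20 (.reg 28) (.reg 27)))))))
  (.comp 24 25 16 (unpack (.ite ((side (.reg 30) (.reg 27)).and
    (((Tm.cell 23 (.reg 25)).eq (.const 2)).and ((Tm.reg 32).lt (.reg 27))))
    (.const 1) (.cell 23 (.reg 25))))))

/-- The candidate number `r` (register `36`) for the slot with first index in register `26`. -/
def cand : Tm := ((Tm.reg 26).mul (.reg 14)).add (.reg 36)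

/-- Array `25` records the signatures at the first cut, for the labellings of array `24`, where the
open unprocessed vertices of that side are closed. Array `26` records those at the second cut, for
the true labellings in array `23`. -/
def winning : Tm :=
  (Tm.cell 22 cand).and ((Tm.cell 25 ((cand.mul (.reg 11)).add (.reg 27))).and
    (.cell 26 ((cand.mul (.reg 11)).add (.reg 28))))

def candWeight : Tm := .sum 34 0 (row 23 cand (.reg 34))

/-- The three indices of a slot are an entry of the first table, a signature at the first cut and a
signature at the second cut. -/
def unpackSlot (e : Tm) : Tm :=
  .bind 26 (((Tm.reg 25).div (.reg 11)).div (.reg 11))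
    (.bind 27 (((Tm.reg 25).div (.reg 11)).mod (.reg 11)) (.bind 28 ((Tm.reg 25).mod (.reg 11)) e))

/-- For every slot, the best candidate with its signatures. -/
def select : Stm :=
  .seq (.comp 25 25 17 (.bind 26 (.reg 30) (.bind 27 ((Tm.reg 25).mod (.reg 11))
    (.bind 28 ((Tm.reg 25).div (.reg 11)) (sat 24).yes))))
  (.seq (.comp 26 25 17 (.bind 26 (.reg 31) (.bind 27 ((Tm.reg 25).mod (.reg 11))
    (.bind 28 ((Tm.reg 25).div (.reg 11)) (sat 23).yes))))
  (.seq (.comp 27 25 18 (unpackSlot (.least 37 5 (.ex 36 14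
    (winning.and (candWeight.eq (.reg 37)))))))
  (.seq (.comp 28 25 18 (unpackSlot (.least 36 14
    (winning.and (candWeight.eq (.cell 27 (.reg 25)))))))
  (.seq (.comp 19 25 18 ((Tm.cell 28 (.reg 25)).lt (.reg 14)))
  (.comp 20 25 19 (unpack (row 23 (((((Tm.reg 26).div (.reg 11)).div (.reg 11)).mul (.reg 14)).add
    (.cell 28 (.reg 26))) (.reg 27))))))))

/-- Join the tables for the cuts in registers `30` and `31`. -/
def join : Stm :=
  .seq initial (.seq select (.seq (.rep 32 0 (.seq step select))
    (.seq (.comp 21 25 19 ((side (.reg 30) ((Tm.reg 25).mod (.reg 0))).or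
      (side (.reg 31) ((Tm.reg 25).mod (.reg 0))))) collect)))

/-- The tables for all cuts. -/
def tables : Stm :=
  .seq (.rep 30 3 (.seq base collect)) (.rep 33 20 (.rep 30 3 (.rep 31 3 join)))

/-- Half of the minimum weight of an entry of the table for the cut number `m * m`. -/
def answer : Tm :=
  (Tm.least 37 5 (.ex 28 11 ((Tm.cell 17 (entry (.reg 2) (.reg 28))).and
    ((Tm.sum 34 0 (row 18 (entry (.reg 2) (.reg 28)) (.reg 34))).eq (.reg 37))))).div (.const 2)

end Code
end EDS

namespace EDS

/-! ### Partial solutions as labellings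

The label of a vertex is `0` if it is not covered, `1` if it is covered by an edge between two
vertices of label `1`, and `2` if it is covered by an edge of its own. -/

section Labels

variable {V : Type*} (G : SimpleGraph V)

/-- A partial solution on the vertex set `A`. -/
structure IsPartial (A : Set V) (X : V → ℕ) : Prop where
  supp : ∀ x ∉ A, X x = 0
  le_two : ∀ x, X x ≤ 2
  cover : ∀ a ∈ A, ∀ b ∈ A, G.Adj a b → X a ≠ 0 ∨ X b ≠ 0
  mate : ∃ f : V → V, ∀ x, X x = 1 → X (f x) = 1 ∧ G.Adj x (f x) ∧ f (f x) = x

/-- The partial solution `X` on `A` covers the edges to the outer vertices in `O`, and the outer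
vertices in `Q` can be matched to vertices of label `2`. -/
def Fits (A : Set V) (X : V → ℕ) (O Q : Set V) : Prop :=
  (∀ o ∈ O, ∀ a ∈ A, G.Adj a o → X a ≠ 0) ∧
    ∃ φ : V → V, Set.InjOn φ Q ∧ ∀ q ∈ Q, φ q ∈ A ∧ G.Adj (φ q) q ∧ X (φ q) = 2

/-- A cut, given by its inner side, with a cover of the crossing edges and a numbering of it. -/
structure Cut (V : Type*) where
  side : Set V
  split : Prop
  cover : Set V
  pos : V → ℕ

/-- The inner vertices with an outer neighbour. -/
def Cut.outer (c : Cut V) : Set V := {a | a ∈ c.side ∧ ∃ b ∉ c.side, G.Adj a b}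

/-- The digit of `t` that belongs to the vertex `x` of the cover. -/
def Cut.digit (c : Cut V) (t : ℕ) (x : V) : ℕ := t / 3 ^ c.pos x % 3

/-- The outer vertices of the cover that have digit `2` both in `t` and in `r`. -/
def Cut.demands (c : Cut V) (t r : ℕ) : Set V :=
  {x | x ∈ c.cover ∧ x ∉ c.side ∧ c.digit t x = 2 ∧ c.digit r x = 2}

/-- The labelling `X` has the signature `t`. -/
def Cut.Sat (c : Cut V) (K t : ℕ) (X : V → ℕ) : Prop :=
  (c.split → (t % 2 = 1 → ∀ a ∈ c.outer G, X a ≠ 0) ∧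
    t / 2 ≤ {a | a ∈ c.outer G ∧ X a = 2}.ncard) ∧
  (¬ c.split → (∀ x ∈ c.cover,
      (x ∈ c.side → (c.digit t x = 1 → X x ≠ 0) ∧ (c.digit t x = 2 → X x = 2)) ∧
      (x ∉ c.side → c.digit t x = 0 → ∀ a ∈ c.side, G.Adj a x → X a ≠ 0)) ∧
    ∀ r < K, (c.demands t r).ncard ≤ {a | a ∈ c.side ∧ a ∉ c.cover ∧ X a = 2 ∧
      ∃ x ∈ c.demands t r, G.Adj a x}.ncard)

/-- What the signatures for a cut depend on is correct. -/
structure Cut.Valid (c : Cut V) (K : ℕ) : Prop where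
  pos_K : 1 ≤ K
  nbr : c.split → ∀ u ∈ c.outer G, ∀ v ∈ c.outer G, ∀ w ∉ c.side, G.Adj u w → G.Adj v w
  isCover : ¬ c.split → ∀ a ∈ c.side, ∀ b ∉ c.side, G.Adj a b → a ∈ c.cover ∨ b ∈ c.cover
  inj : ¬ c.split → Set.InjOn c.pos c.cover
  pos_lt : ¬ c.split → ∀ x ∈ c.cover, c.pos x < c.cover.ncard
  pow_le : ¬ c.split → 3 ^ c.cover.ncard ≤ K

theorem exists_digits (k : ℕ) (g : ℕ → ℕ) (hg : ∀ i, g i < 3) :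
    ∃ t < 3 ^ k, ∀ i < k, t / 3 ^ i % 3 = g i := by
  induction k with
  | zero => exact ⟨0, by simp⟩
  | succ k ih =>
    obtain ⟨t, ht, h⟩ := ih
    refine ⟨t + 3 ^ k * g k, ?_, fun i hi => ?_⟩
    · have := hg k
      rw [pow_succ]; nlinarith
    · rcases Nat.lt_succ_iff_lt_or_eq.1 hi with h1 | rfl
      · rw [← h i h1]
        obtain ⟨j, rfl⟩ : ∃ j, k = i + 1 + j := ⟨k - (i + 1), by omega⟩
        have : t + 3 ^ (i + 1 + j) * g (i + 1 + j) =
            t + 3 ^ i * (3 * (3 ^ j * g (i + 1 + j))) := by ring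
        rw [this, Nat.add_mul_div_left _ _ (by positivity), Nat.add_mul_mod_self_left]
      · rw [Nat.add_mul_div_left _ _ (by positivity), Nat.div_eq_of_lt ht, zero_add,
          Nat.mod_eq_of_lt (hg i)]

/-- Distinct vertices of `S` own distinct digit positions, so their digits can be prescribed
independently. -/
theorem exists_code {S : Set V} {pos : V → ℕ} {k : ℕ} (hinj : Set.InjOn pos S)
    (hlt : ∀ x ∈ S, pos x < k) (f : V → ℕ) (hf : ∀ x, f x < 3) :
    ∃ t < 3 ^ k, ∀ x ∈ S, t / 3 ^ pos x % 3 = f x := by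
  classical
  obtain ⟨t, ht, h⟩ := exists_digits k
    (fun i => if h : ∃ x ∈ S, pos x = i then f h.choose else 0)
    (fun i => by split_ifs with h; exacts [hf _, by norm_num])
  refine ⟨t, ht, fun x hx => ?_⟩
  have hex : ∃ y ∈ S, pos y = pos x := ⟨x, hx, rfl⟩
  rw [h _ (hlt x hx), dif_pos hex, hinj hex.choose_spec.1 hx hex.choose_spec.2]

variable {G}

/-- The exchange property behind the tables. At a split, any sufficiently many open boundary
vertices serve `Q`, since all of them have the same outer neighbours. At another cut, an inner cover
vertex gets digit `2` if `φ` uses it, else `1` if it has a label, else `0`. An outer cover vertex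
gets `0` if it lies in `O`, `2` if it lies in `Q` and its partner is outside the cover, and `1` if
nothing is asked. The counting condition over all `r` ranges over the subsets of the vertices of the
last kind with digit `2`, so it is Hall's condition. -/
theorem Cut.exists_sat [Fintype V] {c : Cut V} {K : ℕ} (hc : c.Valid G K) {X : V → ℕ}
    {O Q : Set V} (hQ : Q ⊆ c.sideᶜ) (hO : O ⊆ c.sideᶜ) (hd : Disjoint O Q)
    (hX : Fits G c.side X O Q) :
    ∃ t < K * (2 * Fintype.card V + 2), c.Sat G K t X ∧
      ∀ Y, c.Sat G K t Y → Fits G c.side Y O Q := by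
  classical
  obtain ⟨hcov, φ, hinj, hφ⟩ := hX
  have hK := hc.pos_K
  by_cases hs : c.split
  · have hcard : Q.ncard ≤ Fintype.card V := by
      rw [← Nat.card_eq_fintype_card, ← Set.ncard_univ]
      exact Set.ncard_le_ncard (Set.subset_univ _)
    have hout : ∀ q ∈ Q, φ q ∈ c.outer G := fun q hq => ⟨(hφ q hq).1, q, hQ hq, (hφ q hq).2.1⟩
    -- If some vertex of `O` has an inner neighbour, it is adjacent to all boundary vertices, so all
    -- of them must have labels; otherwise `O` asks for nothing.
    let b : ℕ := if ∃ o ∈ O, ∃ a ∈ c.side, G.Adj a o then 1 else 0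
    have hb : b ≤ 1 := by simp only [b]; split_ifs <;> simp
    -- The bit and the count give a number below `2 * n + 2`, where `n` is the number of vertices;
    -- the factor `K` only makes the bound common to both kinds of cuts.
    refine ⟨b + 2 * Q.ncard, by nlinarith, ⟨fun _ => ⟨fun h => ?_, ?_⟩, fun h => absurd hs h⟩,
      fun Y hY => ?_⟩
    · have : b = 1 := by omega
      simp only [b] at this
      split_ifs at this with h'
      obtain ⟨o, ho, a, ha, hao⟩ := h'
      intro a' ha'
      exact hcov o ho a' ha'.1 (hc.nbr hs a ⟨ha, o, hO ho, hao⟩ a' ha' o (hO ho) hao)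
    · rw [show (b + 2 * Q.ncard) / 2 = Q.ncard by omega, ← hinj.ncard_image]
      refine Set.ncard_le_ncard ?_
      rintro _ ⟨q, hq, rfl⟩
      exact ⟨hout q hq, (hφ q hq).2.2⟩
    · obtain ⟨h1, h2⟩ := hY.1 hs
      rw [show (b + 2 * Q.ncard) / 2 = Q.ncard by omega] at h2
      refine ⟨fun o ho a ha hao => ?_, ?_⟩
      · refine h1 ?_ a ⟨ha, o, hO ho, hao⟩
        have : b = 1 := if_pos ⟨o, ho, a, ha, hao⟩
        omega
      · have hfin : {a | a ∈ c.outer G ∧ Y a = 2}.Finite := Set.toFinite _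
        by_cases hne : Nonempty V
        · obtain ⟨ψ, h3, h4⟩ := (Set.toFinite Q).exists_injOn_of_encard_le
            (t := {a | a ∈ c.outer G ∧ Y a = 2}) (by
              rw [← (Set.toFinite Q).cast_ncard_eq, ← hfin.cast_ncard_eq]
              exact_mod_cast h2)
          refine ⟨ψ, h4, fun q hq => ?_⟩
          have h5 := h3 hq
          exact ⟨h5.1.1, hc.nbr hs _ (hout q hq) _ h5.1 q (hQ hq) (hφ q hq).2.1, h5.2⟩
        · exact ⟨φ, fun x => (hne ⟨x⟩).elim, fun x => (hne ⟨x⟩).elim⟩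
  · let f : V → ℕ := fun x => if x ∈ c.side then
        (if x ∈ φ '' Q then 2 else if X x ≠ 0 then 1 else 0)
      else if x ∈ O then 0 else if x ∈ Q ∧ φ x ∉ c.cover then 2 else 1
    obtain ⟨t, ht, h⟩ := exists_code (hc.inj hs) (hc.pos_lt hs) f
      (fun x => by simp only [f]; split_ifs <;> norm_num)
    have htK := ht.trans_le (hc.pow_le hs)
    change ∀ x ∈ c.cover, c.digit t x = f x at h
    have key : ∀ r, ∀ x ∈ c.demands t r, x ∈ Q ∧ φ x ∉ c.cover := by
      intro r x hx
      have h1 := h x hx.1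
      rw [hx.2.2.1] at h1
      simp only [f, if_neg hx.2.1] at h1
      split_ifs at h1 with h2 h3 <;> first | exact h3 | omega
    refine ⟨t, htK.trans_le (by nlinarith), ⟨fun h' => absurd h' hs, fun _ => ⟨fun x hx =>
      ⟨fun hxs => ⟨fun h1 => ?_, fun h1 => ?_⟩, fun hxs h1 a ha hax => ?_⟩, fun r _ => ?_⟩⟩,
      fun Y hY => ?_⟩
    · rw [h x hx] at h1
      simp only [f, if_pos hxs] at h1
      split_ifs at h1 with h2 h3 <;> first | exact h3 | omega
    · rw [h x hx] at h1
      simp only [f, if_pos hxs] at h1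
      have h2 : x ∈ φ '' Q := by
        by_contra h2
        rw [if_neg h2] at h1
        split_ifs at h1
        all_goals omega
      obtain ⟨q, hq, rfl⟩ := h2
      exact (hφ q hq).2.2
    · rw [h x hx] at h1
      simp only [f, if_neg hxs] at h1
      split_ifs at h1 with h2
      exact hcov x h2 a ha hax
    · rw [← (hinj.mono fun x hx => (key r x hx).1).ncard_image]
      refine Set.ncard_le_ncard ?_
      rintro _ ⟨q, hq, rfl⟩
      obtain ⟨h1, h2⟩ := key r q hq
      exact ⟨(hφ q h1).1, h2, (hφ q h1).2.2, q, hq, (hφ q h1).2.1⟩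
    · obtain ⟨h1, h2⟩ := hY.2 hs
      refine ⟨fun o ho a ha hao => ?_, ?_⟩
      -- If the inner end is in the cover, its digit is not `0` because `X` labels it, and this
      -- forces a label in `Y`; if the outer end is, its digit is `0`.
      · rcases hc.isCover hs a ha o (hO ho) hao with h3 | h3
        · have hXa := hcov o ho a ha hao
          have h4 := h a h3
          simp only [f, if_pos ha] at h4
          split_ifs at h4 with h5
          · rw [((h1 a h3).1 ha).2 h4]; norm_num
          · exact ((h1 a h3).1 ha).1 h4
        · refine (h1 o h3).2 (hO ho) ?_ a ha hao
          rw [h o h3]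
          simp only [f, if_neg (show o ∉ c.side from hO ho), if_pos ho]
      -- Only these vertices get new partners, and these are outside the cover. The other vertices
      -- of `Q` keep their partners in the cover, where digit `2` forces label `2`. Hence the two
      -- kinds of partners cannot collide.
      · let D : Set V := {q | q ∈ Q ∧ φ q ∉ c.cover}
        have hD : ∀ q ∈ D, q ∈ c.cover ∧ q ∉ c.side ∧ c.digit t q = 2 := by
          rintro q ⟨hq, hq'⟩
          have h3 : q ∈ c.cover :=
            (hc.isCover hs _ (hφ q hq).1 q (hQ hq) (hφ q hq).2.1).resolve_left hq'
          refine ⟨h3, hQ hq, ?_⟩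
          rw [h q h3]
          simp only [f, if_neg (show q ∉ c.side from hQ hq), if_neg (hd.notMem_of_mem_right hq),
            if_pos (show q ∈ Q ∧ φ q ∉ c.cover from ⟨hq, hq'⟩)]
        let T : D → Finset V := fun q =>
          Finset.univ.filter fun a => a ∈ c.side ∧ a ∉ c.cover ∧ Y a = 2 ∧ G.Adj a q
        have hall : ∀ W : Finset D, W.card ≤ (W.biUnion T).card := by
          intro W
          -- The number `r` encodes the subset `W` in Hall's condition.
          obtain ⟨r, hr, hr'⟩ := exists_code (hc.inj hs) (hc.pos_lt hs)
            (fun x => if ∃ q ∈ W, q.1 = x then 2 else 0) (fun x => by split_ifs <;> norm_num)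
          have h3 : c.demands t r = Subtype.val '' (W : Set D) := by
            ext x
            constructor
            · rintro ⟨e1, e2, e3, e4⟩
              change r / 3 ^ c.pos x % 3 = 2 at e4
              rw [hr' x e1] at e4
              split_ifs at e4 with e5
              obtain ⟨q, hq, rfl⟩ := e5
              exact ⟨q, hq, rfl⟩
            · rintro ⟨q, hq, rfl⟩
              obtain ⟨e1, e2, e3⟩ := hD q.1 q.2
              refine ⟨e1, e2, e3, ?_⟩
              change r / 3 ^ c.pos _ % 3 = 2
              rw [hr' _ e1, if_pos ⟨q, hq, rfl⟩]
          have h4 := h2 r (hr.trans_le (hc.pow_le hs))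
          rw [h3, Set.ncard_image_of_injective _ Subtype.val_injective, Set.ncard_coe_finset] at h4
          refine h4.trans ?_
          rw [← Set.ncard_coe_finset]
          refine Set.ncard_le_ncard ?_
          rintro a ⟨e1, e2, e3, _, ⟨q, hq, rfl⟩, e4⟩
          simp only [Finset.coe_biUnion, Set.mem_iUnion]
          exact ⟨q, hq, by simp [T, e1, e2, e3, e4]⟩
        obtain ⟨ψ, h3, h4⟩ := (Finset.all_card_le_biUnion_card_iff_exists_injective T).1 hall
        have h4' : ∀ q : D, ψ q ∈ c.side ∧ ψ q ∉ c.cover ∧ Y (ψ q) = 2 ∧ G.Adj (ψ q) q :=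
          fun q => by simpa [T] using h4 q
        refine ⟨fun q => if hq : q ∈ D then ψ ⟨q, hq⟩ else φ q, fun q hq q' hq' e => ?_,
          fun q hq => ?_⟩
        · dsimp only at e
          split_ifs at e with e1 e2 e2
          · simpa using h3 e
          · have e3 : φ q' ∈ c.cover := by
              by_contra hc'; exact e2 ⟨hq', hc'⟩
            rw [← e] at e3
            exact absurd e3 (h4' _).2.1
          · have e3 : φ q ∈ c.cover := by
              by_contra hc'; exact e1 ⟨hq, hc'⟩
            rw [e] at e3
            exact absurd e3 (h4' _).2.1
          · exact hinj hq hq' e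
        · dsimp only
          split_ifs with e1
          · exact ⟨(h4' _).1, (h4' ⟨q, e1⟩).2.2.2, (h4' _).2.2.1⟩
          · have e3 : φ q ∈ c.cover := by
              by_contra hc'; exact e1 ⟨hq, hc'⟩
            refine ⟨(hφ q hq).1, (hφ q hq).2.1, ((h1 _ e3).1 (hφ q hq).1).2 ?_⟩
            rw [h _ e3]
            simp only [f, if_pos (hφ q hq).1, if_pos (Set.mem_image_of_mem φ hq)]

end Labels

end EDS

namespace EDS

/-! ### Joining partial solutions -/

section Join

variable {V : Type*} [Fintype V] (G : SimpleGraph V)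

/-- The labelling `Y` on `A ∪ B` is part of a solution in which the vertices of `Q` are matched to
vertices of label `2` and some vertices of `A` in `U` are matched to `B`; without the cost of the
latter edges, the weight is at most `w`. -/
def Pending (A B O Q U : Set V) (w : ℕ) (Y : V → ℕ) : Prop :=
  (∀ o ∈ O, ∀ x ∈ A ∪ B, G.Adj x o → Y x ≠ 0) ∧ ∃ (M : Finset V) (φ : V → V),
    Set.InjOn φ (Q ∪ M) ∧
    (∀ q ∈ Q, φ q ∈ A ∪ B ∧ G.Adj (φ q) q ∧ Y (φ q) = 2 ∧ φ q ∉ M) ∧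
    (∀ u ∈ M, u ∈ A ∧ u ∈ U ∧ Y u = 2 ∧ φ u ∈ B ∧ G.Adj (φ u) u ∧ Y (φ u) = 2) ∧
    ∑ x, Y x ≤ w + 2 * M.card

/-- The labelling that is `YA` where this is not `0`, and `YB` elsewhere. -/
def overlay (YA YB : V → ℕ) (x : V) : ℕ := if YA x ≠ 0 then YA x else YB x

open Classical in
/-- Close the vertices of `A ∩ U` with label `2`. -/
noncomputable def mask (A U : Set V) (Y : V → ℕ) (x : V) : ℕ :=
  if x ∈ A ∧ x ∈ U ∧ Y x = 2 then 1 else Y x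

variable {G} {A B O Q : Set V}

omit [Fintype V] in
theorem overlay_left {YA YB : V → ℕ} (hAB : Disjoint A B) (hB : IsPartial G B YB) {x : V}
    (hx : x ∈ A) : overlay YA YB x = YA x := by
  unfold overlay
  split_ifs with h
  · rfl
  · rw [hB.supp x (hAB.notMem_of_mem_left hx)]; omega

omit [Fintype V] in
theorem overlay_right {YA YB : V → ℕ} (hAB : Disjoint A B) (hA : IsPartial G A YA) {x : V}
    (hx : x ∈ B) : overlay YA YB x = YB x := by
  unfold overlay
  rw [if_neg]
  rw [hA.supp x (hAB.notMem_of_mem_right hx)]; simp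

omit [Fintype V] in
theorem IsPartial.union {YA YB : V → ℕ} (hAB : Disjoint A B) (hA : IsPartial G A YA)
    (hB : IsPartial G B YB)
    (hcross : ∀ a ∈ A, ∀ b ∈ B, G.Adj a b → YA a ≠ 0 ∨ YB b ≠ 0) :
    IsPartial G (A ∪ B) (overlay YA YB) := by
  classical
  have hl : ∀ x ∈ A, overlay YA YB x = YA x := fun x hx => overlay_left hAB hB hx
  have hr : ∀ x ∈ B, overlay YA YB x = YB x := fun x hx => overlay_right hAB hA hx
  obtain ⟨f, hf⟩ := hA.mate
  obtain ⟨g, hg⟩ := hB.mate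
  have memA : ∀ x, YA x ≠ 0 → x ∈ A := fun x hx => by_contra fun h => hx (hA.supp x h)
  have memB : ∀ x, YB x ≠ 0 → x ∈ B := fun x hx => by_contra fun h => hx (hB.supp x h)
  refine ⟨fun x hx => ?_, fun x => ?_, fun a ha b hb hab => ?_,
    fun x => if x ∈ A then f x else g x, fun x hx => ?_⟩
  · simp only [Set.mem_union, not_or] at hx
    simp [overlay, hA.supp x hx.1, hB.supp x hx.2]
  · unfold overlay; split_ifs; exacts [hA.le_two x, hB.le_two x]
  · rcases ha with ha | ha <;> rcases hb with hb | hb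
    · rw [hl a ha, hl b hb]; exact hA.cover a ha b hb hab
    · rw [hl a ha, hr b hb]; exact hcross a ha b hb hab
    · rw [hr a ha, hl b hb]; exact (hcross b hb a ha hab.symm).symm
    · rw [hr a ha, hr b hb]; exact hB.cover a ha b hb hab
  · by_cases hxA : x ∈ A
    · rw [hl x hxA] at hx
      obtain ⟨h1, h2, h3⟩ := hf x hx
      have h4 := memA (f x) (by omega)
      beta_reduce
      rw [if_pos hxA, if_pos h4, hl _ h4]
      exact ⟨h1, h2, h3⟩
    · have hxB : x ∈ B := by
        refine memB x fun h => ?_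
        simp [overlay, hA.supp x hxA, h] at hx
      rw [hr x hxB] at hx
      obtain ⟨h1, h2, h3⟩ := hg x hx
      have h4 := memB (g x) (by omega)
      beta_reduce
      rw [if_neg hxA, if_neg (hAB.notMem_of_mem_right h4), hr _ h4]
      exact ⟨h1, h2, h3⟩

omit [Fintype V] in
open Classical in
/-- The part of a partial solution inside `A`, where matched vertices lose their partners in `B`. -/
theorem IsPartial.restrict {X : V → ℕ} (hAB : Disjoint A B) (hX : IsPartial G (A ∪ B) X)
    {f : V → V} (hf : ∀ x, X x = 1 → X (f x) = 1 ∧ G.Adj x (f x) ∧ f (f x) = x) :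
    IsPartial G A fun x => if x ∈ A then (if X x = 1 ∧ f x ∈ B then 2 else X x) else 0 := by
  refine ⟨fun x hx => if_neg hx, fun x => ?_, fun a ha b hb hab => ?_, f, fun x hx => ?_⟩
  · have := hX.le_two x
    split_ifs <;> omega
  · rw [if_pos ha, if_pos hb]
    rcases hX.cover a (Or.inl ha) b (Or.inl hb) hab with h | h
    · left; split_ifs <;> omega
    · right; split_ifs <;> omega
  · split_ifs at hx with h1 h2
    · omega
    obtain ⟨h3, h4, h5⟩ := hf x hx
    have h6 : f x ∈ A := by
      have : f x ∈ A ∪ B := by_contra fun h => by rw [hX.supp _ h] at h3; omega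
      exact this.resolve_right fun h => h2 ⟨hx, h⟩
    rw [if_pos h6, if_neg, h3]
    · exact ⟨rfl, h4, h5⟩
    · rw [h5]; exact fun h => hAB.notMem_of_mem_left h1 h.2

/-- The two halves of `X` are replaced in turn. First the part on `A` is exchanged, with the part of
`X` on `B` as its environment; then the part on `B` is exchanged, with the new part on `A` as its
environment. Cutting a pair that crosses raises both of its labels from `1` to `2`, and the
allowance of `2` for every vertex of `M` pays for that. -/
theorem IsPartial.exists_pending {X : V → ℕ} (hAB : Disjoint A B) (hX : IsPartial G (A ∪ B) X)
    (hO : O ⊆ (A ∪ B)ᶜ) (hQ : Q ⊆ (A ∪ B)ᶜ) (hd : Disjoint O Q) (hfit : Fits G (A ∪ B) X O Q)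
    {TA TB : (V → ℕ) → Prop} (hTA : ∀ Y, TA Y → IsPartial G A Y) (hTB : ∀ Y, TB Y → IsPartial G B Y)
    (hA : ∀ X O Q, IsPartial G A X → O ⊆ Aᶜ → Q ⊆ Aᶜ → Disjoint O Q → Fits G A X O Q →
      ∃ Y, TA Y ∧ Fits G A Y O Q ∧ ∑ x, Y x ≤ ∑ x, X x)
    (hB : ∀ X O Q, IsPartial G B X → O ⊆ Bᶜ → Q ⊆ Bᶜ → Disjoint O Q → Fits G B X O Q →
      ∃ Y, TB Y ∧ Fits G B Y O Q ∧ ∑ x, Y x ≤ ∑ x, X x) :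
    ∃ YA YB, TA YA ∧ TB YB ∧ (∀ a ∈ A, ∀ b ∈ B, G.Adj a b → YA a ≠ 0 ∨ YB b ≠ 0) ∧
      Pending G A B O Q Set.univ (∑ x, X x) (overlay YA YB) := by
  classical
  obtain ⟨f, hf⟩ := hX.mate
  obtain ⟨hcov, φ, hinj, hφ⟩ := hfit
  have hBA : Disjoint B A := hAB.symm
  set XA : V → ℕ := fun x => if x ∈ A then (if X x = 1 ∧ f x ∈ B then 2 else X x) else 0 with hXA
  set XB : V → ℕ := fun x => if x ∈ B then (if X x = 1 ∧ f x ∈ A then 2 else X x) else 0 with hXB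
  have pA : IsPartial G A XA := hX.restrict hAB hf
  have pB : IsPartial G B XB := IsPartial.restrict hBA (by rwa [Set.union_comm]) hf
  have OA : ∀ o ∈ O, o ∉ A ∧ o ∉ B := fun o ho => by simpa [not_or] using hO ho
  have QA : ∀ q ∈ Q, q ∉ A ∧ q ∉ B := fun q hq => by simpa [not_or] using hQ hq
  have nA : ∀ x ∈ A, x ∉ B := fun x hx => hAB.notMem_of_mem_left hx
  have nB : ∀ x ∈ B, x ∉ A := fun x hx => hAB.notMem_of_mem_right hx
  have zA : ∀ x ∈ A, X x ≠ 0 → XA x ≠ 0 := fun x hx h => by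
    simp only [hXA, if_pos hx]; split_ifs <;> omega
  have zB : ∀ x ∈ B, X x ≠ 0 → XB x ≠ 0 := fun x hx h => by
    simp only [hXB, if_pos hx]; split_ifs <;> omega
  have tA : ∀ x ∈ A, X x = 2 → XA x = 2 := fun x hx h => by
    simp only [hXA, if_pos hx]; split_ifs <;> omega
  have tB : ∀ x ∈ B, X x = 2 → XB x = 2 := fun x hx h => by
    simp only [hXB, if_pos hx]; split_ifs <;> omega
  let N : Set V := {b | b ∈ B ∧ X b = 1 ∧ f b ∈ A}
  -- Seen from `A`, the unlabelled vertices of `B` join `O`, and the vertices of `B` with a partner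
  -- in `A` join `Q`.
  obtain ⟨YA, hYA, ⟨covA, φA, injA, hφA⟩, wA⟩ := hA XA (O ∪ {b | b ∈ B ∧ X b = 0})
    ({q | q ∈ Q ∧ φ q ∈ A} ∪ N) pA (by
      rintro x (hx | hx)
      · exact (OA x hx).1
      · exact nB x hx.1) (by
      rintro x (hx | hx)
      · exact (QA x hx.1).1
      · exact nB x hx.1) (by
      rw [Set.disjoint_left]
      rintro x (hx | hx) (hx' | hx')
      · exact hd.notMem_of_mem_left hx hx'.1
      · exact (OA x hx).2 hx'.1
      · exact (QA x hx'.1).2 hx.1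
      · have := hx'.2.1; rw [hx.2] at this; omega) (by
      refine ⟨?_, fun q => if q ∈ B then f q else φ q, ?_, ?_⟩
      · rintro o (ho | ho) a ha hao
        · exact zA a ha (hcov o ho a (Or.inl ha) hao)
        · exact zA a ha ((hX.cover a (Or.inl ha) o (Or.inr ho.1) hao).resolve_right
            fun h => h ho.2)
      · rintro q (hq | hq) q' (hq' | hq') e
        · simp only [if_neg (QA q hq.1).2, if_neg (QA q' hq'.1).2] at e
          exact hinj hq.1 hq'.1 e
        · simp only [if_neg (QA q hq.1).2, if_pos hq'.1] at e
          have h1 := (hφ q hq.1).2.2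
          have h2 := (hf q' hq'.2.1).1
          rw [e] at h1; omega
        · simp only [if_neg (QA q' hq'.1).2, if_pos hq.1] at e
          have h1 := (hφ q' hq'.1).2.2
          have h2 := (hf q hq.2.1).1
          rw [← e] at h1; omega
        · simp only [if_pos hq.1, if_pos hq'.1] at e
          rw [← (hf q hq.2.1).2.2, e, (hf q' hq'.2.1).2.2]
      · rintro q (hq | hq)
        · simp only [if_neg (QA q hq.1).2]
          exact ⟨hq.2, (hφ q hq.1).2.1, tA _ hq.2 (hφ q hq.1).2.2⟩
        · simp only [if_pos hq.1]
          obtain ⟨h1, h2, h3⟩ := hf q hq.2.1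
          refine ⟨hq.2.2, h2.symm, ?_⟩
          simp only [hXA, if_pos hq.2.2]
          rw [if_pos ⟨h1, by rw [h3]; exact hq.1⟩])
  have pYA := hTA YA hYA
  have injN : Set.InjOn φA N := injA.mono fun x hx => Or.inr hx
  let M : Set V := φA '' N
  have hM : ∀ u ∈ M, u ∈ A ∧ YA u = 2 := by
    rintro _ ⟨b, hb, rfl⟩
    exact ⟨(hφA b (Or.inr hb)).1, (hφA b (Or.inr hb)).2.2⟩
  obtain ⟨g, hg⟩ : ∃ g : V → V, ∀ b ∈ N, g (φA b) = b := by
    by_cases hne : Nonempty V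
    · exact ⟨Function.invFunOn φA N, fun b hb => injN.leftInvOn_invFunOn hb⟩
    · exact ⟨id, fun b => (hne ⟨b⟩).elim⟩
  -- The demand on `B` refers to the new labelling on `A`; `M` is disjoint from its unlabelled
  -- vertices since it consists of open ones.
  obtain ⟨YB, hYB, ⟨covB, φB, injB, hφB⟩, wB⟩ := hB XB (O ∪ {a | a ∈ A ∧ YA a = 0})
    ({q | q ∈ Q ∧ φ q ∈ B} ∪ M) pB (by
      rintro x (hx | hx)
      · exact (OA x hx).2
      · exact nA x hx.1) (by
      rintro x (hx | hx)
      · exact (QA x hx.1).2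
      · exact nA x (hM x hx).1) (by
      rw [Set.disjoint_left]
      rintro x (hx | hx) (hx' | hx')
      · exact hd.notMem_of_mem_left hx hx'.1
      · exact (OA x hx).1 (hM x hx').1
      · exact (QA x hx'.1).1 hx.1
      · have := (hM x hx').2; rw [hx.2] at this; omega) (by
      refine ⟨?_, fun q => if q ∈ A then g q else φ q, ?_, ?_⟩
      · rintro o (ho | ho) b hb hbo
        · exact zB b hb (hcov o ho b (Or.inr hb) hbo)
        · refine zB b hb fun h => ?_
          -- An unlabelled `b` belonged to the demand on `A`, so all its neighbours in `A` have
          -- labels there.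
          exact covA b (Or.inr ⟨hb, h⟩) o ho.1 hbo.symm ho.2
      · rintro q (hq | hq) q' (hq' | hq') e
        · simp only [if_neg (QA q hq.1).1, if_neg (QA q' hq'.1).1] at e
          exact hinj hq.1 hq'.1 e
        · simp only [if_neg (QA q hq.1).1, if_pos (hM q' hq').1] at e
          obtain ⟨b, hb, rfl⟩ := hq'
          rw [hg b hb] at e
          have h1 := (hφ q hq.1).2.2
          have h2 := hb.2.1
          rw [e] at h1; omega
        · simp only [if_neg (QA q' hq'.1).1, if_pos (hM q hq).1] at e
          obtain ⟨b, hb, rfl⟩ := hq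
          rw [hg b hb] at e
          have h1 := (hφ q' hq'.1).2.2
          have h2 := hb.2.1
          rw [← e] at h1; omega
        · simp only [if_pos (hM q hq).1, if_pos (hM q' hq').1] at e
          obtain ⟨b, hb, rfl⟩ := hq
          obtain ⟨b', hb', rfl⟩ := hq'
          rw [hg b hb, hg b' hb'] at e
          rw [e]
      · rintro q (hq | hq)
        · simp only [if_neg (QA q hq.1).1]
          exact ⟨hq.2, (hφ q hq.1).2.1, tB _ hq.2 (hφ q hq.1).2.2⟩
        · simp only [if_pos (hM q hq).1]
          obtain ⟨b, hb, rfl⟩ := hq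
          rw [hg b hb]
          refine ⟨hb.1, (hφA b (Or.inr hb)).2.1.symm, ?_⟩
          simp only [hXB, if_pos hb.1, if_pos hb.2])
  have pYB := hTB YB hYB
  have hl : ∀ x ∈ A, overlay YA YB x = YA x := fun x hx => overlay_left hAB pYB hx
  have hr : ∀ x ∈ B, overlay YA YB x = YB x := fun x hx => overlay_right hAB pYA hx
  have hcross : ∀ a ∈ A, ∀ b ∈ B, G.Adj a b → YA a ≠ 0 ∨ YB b ≠ 0 := by
    intro a ha b hb hab
    by_cases h : YA a = 0
    · exact Or.inr (covB a (Or.inr ⟨ha, h⟩) b hb hab.symm)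
    · exact Or.inl h
  -- The vertices of `M` lie in `A` and get partners in `B`, while a vertex of `Q` gets its new
  -- partner on the side on which `φ` placed the old one.
  refine ⟨YA, YB, hYA, hYB, hcross, ?_, M.toFinset,
    fun x => if x ∈ A then φB x else if φ x ∈ A then φA x else φB x, ?_, ?_, ?_, ?_⟩
  · rintro o ho x (hx | hx) hxo
    · rw [hl x hx]; exact covA o (Or.inl ho) x hx hxo
    · rw [hr x hx]; exact covB o (Or.inl ho) x hx hxo
  · have hval : ∀ x ∈ Q ∪ (M.toFinset : Set V),
        (x ∈ Q ∧ x ∉ A ∧ φ x ∈ A) ∨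
        (x ∈ {q | q ∈ Q ∧ φ q ∈ B} ∪ M ∧ (x ∈ A ∨ φ x ∉ A)) := by
      rintro x (hx | hx)
      · by_cases h : φ x ∈ A
        · exact Or.inl ⟨hx, (QA x hx).1, h⟩
        · exact Or.inr ⟨Or.inl ⟨hx, (hφ x hx).1.resolve_left h⟩, Or.inr h⟩
      · have hx' : x ∈ M := by simpa using hx
        exact Or.inr ⟨Or.inr hx', Or.inl (hM x hx').1⟩
    have e1 : ∀ x, x ∉ A → φ x ∈ A → (if x ∈ A then φB x else if φ x ∈ A then φA x else φB x) =
        φA x := fun x h1 h2 => by rw [if_neg h1, if_pos h2]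
    have e2 : ∀ x, (x ∈ A ∨ φ x ∉ A) → (if x ∈ A then φB x else if φ x ∈ A then φA x else φB x) =
        φB x := fun x h => by split_ifs <;> tauto
    intro x hx y hy e
    dsimp only at e
    rcases hval x hx with ⟨h1, h2, h3⟩ | ⟨h1, h2⟩ <;> rcases hval y hy with ⟨k1, k2, k3⟩ | ⟨k1, k2⟩
    · rw [e1 x h2 h3, e1 y k2 k3] at e
      exact injA (Or.inl ⟨h1, h3⟩) (Or.inl ⟨k1, k3⟩) e
    · rw [e1 x h2 h3, e2 y k2] at e
      have := (hφB y k1).1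
      rw [← e] at this
      exact absurd this (nA _ (hφA x (Or.inl ⟨h1, h3⟩)).1)
    · rw [e2 x h2, e1 y k2 k3] at e
      have := (hφB x h1).1
      rw [e] at this
      exact absurd this (nA _ (hφA y (Or.inl ⟨k1, k3⟩)).1)
    · rw [e2 x h2, e2 y k2] at e
      exact injB h1 k1 e
  · intro q hq
    have hqA := (QA q hq).1
    by_cases h : φ q ∈ A
    · simp only [if_neg hqA, if_pos h]
      obtain ⟨h1, h2, h3⟩ := hφA q (Or.inl ⟨hq, h⟩)
      refine ⟨Or.inl h1, h2, by rw [hl _ h1, h3], ?_⟩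
      simp only [Set.mem_toFinset]
      rintro ⟨b, hb, hbe⟩
      have := injA (Or.inr hb) (Or.inl ⟨hq, h⟩) hbe
      exact (QA q hq).2 (this ▸ hb.1)
    · simp only [if_neg hqA, if_neg h]
      obtain ⟨h1, h2, h3⟩ := hφB q (Or.inl ⟨hq, (hφ q hq).1.resolve_left h⟩)
      refine ⟨Or.inr h1, h2, by rw [hr _ h1, h3], ?_⟩
      simp only [Set.mem_toFinset]
      exact fun h4 => nB _ h1 (hM _ h4).1
  · intro u hu
    rw [Set.mem_toFinset] at hu
    obtain ⟨h1, h2⟩ := hM u hu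
    obtain ⟨h3, h4, h5⟩ := hφB u (Or.inr hu)
    simp only [if_pos h1]
    exact ⟨h1, trivial, by rw [hl u h1, h2], h3, h4, by rw [hr _ h3, h5]⟩
  · have c1 : M.toFinset.card = (Finset.univ.filter fun b => b ∈ B ∧ X b = 1 ∧ f b ∈ A).card := by
      rw [← Finset.card_image_of_injOn (f := φA) (s := Finset.univ.filter
        fun b => b ∈ B ∧ X b = 1 ∧ f b ∈ A) (injN.mono fun x hx => by simpa [N] using hx)]
      congr 1
      ext x
      simp only [M, N, Finset.mem_image, Finset.mem_filter, Finset.mem_univ, true_and,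
        Set.mem_toFinset, Set.mem_image, Set.mem_ofPred_eq]
    have c2 : (Finset.univ.filter fun a => a ∈ A ∧ X a = 1 ∧ f a ∈ B).card =
        (Finset.univ.filter fun b => b ∈ B ∧ X b = 1 ∧ f b ∈ A).card := by
      refine Finset.card_nbij f ?_ ?_ ?_
      · intro a ha
        simp only [Finset.mem_univ, true_and, Finset.coe_filter,
          Set.mem_ofPred_eq] at ha ⊢
        obtain ⟨h1, h2, h3⟩ := hf a ha.2.1
        exact ⟨ha.2.2, h1, by rw [h3]; exact ha.1⟩
      · intro a ha a' ha' e
        simp only [Finset.coe_filter, Finset.mem_univ, true_and, Set.mem_ofPred_eq] at ha ha'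
        rw [← (hf a ha.2.1).2.2, e, (hf a' ha'.2.1).2.2]
      · intro b hb
        simp only [Finset.coe_filter, Finset.mem_univ, true_and, Set.mem_ofPred_eq] at hb
        obtain ⟨h1, h2, h3⟩ := hf b hb.2.1
        exact ⟨f b, by simp [hb.2.2, h1, h3, hb.1], h3⟩
    have s1 : ∑ x, overlay YA YB x ≤ ∑ x, YA x + ∑ x, YB x := by
      rw [← Finset.sum_add_distrib]
      refine Finset.sum_le_sum fun x _ => ?_
      unfold overlay; split_ifs <;> omega
    -- Both ends of every crossing pair gain one; by `c1` and `c2` there are as many ends on either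
    -- side as elements of `M`.
    have s2 : ∑ x, XA x + ∑ x, XB x = ∑ x, X x +
        (Finset.univ.filter fun a => a ∈ A ∧ X a = 1 ∧ f a ∈ B).card +
        (Finset.univ.filter fun b => b ∈ B ∧ X b = 1 ∧ f b ∈ A).card := by
      rw [Finset.card_filter, Finset.card_filter, ← Finset.sum_add_distrib,
        ← Finset.sum_add_distrib, ← Finset.sum_add_distrib]
      refine Finset.sum_congr rfl fun x _ => ?_
      by_cases hxA : x ∈ A
      · have hxB := nA x hxA
        simp only [hXA, hXB, hxA, hxB, if_true, if_false, true_and, false_and, add_zero]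
        split_ifs with h <;> omega
      · by_cases hxB : x ∈ B
        · simp only [hXA, hXB, hxA, hxB, if_true, if_false, true_and, false_and, add_zero, zero_add]
          split_ifs with h <;> omega
        · simp [hXA, hXB, hxA, hxB, hX.supp x (by simp [hxA, hxB])]
    omega

omit [Fintype V] in
theorem IsPartial.match_pair [DecidableEq V] {A : Set V} {Y : V → ℕ} (hY : IsPartial G A Y)
    {a b : V} (hab : G.Adj a b) (ha : Y a = 2) (hb : Y b = 2) :
    IsPartial G A fun x => if x = a ∨ x = b then 1 else Y x := by
  obtain ⟨f, hf⟩ := hY.mate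
  have hne : a ≠ b := hab.ne
  refine ⟨fun x hx => ?_, fun x => ?_, fun x hx y hy hxy => ?_,
    fun x => if x = a then b else if x = b then a else f x, fun x hx => ?_⟩
  · rw [if_neg]
    · exact hY.supp x hx
    · rintro (rfl | rfl)
      · rw [hY.supp _ hx] at ha; omega
      · rw [hY.supp _ hx] at hb; omega
  · split_ifs
    · norm_num
    · exact hY.le_two x
  · rcases hY.cover x hx y hy hxy with h | h
    · left; split_ifs <;> omega
    · right; split_ifs <;> omega
  · by_cases h1 : x = a
    · subst h1; simp [hab, hne.symm]
    · by_cases h2 : x = b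
      · subst h2; simp [hab.symm, h1]
      · simp only [h1, h2, or_self, if_false] at hx ⊢
        obtain ⟨k1, k2, k3⟩ := hf x hx
        have h3 : f x ≠ a := fun h => by rw [h] at k1; omega
        have h4 : f x ≠ b := fun h => by rw [h] at k1; omega
        simp [h3, h4, k1, k2, k3]

/-- If `a` is in `M`, its planned partner in `B` is taken now: two labels drop from `2` to `1`,
which balances the loss of one element of `M` in the bound for the weight. If `a` is not in `M`, it
is no longer needed for the matching into `B`. -/
theorem Pending.step [DecidableEq V] {U : Set V} {w : ℕ} {Y : V → ℕ} (hAB : Disjoint A B)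
    (h : Pending G A B O Q U w Y) (hQ : Q ⊆ (A ∪ B)ᶜ) (a : V) :
    Pending G A B O Q (U \ {a}) w Y ∨ ∃ b ∈ B, a ∈ A ∧ G.Adj a b ∧ Y a = 2 ∧ Y b = 2 ∧
      Pending G A B O Q (U \ {a}) w fun x => if x = a ∨ x = b then 1 else Y x := by
  obtain ⟨hcov, M, φ, hinj, hq, hM, hw⟩ := h
  by_cases ha : a ∈ M
  · obtain ⟨h1, h2, h3, h4, h5, h6⟩ := hM a ha
    refine Or.inr ⟨φ a, h4, h1, h5.symm, h3, h6, ?_, M.erase a, φ, ?_, ?_, ?_, ?_⟩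
    · intro o ho x hx hxo
      dsimp only
      split_ifs
      · norm_num
      · exact hcov o ho x hx hxo
    · refine hinj.mono (Set.union_subset_union_right _ ?_)
      simp
    · intro q hqQ
      obtain ⟨k1, k2, k3, k4⟩ := hq q hqQ
      refine ⟨k1, k2, ?_, fun hk => k4 (Finset.mem_of_mem_erase hk)⟩
      beta_reduce
      rw [if_neg, k3]
      rintro (e | e)
      · exact k4 (e ▸ ha)
      · have : q = a := hinj (Or.inl hqQ) (Or.inr ha) e
        exact hQ hqQ (Or.inl (this ▸ h1))
    · intro u hu
      obtain ⟨hne, huM⟩ := Finset.mem_erase.1 hu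
      obtain ⟨k1, k2, k3, k4, k5, k6⟩ := hM u huM
      refine ⟨k1, ⟨k2, hne⟩, ?_, k4, k5, ?_⟩
      · beta_reduce
        rw [if_neg, k3]
        rintro (e | e)
        · exact hne e
        · exact hAB.notMem_of_mem_left k1 (e ▸ h4)
      · beta_reduce
        rw [if_neg, k6]
        rintro (e | e)
        · exact hAB.notMem_of_mem_left h1 (e ▸ k4)
        · exact hne (hinj (Or.inr huM) (Or.inr ha) e)
    · have hne : a ≠ φ a := fun e => hAB.notMem_of_mem_left h1 (e ▸ h4)
      have hs : ∑ x, Y x = ∑ x, (if x = a ∨ x = φ a then 1 else Y x) + 2 := by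
        have e1 : ∀ x, Y x = (if x = a ∨ x = φ a then 1 else Y x) +
            ((if x = a then 1 else 0) + if x = φ a then 1 else 0) := by
          intro x
          by_cases e1 : x = a
          · subst e1; simp [hne, h3]
          · by_cases e2 : x = φ a
            · subst e2; simp [e1, h6]
            · simp [e1, e2]
        rw [Finset.sum_congr rfl fun x _ => e1 x, Finset.sum_add_distrib, Finset.sum_add_distrib]
        simp
      have hc := Finset.card_erase_of_mem ha
      have hpos := Finset.card_pos.2 ⟨a, ha⟩
      beta_reduce
      omega
  · refine Or.inl ⟨hcov, M, φ, hinj, hq, fun u hu => ?_, hw⟩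
    obtain ⟨k1, k2, k3⟩ := hM u hu
    exact ⟨k1, ⟨k2, fun e => ha (e ▸ hu)⟩, k3⟩

theorem Pending.finish {w : ℕ} {Y : V → ℕ} (h : Pending G A B O Q ∅ w Y) :
    Fits G (A ∪ B) Y O Q ∧ ∑ x, Y x ≤ w := by
  obtain ⟨hcov, M, φ, hinj, hq, hM, hw⟩ := h
  have hM0 : M = ∅ := Finset.eq_empty_of_forall_notMem fun u hu => (hM u hu).2.1
  subst hM0
  exact ⟨⟨hcov, φ, hinj.mono Set.subset_union_left, fun q h => ⟨(hq q h).1, (hq q h).2.1,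
    (hq q h).2.2.1⟩⟩, by simpa using hw⟩

/-- A pair of signatures such that all labellings with these signatures can replace `Y`. -/
theorem Pending.exists_sat {U : Set V} {w K : ℕ} {Y : V → ℕ} {cA cB : Cut V}
    (hcA : cA.Valid G K) (hcB : cB.Valid G K) (hAB : Disjoint cA.side cB.side)
    (h : Pending G cA.side cB.side O Q U w Y) (hO : O ⊆ (cA.side ∪ cB.side)ᶜ)
    (hQ : Q ⊆ (cA.side ∪ cB.side)ᶜ) (hd : Disjoint O Q) :
    ∃ t < K * (2 * Fintype.card V + 2), ∃ t' < K * (2 * Fintype.card V + 2),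
      cA.Sat G K t (mask cA.side U Y) ∧ cB.Sat G K t' Y ∧
      ∀ Y', cA.Sat G K t (mask cA.side U Y') → cB.Sat G K t' Y' →
        (∀ x ∈ cA.side, x ∈ U → Y' x = Y x) → (∀ x ∈ cA.side, Y' x = 0 → Y x = 0) →
        ∑ x, Y' x ≤ ∑ x, Y x → Pending G cA.side cB.side O Q U w Y' := by
  classical
  obtain ⟨hcov, M, φ, hinj, hq, hM, hw⟩ := h
  have OA : ∀ o ∈ O, o ∉ cA.side ∧ o ∉ cB.side := fun o ho => by simpa [not_or] using hO ho
  have QA : ∀ q ∈ Q, q ∉ cA.side ∧ q ∉ cB.side := fun q hq => by simpa [not_or] using hQ hq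
  have nA : ∀ x ∈ cA.side, x ∉ cB.side := fun x hx => hAB.notMem_of_mem_left hx
  have nB : ∀ x ∈ cB.side, x ∉ cA.side := fun x hx => hAB.notMem_of_mem_right hx
  -- The partners of `Q` are processed vertices of `A`, vertices of `B`, or unprocessed vertices of
  -- `A`. The signatures care for the first two kinds; the third kind survives because the
  -- replacement has the same labels on `A ∩ U`.
  let QP : Set V := {q | q ∈ Q ∧ φ q ∈ cA.side ∧ φ q ∉ U}
  let QB : Set V := {q | q ∈ Q ∧ φ q ∈ cB.side}
  -- No set `O` is needed on `A`, because the replacement introduces no new zeros there. Masking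
  -- closes the open unprocessed vertices, so the partners that this signature promises are
  -- processed ones.
  obtain ⟨t, ht, hsat, hfor⟩ := Cut.exists_sat hcA (X := mask cA.side U Y) (O := ∅) (Q := QP)
    (fun q h => (QA q h.1).1) (Set.empty_subset _) (Set.empty_disjoint _)
    ⟨fun o h => h.elim, φ, hinj.mono fun q h => Or.inl h.1, fun q h =>
      ⟨h.2.1, (hq q h.1).2.1, by
        unfold mask
        rw [if_neg (fun h' => h.2.2 h'.2.1), (hq q h.1).2.2.1]⟩⟩
  obtain ⟨t', ht', hsat', hfor'⟩ := Cut.exists_sat hcB (X := Y) (O := O) (Q := QB ∪ M)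
    (by
      rintro q (h | h)
      · exact (QA q h.1).2
      · exact nA q (hM q h).1)
    (fun o h => (OA o h).2) (by
      rw [Set.disjoint_left]
      rintro o ho (h | h)
      · exact hd.notMem_of_mem_left ho h.1
      · exact (OA o ho).1 (hM o h).1)
    ⟨fun o ho b hb hbo => hcov o ho b (Or.inr hb) hbo, φ, hinj.mono (by
      rintro q (h | h)
      · exact Or.inl h.1
      · exact Or.inr h), by
      rintro q (h | h)
      · exact ⟨h.2, (hq q h.1).2.1, (hq q h.1).2.2.1⟩
      · exact (hM q h).2.2.2⟩
  refine ⟨t, ht, t', ht', hsat, hsat', fun Y' h1 h2 h3 h4 h5 => ?_⟩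
  obtain ⟨-, φA, injA, hφA⟩ := hfor (mask cA.side U Y') h1
  obtain ⟨covB, φB, injB, hφB⟩ := hfor' Y' h2
  have hφA' : ∀ q ∈ QP, φA q ∈ cA.side ∧ φA q ∉ U ∧ G.Adj (φA q) q ∧ Y' (φA q) = 2 := by
    intro q h
    obtain ⟨k1, k2, k3⟩ := hφA q h
    unfold mask at k3
    split_ifs at k3 with k4
    · omega
    refine ⟨k1, fun k5 => k4 ⟨k1, k5, k3⟩, k2, k3⟩
  -- The three kinds of partners lie in disjoint sets: `A` without `U`, `B`, and `A ∩ U`. So the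
  -- combined function is injective.
  let ψ : V → V := fun x => if x ∈ QP then φA x else if x ∈ QB ∪ M then φB x else φ x
  have hQP : ∀ x ∈ QB ∪ (M : Set V), x ∉ QP := by
    rintro x (h | h) h'
    · exact nA _ h'.2.1 h.2
    · exact (QA x h'.1).1 (hM x h).1
  have hψ : ∀ x ∈ Q ∪ (M : Set V), (x ∈ QP ∧ ψ x = φA x) ∨ (x ∈ QB ∪ (M : Set V) ∧ ψ x = φB x) ∨
      (x ∈ Q ∧ φ x ∈ cA.side ∧ φ x ∈ U ∧ ψ x = φ x) := by
    intro x hx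
    by_cases e1 : x ∈ QP
    · exact Or.inl ⟨e1, if_pos e1⟩
    · by_cases e2 : x ∈ QB ∪ (M : Set V)
      · refine Or.inr (Or.inl ⟨e2, ?_⟩)
        simp only [ψ, if_neg e1, if_pos e2]
      · have hxQ : x ∈ Q := hx.resolve_right fun h => e2 (Or.inr h)
        have hxA : φ x ∈ cA.side := (hq x hxQ).1.resolve_right fun h => e2 (Or.inl ⟨hxQ, h⟩)
        refine Or.inr (Or.inr ⟨hxQ, hxA, by_contra fun h => e1 ⟨hxQ, hxA, h⟩, ?_⟩)
        simp only [ψ, if_neg e1, if_neg e2]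
  refine ⟨?_, M, ψ, ?_, ?_, ?_, h5.trans hw⟩
  · rintro o ho x (hx | hx) hxo
    · exact fun h => hcov o ho x (Or.inl hx) hxo (h4 x hx h)
    · exact covB o ho x hx hxo
  · intro x hx y hy e
    rcases hψ x hx with ⟨a1, a2⟩ | ⟨a1, a2⟩ | ⟨a1, a2, a3, a4⟩ <;>
      rcases hψ y hy with ⟨b1, b2⟩ | ⟨b1, b2⟩ | ⟨b1, b2, b3, b4⟩
    · exact injA a1 b1 (by rw [← a2, e, b2])
    · refine absurd (hφB y b1).1 (nA _ ?_)
      rw [← b2, ← e, a2]; exact (hφA' x a1).1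
    · refine absurd b3 ?_
      rw [← b4, ← e, a2]; exact (hφA' x a1).2.1
    · refine absurd (hφB x a1).1 (nA _ ?_)
      rw [← a2, e, b2]; exact (hφA' y b1).1
    · exact injB a1 b1 (by rw [← a2, e, b2])
    · refine absurd (hφB x a1).1 (nA _ ?_)
      rw [← a2, e, b4]; exact b2
    · refine absurd a3 ?_
      rw [← a4, e, b2]; exact (hφA' y b1).2.1
    · refine absurd (hφB y b1).1 (nA _ ?_)
      rw [← b2, ← e, a4]; exact a2
    · exact hinj (Or.inl a1) (Or.inl b1) (by rw [← a4, e, b4])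
  · intro q hqQ
    rcases hψ q (Or.inl hqQ) with ⟨a1, a2⟩ | ⟨a1, a2⟩ | ⟨a1, a2, a3, a4⟩
    · obtain ⟨k1, k2, k3, k4⟩ := hφA' q a1
      rw [a2]
      exact ⟨Or.inl k1, k3, k4, fun h => k2 (hM _ h).2.1⟩
    · obtain ⟨k1, k2, k3⟩ := hφB q a1
      rw [a2]
      exact ⟨Or.inr k1, k2, k3, fun h => nB _ k1 (hM _ h).1⟩
    · obtain ⟨k1, k2, k3, k4⟩ := hq q hqQ
      rw [a4]
      exact ⟨k1, k2, by rw [h3 _ a2 a3, k3], k4⟩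
  · intro u hu
    obtain ⟨k1, k2, k3, k4, k5, k6⟩ := hM u hu
    have e2 : u ∈ QB ∪ (M : Set V) := Or.inr hu
    have e : ψ u = φB u := by simp only [ψ, if_neg (hQP u e2), if_pos e2]
    obtain ⟨l1, l2, l3⟩ := hφB u e2
    rw [e]
    exact ⟨k1, k2, by rw [h3 u k1 k2, k3], l1, l2, l3⟩

end Join

end EDS

namespace EDS

/-! ### Edge dominating sets and labellings -/

section Dominating

variable {V : Type*} {G : SimpleGraph V}

/-- Label the endpoints of a set of edges, at a cost of at most `2` for every edge. -/
theorem exists_labelling [Fintype V] [DecidableEq V] (E : Finset (Sym2 V))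
    (hE : ∀ e ∈ E, e ∈ G.edgeSet) :
    ∃ X : V → ℕ, (∀ x, X x ≤ 2) ∧ (∀ x, X x ≠ 0 ↔ ∃ e ∈ E, x ∈ e) ∧
      (∃ f : V → V, ∀ x, X x = 1 → X (f x) = 1 ∧ G.Adj x (f x) ∧ f (f x) = x) ∧
      ∑ x, X x ≤ 2 * E.card := by
  induction E using Finset.induction_on with
  | empty => exact ⟨fun _ => 0, by simp, by simp, ⟨id, by simp⟩, by simp⟩
  | insert e E he ih =>
    obtain ⟨X, h1, h2, ⟨f, h3⟩, h4⟩ := ih fun e' h => hE e' (Finset.mem_insert_of_mem h)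
    have hadj := hE e (Finset.mem_insert_self _ _)
    induction e using Sym2.ind with
    | _ a b =>
    rw [SimpleGraph.mem_edgeSet] at hadj
    have hne := hadj.ne
    rw [Finset.card_insert_of_notMem he]
    have key : ∀ x, (∃ e ∈ insert s(a, b) E, x ∈ e) ↔ x = a ∨ x = b ∨ X x ≠ 0 := by
      intro x; rw [h2 x]; simp [or_assoc]
    have upd : ∀ c l, X c = 0 → ∑ x, Function.update X c l x = ∑ x, X x + l := by
      intro c l hc
      rw [Finset.sum_update_of_mem (Finset.mem_univ c),
        ← Finset.sum_sdiff (Finset.subset_univ {c}), Finset.sum_singleton, hc]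
      omega
    have single : ∀ c, X c = 0 → (∀ x, x = a ∨ x = b → x = c ∨ X x ≠ 0) → (c = a ∨ c = b) →
        ∃ X : V → ℕ, (∀ x, X x ≤ 2) ∧ (∀ x, X x ≠ 0 ↔ ∃ e ∈ insert s(a, b) E, x ∈ e) ∧
      (∃ f : V → V, ∀ x, X x = 1 → X (f x) = 1 ∧ G.Adj x (f x) ∧ f (f x) = x) ∧
      ∑ x, X x ≤ 2 * (E.card + 1) := by
      intro c hc h5 h6
      refine ⟨Function.update X c 2, fun x => ?_, fun x => ?_, ⟨f, fun x hx => ?_⟩, ?_⟩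
      · by_cases h : x = c
        · subst h; simp
        · simpa [h] using h1 x
      · rw [key]
        by_cases h : x = c
        · subst h; simp; tauto
        · rw [Function.update_of_ne h]
          constructor
          · tauto
          · rintro (h7 | h7 | h7)
            · exact (h5 x (Or.inl h7)).resolve_left h
            · exact (h5 x (Or.inr h7)).resolve_left h
            · exact h7
      · have h : x ≠ c := by rintro rfl; simp at hx
        rw [Function.update_of_ne h] at hx
        obtain ⟨k1, k2, k3⟩ := h3 x hx
        have h' : f x ≠ c := by rintro h'; rw [h'] at k1; omega
        exact ⟨by rw [Function.update_of_ne h', k1], k2, k3⟩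
      · rw [upd c 2 hc]; omega
    -- If both ends are new they become a pair of label `1`; if only one is, it gets label `2`; if
    -- none is, the labelling stays. The cost is at most `2` in each case.
    by_cases ha : X a = 0 <;> by_cases hb : X b = 0
    · refine ⟨Function.update (Function.update X a 1) b 1, fun x => ?_, fun x => ?_,
        ⟨fun x => if x = a then b else if x = b then a else f x, fun x hx => ?_⟩, ?_⟩
      · by_cases hxb : x = b
        · subst hxb; simp
        · by_cases hxa : x = a
          · subst hxa; simp [hxb]
          · simpa [hxa, hxb] using h1 x
      · rw [key]
        by_cases hxb : x = b
        · subst hxb; simp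
        · by_cases hxa : x = a
          · subst hxa; simp [hxb]
          · simp [hxa, hxb]
      · by_cases hxa : x = a
        · subst hxa; simp [hne.symm, hadj]
        · by_cases hxb : x = b
          · subst hxb; simp [hne, hne.symm, hadj.symm]
          · simp only [Function.update_of_ne hxb, Function.update_of_ne hxa] at hx
            obtain ⟨k1, k2, k3⟩ := h3 x hx
            have h' : f x ≠ a := by rintro h'; rw [h'] at k1; omega
            have h'' : f x ≠ b := by rintro h'; rw [h'] at k1; omega
            simp [hxa, hxb, h', h'', k1, k2, k3]
      · have e1 : ∑ x, Function.update (Function.update X a 1) b 1 x =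
            ∑ x, Function.update X a 1 x + 1 := by
          rw [Finset.sum_update_of_mem (Finset.mem_univ b),
            ← Finset.sum_sdiff (Finset.subset_univ {b}), Finset.sum_singleton,
            Function.update_of_ne hne.symm, hb]
          omega
        rw [e1, upd a 1 ha]; omega
    · exact single a ha (by rintro x (rfl | rfl) <;> tauto) (Or.inl rfl)
    · exact single b hb (by rintro x (rfl | rfl) <;> tauto) (Or.inr rfl)
    · refine ⟨X, h1, fun x => ?_, ⟨f, h3⟩, by omega⟩
      rw [key]
      constructor
      · tauto
      · rintro (rfl | rfl | h) <;> assumption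

theorem HasEdgeDominatingSet.exists_isPartial [Fintype V] {t : ℕ} (h : HasEdgeDominatingSet G t) :
    ∃ X, IsPartial G Set.univ X ∧ ∑ x, X x ≤ 2 * t := by
  classical
  obtain ⟨E, ⟨h1, h2⟩, h3⟩ := h
  obtain ⟨X, k1, k2, k3, k4⟩ := exists_labelling E h1
  refine ⟨X, ⟨fun x hx => absurd (Set.mem_univ x) hx, k1, fun a _ b _ hab => ?_, k3⟩, by omega⟩
  rw [k2, k2]
  rcases h2 s(a, b) hab with h | ⟨e, he, v, hv, hve⟩
  · exact Or.inl ⟨_, h, by simp⟩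
  · rcases Sym2.mem_iff.1 hv with rfl | rfl
    · exact Or.inl ⟨e, he, hve⟩
    · exact Or.inr ⟨e, he, hve⟩

/-- Each edge between mates arises from both of its ends, so there are at most half as many as
vertices of label `1`. A vertex of label `2` takes any incident edge; an isolated one needs none. -/
theorem IsPartial.hasEdgeDominatingSet [Fintype V] {X : V → ℕ} (h : IsPartial G Set.univ X) :
    HasEdgeDominatingSet G ((∑ x, X x) / 2) := by
  classical
  obtain ⟨f, hf⟩ := h.mate
  obtain ⟨g, hg⟩ : ∃ g : V → V, ∀ x, (∃ y, G.Adj x y) → G.Adj x (g x) :=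
    ⟨fun x => if hx : ∃ y, G.Adj x y then hx.choose else x,
      fun x hx => by simp only [dif_pos hx]; exact hx.choose_spec⟩
  let S1 : Finset V := Finset.univ.filter fun x => X x = 1
  let S2 : Finset V := Finset.univ.filter fun x => X x = 2 ∧ ∃ y, G.Adj x y
  let E1 : Finset (Sym2 V) := S1.image fun x => s(x, f x)
  let E2 : Finset (Sym2 V) := S2.image fun x => s(x, g x)
  refine ⟨E1 ∪ E2, ⟨fun e he => ?_, fun e he => ?_⟩, ?_⟩
  · rcases Finset.mem_union.1 he with he | he
    · obtain ⟨x, hx, rfl⟩ := Finset.mem_image.1 he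
      exact (hf x (by simpa [S1] using hx)).2.1
    · obtain ⟨x, hx, rfl⟩ := Finset.mem_image.1 he
      exact hg x (by simpa [S2] using (Finset.mem_filter.1 hx).2.2)
  · have key : ∀ x y, G.Adj x y → X x ≠ 0 → ∃ e ∈ E1 ∪ E2, x ∈ e := by
      intro x y hxy hx
      have := h.le_two x
      have hx' : X x = 1 ∨ X x = 2 := by omega
      rcases hx' with hx' | hx'
      · exact ⟨s(x, f x), Finset.mem_union_left _ (Finset.mem_image.2 ⟨x, by simp [S1, hx'], rfl⟩),
          by simp⟩
      · exact ⟨s(x, g x), Finset.mem_union_right _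
          (Finset.mem_image.2 ⟨x, by simpa [S2, hx'] using ⟨y, hxy⟩, rfl⟩), by simp⟩
    induction e using Sym2.ind with
    | _ a b =>
    right
    rcases h.cover a trivial b trivial he with h1 | h1
    · obtain ⟨e, k1, k2⟩ := key a b he h1
      exact ⟨e, k1, a, by simp, k2⟩
    · obtain ⟨e, k1, k2⟩ := key b a he.symm h1
      exact ⟨e, k1, b, by simp, k2⟩
  · have h1 : 2 * E1.card ≤ S1.card := by
      refine Finset.mul_card_image_le_card S1 2 fun e he => ?_
      obtain ⟨x, hx, rfl⟩ := Finset.mem_image.1 he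
      have hx' : X x = 1 := by simpa [S1] using hx
      obtain ⟨k1, k2, k3⟩ := hf x hx'
      rw [← Finset.card_pair k2.ne]
      refine Finset.card_le_card fun y hy => ?_
      rcases Finset.mem_insert.1 hy with rfl | hy
      · simp [hx]
      · rw [Finset.mem_singleton] at hy
        subst hy
        simp [S1, k1, k3]
    have h2 : E2.card ≤ S2.card := Finset.card_image_le
    have h3 : S1.card + 2 * S2.card ≤ ∑ x, X x := by
      simp only [S1, S2, Finset.card_filter, Finset.mul_sum, ← Finset.sum_add_distrib]
      refine Finset.sum_le_sum fun x _ => ?_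
      have := h.le_two x
      split_ifs <;> omega
    have h4 := Finset.card_union_le E1 E2
    omega

end Dominating

/-! ### Matchings and covers of a cut -/

section Cover

variable {V : Type*} {G : SimpleGraph V}

theorem bddAbove_matching [Finite V] (G : SimpleGraph V) :
    BddAbove {k | ∃ M : Finset (Sym2 V), IsMatching G M ∧ M.card = k} := by
  classical
  have := Fintype.ofFinite V
  refine ⟨Fintype.card (Sym2 V), ?_⟩
  rintro k ⟨M, -, rfl⟩
  exact Finset.card_le_univ M

theorem card_le_mm [Finite V] {A : Set V} {ι : Type*} (s : Finset ι) (a b : ι → V)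
    (ha : ∀ i ∈ s, a i ∈ A) (hb : ∀ i ∈ s, b i ∉ A) (hab : ∀ i ∈ s, G.Adj (a i) (b i))
    (hia : Set.InjOn a s) (hib : Set.InjOn b s) : s.card ≤ mm G A := by
  classical
  have hne : ∀ i ∈ s, ∀ j ∈ s, a i ≠ b j := fun i hi j hj h => hb j hj (h ▸ ha i hi)
  refine le_csSup (bddAbove_matching _) ⟨s.image fun i => s(a i, b i), ⟨?_, ?_⟩, ?_⟩
  · intro e he
    obtain ⟨i, hi, rfl⟩ := Finset.mem_image.1 he
    exact SimpleGraph.between_adj.2 ⟨hab i hi, Or.inl ⟨ha i hi, hb i hi⟩⟩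
  · intro e he e' he' v hv hv'
    obtain ⟨i, hi, rfl⟩ := Finset.mem_image.1 he
    obtain ⟨j, hj, rfl⟩ := Finset.mem_image.1 he'
    have : i = j := by
      rcases Sym2.mem_iff.1 hv with rfl | rfl <;> rcases Sym2.mem_iff.1 hv' with h | h
      · exact hia hi hj h
      · exact absurd h (hne i hi j hj)
      · exact absurd h.symm (hne j hj i hi)
      · exact hib hi hj h
    rw [this]
  · rw [Finset.card_image_of_injOn]
    intro i hi j hj h
    rcases Sym2.eq_iff.1 h with ⟨h, -⟩ | ⟨h, -⟩
    · exact hia hi hj h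
    · exact absurd h (hne i hi j hj)

/-- In a minimum cover of a bipartite graph, the vertices on one side can be matched to vertices
outside the cover. -/
theorem exists_matching_of_minimum_cover [Fintype V] [DecidableEq V] {H : SimpleGraph V}
    {P : Set V} (hP : ∀ x ∈ P, ∀ y ∈ P, ¬ H.Adj x y) {S : Finset V}
    (hS : ∀ x y, H.Adj x y → x ∈ S ∨ y ∈ S)
    (hmin : ∀ S' : Finset V, (∀ x y, H.Adj x y → x ∈ S' ∨ y ∈ S') → S.card ≤ S'.card) :
    ∃ φ : V → V, Set.InjOn φ {x | x ∈ S ∧ x ∈ P} ∧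
      ∀ x ∈ S, x ∈ P → H.Adj x (φ x) ∧ φ x ∉ S := by
  classical
  let T : {x | x ∈ S ∧ x ∈ P} → Finset V := fun x => Finset.univ.filter fun y => H.Adj x y ∧ y ∉ S
  have hall : ∀ W : Finset {x | x ∈ S ∧ x ∈ P}, W.card ≤ (W.biUnion T).card := by
    intro W
    let W' : Finset V := W.map (Function.Embedding.subtype _)
    have hW' : ∀ x, x ∈ W' ↔ ∃ h : x ∈ S ∧ x ∈ P, ⟨x, h⟩ ∈ W := fun x => by simp [W']
    have hsub : W' ⊆ S := fun x hx => by obtain ⟨h, -⟩ := (hW' x).1 hx; exact h.1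
    have half : ∀ x y, H.Adj x y → x ∈ S →
        x ∈ S \ W' ∪ W.biUnion T ∨ y ∈ S \ W' ∪ W.biUnion T := by
      intro x y hxy hx
      by_cases hxW : x ∈ W'
      · right
        obtain ⟨h, hx'⟩ := (hW' x).1 hxW
        by_cases hy : y ∈ S
        · refine Finset.mem_union_left _ (Finset.mem_sdiff.2 ⟨hy, fun hyW => ?_⟩)
          obtain ⟨h', -⟩ := (hW' y).1 hyW
          exact hP x h.2 y h'.2 hxy
        · exact Finset.mem_union_right _ (Finset.mem_biUnion.2 ⟨_, hx', by simp [T, hxy, hy]⟩)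
      · exact Or.inl (Finset.mem_union_left _ (Finset.mem_sdiff.2 ⟨hx, hxW⟩))
    -- Exchanging `W` for its neighbours outside `S` gives another cover, so minimality of `S` is
    -- Hall's condition.
    have h1 := hmin (S \ W' ∪ W.biUnion T) fun x y hxy => (hS x y hxy).elim (half x y hxy)
      fun h => (half y x hxy.symm h).symm
    have h2 := Finset.card_union_le (S \ W') (W.biUnion T)
    have h3 := Finset.card_sdiff_add_card_eq_card hsub
    have h4 : W'.card = W.card := Finset.card_map _
    omega
  obtain ⟨ψ, h1, h2⟩ := (Finset.all_card_le_biUnion_card_iff_exists_injective T).1 hall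
  refine ⟨fun x => if h : x ∈ S ∧ x ∈ P then ψ ⟨x, h⟩ else x, fun x hx y hy e => ?_,
    fun x hx hx' => ?_⟩
  · have hx' : x ∈ S ∧ x ∈ P := hx
    have hy' : y ∈ S ∧ y ∈ P := hy
    simp only [dif_pos hx', dif_pos hy'] at e
    simpa using h1 e
  · simp only [dif_pos (show x ∈ S ∧ x ∈ P from ⟨hx, hx'⟩)]
    simpa [T] using h2 ⟨x, hx, hx'⟩

/-- The set `S` covers the edges that cross the cut `A`. -/
def Covers (G : SimpleGraph V) (A : Set V) (S : Finset V) : Prop :=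
  ∀ a ∈ A, ∀ b ∉ A, G.Adj a b → a ∈ S ∨ b ∈ S

/-- König's theorem. In a minimum cover, the part inside `A` and the part outside `A` can both be
matched across the cut to vertices not in the cover. The two matchings do not interfere, and
together they have as many edges as the cover has vertices. -/
theorem exists_covers [Fintype V] (G : SimpleGraph V) (A : Set V) :
    ∃ S : Finset V, Covers G A S ∧ S.card ≤ mm G A ∧
      ∀ S', Covers G A S' → S.card ≤ S'.card := by
  classical
  have hex : ∃ k, ∃ S : Finset V, Covers G A S ∧ S.card = k :=
    ⟨_, Finset.univ, fun a _ b _ _ => Or.inl (Finset.mem_univ a), rfl⟩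
  obtain ⟨S, hS, hcard⟩ := Nat.find_spec hex
  have hmin : ∀ S', Covers G A S' → S.card ≤ S'.card := fun S' h => by
    rw [hcard]; exact Nat.find_min' hex ⟨S', h, rfl⟩
  refine ⟨S, hS, ?_, hmin⟩
  set H := G.between A Aᶜ with hH
  have conv : ∀ S', Covers G A S' ↔ ∀ x y, H.Adj x y → x ∈ S' ∨ y ∈ S' := by
    intro S'
    constructor
    · rintro h x y ⟨h1, ⟨h2, h3⟩ | ⟨h2, h3⟩⟩
      · exact h x h2 y h3 h1
      · exact (h y h3 x h2 h1.symm).symm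
    · intro h a ha b hb hab
      exact h a b ⟨hab, Or.inl ⟨ha, hb⟩⟩
  have hmin' : ∀ S' : Finset V, (∀ x y, H.Adj x y → x ∈ S' ∨ y ∈ S') → S.card ≤ S'.card :=
    fun S' h => hmin S' ((conv S').2 h)
  obtain ⟨φ, f1, f2⟩ := exists_matching_of_minimum_cover (H := H) (P := A) (S := S)
    (by rintro x hx y hy ⟨-, ⟨-, h⟩ | ⟨h, -⟩⟩; exacts [h hy, h hx]) ((conv S).1 hS) hmin'
  obtain ⟨ψ, g1, g2⟩ := exists_matching_of_minimum_cover (H := H) (P := Aᶜ) (S := S)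
    (by rintro x hx y hy ⟨-, ⟨h, -⟩ | ⟨-, h⟩⟩; exacts [hx h, hy h]) ((conv S).1 hS) hmin'
  have f3 : ∀ x ∈ S, x ∈ A → φ x ∉ A ∧ G.Adj x (φ x) ∧ φ x ∉ S := by
    intro x hx hxA
    obtain ⟨⟨h1, ⟨-, h2⟩ | ⟨h2, -⟩⟩, h3⟩ := f2 x hx hxA
    · exact ⟨h2, h1, h3⟩
    · exact absurd hxA h2
  have g3 : ∀ x ∈ S, x ∉ A → ψ x ∈ A ∧ G.Adj (ψ x) x ∧ ψ x ∉ S := by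
    intro x hx hxA
    obtain ⟨⟨h1, ⟨h2, -⟩ | ⟨-, h2⟩⟩, h3⟩ := g2 x hx hxA
    · exact absurd h2 hxA
    · exact ⟨h2, h1.symm, h3⟩
  refine card_le_mm S (fun x => if x ∈ A then x else ψ x) (fun x => if x ∈ A then φ x else x)
    (fun x hx => ?_) (fun x hx => ?_) (fun x hx => ?_) ?_ ?_
  · split_ifs with h
    · exact h
    · exact (g3 x hx h).1
  · split_ifs with h
    · exact (f3 x hx h).1
    · exact h
  · split_ifs with h
    · exact (f3 x hx h).2.1
    · exact (g3 x hx h).2.1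
  · intro x hx y hy e
    dsimp only at e
    split_ifs at e with h1 h2 h2
    · exact e
    · exact absurd (e ▸ hx) (g3 y hy h2).2.2
    · exact absurd (e ▸ hy) (g3 x hx h1).2.2
    · exact g1 ⟨hx, h1⟩ ⟨hy, h2⟩ e
  · intro x hx y hy e
    dsimp only at e
    split_ifs at e with h1 h2 h2
    · exact f1 ⟨hx, h1⟩ ⟨hy, h2⟩ e
    · exact absurd (e ▸ hy) (f3 x hx h1).2.2
    · exact absurd (e ▸ hx) (f3 y hy h2).2.2
    · exact e

/-- A maximal matching of the edges that cross the cut `A`; the pairs are numbered. -/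
structure Pairs (G : SimpleGraph V) (A : Set V) (g : ℕ) (a b : ℕ → V) : Prop where
  mem : ∀ i < g, a i ∈ A
  notMem : ∀ i < g, b i ∉ A
  adj : ∀ i < g, G.Adj (a i) (b i)
  injA : ∀ i < g, ∀ j < g, a i = a j → i = j
  injB : ∀ i < g, ∀ j < g, b i = b j → i = j

theorem Pairs.le_mm [Finite V] {A : Set V} {g : ℕ} {a b : ℕ → V} (h : Pairs G A g a b) :
    g ≤ mm G A := by
  have := card_le_mm (G := G) (A := A) (Finset.range g) a b
    (fun i hi => h.mem i (Finset.mem_range.1 hi)) (fun i hi => h.notMem i (Finset.mem_range.1 hi))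
    (fun i hi => h.adj i (Finset.mem_range.1 hi))
    (fun i hi j hj e => h.injA i (by simpa using hi) j (by simpa using hj) e)
    (fun i hi j hj e => h.injB i (by simpa using hi) j (by simpa using hj) e)
  simpa using this

/-- The vertex `y` with number `ord y` is chosen by the code `z`. -/
def Chosen (A : Set V) (ord : V → ℕ) (z : ℕ) (y : V) : Prop :=
  (y ∈ A → z / 3 ^ ord y % 3 ≠ 1) ∧ (y ∉ A → z / 3 ^ ord y % 3 ≠ 0)

/-- The set with code `z`: the chosen vertices of the matching, and the other vertices with a
neighbour in the matching that is not chosen. -/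
def Decode (G : SimpleGraph V) (A : Set V) (marked : V → Prop) (ord : V → ℕ) (z : ℕ) (x : V) :
    Prop :=
  (marked x → Chosen A ord z x) ∧
  (¬ marked x → ∃ y, G.Adj x y ∧ (x ∈ A ↔ y ∉ A) ∧ marked y ∧ ¬ Chosen A ord z y)

/-- A minimum cover contains one end or both ends of every matched edge, so a ternary digit
describes the choice. A vertex off the matching is forced into the cover if it has a matched
neighbour across that was not chosen. Adding only the forced vertices suffices, since by maximality
every crossing edge meets the matching. The result lies inside the minimum cover. -/
theorem Pairs.exists_decode [Fintype V] {A : Set V} {g : ℕ} {a b : ℕ → V} (h : Pairs G A g a b)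
    {marked : V → Prop} {ord : V → ℕ}
    (hm : ∀ x, marked x ↔ ∃ i < g, (x = a i ∨ x = b i) ∧ ord x = i)
    (hmax : ∀ x ∈ A, ∀ y ∉ A, G.Adj x y → marked x ∨ marked y) :
    ∃ z < 3 ^ g, ∃ S : Finset V, (∀ x, x ∈ S ↔ Decode G A marked ord z x) ∧ Covers G A S ∧
      S.card ≤ mm G A := by
  classical
  obtain ⟨S, hS, hmm, -⟩ := exists_covers G A
  -- Digit `0` means that only the inner end is in `S`, digit `1` only the outer end, digit `2`
  -- both.
  obtain ⟨z, hz, hz'⟩ := exists_digits g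
    (fun i => if a i ∈ S then (if b i ∈ S then 2 else 0) else 1)
    (fun i => by split_ifs <;> norm_num)
  have hch : ∀ x, marked x → (Chosen A ord z x ↔ x ∈ S) := by
    intro x hx
    obtain ⟨i, hi, hx', rfl⟩ := (hm x).1 hx
    have hc := hS _ (h.mem _ hi) _ (h.notMem _ hi) (h.adj _ hi)
    unfold Chosen
    rw [hz' _ hi]
    rcases hx' with hx' | hx'
    · have hxA : x ∈ A := by rw [hx']; exact h.mem _ hi
      rw [← hx'] at hc ⊢
      simp only [hxA, not_true, false_implies, and_true, true_implies]
      split_ifs <;> norm_num <;> tauto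
    · have hxA : x ∉ A := by rw [hx']; exact h.notMem _ hi
      rw [← hx'] at hc ⊢
      simp only [hxA, false_implies, true_and, not_false_eq_true, true_implies]
      split_ifs <;> norm_num <;> tauto
  have hsub : ∀ x, Decode G A marked ord z x → x ∈ S := by
    intro x hx
    by_cases hmx : marked x
    · exact (hch x hmx).1 (hx.1 hmx)
    · obtain ⟨y, h1, h2, h3, h4⟩ := hx.2 hmx
      rw [hch y h3] at h4
      by_cases hxA : x ∈ A
      · exact (hS x hxA y (h2.1 hxA) h1).resolve_right h4
      · exact (hS y (by tauto) x hxA h1.symm).resolve_left h4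
  refine ⟨z, hz, Finset.univ.filter (Decode G A marked ord z), by simp, ?_, ?_⟩
  · intro x hx y hy hxy
    simp only [Finset.mem_filter, Finset.mem_univ, true_and]
    have h1 := hS x hx y hy hxy
    by_cases hmx : marked x <;> by_cases hmy : marked y
    · rcases h1 with h1 | h1
      · exact Or.inl ⟨fun _ => (hch x hmx).2 h1, fun h => absurd hmx h⟩
      · exact Or.inr ⟨fun _ => (hch y hmy).2 h1, fun h => absurd hmy h⟩
    · by_cases hxS : x ∈ S
      · exact Or.inl ⟨fun _ => (hch x hmx).2 hxS, fun h => absurd hmx h⟩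
      · exact Or.inr ⟨fun h => absurd h hmy, fun _ => ⟨x, hxy.symm, by tauto, hmx,
          by rwa [hch x hmx]⟩⟩
    · by_cases hyS : y ∈ S
      · exact Or.inr ⟨fun _ => (hch y hmy).2 hyS, fun h => absurd hmy h⟩
      · exact Or.inl ⟨fun h => absurd h hmx, fun _ => ⟨y, hxy, by tauto, hmy,
          by rwa [hch y hmy]⟩⟩
    · rcases hmax x hx y hy hxy with h | h <;> contradiction
  · refine (Finset.card_le_card fun x hx => ?_).trans hmm
    exact hsub x (by simpa using hx)

end Cover

end EDS

namespace EDS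

/-! ### The cuts of a branch decomposition -/

section Tree

variable {W : Type*} {T : SimpleGraph W}

/-- The nodes that can be reached from `u` without visiting `v`. -/
def branch (T : SimpleGraph W) (u v : W) : Set W := {x | ∃ p : T.Walk u x, v ∉ p.support}

/-- Otherwise the edge `uv` followed by the walk contains a path from `u` to `w` other than the edge
`uw`. -/
theorem not_walk_avoiding (hT : T.IsAcyclic) {u v w : W} (hv : T.Adj u v) (hw : T.Adj u w)
    (p : T.Walk v w) (hp : u ∉ p.support) : v = w := by
  classical
  have hq : u ∉ p.bypass.support := fun h => hp (p.support_bypass_subset_support h)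
  have := (hT.subsingleton_path u w).elim ⟨.cons hv p.bypass, p.bypass_isPath.cons hq⟩
    (SimpleGraph.Path.singleton hw)
  have h1 := congrArg (fun q => q.1.length) this
  simp only [SimpleGraph.Walk.length_cons, SimpleGraph.Path.singleton,
    SimpleGraph.Walk.length_nil] at h1
  exact SimpleGraph.Walk.eq_of_length_eq_zero (p := p.bypass) (by omega)

theorem branch_subset (hT : T.IsAcyclic) {u v w : W} (hv : T.Adj u v) (hw : T.Adj u w)
    (hne : w ≠ v) : branch T w u ⊆ branch T u v := by
  classical
  rintro x ⟨p, hp⟩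
  refine ⟨.cons hw p, ?_⟩
  rw [SimpleGraph.Walk.support_cons, List.mem_cons, not_or]
  refine ⟨hv.ne.symm, fun h => hne ?_⟩
  exact not_walk_avoiding hT hw hv (p.takeUntil v h)
    fun h' => hp (p.support_takeUntil_subset_support h h')

theorem exists_mem_branch {u v x : W} (hx : x ∈ branch T u v) (hne : x ≠ u) :
    ∃ w, T.Adj u w ∧ w ≠ v ∧ x ∈ branch T w u := by
  classical
  obtain ⟨p, hp⟩ := hx
  have hq : v ∉ p.bypass.support := fun h => hp (p.support_bypass_subset_support h)
  have hpath := p.bypass_isPath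
  revert hq hpath
  generalize p.bypass = q
  intro hq hpath
  cases q with
  | nil => exact absurd rfl hne
  | cons h q =>
    rw [SimpleGraph.Walk.cons_isPath_iff] at hpath
    refine ⟨_, h, fun e => hq ?_, q, hpath.2⟩
    rw [SimpleGraph.Walk.support_cons, ← e]
    exact List.mem_cons_of_mem _ q.start_mem_support

theorem disjoint_branch (hT : T.IsAcyclic) {u v w : W} (hv : T.Adj u v) (hw : T.Adj u w)
    (hne : v ≠ w) : Disjoint (branch T v u) (branch T w u) := by
  rw [Set.disjoint_left]
  rintro x ⟨p, hp⟩ ⟨q, hq⟩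
  refine hne (not_walk_avoiding hT hv hw (p.append q.reverse) ?_)
  rw [SimpleGraph.Walk.mem_support_append_iff, SimpleGraph.Walk.support_reverse, List.mem_reverse]
  tauto

theorem mem_branch_or (hT : T.IsTree) {u v : W} (hv : T.Adj u v) (x : W) :
    x ∈ branch T u v ∨ x ∈ branch T v u := by
  by_cases hx : x = u
  · subst hx; exact Or.inl ⟨.nil, by simpa using hv.ne.symm⟩
  · by_cases h : x ∈ branch T v u
    · exact Or.inr h
    · obtain ⟨p⟩ := hT.connected.preconnected u x
      classical
      have hpath := p.bypass_isPath
      revert hpath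
      generalize p.bypass = q
      intro hpath
      cases q with
      | nil => exact absurd rfl hx
      | @cons _ w _ hw q =>
        rw [SimpleGraph.Walk.cons_isPath_iff] at hpath
        have hxw : x ∈ branch T w u := ⟨q, hpath.2⟩
        exact Or.inl (branch_subset hT.isAcyclic hv hw (fun e => h (e ▸ hxw)) hxw)

theorem disjoint_branch_swap (hT : T.IsAcyclic) {u v : W} (hv : T.Adj u v) :
    Disjoint (branch T u v) (branch T v u) := by
  rw [Set.disjoint_left]
  intro x hx hx'
  by_cases hxu : x = u
  · subst hxu
    obtain ⟨p, hp⟩ := hx'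
    exact hp p.end_mem_support
  · obtain ⟨w, h1, h2, h3⟩ := exists_mem_branch hx hxu
    exact (disjoint_branch hT h1 hv h2).notMem_of_mem_left h3 hx'

theorem self_mem_branch {u v : W} (hv : T.Adj u v) : u ∈ branch T u v :=
  ⟨.nil, by simpa using hv.ne.symm⟩

theorem self_notMem_branch {u v : W} : u ∉ branch T v u := fun ⟨p, hp⟩ => hp p.end_mem_support

/-- Sides are defined by deleting an edge, but walks that avoid a node are easier to split and to
extend. The two notions agree because the edge is a bridge. -/
theorem reachable_deleteEdges_iff (hT : T.IsTree) {u v : W} (hv : T.Adj u v) (x : W) :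
    (T.deleteEdges {s(u, v)}).Reachable u x ↔ x ∈ branch T u v := by
  have key : ∀ a b y : W, (p : T.Walk a y) → b ∉ p.support →
      (T.deleteEdges {s(a, b)}).Reachable a y := fun a b y p hp =>
    ⟨p.toDeleteEdges {s(a, b)} fun e he h => by
      rw [Set.mem_singleton_iff] at h
      subst h
      exact hp (p.snd_mem_support_of_mem_edges he)⟩
  constructor
  · intro h
    refine (mem_branch_or hT hv x).resolve_right fun ⟨q, hq⟩ => ?_
    have h1 := key v u x q hq
    rw [Sym2.eq_swap] at h1
    have h2 := SimpleGraph.isAcyclic_iff_forall_adj_isBridge.1 hT.isAcyclic hv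
    exact (SimpleGraph.isBridge_iff.1 h2) (h.trans h1.symm)
  · rintro ⟨p, hp⟩
    exact key u v x p hp

end Tree

namespace BranchDecomposition

variable {V W : Type*} (D : BranchDecomposition V W)

theorem mem_side {u v : W} (h : D.tree.Adj u v) (x : V) :
    x ∈ D.side u v ↔ (D.leafEquiv.symm x).1 ∈ branch D.tree u v :=
  reachable_deleteEdges_iff D.isTree h _

/-- The sides of cuts for which the algorithm keeps a table. -/
def IsSide (A : Set V) : Prop := A = Set.univ ∨ A = ∅ ∨ ∃ u v, D.tree.Adj u v ∧ A = D.side u v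

/-- The sides of cuts that have a complete table after `r` rounds. -/
inductive Built : ℕ → Set V → Prop
  | base (r : ℕ) (A : Set V) : D.IsSide A → A.ncard ≤ 1 → Built r A
  | join (r : ℕ) (A B : Set V) : Built r A → Built r B → Disjoint A B → D.IsSide (A ∪ B) →
      Built (r + 1) (A ∪ B)

variable {D}

theorem Built.mono {r q : ℕ} {A : Set V} (h : D.Built r A) (hq : r ≤ q) : D.Built q A := by
  induction h generalizing q with
  | base r A h1 h2 => exact .base q A h1 h2
  | join r A B _ _ h3 h4 ih1 ih2 =>
    obtain ⟨q, rfl⟩ : ∃ q', q = q' + 1 := ⟨q - 1, by omega⟩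
    exact .join q A B (ih1 (by omega)) (ih2 (by omega)) h3 h4

variable (D)

/-- Induction on the size of the branch. If `u` is a leaf, the side has at most one vertex.
Otherwise the side is the union of the sides behind the other neighbours of `u`, of which there are
one or two by the degree bound. A single one is joined with the empty side. -/
theorem built_side [Finite W] {u v : W} (h : D.tree.Adj u v) :
    D.Built (branch D.tree u v).ncard (D.side u v) := by
  induction hN : (branch D.tree u v).ncard using Nat.strong_induction_on generalizing u v with
  | _ N ih =>
  have hT := D.isTree.isAcyclic
  have hside : D.IsSide (D.side u v) := Or.inr (Or.inr ⟨u, v, h, rfl⟩)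
  by_cases hsmall : (D.side u v).ncard ≤ 1
  · exact .base _ _ hside hsmall
  have hleaf : ¬ IsLeaf D.tree u := by
    intro hl
    apply hsmall
    have hsub : D.side u v ⊆ {D.leafEquiv ⟨u, hl⟩} := by
      intro x hx
      rw [D.mem_side h] at hx
      by_cases e : (D.leafEquiv.symm x).1 = u
      · exact (Equiv.symm_apply_eq _).1 (Subtype.ext e)
      · obtain ⟨w, h1, h2, -⟩ := exists_mem_branch hx e
        exact absurd ((Set.ncard_le_one (Set.toFinite _)).1 hl w h1 v h) h2
    exact (Set.ncard_le_ncard hsub).trans (by simp)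
  have hlt : ∀ w, D.tree.Adj u w → w ≠ v →
      (branch D.tree w u).ncard < (branch D.tree u v).ncard := fun w hw hne =>
    Set.ncard_lt_ncard ((Set.ssubset_iff_of_subset (branch_subset hT h hw hne)).2
      ⟨u, self_mem_branch h, self_notMem_branch⟩) (Set.toFinite _)
  have hcov : ∀ x, x ∈ D.side u v ↔ ∃ w, D.tree.Adj u w ∧ w ≠ v ∧ x ∈ D.side w u := by
    intro x
    rw [D.mem_side h]
    constructor
    · intro hx
      obtain ⟨w, h1, h2, h3⟩ := exists_mem_branch hx fun e => hleaf (e ▸ (D.leafEquiv.symm x).2)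
      exact ⟨w, h1, h2, (D.mem_side h1.symm x).2 h3⟩
    · rintro ⟨w, h1, h2, h3⟩
      exact branch_subset hT h h1 h2 ((D.mem_side h1.symm x).1 h3)
  obtain ⟨w, hw, hwv⟩ : ∃ w, D.tree.Adj u w ∧ w ≠ v := by
    by_contra hno
    push Not at hno
    refine hleaf ((Set.ncard_le_one (Set.toFinite _)).2 fun a ha b hb => ?_)
    rw [hno a ha, hno b hb]
  have hN1 : 1 ≤ N := by have := hlt w hw hwv; omega
  obtain ⟨M, rfl⟩ : ∃ M, N = M + 1 := ⟨N - 1, by omega⟩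
  have hb : ∀ w, D.tree.Adj u w → w ≠ v → D.Built M (D.side w u) := fun w hw hne =>
    (ih _ (hN ▸ hlt w hw hne) hw.symm rfl).mono (by have := hlt w hw hne; omega)
  by_cases hex : ∃ w', D.tree.Adj u w' ∧ w' ≠ v ∧ w' ≠ w
  · obtain ⟨w', hw', hw'v, hne⟩ := hex
    have heq : D.side u v = D.side w u ∪ D.side w' u := by
      ext x
      rw [hcov, Set.mem_union]
      constructor
      · rintro ⟨y, h1, h2, h3⟩
        by_cases e1 : y = w
        · subst e1; exact Or.inl h3
        by_cases e2 : y = w'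
        · subst e2; exact Or.inr h3
        exfalso
        classical
        -- A third neighbour besides `v` would make the degree of `u` at least four.
        have h4 : (({v, w, w', y} : Finset W) : Set W) ⊆ D.tree.neighborSet u := by
          intro z hz
          simp only [Finset.coe_insert, Finset.coe_singleton, Set.mem_insert_iff,
            Set.mem_singleton_iff] at hz
          rcases hz with rfl | rfl | rfl | rfl <;> assumption
        have h5 := Set.ncard_le_ncard h4
        have h6 : ({v, w, w', y} : Finset W).card = 4 := by
          simp [hwv.symm, hw'v.symm, Ne.symm h2, Ne.symm hne, Ne.symm e1, Ne.symm e2]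
        rw [Set.ncard_coe_finset, h6] at h5
        have := D.subcubic u
        omega
      · rintro (hx | hx)
        · exact ⟨w, hw, hwv, hx⟩
        · exact ⟨w', hw', hw'v, hx⟩
    rw [heq] at hside ⊢
    refine .join _ _ _ (hb w hw hwv) (hb w' hw' hw'v) ?_ hside
    rw [Set.disjoint_left]
    intro x hx hx'
    exact (disjoint_branch hT hw hw' hne.symm).notMem_of_mem_left
      ((D.mem_side hw.symm x).1 hx) ((D.mem_side hw'.symm x).1 hx')
  · push Not at hex
    have heq : D.side u v = D.side w u ∪ ∅ := by
      ext x
      rw [hcov, Set.union_empty]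
      constructor
      · rintro ⟨y, h1, h2, h3⟩
        rw [← hex y h1 h2]; exact h3
      · exact fun hx => ⟨w, hw, hwv, hx⟩
    rw [heq] at hside ⊢
    exact .join _ _ _ (hb w hw hwv) (.base _ _ (Or.inr (Or.inl rfl)) (by simp))
      (Set.disjoint_empty _) hside

/-- Any tree edge splits the vertices into two sides that are built after as many rounds as there
are nodes, and one more round joins them. A tree without edges has a single node, so the graph has
at most one vertex. -/
theorem built_univ [Finite W] : D.Built (Nat.card W + 1) Set.univ := by
  by_cases hex : ∃ u v, D.tree.Adj u v
  · obtain ⟨u, v, h⟩ := hex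
    have hT := D.isTree.isAcyclic
    have heq : (Set.univ : Set V) = D.side u v ∪ D.side v u := by
      ext x
      simp only [Set.mem_univ, Set.mem_union, true_iff]
      rw [D.mem_side h, D.mem_side h.symm]
      exact mem_branch_or D.isTree h _
    have hle : ∀ s : Set W, s.ncard ≤ Nat.card W := fun s => Set.ncard_le_card s
    rw [heq]
    refine .join _ _ _ ((D.built_side h).mono (hle _)) ((D.built_side h.symm).mono (hle _)) ?_
      (Or.inl heq.symm)
    rw [Set.disjoint_left]
    intro x hx hx'
    exact (disjoint_branch_swap hT h).notMem_of_mem_left ((D.mem_side h x).1 hx)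
      ((D.mem_side h.symm x).1 hx')
  · push Not at hex
    refine .base _ _ (Or.inl rfl) ?_
    have hW : Subsingleton W := by
      refine ⟨fun a b => ?_⟩
      obtain ⟨p⟩ := D.isTree.connected.preconnected a b
      cases p with
      | nil => rfl
      | cons h _ => exact absurd h (hex _ _)
    have : Subsingleton V := D.leafEquiv.symm.subsingleton
    exact Set.ncard_le_one_of_subsingleton _

end BranchDecomposition

end EDS

namespace EDS

/-! ### Effects of statements -/

theorem Store.setReg_reg (s : Store) (v i x : ℕ) :
    (s.setReg v i).reg x = if x = v then i else s.reg x := by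
  by_cases h : x = v
  · rw [if_pos h, h, Store.setReg_reg_self]
  · rw [if_neg h, Store.setReg_reg_ne _ _ h]

theorem Store.fill_arr (s : Store) (a N b i : ℕ) (f : ℕ → ℕ) :
    (s.fill a N f).arr b i = if b = a ∧ i < N then f i else s.arr b i := by
  by_cases h : b = a
  · subst h; simp [Store.fill]
  · simp [Store.fill, h]

/-- The arrays that a statement changes. -/
def Stm.writes : Stm → List ℕ
  | .comp a _ _ _ => [a]
  | .seq p q => p.writes ++ q.writes
  | .rep _ _ p => p.writes

/-- The loop variables of a statement. -/
def Stm.vars : Stm → List ℕ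
  | .comp _ _ _ _ => []
  | .seq p q => p.vars ++ q.vars
  | .rep v _ p => v :: p.vars

theorem Stm.den_rep (v x : ℕ) (p : Stm) (I : ℕ → Store → Prop) (s : Store) (h0 : I 0 s)
    (hstep : ∀ i < s.reg x, ∀ r, I i r → I (i + 1) (p.den (r.setReg v i))) :
    I (s.reg x) ((Stm.rep v x p).den s) := by
  simp only [Stm.den]
  generalize hN : s.reg x = N
  rw [hN] at hstep
  clear hN
  induction N with
  | zero => exact h0
  | succ N ih => exact hstep N (by omega) _ (ih fun i hi => hstep i (by omega))

theorem Stm.den_frame (p : Stm) : ∀ s : Store,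
    (∀ x, x ∉ p.vars → (p.den s).reg x = s.reg x) ∧
    ∀ a, a ∉ p.writes → (p.den s).arr a = s.arr a := by
  induction p with
  | comp a v x e =>
    refine fun s => ⟨fun _ _ => rfl, fun b hb => ?_⟩
    funext i
    rw [Stm.den, Store.fill_arr, if_neg]
    exact fun h => hb (by simp [Stm.writes, h.1])
  | seq p q ihp ihq =>
    intro s
    simp only [Stm.vars, Stm.writes, List.mem_append, not_or, Stm.den]
    exact ⟨fun x hx => by rw [(ihq _).1 x hx.2, (ihp _).1 x hx.1],
      fun a ha => by rw [(ihq _).2 a ha.2, (ihp _).2 a ha.1]⟩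
  | rep v x p ih =>
    intro s
    simp only [Stm.vars, Stm.writes, List.mem_cons, not_or]
    refine Stm.den_rep v x p (fun _ r => (∀ x, ¬ x = v ∧ x ∉ p.vars → r.reg x = s.reg x) ∧
      ∀ a, a ∉ p.writes → r.arr a = s.arr a) s ⟨fun _ _ => rfl, fun _ _ => rfl⟩
      fun i _ r hr => ⟨fun y hy => ?_, fun a ha => ?_⟩
    · rw [(ih _).1 y hy.2, Store.setReg_reg_ne _ _ hy.1, hr.1 y hy]
    · rw [(ih _).2 a ha, ← hr.2 a ha]; rfl

theorem forall_lt_iff {n : ℕ} {P : ℕ → Prop} : (∀ i < n, P i) ↔ ∀ x : Fin n, P x :=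
  ⟨fun h x => h x x.2, fun h i hi => h ⟨i, hi⟩⟩

theorem exists_lt_iff {n : ℕ} {P : ℕ → Prop} : (∃ i < n, P i) ↔ ∃ x : Fin n, P x :=
  ⟨fun ⟨i, hi, h⟩ => ⟨⟨i, hi⟩, h⟩, fun ⟨x, h⟩ => ⟨x, x.2, h⟩⟩

theorem card_filter_range {n : ℕ} (P : ℕ → Prop) [DecidablePred P] :
    ((Finset.range n).filter P).card = {x : Fin n | P x}.ncard := by
  classical
  rw [← Set.ncard_image_of_injective _ Fin.val_injective, ← Set.ncard_coe_finset]
  congr 1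
  ext i
  simp only [Finset.coe_filter, Finset.mem_range, Set.mem_ofPred_eq, Set.mem_image]
  exact ⟨fun ⟨h1, h2⟩ => ⟨⟨i, h1⟩, h2, rfl⟩, fun ⟨x, h1, h2⟩ => h2 ▸ ⟨x.2, h1⟩⟩

theorem row_lt {c C n x : ℕ} (hc : c < C) (hx : x < n) : c * n + x < C * n := by
  calc c * n + x < (c + 1) * n := by rw [add_mul]; omega
    _ ≤ C * n := Nat.mul_le_mul_right _ hc

theorem row_div {c n x : ℕ} (hx : x < n) : (c * n + x) / n = c := by
  rw [mul_comm, Nat.mul_add_div (by omega), Nat.div_eq_of_lt hx, add_zero]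

theorem row_mod {c n x : ℕ} (hx : x < n) : (c * n + x) % n = x := by
  rw [mul_comm, Nat.mul_add_mod, Nat.mod_eq_of_lt hx]

/-- The row `i` of the array `L`, as a labelling. -/
def Store.lab (s : Store) (n L i : ℕ) (x : Fin n) : ℕ := s.arr L (i * n + x)

/-- What the computation of the tables needs to know about the cuts. -/
structure Ctx (n Kc K Ks : ℕ) (G : SimpleGraph (Fin n)) (C : ℕ → Cut (Fin n)) (s : Store) :
    Prop where
  reg0 : s.reg 0 = n
  reg3 : s.reg 3 = Kc
  reg4 : s.reg 4 = n + 1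
  reg5 : s.reg 5 = 2 * n + 1
  reg10 : s.reg 10 = K
  reg11 : s.reg 11 = Ks
  reg12 : s.reg 12 = Kc * Ks
  reg13 : s.reg 13 = Kc * Ks * n
  reg14 : s.reg 14 = Ks * Ks * (n + 1)
  reg15 : s.reg 15 = Ks * (Ks * Ks * (n + 1))
  reg16 : s.reg 16 = Ks * (Ks * Ks * (n + 1)) * n
  reg17 : s.reg 17 = Ks * (Ks * Ks * (n + 1)) * Ks
  reg18 : s.reg 18 = Ks * Ks * Ks
  reg19 : s.reg 19 = Ks * Ks * Ks * n
  Ks_eq : Ks = K * (2 * Fintype.card (Fin n) + 2)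
  adj : ∀ x y : Fin n, s.arr 0 (x * n + y) ≠ 0 ↔ G.Adj x y
  side_le : ∀ c < Kc, ∀ x : Fin n, s.arr 6 (c * n + x) ≤ 1
  side : ∀ c < Kc, ∀ x : Fin n, s.arr 6 (c * n + x) ≠ 0 ↔ x ∈ (C c).side
  outer : ∀ c < Kc, ∀ x : Fin n, s.arr 7 (c * n + x) ≠ 0 ↔ x ∈ (C c).outer G
  split : ∀ c < Kc, s.arr 8 c ≠ 0 ↔ (C c).split
  cover : ∀ c < Kc, ∀ x : Fin n, s.arr 15 (c * n + x) ≠ 0 ↔ x ∈ (C c).cover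
  pow_pos : ∀ c < Kc, ∀ x : Fin n, s.arr 3 (s.arr 16 (c * n + x)) = 3 ^ (C c).pos x
  valid : ∀ c < Kc, (C c).Valid G K

variable {n Kc K Ks : ℕ} {G : SimpleGraph (Fin n)} {C : ℕ → Cut (Fin n)} {s r : Store}

theorem Ctx.congr (h : Ctx n Kc K Ks G C s) (hr : ∀ x < 25, r.reg x = s.reg x)
    (ha : ∀ a < 17, r.arr a = s.arr a) : Ctx n Kc K Ks G C r := by
  constructor
  case Ks_eq => exact h.Ks_eq
  case valid => exact h.valid
  all_goals
    first
    | rw [hr _ (by norm_num)]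
    | rw [ha 3 (by norm_num), ha 16 (by norm_num)]
    | rw [ha _ (by norm_num)]
  exacts [h.reg0, h.reg3, h.reg4, h.reg5, h.reg10, h.reg11, h.reg12, h.reg13, h.reg14, h.reg15,
    h.reg16, h.reg17, h.reg18, h.reg19, h.adj, h.side_le, h.side, h.outer, h.split, h.cover,
    h.pow_pos]

theorem Ctx.setReg (h : Ctx n Kc K Ks G C s) {v : ℕ} (hv : 25 ≤ v) (i : ℕ) :
    Ctx n Kc K Ks G C (s.setReg v i) :=
  h.congr (fun x hx => Store.setReg_reg_ne _ _ (by omega)) fun _ _ => rfl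

theorem Ctx.den (h : Ctx n Kc K Ks G C s) (p : Stm) (hv : ∀ x ∈ p.vars, 25 ≤ x)
    (hw : ∀ a ∈ p.writes, 17 ≤ a) : Ctx n Kc K Ks G C (p.den s) :=
  h.congr (fun x hx => (p.den_frame s).1 x fun hx' => by have := hv x hx'; omega)
    fun a ha => (p.den_frame s).2 a fun ha' => by have := hw a ha'; omega

namespace Code
open Tm

theorem T_sat (h : Ctx n Kc K Ks G C s) (L : ℕ) (hc : s.reg 26 < Kc) :
    (sat L).T s ↔ (C (s.reg 26)).Sat G K (s.reg 27) (s.lab n L (s.reg 28)) := by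
  simp only [sat, satSplit, satCover, demands, cross, side, outer, split, inCover, adj, digit,
    label, row, T_ite, T_and, T_imp, T_eq, T_le, T_all, T_ex, T_no, T_cell, eval_mod, eval_div,
    eval_add, eval_mul, eval_reg, eval_const, eval_cell, eval_cnt, Store.setReg_reg,
    Store.setReg_arr, Nat.reduceEqDiff, if_true, if_false, OfNat.zero_ne_ofNat, h.reg0, h.reg10,
    forall_lt_iff, exists_lt_iff, card_filter_range, h.split _ hc, h.side _ hc, h.outer _ hc,
    h.cover _ hc, h.pow_pos _ hc, h.adj]
  unfold Cut.Sat Cut.demands Cut.digit Store.lab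
  -- The two sides now differ only in a redundancy: the test for a crossing edge repeats that the
  -- outer cover vertex is outside.
  refine and_congr Iff.rfl (imp_congr_right fun hs => and_congr (forall_congr' fun x =>
    imp_congr_right fun hx => and_congr Iff.rfl (imp_congr_right fun hxs =>
      imp_congr_right fun h0 => ⟨fun h a ha hax => h a ⟨ha, hxs, hax⟩,
        fun h a ha => h a ha.1 ha.2.2⟩)) ?_)
  exact ⟨fun h r hr => h ⟨r, hr⟩, fun h x => h x x.2⟩

end Code
end EDS

/-! ### Improving table entries by slots. -/

namespace EDS

theorem Stm.den_comp_self (a v x : ℕ) (e : Tm) (s : Store) {i : ℕ} (hi : i < s.reg x) :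
    ((Stm.comp a v x e).den s).arr a i = e.eval (s.setReg v i) := by
  rw [Stm.den, Store.fill_arr, if_pos ⟨rfl, hi⟩]

theorem Stm.den_comp_ne {a b v x : ℕ} {e : Tm} {s : Store} (h : b ≠ a) :
    ((Stm.comp a v x e).den s).arr b = s.arr b := by
  funext i
  rw [Stm.den, Store.fill_arr, if_neg fun h' => h h'.1]

theorem Stm.den_comp_reg {a v x y : ℕ} {e : Tm} {s : Store} :
    ((Stm.comp a v x e).den s).reg y = s.reg y := rfl

theorem Stm.den_seq (p q : Stm) (s : Store) : (Stm.seq p q).den s = q.den (p.den s) := rfl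

/-- The search for an index with a property and of minimum weight. -/
theorem leastBelow_best {P : ℕ → Prop} {w f g : ℕ → ℕ} {N B : ℕ} (hw : ∀ j < N, P j → w j < B)
    (hf : ∀ v, f v ≠ 0 ↔ ∃ j < N, P j ∧ w j = v)
    (hg : ∀ j < N, g j ≠ 0 ↔ P j ∧ w j = leastBelow f B) :
    (leastBelow g N < N ↔ ∃ j < N, P j) ∧
    (leastBelow g N < N → P (leastBelow g N) ∧ w (leastBelow g N) = leastBelow f B) ∧
    ∀ j < N, P j → leastBelow f B ≤ w j := by
  refine ⟨⟨fun h => ⟨_, h, ((hg _ h).1 (leastBelow_spec g N h)).1⟩, fun ⟨j, hj, hP⟩ => ?_⟩,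
    fun h => (hg _ h).1 (leastBelow_spec g N h), fun j hj hP =>
      leastBelow_le_of f B _ ((hf _).2 ⟨j, hj, hP, rfl⟩)⟩
  have h1 : leastBelow f B < B := (leastBelow_lt_iff f B).2
    ⟨_, hw j hj hP, (hf _).2 ⟨j, hj, hP, rfl⟩⟩
  obtain ⟨i, hi, hPi, hwi⟩ := (hf _).1 (leastBelow_spec f B h1)
  exact (leastBelow_lt_iff g N).2 ⟨i, hi, (hg i hi).2 ⟨hPi, hwi⟩⟩

namespace Code
open Tm

variable {n Kc K Ks : ℕ} {G : SimpleGraph (Fin n)} {C : ℕ → Cut (Fin n)} {s r : Store}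

theorem eval_unpack (e : Tm) (s : Store) : (unpack e).eval s =
    e.eval ((s.setReg 26 (s.reg 25 / s.reg 0)).setReg 27 (s.reg 25 % s.reg 0)) := by
  simp only [unpack, eval_bind, eval_div, eval_mod, eval_reg, Store.setReg_reg, Nat.reduceEqDiff,
    if_false, OfNat.zero_ne_ofNat]

/-- A comprehension over the cells `(c, x)`. -/
theorem den_unpack (a k : ℕ) (e : Tm) (s : Store) {N c x : ℕ} (h0 : s.reg 0 = n)
    (hk : s.reg k = N * n) (hc : c < N) (hx : x < n) :
    ((Stm.comp a 25 k (unpack e)).den s).arr a (c * n + x) =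
      e.eval (((s.setReg 25 (c * n + x)).setReg 26 c).setReg 27 x) := by
  rw [Stm.den_comp_self _ _ _ _ _ (by rw [hk]; exact row_lt hc hx), eval_unpack]
  simp only [Store.setReg_reg, OfNat.zero_ne_ofNat, if_false, if_true, h0, row_div hx, row_mod hx]

theorem eval_unpackEntry (e : Tm) (s : Store) : (unpackEntry e).eval s =
    e.eval ((s.setReg 26 (s.reg 25 / s.reg 11)).setReg 27 (s.reg 25 % s.reg 11)) := by
  simp only [unpackEntry, eval_bind, eval_div, eval_mod, eval_reg, Store.setReg_reg,
    Nat.reduceEqDiff, if_false]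

theorem den_unpackEntry (h : Ctx n Kc K Ks G C s) (a : ℕ) (e : Tm) {c t : ℕ} (hc : c < Kc)
    (ht : t < Ks) : ((Stm.comp a 25 12 (unpackEntry e)).den s).arr a (c * Ks + t) =
      e.eval (((s.setReg 25 (c * Ks + t)).setReg 26 c).setReg 27 t) := by
  rw [Stm.den_comp_self _ _ _ _ _ (by rw [h.reg12]; exact row_lt hc ht), eval_unpackEntry]
  simp only [Store.setReg_reg, Nat.reduceEqDiff, if_false, if_true, h.reg11, row_div ht, row_mod ht]

theorem sum_range_lab (L i : ℕ) : ∑ x ∈ Finset.range n, s.arr L (i * n + x) =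
    ∑ x, s.lab n L i x := by
  rw [Finset.sum_range]; rfl

/-- The slot `j` improves the entry `t` for the cut `c`. -/
def Fit (G : SimpleGraph (Fin n)) (K : ℕ) (C : ℕ → Cut (Fin n)) (s : Store) (c t j : ℕ) : Prop :=
  s.arr 19 j ≠ 0 ∧ (∀ x : Fin n, s.arr 21 (j * n + x) = s.arr 6 (c * n + x)) ∧
    (C c).Sat G K t (s.lab n 20 j)

theorem Fit_setReg (v i c t j : ℕ) : Fit G K C (s.setReg v i) c t j ↔ Fit G K C s c t j := Iff.rfl

theorem lab_setReg (v i L j : ℕ) : (s.setReg v i).lab n L j = s.lab n L j := rfl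

theorem lab_congr {L : ℕ} (h : r.arr L = s.arr L) (j : ℕ) : r.lab n L j = s.lab n L j := by
  funext x; rw [Store.lab, h]; rfl

theorem Fit_congr (h : ∀ a ∈ [6, 19, 20, 21], r.arr a = s.arr a) (c t j : ℕ) :
    Fit G K C r c t j ↔ Fit G K C s c t j := by
  simp only [List.mem_cons, List.not_mem_nil, or_false, forall_eq_or_imp, forall_eq] at h
  unfold Fit
  rw [h.1, h.2.1, lab_congr h.2.2.1, h.2.2.2]

theorem T_fitting (h : Ctx n Kc K Ks G C s) (hc : s.reg 26 < Kc) :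
    fitting.T s ↔ Fit G K C s (s.reg 26) (s.reg 27) (s.reg 28) := by
  rw [fitting, T_and, T_and, T_sat h _ hc]
  simp only [T_all, T_cell, T_eq, row, side, eval_add, eval_mul, eval_reg, eval_cell,
    Store.setReg_reg, Store.setReg_arr, Nat.reduceEqDiff, if_true, if_false, OfNat.zero_ne_ofNat,
    h.reg0, forall_lt_iff]
  rfl

theorem eval_slotWeight (h : s.reg 0 = n) :
    slotWeight.eval s = ∑ x, s.lab n 20 (s.reg 28) x := by
  simp only [slotWeight, label, row, eval_sum, eval_add, eval_mul, eval_reg, eval_cell,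
    Store.setReg_reg, Store.setReg_arr, Nat.reduceEqDiff, if_true, if_false, OfNat.zero_ne_ofNat,
    h, sum_range_lab]

/-- Array `31` flags the entries to be replaced and is computed before arrays `17` and `18` change,
so everything depends on this flag. Weights are at most `2 * n`, so the search below `2 * n + 1`
meets all of them. -/
theorem collect_spec (h : Ctx n Kc K Ks G C s)
    (hw : ∀ j < Ks * Ks * Ks, s.arr 19 j ≠ 0 → ∑ x, s.lab n 20 j x ≤ 2 * n) {c t : ℕ}
    (hc : c < Kc) (ht : t < Ks) :
    ((collect.den s).arr 17 (c * Ks + t) ≠ 0 ↔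
      s.arr 17 (c * Ks + t) ≠ 0 ∨ ∃ j < Ks * Ks * Ks, Fit G K C s c t j) ∧
    ((collect.den s).arr 17 (c * Ks + t) ≠ 0 →
      s.arr 17 (c * Ks + t) ≠ 0 ∧ (collect.den s).lab n 18 (c * Ks + t) = s.lab n 18 (c * Ks + t) ∨
      ∃ j < Ks * Ks * Ks, Fit G K C s c t j ∧
        (collect.den s).lab n 18 (c * Ks + t) = s.lab n 20 j) ∧
    (s.arr 17 (c * Ks + t) ≠ 0 →
      ∑ x, (collect.den s).lab n 18 (c * Ks + t) x ≤ ∑ x, s.lab n 18 (c * Ks + t) x) ∧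
    ∀ j < Ks * Ks * Ks, Fit G K C s c t j →
      ∑ x, (collect.den s).lab n 18 (c * Ks + t) x ≤ ∑ x, s.lab n 20 j x := by
  set e := c * Ks + t with he
  have heK : e < Kc * Ks := row_lt hc ht
  unfold collect
  simp only [Stm.den_seq]
  set s1 := Stm.den _ s with h1
  set s2 := Stm.den _ s1 with h2
  set s3 := Stm.den _ s2 with h3
  set s4 := Stm.den _ s3 with h4
  set s5 := Stm.den _ s4 with h5
  set s6 := Stm.den _ s5 with h6
  have r1 : ∀ x, s1.reg x = s.reg x := fun _ => rfl
  have r2 : ∀ x, s2.reg x = s.reg x := fun _ => rfl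
  have r3 : ∀ x, s3.reg x = s.reg x := fun _ => rfl
  have r4 : ∀ x, s4.reg x = s.reg x := fun _ => rfl
  have r5 : ∀ x, s5.reg x = s.reg x := fun _ => rfl
  have r6 : ∀ x, s6.reg x = s.reg x := fun _ => rfl
  have a1 : ∀ b, b ≠ 29 → s1.arr b = s.arr b := fun b hb => Stm.den_comp_ne hb
  have a2 : ∀ b, b ≠ 30 → s2.arr b = s1.arr b := fun b hb => Stm.den_comp_ne hb
  have a3 : ∀ b, b ≠ 31 → s3.arr b = s2.arr b := fun b hb => Stm.den_comp_ne hb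
  have a4 : ∀ b, b ≠ 32 → s4.arr b = s3.arr b := fun b hb => Stm.den_comp_ne hb
  have a5 : ∀ b, b ≠ 33 → s5.arr b = s4.arr b := fun b hb => Stm.den_comp_ne hb
  have a6 : ∀ b, b ≠ 17 → s6.arr b = s5.arr b := fun b hb => Stm.den_comp_ne hb
  have c1 : Ctx n Kc K Ks G C s1 := h.congr (fun _ _ => rfl) fun b hb => a1 b (by omega)
  have F1 : ∀ j, Fit G K C s1 c t j ↔ Fit G K C s c t j := fun j => Fit_congr (fun b hb =>
    a1 b (by rintro rfl; revert hb; decide)) c t j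
  set f : ℕ → ℕ := fun w => (Tm.ex 28 18 (fitting.and (slotWeight.eq (.reg 37)))).eval
    ((((s.setReg 25 e).setReg 26 c).setReg 27 t).setReg 37 w) with hf
  set g : ℕ → ℕ := fun j => (fitting.and (slotWeight.eq (.cell 29 (.reg 25)))).eval
    ((((s1.setReg 25 e).setReg 26 c).setReg 27 t).setReg 28 j) with hg
  have v29 : s1.arr 29 e = leastBelow f (2 * n + 1) := by
    rw [h1, he, den_unpackEntry h _ _ hc ht, eval_least]
    simp only [Store.setReg_reg, Nat.reduceEqDiff, if_false, h.reg5]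
    rfl
  have v30 : s2.arr 30 e = leastBelow g (Ks * Ks * Ks) := by
    rw [h2, he, den_unpackEntry c1 _ _ hc ht, eval_least]
    simp only [Store.setReg_reg, Nat.reduceEqDiff, if_false, c1.reg18]
    rfl
  obtain ⟨k1, k2, k3⟩ := leastBelow_best (P := Fit G K C s c t) (f := f) (g := g)
    (w := fun j => ∑ x, s.lab n 20 j x) (N := Ks * Ks * Ks) (B := 2 * n + 1)
    (fun j hj hP => Nat.lt_succ_of_le (hw j hj hP.1)) (fun v => by
      refine (T_ex _ _ _ _).trans ?_
      simp only [Store.setReg_reg, Nat.reduceEqDiff, if_false, h.reg18, T_and, T_eq, eval_reg]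
      refine exists_congr fun j => and_congr Iff.rfl ?_
      rw [T_fitting (((((h.setReg (by norm_num) _).setReg (by norm_num) _).setReg (by norm_num)
        _).setReg (by norm_num) _).setReg (by norm_num) _), eval_slotWeight (n := n)]
      all_goals
        simp only [Store.setReg_reg, Nat.reduceEqDiff, if_false, if_true, Fit_setReg, lab_setReg,
          OfNat.zero_ne_ofNat, h.reg0, hc])
    (fun j _ => by
      refine (T_and _ _ _).trans ?_
      rw [T_fitting ((((c1.setReg (by norm_num) _).setReg (by norm_num) _).setReg (by norm_num)
        _).setReg (by norm_num) _), T_eq, eval_slotWeight (n := n), ← v29]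
      all_goals
        simp only [Store.setReg_reg, Nat.reduceEqDiff, if_false, if_true, Fit_setReg, lab_setReg,
          OfNat.zero_ne_ofNat, h.reg0, r1, hc, F1, eval_cell, eval_reg, Store.setReg_arr,
          lab_congr (a1 20 (by norm_num))])
  rw [← v30] at k1 k2
  rw [← v29] at k2 k3
  have v31 : s3.arr 31 e ≠ 0 ↔ s2.arr 30 e < Ks * Ks * Ks ∧
      (¬ s.arr 17 e ≠ 0 ∨ s1.arr 29 e < ∑ x, s.lab n 18 e x) := by
    rw [h3, Stm.den_comp_self _ _ _ _ _ (by rw [r2, h.reg12]; exact heK)]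
    refine (T_and _ _ _).trans ?_
    simp only [T_lt, T_or, T_no, row, T_cell, eval_cell, eval_reg, eval_sum, eval_add, eval_mul,
      Store.setReg_reg, Store.setReg_arr, Nat.reduceEqDiff, if_false, if_true, OfNat.zero_ne_ofNat,
      r2, h.reg18, h.reg0, a2 _ (show (17 : ℕ) ≠ 30 by norm_num), a1 _ (show (17 : ℕ) ≠ 29 by norm_num),
      a2 _ (show (29 : ℕ) ≠ 30 by norm_num), a2 _ (show (18 : ℕ) ≠ 30 by norm_num),
      a1 _ (show (18 : ℕ) ≠ 29 by norm_num), sum_range_lab]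
  have v32 : s4.arr 32 e ≠ 0 ↔ s.arr 17 e ≠ 0 ∨ s3.arr 31 e ≠ 0 := by
    rw [h4, Stm.den_comp_self _ _ _ _ _ (by rw [r3, h.reg12]; exact heK)]
    refine (T_or _ _ _).trans ?_
    simp only [T_cell, eval_reg, Store.setReg_reg, Store.setReg_arr, if_true]
    rw [a3 _ (by norm_num), a2 _ (by norm_num), a1 _ (by norm_num)]
  have v33 : ∀ x : Fin n, s5.arr 33 (e * n + x) = if s3.arr 31 e ≠ 0 then
      s.lab n 20 (s2.arr 30 e) x else s.lab n 18 e x := by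
    intro x
    rw [h5, den_unpack (n := n) (N := Kc * Ks) _ _ _ _ (by rw [r4, h.reg0]) (by rw [r4, h.reg13])
      heK x.2, eval_ite]
    simp only [T_cell, row, eval_cell, eval_add, eval_mul, eval_reg, Store.setReg_reg,
      Store.setReg_arr, Nat.reduceEqDiff, if_false, if_true, OfNat.zero_ne_ofNat, r4, h.reg0]
    rw [a4 _ (by norm_num), a4 _ (by norm_num), a4 _ (by norm_num), a4 _ (by norm_num),
      a3 20 (by norm_num), a3 30 (by norm_num), a3 18 (by norm_num), a2 20 (by norm_num),
      a2 18 (by norm_num), a1 20 (by norm_num), a1 18 (by norm_num)]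
    rfl
  have v17 : (Stm.den (.comp 18 25 13 (.cell 33 (.reg 25))) s6).arr 17 e = s4.arr 32 e := by
    rw [Stm.den_comp_ne (by norm_num), h6,
      Stm.den_comp_self _ _ _ _ _ (by rw [r5, h.reg12]; exact heK)]
    simp only [eval_cell, eval_reg, Store.setReg_reg, Store.setReg_arr, if_true]
    rw [a5 _ (by norm_num)]
  have v18 : (Stm.den (.comp 18 25 13 (.cell 33 (.reg 25))) s6).lab n 18 e =
      if s3.arr 31 e ≠ 0 then s.lab n 20 (s2.arr 30 e) else s.lab n 18 e := by
    funext x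
    rw [Store.lab, Stm.den_comp_self _ _ _ _ _ (by rw [r6, h.reg13]; exact row_lt heK x.2)]
    simp only [eval_cell, eval_reg, Store.setReg_reg, Store.setReg_arr, if_true]
    rw [a6 _ (by norm_num), v33]
    split_ifs <;> rfl
  rw [v17, v18, v32]
  by_cases hb : s3.arr 31 e ≠ 0
  · have hb' := v31.1 hb
    obtain ⟨k4, k5⟩ := k2 hb'.1
    simp only [if_pos hb]
    refine ⟨iff_of_true (Or.inr hb) (Or.inr ⟨_, hb'.1, k4⟩), fun _ => Or.inr ⟨_, hb'.1, k4, rfl⟩,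
      fun h17 => ?_, fun j hj hf => k5.trans_le (k3 j hj hf)⟩
    rw [k5]
    exact (hb'.2.resolve_left (not_not.2 h17)).le
  · simp only [if_neg hb]
    refine ⟨⟨fun h => Or.inl (h.resolve_right hb), fun h => Or.inl ?_⟩,
      fun h => Or.inl ⟨h.resolve_right hb, trivial⟩, fun _ => le_rfl, fun j hj hf => ?_⟩
    · rcases h with h | hex
      · exact h
      · by_contra h17
        exact hb (v31.2 ⟨k1.2 hex, Or.inl (not_not.2 h17)⟩)
    · have hJ := k1.2 ⟨j, hj, hf⟩
      refine le_trans ?_ (k3 j hj hf)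
      by_contra hlt
      exact hb (v31.2 ⟨hJ, Or.inr (not_le.1 hlt)⟩)

end Code
end EDS

/-! ### Choosing the best candidate for every slot. -/

namespace EDS
namespace Code
open Tm

variable {n Kc K Ks : ℕ} {G : SimpleGraph (Fin n)} {C : ℕ → Cut (Fin n)} {s r : Store}

theorem eval_unpackSlot (e : Tm) (s : Store) : (unpackSlot e).eval s =
    e.eval (((s.setReg 26 (s.reg 25 / s.reg 11 / s.reg 11)).setReg 27
      (s.reg 25 / s.reg 11 % s.reg 11)).setReg 28 (s.reg 25 % s.reg 11)) := by
  simp only [unpackSlot, eval_bind, eval_div, eval_mod, eval_reg, Store.setReg_reg,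
    Nat.reduceEqDiff, if_false]

/-- The number of a slot. -/
def slot (Ks i t u : ℕ) : ℕ := (i * Ks + t) * Ks + u

theorem slot_lt {i t u : ℕ} (hi : i < Ks) (ht : t < Ks) (hu : u < Ks) :
    slot Ks i t u < Ks * Ks * Ks := row_lt (row_lt hi ht) hu

theorem exists_slot {j : ℕ} (hj : j < Ks * Ks * Ks) :
    ∃ i < Ks, ∃ t < Ks, ∃ u < Ks, j = slot Ks i t u := by
  have hK : 0 < Ks := by
    rcases Nat.eq_zero_or_pos Ks with h | h
    · simp [h] at hj
    · exact h
  refine ⟨j / Ks / Ks, ?_, j / Ks % Ks, Nat.mod_lt _ hK, j % Ks, Nat.mod_lt _ hK, ?_⟩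
  · rw [Nat.div_div_eq_div_mul]
    exact Nat.div_lt_of_lt_mul hj
  · rw [slot, Nat.div_add_mod', Nat.div_add_mod']

theorem den_unpackSlot (h : Ctx n Kc K Ks G C s) (a : ℕ) (e : Tm) {i t u : ℕ} (hi : i < Ks)
    (ht : t < Ks) (hu : u < Ks) : ((Stm.comp a 25 18 (unpackSlot e)).den s).arr a (slot Ks i t u) =
      e.eval ((((s.setReg 25 (slot Ks i t u)).setReg 26 i).setReg 27 t).setReg 28 u) := by
  rw [Stm.den_comp_self _ _ _ _ _ (by rw [h.reg18]; exact slot_lt hi ht hu), eval_unpackSlot]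
  simp only [Store.setReg_reg, Nat.reduceEqDiff, if_false, if_true, h.reg11, slot, row_div hu,
    row_mod hu, row_div ht, row_mod ht]

/-- The candidate `q` has the signatures `t` and `u`. -/
def Win (G : SimpleGraph (Fin n)) (K : ℕ) (C : ℕ → Cut (Fin n)) (s : Store) (t u q : ℕ) : Prop :=
  s.arr 22 q ≠ 0 ∧ (C (s.reg 30)).Sat G K t (s.lab n 24 q) ∧
    (C (s.reg 31)).Sat G K u (s.lab n 23 q)

/-- A slot and its candidates share the index `i`. This is why a slot, one of `Ks ^ 3`, is compared
with `Ks ^ 2 * (n + 1)` candidates only, and it keeps the total exponent of `Ks` at five. -/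
theorem select_spec (h : Ctx n Kc K Ks G C s) (h30 : s.reg 30 < Kc) (h31 : s.reg 31 < Kc)
    (hw : ∀ q < Ks * (Ks * Ks * (n + 1)), s.arr 22 q ≠ 0 → ∑ x, s.lab n 23 q x ≤ 2 * n) {i t u : ℕ}
    (hi : i < Ks) (ht : t < Ks) (hu : u < Ks) :
    ((select.den s).arr 19 (slot Ks i t u) ≠ 0 → ∃ q < Ks * Ks * (n + 1),
      Win G K C s t u (i * (Ks * Ks * (n + 1)) + q) ∧
      (select.den s).lab n 20 (slot Ks i t u) = s.lab n 23 (i * (Ks * Ks * (n + 1)) + q)) ∧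
    ∀ q < Ks * Ks * (n + 1), Win G K C s t u (i * (Ks * Ks * (n + 1)) + q) →
      (select.den s).arr 19 (slot Ks i t u) ≠ 0 ∧ ∑ x, (select.den s).lab n 20 (slot Ks i t u) x ≤
        ∑ x, s.lab n 23 (i * (Ks * Ks * (n + 1)) + q) x := by
  set N := Ks * Ks * (n + 1) with hN
  set e := slot Ks i t u with he
  have heK : e < Ks * Ks * Ks := slot_lt hi ht hu
  unfold select
  simp only [Stm.den_seq]
  set s1 := Stm.den _ s with h1
  set s2 := Stm.den _ s1 with h2
  set s3 := Stm.den _ s2 with h3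
  set s4 := Stm.den _ s3 with h4
  set s5 := Stm.den _ s4 with h5
  have r1 : ∀ x, s1.reg x = s.reg x := fun _ => rfl
  have r2 : ∀ x, s2.reg x = s.reg x := fun _ => rfl
  have r3 : ∀ x, s3.reg x = s.reg x := fun _ => rfl
  have r4 : ∀ x, s4.reg x = s.reg x := fun _ => rfl
  have r5 : ∀ x, s5.reg x = s.reg x := fun _ => rfl
  have a1 : ∀ b, b ≠ 25 → s1.arr b = s.arr b := fun b hb => Stm.den_comp_ne hb
  have a2 : ∀ b, b ≠ 26 → s2.arr b = s1.arr b := fun b hb => Stm.den_comp_ne hb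
  have a3 : ∀ b, b ≠ 27 → s3.arr b = s2.arr b := fun b hb => Stm.den_comp_ne hb
  have a4 : ∀ b, b ≠ 28 → s4.arr b = s3.arr b := fun b hb => Stm.den_comp_ne hb
  have a5 : ∀ b, b ≠ 19 → s5.arr b = s4.arr b := fun b hb => Stm.den_comp_ne hb
  have c1 : Ctx n Kc K Ks G C s1 := h.congr (fun _ _ => rfl) fun b hb => a1 b (by omega)
  have c2 : Ctx n Kc K Ks G C s2 := c1.congr (fun _ _ => rfl) fun b hb => a2 b (by omega)
  have c3 : Ctx n Kc K Ks G C s3 := c2.congr (fun _ _ => rfl) fun b hb => a3 b (by omega)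
  have v25 : ∀ q < Ks * N, ∀ τ < Ks, s1.arr 25 (q * Ks + τ) ≠ 0 ↔
      (C (s.reg 30)).Sat G K τ (s.lab n 24 q) := by
    intro q hq τ hτ
    rw [h1, Stm.den_comp_self _ _ _ _ _ (by rw [h.reg17]; exact row_lt hq hτ)]
    refine (T_bind _ _ _ _).trans ((T_bind _ _ _ _).trans ((T_bind _ _ _ _).trans
      ((T_yes _ _).trans ?_)))
    rw [T_sat ((((h.setReg (by norm_num) _).setReg (by norm_num) _).setReg (by norm_num)
        _).setReg (by norm_num) _)]
    all_goals
      simp only [Store.setReg_reg, Nat.reduceEqDiff, if_false, if_true, lab_setReg, eval_div,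
        eval_mod, eval_reg, h.reg11, row_div hτ, row_mod hτ, h30]
  have v26 : ∀ q < Ks * N, ∀ τ < Ks, s2.arr 26 (q * Ks + τ) ≠ 0 ↔
      (C (s.reg 31)).Sat G K τ (s.lab n 23 q) := by
    intro q hq τ hτ
    rw [h2, Stm.den_comp_self _ _ _ _ _ (by rw [r1, h.reg17]; exact row_lt hq hτ)]
    refine (T_bind _ _ _ _).trans ((T_bind _ _ _ _).trans ((T_bind _ _ _ _).trans
      ((T_yes _ _).trans ?_)))
    rw [T_sat ((((c1.setReg (by norm_num) _).setReg (by norm_num) _).setReg (by norm_num)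
        _).setReg (by norm_num) _)]
    all_goals
      simp only [Store.setReg_reg, Nat.reduceEqDiff, if_false, if_true, lab_setReg, eval_div,
        eval_mod, eval_reg, c1.reg11, row_div hτ, row_mod hτ, h31, r1,
        lab_congr (a1 23 (by norm_num))]
  have hwin : ∀ σ : Store, (∀ b ∈ [22, 25, 26], σ.arr b = s2.arr b) → σ.reg 11 = Ks →
      σ.reg 14 = N → σ.reg 26 = i → σ.reg 27 = t → σ.reg 28 = u → σ.reg 36 < N →
      (winning.T σ ↔ Win G K C s t u (i * N + σ.reg 36)) := by
    intro σ hb k1 k2 k3 k4 k5 k6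
    simp only [List.mem_cons, List.not_mem_nil, or_false, forall_eq_or_imp, forall_eq] at hb
    simp only [winning, cand, T_and, T_cell, eval_add, eval_mul, eval_reg, k1, k2, k3, k4, k5,
      hb.1, hb.2.1, hb.2.2, v26 _ (row_lt hi k6) _ hu]
    rw [a2 22 (by norm_num), a1 22 (by norm_num), a2 25 (by norm_num), v25 _ (row_lt hi k6) _ ht]
    rfl
  have hcw : ∀ σ : Store, σ.arr 23 = s.arr 23 → σ.reg 0 = n → σ.reg 14 = N → σ.reg 26 = i →
      candWeight.eval σ = ∑ x, s.lab n 23 (i * N + σ.reg 36) x := by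
    intro σ hb k0 k1 k2
    simp only [candWeight, cand, row, eval_sum, eval_cell, eval_add, eval_mul, eval_reg,
      Store.setReg_reg, Store.setReg_arr, Nat.reduceEqDiff, if_false, if_true, OfNat.zero_ne_ofNat,
      k0, k1, k2, hb, sum_range_lab]
  have b23 : s2.arr 23 = s.arr 23 := by rw [a2 _ (by norm_num), a1 _ (by norm_num)]
  have b23' : s3.arr 23 = s.arr 23 := by rw [a3 _ (by norm_num), b23]
  set f : ℕ → ℕ := fun w => (Tm.ex 36 14 (winning.and (candWeight.eq (.reg 37)))).eval
    (((((s2.setReg 25 e).setReg 26 i).setReg 27 t).setReg 28 u).setReg 37 w) with hf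
  set g : ℕ → ℕ := fun q => (winning.and (candWeight.eq (.cell 27 (.reg 25)))).eval
    (((((s3.setReg 25 e).setReg 26 i).setReg 27 t).setReg 28 u).setReg 36 q) with hg
  have v27 : s3.arr 27 e = leastBelow f (2 * n + 1) := by
    rw [h3, he, den_unpackSlot c2 _ _ hi ht hu, eval_least]
    simp only [Store.setReg_reg, Nat.reduceEqDiff, if_false, c2.reg5]
    rfl
  have v28 : s4.arr 28 e = leastBelow g N := by
    rw [h4, he, den_unpackSlot c3 _ _ hi ht hu, eval_least]
    simp only [Store.setReg_reg, Nat.reduceEqDiff, if_false, c3.reg14]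
    rfl
  obtain ⟨k1, k2, k3⟩ := leastBelow_best (P := fun q => Win G K C s t u (i * N + q)) (f := f)
    (g := g) (w := fun q => ∑ x, s.lab n 23 (i * N + q) x) (N := N) (B := 2 * n + 1)
    (fun q hq hP => Nat.lt_succ_of_le (hw _ (row_lt hi hq) hP.1)) (fun v => by
      refine (T_ex _ _ _ _).trans ?_
      simp only [Store.setReg_reg, Nat.reduceEqDiff, if_false, c2.reg14, T_and, T_eq, eval_reg]
      refine exists_congr fun q => and_congr_right fun hq => ?_
      rw [hwin, hcw]
      all_goals
        simp only [Store.setReg_reg, Nat.reduceEqDiff, if_false, if_true, Store.setReg_arr,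
          OfNat.zero_ne_ofNat, c2.reg0, c2.reg11, c2.reg14, b23, implies_true, ← hN]
      exact hq) (fun q hq => by
      refine (T_and _ _ _).trans ?_
      rw [hwin, T_eq, hcw, eval_cell, ← v27]
      all_goals
        simp only [Store.setReg_reg, Nat.reduceEqDiff, if_false, if_true, Store.setReg_arr,
          OfNat.zero_ne_ofNat, c3.reg0, c3.reg11, c3.reg14, hq, b23', eval_reg, ← hN]
      intro b hb
      exact a3 b (by rintro rfl; revert hb; decide))
  rw [← v28] at k1 k2
  rw [← v27] at k2 k3
  have v19 : s5.arr 19 e ≠ 0 ↔ s4.arr 28 e < N := by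
    rw [h5, Stm.den_comp_self _ _ _ _ _ (by rw [r4, h.reg18]; exact heK)]
    refine (T_lt _ _ _).trans ?_
    simp only [eval_cell, eval_reg, Store.setReg_reg, Store.setReg_arr, Nat.reduceEqDiff, if_false,
      if_true, r4, h.reg14, ← hN]
  have w19 := fun e' : Tm => (Stm.den_comp_ne (a := 20) (b := 19) (v := 25) (x := 19) (e := e')
    (s := s5) (by norm_num))
  have v20 : ∀ e', e' = unpack (row 23 (((((Tm.reg 26).div (.reg 11)).div (.reg 11)).mul
      (.reg 14)).add (.cell 28 (.reg 26))) (.reg 27)) →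
      (Stm.den (.comp 20 25 19 e') s5).lab n 20 e = s.lab n 23 (i * N + s4.arr 28 e) := by
    rintro _ rfl
    funext x
    rw [Store.lab, den_unpack (n := n) (N := Ks * Ks * Ks) _ _ _ _ (by rw [r5, h.reg0])
      (by rw [r5, h.reg19]) heK x.2]
    simp only [row, eval_cell, eval_add, eval_mul, eval_div, eval_reg, Store.setReg_reg,
      Store.setReg_arr, Nat.reduceEqDiff, if_false, if_true, OfNat.zero_ne_ofNat, r5, h.reg0,
      h.reg11, h.reg14, ← hN]
    rw [a5 _ (by norm_num), a5 _ (by norm_num), a4 23 (by norm_num), b23', he, slot, row_div hu,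
      row_div ht]
    rfl
  rw [v20 _ rfl, w19, v19]
  refine ⟨fun hJ => ⟨_, hJ, (k2 hJ).1, rfl⟩, fun q hq hW => ?_⟩
  have hJ := k1.2 ⟨q, hq, hW⟩
  exact ⟨hJ, (k2 hJ).2.trans_le (k3 q hq hW)⟩

end Code
end EDS

/-! ### The candidates that start and continue a join, and the slots for small sides. -/

namespace EDS
namespace Code
open Tm

variable {n Kc K Ks : ℕ} {G : SimpleGraph (Fin n)} {C : ℕ → Cut (Fin n)} {s r : Store}

/-- The vertices from number `i` on. -/
def above (n i : ℕ) : Set (Fin n) := {x | i ≤ x.1}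

/-- A candidate pairs entry `i` for the first cut with entry `q` for the second. The rows have the
length that `step` needs, so the candidates from `Ks` on are disabled. Nothing has been processed,
hence the mask concerns all vertices of the first side. -/
theorem initial_spec (h : Ctx n Kc K Ks G C s) (h30 : s.reg 30 < Kc) (h31 : s.reg 31 < Kc)
    {i q : ℕ} (hi : i < Ks) (hq : q < Ks * Ks * (n + 1)) :
    ((initial.den s).arr 22 (i * (Ks * Ks * (n + 1)) + q) ≠ 0 ↔ q < Ks ∧
      s.arr 17 (s.reg 30 * Ks + i) ≠ 0 ∧ s.arr 17 (s.reg 31 * Ks + q) ≠ 0 ∧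
      Disjoint (C (s.reg 30)).side (C (s.reg 31)).side ∧
      ∀ a ∈ (C (s.reg 30)).side, ∀ b ∈ (C (s.reg 31)).side, G.Adj a b →
        s.lab n 18 (s.reg 30 * Ks + i) a ≠ 0 ∨ s.lab n 18 (s.reg 31 * Ks + q) b ≠ 0) ∧
    (initial.den s).lab n 23 (i * (Ks * Ks * (n + 1)) + q) =
      overlay (s.lab n 18 (s.reg 30 * Ks + i)) (s.lab n 18 (s.reg 31 * Ks + q)) ∧
    (initial.den s).lab n 24 (i * (Ks * Ks * (n + 1)) + q) = mask (C (s.reg 30)).side (above n 0)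
      ((initial.den s).lab n 23 (i * (Ks * Ks * (n + 1)) + q)) := by
  set N := Ks * Ks * (n + 1) with hN
  have hqN : i * N + q < Ks * N := row_lt hi hq
  unfold initial
  simp only [Stm.den_seq]
  set s1 := Stm.den _ s with h1
  set s2 := Stm.den _ s1 with h2
  have r1 : ∀ x, s1.reg x = s.reg x := fun _ => rfl
  have r2 : ∀ x, s2.reg x = s.reg x := fun _ => rfl
  have a1 : ∀ b, b ≠ 22 → s1.arr b = s.arr b := fun b hb => Stm.den_comp_ne hb
  have a2 : ∀ b, b ≠ 23 → s2.arr b = s1.arr b := fun b hb => Stm.den_comp_ne hb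
  have v22 : s1.arr 22 (i * N + q) ≠ 0 ↔ q < Ks ∧
      s.arr 17 (s.reg 30 * Ks + i) ≠ 0 ∧ s.arr 17 (s.reg 31 * Ks + q) ≠ 0 ∧
      Disjoint (C (s.reg 30)).side (C (s.reg 31)).side ∧
      ∀ a ∈ (C (s.reg 30)).side, ∀ b ∈ (C (s.reg 31)).side, G.Adj a b →
        s.lab n 18 (s.reg 30 * Ks + i) a ≠ 0 ∨ s.lab n 18 (s.reg 31 * Ks + q) b ≠ 0 := by
    rw [h1, Stm.den_comp_self _ _ _ _ _ (by rw [h.reg15]; exact hqN)]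
    refine (T_bind _ _ _ _).trans ((T_bind _ _ _ _).trans ((T_yes _ _).trans ?_))
    simp only [entry, row, side, adj, T_and, T_lt, T_cell, T_all, T_no, T_imp, T_or, eval_add,
      eval_mul, eval_div, eval_mod, eval_reg, Store.setReg_reg, Store.setReg_arr, Nat.reduceEqDiff,
      if_false, if_true, OfNat.zero_ne_ofNat, h.reg0, h.reg11, h.reg14, ← hN, row_div hq,
      row_mod hq, forall_lt_iff, h.side _ h30, h.side _ h31, h.adj]
    refine and_congr Iff.rfl (and_congr Iff.rfl (and_congr Iff.rfl (and_congr ?_ ?_)))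
    · rw [Set.disjoint_left]
      exact forall_congr' fun x => by tauto
    · exact ⟨fun h a ha b hb hab => h a b ⟨ha, hb, hab⟩,
        fun h a b hab => h a hab.1 b hab.2.1 hab.2.2⟩
  have v23 : s2.lab n 23 (i * N + q) =
      overlay (s.lab n 18 (s.reg 30 * Ks + i)) (s.lab n 18 (s.reg 31 * Ks + q)) := by
    funext x
    rw [Store.lab, h2, den_unpack (n := n) (N := Ks * N) _ _ _ _ (by rw [r1, h.reg0])
      (by rw [r1, h.reg16]) hqN x.2, eval_bind, eval_bind, eval_ite]
    simp only [entry, row, T_cell, eval_cell, eval_add, eval_mul, eval_div, eval_mod, eval_reg,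
      Store.setReg_reg, Store.setReg_arr, Nat.reduceEqDiff, if_false, if_true, OfNat.zero_ne_ofNat,
      r1, h.reg0, h.reg11, h.reg14, ← hN, row_div hq, row_mod hq, a1 _ (show (18 : ℕ) ≠ 22 by norm_num)]
    rfl
  have v24 : ∀ e', e' = unpack (.ite ((side (.reg 30) (.reg 27)).and
      ((Tm.cell 23 (.reg 25)).eq (.const 2))) (.const 1) (.cell 23 (.reg 25))) →
      (Stm.den (.comp 24 25 16 e') s2).lab n 24 (i * N + q) = mask (C (s.reg 30)).side (above n 0)
        (s2.lab n 23 (i * N + q)) := by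
    classical
    rintro _ rfl
    funext x
    rw [Store.lab, den_unpack (n := n) (N := Ks * N) _ _ _ _ (by rw [r2, h.reg0])
      (by rw [r2, h.reg16]) hqN x.2, eval_ite]
    simp only [side, row, T_and, T_eq, T_cell, eval_cell, eval_add, eval_mul, eval_reg, eval_const,
      Store.setReg_reg, Store.setReg_arr, Nat.reduceEqDiff, if_false, if_true, OfNat.zero_ne_ofNat,
      r2, h.reg0, a2 _ (show (6 : ℕ) ≠ 23 by norm_num), a1 _ (show (6 : ℕ) ≠ 22 by norm_num),
      h.side _ h30]
    unfold mask
    refine if_congr ?_ rfl rfl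
    exact ⟨fun h => ⟨h.1, Nat.zero_le _, h.2⟩, fun h => ⟨h.1, h.2.2⟩⟩
  have w23 := fun e' : Tm => lab_congr (n := n) (Stm.den_comp_ne (a := 24) (b := 23) (v := 25)
    (x := 16) (e := e') (s := s2) (by norm_num)) (i * N + q)
  rw [v24 _ rfl, w23, v23, Stm.den_comp_ne (by norm_num), a2 _ (by norm_num), v22]
  exact ⟨Iff.rfl, rfl, rfl⟩

/-- Each slot gives `n + 1` candidates: option `n` keeps the slot as it is, and an option `b < n`
matches `a` with `b`. The new mask leaves `a` visible to the signature, since `a` has now been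
processed. -/
theorem step_spec (h : Ctx n Kc K Ks G C s) (h30 : s.reg 30 < Kc) (h31 : s.reg 31 < Kc)
    {a : Fin n} (h32 : s.reg 32 = a) {j : ℕ} (hj : j < Ks * Ks * Ks) :
    ((step.den s).arr 22 (j * (n + 1) + n) ≠ 0 ↔ s.arr 19 j ≠ 0) ∧
    (step.den s).lab n 23 (j * (n + 1) + n) = s.lab n 20 j ∧
    (∀ b : Fin n, ((step.den s).arr 22 (j * (n + 1) + b) ≠ 0 ↔ s.arr 19 j ≠ 0 ∧
      a ∈ (C (s.reg 30)).side ∧ b ∈ (C (s.reg 31)).side ∧ G.Adj a b ∧ s.lab n 20 j a = 2 ∧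
      s.lab n 20 j b = 2) ∧
      (step.den s).lab n 23 (j * (n + 1) + b) =
        fun x => if x = a ∨ x = b then 1 else s.lab n 20 j x) ∧
    ∀ o ≤ n, (step.den s).lab n 24 (j * (n + 1) + o) = mask (C (s.reg 30)).side (above n (a + 1))
      ((step.den s).lab n 23 (j * (n + 1) + o)) := by
  have hN : Ks * (Ks * Ks * (n + 1)) = Ks * Ks * Ks * (n + 1) := by ring
  unfold step
  simp only [Stm.den_seq]
  set s1 := Stm.den _ s with h1
  set s2 := Stm.den _ s1 with h2
  have r1 : ∀ x, s1.reg x = s.reg x := fun _ => rfl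
  have r2 : ∀ x, s2.reg x = s.reg x := fun _ => rfl
  have a1 : ∀ b, b ≠ 22 → s1.arr b = s.arr b := fun b hb => Stm.den_comp_ne hb
  have a2 : ∀ b, b ≠ 23 → s2.arr b = s1.arr b := fun b hb => Stm.den_comp_ne hb
  have hlt : ∀ o ≤ n, j * (n + 1) + o < Ks * Ks * Ks * (n + 1) := fun o ho =>
    row_lt hj (Nat.lt_succ_of_le ho)
  have v22 : ∀ o ≤ n, s1.arr 22 (j * (n + 1) + o) ≠ 0 ↔ s.arr 19 j ≠ 0 ∧ (o = n ∨
      (a ∈ (C (s.reg 30)).side ∧ s.arr 6 (s.reg 31 * n + o) ≠ 0 ∧ s.arr 0 (a * n + o) ≠ 0 ∧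
      s.lab n 20 j a = 2 ∧ s.arr 20 (j * n + o) = 2)) := by
    intro o ho
    rw [h1, Stm.den_comp_self _ _ _ _ _ (by rw [h.reg15, hN]; exact hlt o ho)]
    refine (T_bind _ _ _ _).trans ((T_bind _ _ _ _).trans ((T_yes _ _).trans ?_))
    simp only [row, side, adj, T_and, T_eq, T_cell, T_or, eval_add, eval_cell, eval_const,
      eval_mul, eval_div, eval_mod, eval_reg, Store.setReg_reg, Store.setReg_arr, Nat.reduceEqDiff,
      if_false, if_true, OfNat.zero_ne_ofNat, h.reg0, h.reg4, h32, row_div (Nat.lt_succ_of_le ho),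
      row_mod (Nat.lt_succ_of_le ho), h.side _ h30]
    rfl
  have v23 : ∀ o ≤ n, ∀ x : Fin n, s2.lab n 23 (j * (n + 1) + o) x =
      if o < n ∧ (x = a ∨ x.1 = o) then 1 else s.lab n 20 j x := by
    intro o ho x
    rw [Store.lab, h2, den_unpack (n := n) (N := Ks * Ks * Ks * (n + 1)) _ _ _ _
      (by rw [r1, h.reg0]) (by rw [r1, h.reg16, hN]) (hlt o ho) x.2, eval_bind, eval_bind, eval_ite]
    simp only [row, T_and, T_or, T_eq, T_lt, eval_cell, eval_add, eval_mul, eval_div, eval_mod,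
      eval_reg, eval_const, Store.setReg_reg, Store.setReg_arr, Nat.reduceEqDiff, if_false, if_true,
      OfNat.zero_ne_ofNat, r1, h.reg0, h.reg4, h32, row_div (Nat.lt_succ_of_le ho),
      row_mod (Nat.lt_succ_of_le ho), a1 _ (show (20 : ℕ) ≠ 22 by norm_num), Fin.val_inj]
    rfl
  have v24 : ∀ e', e' = unpack (.ite ((side (.reg 30) (.reg 27)).and
      (((Tm.cell 23 (.reg 25)).eq (.const 2)).and ((Tm.reg 32).lt (.reg 27))))
      (.const 1) (.cell 23 (.reg 25))) → ∀ o ≤ n,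
      (Stm.den (.comp 24 25 16 e') s2).lab n 24 (j * (n + 1) + o) =
        mask (C (s.reg 30)).side (above n (a + 1)) (s2.lab n 23 (j * (n + 1) + o)) := by
    classical
    rintro _ rfl o ho
    funext x
    rw [Store.lab, den_unpack (n := n) (N := Ks * Ks * Ks * (n + 1)) _ _ _ _ (by rw [r2, h.reg0])
      (by rw [r2, h.reg16, hN]) (hlt o ho) x.2, eval_ite]
    simp only [side, row, T_and, T_eq, T_lt, T_cell, eval_cell, eval_add, eval_mul, eval_reg,
      eval_const, Store.setReg_reg, Store.setReg_arr, Nat.reduceEqDiff, if_false, if_true,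
      OfNat.zero_ne_ofNat, r2, h.reg0, h32, a2 _ (show (6 : ℕ) ≠ 23 by norm_num),
      a1 _ (show (6 : ℕ) ≠ 22 by norm_num), h.side _ h30]
    unfold mask
    refine if_congr ?_ rfl rfl
    exact ⟨fun h => ⟨h.1, h.2.2, h.2.1⟩, fun h => ⟨h.1, h.2.2, h.2.1⟩⟩
  have w23 := fun (e' : Tm) q => lab_congr (n := n) (Stm.den_comp_ne (a := 24) (b := 23) (v := 25)
    (x := 16) (e := e') (s := s2) (by norm_num)) q
  simp only [w23, Stm.den_comp_ne (show (22 : ℕ) ≠ 24 by norm_num), a2 22 (by norm_num)]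
  refine ⟨(v22 n le_rfl).trans ?_, ?_, fun b => ⟨(v22 b b.2.le).trans ?_, ?_⟩, v24 _ rfl⟩
  · simp
  · funext x
    rw [v23 n le_rfl, if_neg (fun h => lt_irrefl _ h.1)]
  · rw [h.side _ h31, h.adj, or_iff_right (ne_of_lt b.2)]
    rfl
  · funext x
    rw [v23 b b.2.le]
    simp only [b.2, true_and, Fin.val_inj]

theorem base_spec (h : Ctx n Kc K Ks G C s) (h30 : s.reg 30 < Kc) {j : ℕ}
    (hj : j < Ks * Ks * Ks) :
    ((base.den s).arr 19 j ≠ 0 ↔ j < 2 ∧ (C (s.reg 30)).side.ncard < 2) ∧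
    (∀ x : Fin n, (base.den s).arr 21 (j * n + x) = s.arr 6 (s.reg 30 * n + x)) ∧
    ∀ x : Fin n, ((base.den s).lab n 20 j x = 2 ∨ (base.den s).lab n 20 j x = 0) ∧
      ((base.den s).lab n 20 j x = 2 ↔ j = 1 ∧ x ∈ (C (s.reg 30)).side) := by
  unfold base
  simp only [Stm.den_seq]
  set s1 := Stm.den _ s with h1
  set s2 := Stm.den _ s1 with h2
  have r1 : ∀ x, s1.reg x = s.reg x := fun _ => rfl
  have r2 : ∀ x, s2.reg x = s.reg x := fun _ => rfl
  have a1 : ∀ b, b ≠ 19 → s1.arr b = s.arr b := fun b hb => Stm.den_comp_ne hb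
  have a2 : ∀ b, b ≠ 21 → s2.arr b = s1.arr b := fun b hb => Stm.den_comp_ne hb
  refine ⟨?_, fun x => ?_, fun x => ?_⟩
  · rw [Stm.den_comp_ne (by norm_num), a2 _ (by norm_num), h1,
      Stm.den_comp_self _ _ _ _ _ (by rw [h.reg18]; exact hj)]
    refine (T_and _ _ _).trans ?_
    simp only [T_lt, T_cell, side, row, eval_reg, eval_const, eval_cnt, eval_add, eval_mul,
      Store.setReg_reg, Store.setReg_arr, Nat.reduceEqDiff, if_false, if_true,
      OfNat.zero_ne_ofNat, h.reg0, card_filter_range, h.side _ h30]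
    rfl
  · rw [Stm.den_comp_ne (by norm_num), h2,
      Stm.den_comp_self _ _ _ _ _ (by rw [r1, h.reg19]; exact row_lt hj x.2)]
    simp only [side, row, eval_reg, eval_add, eval_mul, eval_cell, eval_mod,
      Store.setReg_reg, Store.setReg_arr, Nat.reduceEqDiff, if_false, if_true,
      OfNat.zero_ne_ofNat, r1, h.reg0, row_mod x.2, a1 _ (show (6 : ℕ) ≠ 19 by norm_num)]
  · classical
    rw [Store.lab, den_unpack (n := n) (N := Ks * Ks * Ks) _ _ _ _ (by rw [r2, h.reg0])
      (by rw [r2, h.reg19]) hj x.2, eval_ite]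
    simp only [side, row, T_and, T_eq, T_cell, eval_add, eval_mul, eval_reg, eval_const,
      Store.setReg_reg, Store.setReg_arr, Nat.reduceEqDiff, if_false, if_true, OfNat.zero_ne_ofNat,
      r2, h.reg0, a2 _ (show (6 : ℕ) ≠ 21 by norm_num), a1 _ (show (6 : ℕ) ≠ 19 by norm_num),
      h.side _ h30]
    split_ifs with h' <;> simp [h']

end Code
end EDS

/-! ### Invariants of tables, slots and candidates. -/

namespace EDS

theorem IsPartial.sum_le {n : ℕ} {G : SimpleGraph (Fin n)} {A : Set (Fin n)} {X : Fin n → ℕ}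
    (h : IsPartial G A X) : ∑ x, X x ≤ 2 * n := by
  calc ∑ x, X x ≤ ∑ _x : Fin n, 2 := Finset.sum_le_sum fun x _ => h.le_two x
    _ = 2 * n := by simp [mul_comm]

/-- Some partial solution on `S` of weight `w` fits `O` and `Q`. -/
def Demand {V : Type*} [Fintype V] (G : SimpleGraph V) (S O Q : Set V) (w : ℕ) : Prop :=
  O ⊆ Sᶜ ∧ Q ⊆ Sᶜ ∧ Disjoint O Q ∧ ∃ X, IsPartial G S X ∧ Fits G S X O Q ∧ ∑ x, X x = w

namespace Code
open Tm

variable {n Kc K Ks : ℕ} {G : SimpleGraph (Fin n)} {C : ℕ → Cut (Fin n)} {s r : Store}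

/-- The entries of the table are partial solutions with the right signatures. -/
def Sound (Kc K Ks : ℕ) (G : SimpleGraph (Fin n)) (C : ℕ → Cut (Fin n)) (s : Store) : Prop :=
  ∀ c < Kc, ∀ t < Ks, s.arr 17 (c * Ks + t) ≠ 0 →
    IsPartial G (C c).side (s.lab n 18 (c * Ks + t)) ∧
      (C c).Sat G K t (s.lab n 18 (c * Ks + t))

/-- The table for the cut `c` has entries for all demands. -/
def Complete (K Ks : ℕ) (G : SimpleGraph (Fin n)) (C : ℕ → Cut (Fin n)) (s : Store) (c : ℕ) :
    Prop :=
  ∀ O Q w, Demand G (C c).side O Q w → ∃ t < Ks, s.arr 17 (c * Ks + t) ≠ 0 ∧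
    (∀ Y, (C c).Sat G K t Y → Fits G (C c).side Y O Q) ∧ ∑ x, s.lab n 18 (c * Ks + t) x ≤ w

/-- The slots hold partial solutions on `S`. -/
structure Ready (Ks : ℕ) (G : SimpleGraph (Fin n)) (S : Set (Fin n)) (s : Store) : Prop where
  sound : ∀ j < Ks * Ks * Ks, s.arr 19 j ≠ 0 → IsPartial G S (s.lab n 20 j)
  set_le : ∀ j < Ks * Ks * Ks, ∀ x : Fin n, s.arr 21 (j * n + x) ≤ 1
  set : ∀ j < Ks * Ks * Ks, ∀ x : Fin n, s.arr 21 (j * n + x) ≠ 0 ↔ x ∈ S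

/-- Both arrays of vertex sets have entries `0` and `1`, so equality of rows is equality of sets. -/
theorem Ready.fit_iff {S : Set (Fin n)} (hR : Ready Ks G S s) (h : Ctx n Kc K Ks G C s)
    {c t j : ℕ} (hc : c < Kc) (hj : j < Ks * Ks * Ks) :
    Fit G K C s c t j ↔ s.arr 19 j ≠ 0 ∧ (C c).side = S ∧ (C c).Sat G K t (s.lab n 20 j) := by
  refine and_congr_right fun _ => and_congr ⟨fun he => ?_, fun he x => ?_⟩ Iff.rfl
  · ext x
    rw [← h.side c hc, ← hR.set j hj, he x]
  · have h1 := h.side c hc x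
    have h2 := hR.set j hj x
    have h3 := h.side_le c hc x
    have h4 := hR.set_le j hj x
    rw [he] at h1
    have h5 := h1.trans h2.symm
    omega

/-- For a demand met by a slot, `Cut.exists_sat` gives a signature of that slot that enforces the
demand. The entry for this signature is then present and at most as heavy; which labelling it holds
does not matter, since every labelling with the signature meets the demand. -/
theorem collect_inv {S : Set (Fin n)} (h : Ctx n Kc K Ks G C s) (hS : Sound Kc K Ks G C s)
    (hR : Ready Ks G S s) :
    Sound Kc K Ks G C (collect.den s) ∧
    (∀ c < Kc, Complete K Ks G C s c → Complete K Ks G C (collect.den s) c) ∧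
    ((∀ O Q w, Demand G S O Q w → ∃ j < Ks * Ks * Ks, s.arr 19 j ≠ 0 ∧
        Fits G S (s.lab n 20 j) O Q ∧ ∑ x, s.lab n 20 j x ≤ w) →
      ∀ c < Kc, (C c).side = S → Complete K Ks G C (collect.den s) c) := by
  have spec := fun {c t : ℕ} (hc : c < Kc) (ht : t < Ks) => collect_spec h
    (fun j hj hf => (hR.sound j hj hf).sum_le) hc ht
  refine ⟨fun c hc t ht hf => ?_, fun c hc hC O Q w hd => ?_, fun hex c hc hcS O Q w hd => ?_⟩
  · obtain ⟨-, h2, -, -⟩ := spec hc ht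
    rcases h2 hf with ⟨h3, h4⟩ | ⟨j, hj, h3, h4⟩
    · rw [h4]; exact hS c hc t ht h3
    · rw [hR.fit_iff h hc hj] at h3
      rw [h4, h3.2.1]
      exact ⟨hR.sound j hj h3.1, h3.2.2⟩
  · obtain ⟨t, ht, h1, h2, h3⟩ := hC O Q w hd
    obtain ⟨k1, -, k3, -⟩ := spec hc ht
    exact ⟨t, ht, k1.2 (Or.inl h1), h2, (k3 h1).trans h3⟩
  · obtain ⟨j, hj, h1, h2, h3⟩ := hex O Q w (hcS ▸ hd)
    obtain ⟨hO, hQ, hd', -⟩ := hd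
    obtain ⟨t, ht, h4, h5⟩ := Cut.exists_sat (h.valid c hc) hQ hO hd' (hcS ▸ h2)
    rw [← h.Ks_eq] at ht
    obtain ⟨k1, -, -, k4⟩ := spec hc ht
    have hfit := (hR.fit_iff h hc hj).2 ⟨h1, hcS, h4⟩
    exact ⟨t, ht, k1.2 (Or.inr ⟨j, hj, hfit⟩), h5, (k4 j hj hfit).trans h3⟩

/-- The labelling `Y` on `A ∪ B` agrees with `L` on `A ∩ U`, and up to closing on `A`. -/
def Near (G : SimpleGraph (Fin n)) (A B U : Set (Fin n)) (L Y : Fin n → ℕ) : Prop :=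
  Disjoint A B ∧ IsPartial G (A ∪ B) Y ∧ (∀ x ∈ A, x ∈ U → Y x = L x) ∧
    ∀ x ∈ A, Y x = 0 ↔ L x = 0

/-- The slots for the join of the cuts `c` and `d`. -/
def Slots (Ks : ℕ) (G : SimpleGraph (Fin n)) (C : ℕ → Cut (Fin n)) (c d : ℕ) (U : Set (Fin n))
    (s : Store) : Prop :=
  ∀ i < Ks, ∀ t < Ks, ∀ u < Ks, s.arr 19 (slot Ks i t u) ≠ 0 →
    Near G (C c).side (C d).side U (s.lab n 18 (c * Ks + i)) (s.lab n 20 (slot Ks i t u))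

/-- The candidates for the join of the cuts `c` and `d`. -/
def Cands (Ks : ℕ) (G : SimpleGraph (Fin n)) (C : ℕ → Cut (Fin n)) (c d : ℕ) (U : Set (Fin n))
    (s : Store) : Prop :=
  ∀ i < Ks, ∀ q < Ks * Ks * (n + 1),
    (s.arr 22 (i * (Ks * Ks * (n + 1)) + q) ≠ 0 →
      Near G (C c).side (C d).side U (s.lab n 18 (c * Ks + i))
        (s.lab n 23 (i * (Ks * Ks * (n + 1)) + q))) ∧
    s.lab n 24 (i * (Ks * Ks * (n + 1)) + q) =
      mask (C c).side U (s.lab n 23 (i * (Ks * Ks * (n + 1)) + q))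

theorem exists_div_cand {N q : ℕ} (hq : q < N * Ks) : ∃ i < N, ∃ u < Ks, q = i * Ks + u := by
  have hK : 0 < Ks := by
    rcases Nat.eq_zero_or_pos Ks with h | h
    · simp [h] at hq
    · exact h
  exact ⟨q / Ks, Nat.div_lt_of_lt_mul (by rwa [mul_comm]), q % Ks, Nat.mod_lt _ hK,
    (Nat.div_add_mod' q Ks).symm⟩

/-- The slot may hold another candidate than the one with the pending solution. Both stem from entry
`i` of the first table, so on the first side they have the same labels on `U` and the same zeros.
With equal signatures this is what `Pending.exists_sat` requires. -/
theorem select_slots (h : Ctx n Kc K Ks G C s) {c d : ℕ} (h30 : s.reg 30 = c) (h31 : s.reg 31 = d)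
    (hc : c < Kc) (hd : d < Kc) {U : Set (Fin n)} (hC : Cands Ks G C c d U s) :
    Slots Ks G C c d U (select.den s) ∧
    ∀ O Q w, O ⊆ ((C c).side ∪ (C d).side)ᶜ → Q ⊆ ((C c).side ∪ (C d).side)ᶜ → Disjoint O Q →
      ∀ i < Ks, ∀ q < Ks * Ks * (n + 1), s.arr 22 (i * (Ks * Ks * (n + 1)) + q) ≠ 0 →
      Pending G (C c).side (C d).side O Q U w (s.lab n 23 (i * (Ks * Ks * (n + 1)) + q)) →
      ∃ t < Ks, ∃ u < Ks, (select.den s).arr 19 (slot Ks i t u) ≠ 0 ∧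
        Pending G (C c).side (C d).side O Q U w ((select.den s).lab n 20 (slot Ks i t u)) := by
  subst h30 h31
  have hw : ∀ q < Ks * (Ks * Ks * (n + 1)), s.arr 22 q ≠ 0 → ∑ x, s.lab n 23 q x ≤ 2 * n := by
    intro q hq hf
    obtain ⟨i, hi, q, hq', rfl⟩ := exists_div_cand hq
    exact ((hC i hi q hq').1 hf).2.1.sum_le
  have spec := fun {i t u : ℕ} (hi : i < Ks) (ht : t < Ks) (hu : u < Ks) =>
    select_spec h hc hd hw hi ht hu
  have e18 : ∀ j, (select.den s).lab n 18 j = s.lab n 18 j := fun j =>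
    lab_congr ((select.den_frame s).2 18 (by decide)) j
  refine ⟨fun i hi t ht u hu hf => ?_, fun O Q w hO hQ hd' i hi q hq hf hp => ?_⟩
  · obtain ⟨q, hq, hW, hl⟩ := (spec hi ht hu).1 hf
    rw [hl, e18]
    exact (hC i hi q hq).1 hW.1
  · obtain ⟨hdisj, hpart, hnear, hzero⟩ := (hC i hi q hq).1 hf
    obtain ⟨t, ht, u, hu, h1, h2, h3⟩ := Pending.exists_sat (h.valid _ hc) (h.valid _ hd) hdisj hp
      hO hQ hd'
    rw [← h.Ks_eq] at ht hu
    have hW : Win G K C s t u (i * (Ks * Ks * (n + 1)) + q) :=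
      ⟨hf, by rw [(hC i hi q hq).2]; exact h1, h2⟩
    obtain ⟨k1, k2⟩ := (spec hi ht hu).2 q hq hW
    obtain ⟨q', hq', hW', hl⟩ := (spec hi ht hu).1 k1
    obtain ⟨-, -, hnear', hzero'⟩ := (hC i hi q' hq').1 hW'.1
    refine ⟨t, ht, u, hu, k1, ?_⟩
    rw [hl] at k2 ⊢
    refine h3 _ (by rw [← (hC i hi q' hq').2]; exact hW'.2.1) hW'.2.2 (fun x hx hxU => ?_)
      (fun x hx h0 => ?_) k2
    · rw [hnear' x hx hxU, hnear x hx hxU]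
    · rw [hzero x hx, ← hzero' x hx, h0]

/-- Completeness in the form in which `IsPartial.exists_pending` uses it; soundness supplies the
signature from which the demand follows. -/
theorem Complete.exists_entry (hT : Sound Kc K Ks G C s) {c : ℕ} (hc : c < Kc)
    (hC : Complete K Ks G C s c) (X : Fin n → ℕ) (O Q : Set (Fin n))
    (hX : IsPartial G (C c).side X) (hO : O ⊆ (C c).sideᶜ) (hQ : Q ⊆ (C c).sideᶜ)
    (hd : Disjoint O Q) (hfit : Fits G (C c).side X O Q) :
    ∃ Y, (∃ t < Ks, s.arr 17 (c * Ks + t) ≠ 0 ∧ s.lab n 18 (c * Ks + t) = Y) ∧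
      Fits G (C c).side Y O Q ∧ ∑ x, Y x ≤ ∑ x, X x := by
  obtain ⟨t, ht, h1, h2, h3⟩ := hC O Q _ ⟨hO, hQ, hd, X, hX, hfit, rfl⟩
  exact ⟨_, ⟨t, ht, h1, rfl⟩, h2 _ (hT c hc t ht h1).2, h3⟩

theorem initial_cands (h : Ctx n Kc K Ks G C s) (hT : Sound Kc K Ks G C s) {c d : ℕ}
    (h30 : s.reg 30 = c) (h31 : s.reg 31 = d) (hc : c < Kc) (hd : d < Kc) :
    Cands Ks G C c d (above n 0) (initial.den s) ∧
    (Disjoint (C c).side (C d).side → Complete K Ks G C s c → Complete K Ks G C s d →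
      ∀ O Q w, Demand G ((C c).side ∪ (C d).side) O Q w → ∃ i < Ks, ∃ q < Ks * Ks * (n + 1),
        (initial.den s).arr 22 (i * (Ks * Ks * (n + 1)) + q) ≠ 0 ∧
        Pending G (C c).side (C d).side O Q (above n 0) w
          ((initial.den s).lab n 23 (i * (Ks * Ks * (n + 1)) + q))) := by
  subst h30 h31
  have e18 : ∀ j, (initial.den s).lab n 18 j = s.lab n 18 j := fun j =>
    lab_congr ((initial.den_frame s).2 18 (by decide)) j
  refine ⟨fun i hi q hq => ?_, fun hdisj hCc hCd O Q w hdem => ?_⟩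
  · obtain ⟨h1, h2, h3⟩ := initial_spec h hc hd hi hq
    refine ⟨fun hf => ?_, h3⟩
    obtain ⟨k1, k2, k3, k4, k5⟩ := h1.1 hf
    have pA := (hT _ hc i hi k2).1
    have pB := (hT _ hd q k1 k3).1
    rw [h2, e18]
    refine ⟨k4, pA.union k4 pB k5, fun x hx _ => overlay_left k4 pB hx, fun x hx => ?_⟩
    rw [overlay_left k4 pB hx]
  · obtain ⟨hO, hQ, hd', X, hX, hfit, rfl⟩ := hdem
    obtain ⟨YA, YB, ⟨i, hi, hfi, rfl⟩, ⟨q, hq, hfq, rfl⟩, hcross, hp⟩ :=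
      hX.exists_pending hdisj hO hQ hd' hfit
        (TA := fun Y => ∃ t < Ks, s.arr 17 (s.reg 30 * Ks + t) ≠ 0 ∧
          s.lab n 18 (s.reg 30 * Ks + t) = Y)
        (TB := fun Y => ∃ t < Ks, s.arr 17 (s.reg 31 * Ks + t) ≠ 0 ∧
          s.lab n 18 (s.reg 31 * Ks + t) = Y)
        (by rintro _ ⟨t, ht, h1, rfl⟩; exact (hT _ hc t ht h1).1)
        (by rintro _ ⟨t, ht, h1, rfl⟩; exact (hT _ hd t ht h1).1)
        (hCc.exists_entry hT hc) (hCd.exists_entry hT hd)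
    have hq' : q < Ks * Ks * (n + 1) := by
      have : 1 ≤ Ks := by omega
      nlinarith [Nat.mul_le_mul this (Nat.le_add_left 1 n)]
    obtain ⟨h1, h2, -⟩ := initial_spec h hc hd hi hq'
    refine ⟨i, hi, q, hq', h1.2 ⟨hq, hfi, hfq, hdisj, hcross⟩, ?_⟩
    rw [h2]
    have : above n 0 = Set.univ := by ext x; simp [above]
    rwa [this]

/-- The numbering of candidates as options of a slot agrees with their numbering within row `i`, so
`step` can write what `select` reads. -/
theorem cand_eq (i t u o : ℕ) : i * (Ks * Ks * (n + 1)) + ((t * Ks + u) * (n + 1) + o) =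
    slot Ks i t u * (n + 1) + o := by
  unfold slot; ring

theorem step_cands (h : Ctx n Kc K Ks G C s) {c d : ℕ} (h30 : s.reg 30 = c) (h31 : s.reg 31 = d)
    (hc : c < Kc) (hd : d < Kc) {a : Fin n} (h32 : s.reg 32 = a)
    (hS : Slots Ks G C c d (above n a) s) :
    Cands Ks G C c d (above n (a + 1)) (step.den s) ∧
    ∀ O Q w, Q ⊆ ((C c).side ∪ (C d).side)ᶜ → ∀ i < Ks, ∀ t < Ks, ∀ u < Ks,
      s.arr 19 (slot Ks i t u) ≠ 0 →
      Pending G (C c).side (C d).side O Q (above n a) w (s.lab n 20 (slot Ks i t u)) →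
      ∃ q < Ks * Ks * (n + 1), (step.den s).arr 22 (i * (Ks * Ks * (n + 1)) + q) ≠ 0 ∧
        Pending G (C c).side (C d).side O Q (above n (a + 1)) w
          ((step.den s).lab n 23 (i * (Ks * Ks * (n + 1)) + q)) := by
  subst h30 h31
  have e18 : ∀ j, (step.den s).lab n 18 j = s.lab n 18 j := fun j =>
    lab_congr ((step.den_frame s).2 18 (by decide)) j
  have habove : above n a \ {a} = above n (a + 1) := by
    ext x
    simp only [above, Set.mem_sdiff, Set.mem_ofPred_eq, Set.mem_singleton_iff, Fin.ext_iff]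
    omega
  refine ⟨fun i hi q hq => ?_, fun O Q w hQ i hi t ht u hu hf hp => ?_⟩
  · obtain ⟨tu, htu, o, ho, rfl⟩ := exists_div_cand hq
    obtain ⟨t, ht, u, hu, rfl⟩ := exists_div_cand htu
    rw [cand_eq, e18]
    obtain ⟨h1, h2, h3, h4⟩ := step_spec h hc hd h32 (slot_lt hi ht hu)
    refine ⟨fun hf => ?_, h4 o (by omega)⟩
    rcases Nat.lt_succ_iff_lt_or_eq.1 ho with ho | rfl
    · obtain ⟨h5, h6⟩ := h3 ⟨o, ho⟩
      obtain ⟨k1, k2, k3, k4, k5, k6⟩ := h5.1 hf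
      obtain ⟨l1, l2, l3, l4⟩ := hS i hi t ht u hu k1
      rw [h6]
      refine ⟨l1, l2.match_pair k4 k5 k6, fun x hx hxa => ?_, fun x hx => ?_⟩
      · rw [← habove] at hxa
        dsimp only
        rw [if_neg, l3 x hx hxa.1]
        rintro (e | e)
        · exact hxa.2 e
        · exact l1.notMem_of_mem_left hx (e ▸ k3)
      · dsimp only
        rw [← l4 x hx]
        split_ifs with he
        · rcases he with rfl | rfl
          · rw [k5]; simp
          · rw [k6]; simp
        · rfl
    · obtain ⟨l1, l2, l3, l4⟩ := hS i hi t ht u hu (h1.1 hf)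
      rw [h2]
      refine ⟨l1, l2, fun x hx hxa => l3 x hx ?_, l4⟩
      rw [← habove] at hxa
      exact hxa.1
  · obtain ⟨h1, h2, h3, -⟩ := step_spec h hc hd h32 (slot_lt hi ht hu)
    obtain ⟨l1, -, -, -⟩ := hS i hi t ht u hu hf
    have hlt : ∀ o ≤ n, (t * Ks + u) * (n + 1) + o < Ks * Ks * (n + 1) := fun o ho =>
      row_lt (row_lt ht hu) (Nat.lt_succ_of_le ho)
    rcases hp.step l1 hQ a with hp | ⟨b, hb, ha, hab, h5, h6, hp⟩
    · refine ⟨_, hlt n le_rfl, ?_, ?_⟩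
      · rw [cand_eq, h1]; exact hf
      · rw [cand_eq, h2, ← habove]; exact hp
    · obtain ⟨h7, h8⟩ := h3 b
      refine ⟨_, hlt b b.2.le, ?_, ?_⟩
      · rw [cand_eq, h7]; exact ⟨hf, ha, hb, hab, h5, h6⟩
      · rw [cand_eq, h8, ← habove]; exact hp

end Code
end EDS

/-! ### The small sides and a complete join. -/

namespace EDS
namespace Code
open Tm

variable {n Kc K Ks : ℕ} {G : SimpleGraph (Fin n)} {C : ℕ → Cut (Fin n)} {s r : Store}

theorem Sound.congr (h : Sound Kc K Ks G C s) (h17 : r.arr 17 = s.arr 17)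
    (h18 : r.arr 18 = s.arr 18) : Sound Kc K Ks G C r := by
  intro c hc t ht hf
  rw [lab_congr h18]
  exact h c hc t ht (by rwa [← h17])

theorem Complete.congr {c : ℕ} (h : Complete K Ks G C s c) (h17 : r.arr 17 = s.arr 17)
    (h18 : r.arr 18 = s.arr 18) : Complete K Ks G C r c := by
  intro O Q w hd
  obtain ⟨t, ht, h1, h2, h3⟩ := h O Q w hd
  exact ⟨t, ht, by rwa [h17], h2, by rwa [lab_congr h18]⟩

theorem base_ready (h : Ctx n Kc K Ks G C s) {c : ℕ} (h30 : s.reg 30 = c) (hc : c < Kc) :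
    Ready Ks G (C c).side (base.den s) ∧ ((C c).side.ncard ≤ 1 →
      ∀ O Q w, Demand G (C c).side O Q w → ∃ j < Ks * Ks * Ks, (base.den s).arr 19 j ≠ 0 ∧
        Fits G (C c).side ((base.den s).lab n 20 j) O Q ∧ ∑ x, (base.den s).lab n 20 j x ≤ w) := by
  subst h30
  have spec := fun {j : ℕ} (hj : j < Ks * Ks * Ks) => base_spec h hc hj
  have small : (C (s.reg 30)).side.ncard ≤ 1 → ∀ a ∈ (C (s.reg 30)).side,
      ∀ b ∈ (C (s.reg 30)).side, ¬ G.Adj a b := fun hle a ha b hb hab =>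
    hab.ne ((Set.ncard_le_one (Set.toFinite _)).1 hle a ha b hb)
  refine ⟨⟨fun j hj hf => ?_, fun j hj x => ?_, fun j hj x => ?_⟩, fun hle O Q w hd => ?_⟩
  · obtain ⟨h1, -, h3⟩ := spec hj
    have hle := (h1.1 hf).2
    refine ⟨fun x hx => ?_, fun x => ?_, fun a ha b hb hab => ?_, id, fun x hx => ?_⟩
    · exact (h3 x).1.resolve_left fun h => hx ((h3 x).2.1 h).2
    · rcases (h3 x).1 with h | h <;> omega
    · exact absurd hab (small (by omega) a ha b hb)
    · rcases (h3 x).1 with h | h <;> omega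
  · rw [(spec hj).2.1]; exact h.side_le _ hc x
  · rw [(spec hj).2.1]; exact h.side _ hc x
  · obtain ⟨-, -, -, X, hX, hfit, rfl⟩ := hd
    have hKs : 2 ≤ Ks := by
      have := (h.valid _ hc).pos_K
      rw [h.Ks_eq]; nlinarith
    -- The mate would be a second vertex of the side.
    have h1 : ∀ x, X x ≠ 1 := by
      intro x hx
      obtain ⟨f, hf⟩ := hX.mate
      obtain ⟨k1, k2, -⟩ := hf x hx
      have mem : ∀ y, X y = 1 → y ∈ (C (s.reg 30)).side := fun y hy => by
        by_contra hn; rw [hX.supp y hn] at hy; omega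
      exact small hle x (mem x hx) _ (mem _ k1) k2
    have key : ∀ j < 2, (∀ x ∈ (C (s.reg 30)).side, X x = 2 ↔ j = 1) →
        ∃ j < Ks * Ks * Ks, (base.den s).arr 19 j ≠ 0 ∧
        Fits G (C (s.reg 30)).side ((base.den s).lab n 20 j) O Q ∧
        ∑ x, (base.den s).lab n 20 j x ≤ ∑ x, X x := by
      intro j hj hX2
      have hjK : j < Ks * Ks * Ks := by nlinarith [Nat.mul_le_mul hKs hKs]
      obtain ⟨k1, -, k3⟩ := spec hjK
      have heq : (base.den s).lab n 20 j = X := by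
        funext x
        have h2 := hX.le_two x
        have h3 := h1 x
        by_cases hx : x ∈ (C (s.reg 30)).side
        · have h4 := hX2 x hx
          have h5 := (k3 x).2
          rcases (k3 x).1 with h6 | h6
          · rw [h6, h4.2 (h5.1 h6).1]
          · have : X x ≠ 2 := fun h7 => by
              have := h5.2 ⟨h4.1 h7, hx⟩; omega
            omega
        · rw [hX.supp x hx]
          exact (k3 x).1.resolve_left fun h => hx ((k3 x).2.1 h).2
      exact ⟨j, hjK, k1.2 ⟨hj, by omega⟩, by rwa [heq], by rw [heq]⟩
    by_cases hex : ∃ x ∈ (C (s.reg 30)).side, X x = 2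
    · obtain ⟨x, hx, hx2⟩ := hex
      refine key 1 (by norm_num) fun y hy => ?_
      rw [(Set.ncard_le_one (Set.toFinite _)).1 hle y hy x hx]
      simp [hx2]
    · push Not at hex
      exact key 0 (by norm_num) fun y hy => by simp [hex y hy]

/-- The invariant of the loop over the vertices `a`: for every demand on the union, some slot holds
a labelling that is pending with respect to the vertices from `a` on. After `n` rounds no vertex is
left, and `Pending.finish` turns pending labellings into solutions. Soundness holds for any two
cuts; only completeness uses that they are disjoint and have complete tables. -/
theorem join_inv (h : Ctx n Kc K Ks G C s) (hS : Sound Kc K Ks G C s) {c d : ℕ}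
    (h30 : s.reg 30 = c) (h31 : s.reg 31 = d) (hc : c < Kc) (hd : d < Kc) :
    Sound Kc K Ks G C (join.den s) ∧
    (∀ c' < Kc, Complete K Ks G C s c' → Complete K Ks G C (join.den s) c') ∧
    (Disjoint (C c).side (C d).side → Complete K Ks G C s c → Complete K Ks G C s d →
      ∀ c' < Kc, (C c').side = (C c).side ∪ (C d).side → Complete K Ks G C (join.den s) c') := by
  classical
  obtain ⟨cand, candC⟩ := initial_cands h hS h30 h31 hc hd
  set s1 := initial.den s with h1
  have c1 : Ctx n Kc K Ks G C s1 := h.den initial (by decide) (by decide)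
  have e30 : s1.reg 30 = c := by rw [h1, (initial.den_frame s).1 30 (by decide), h30]
  have e31 : s1.reg 31 = d := by rw [h1, (initial.den_frame s).1 31 (by decide), h31]
  obtain ⟨slots, slotsC⟩ := select_slots c1 e30 e31 hc hd cand
  set s2 := select.den s1 with h2
  set Q0 : Prop := Disjoint (C c).side (C d).side ∧ Complete K Ks G C s c ∧
    Complete K Ks G C s d with hQ0
  have hI := Stm.den_rep 32 0 (.seq step select) (fun a r => Ctx n Kc K Ks G C r ∧ r.reg 30 = c ∧
    r.reg 31 = d ∧ Slots Ks G C c d (above n a) r ∧ (Q0 → ∀ O Q w,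
      Demand G ((C c).side ∪ (C d).side) O Q w → ∃ i < Ks, ∃ t < Ks, ∃ u < Ks,
        r.arr 19 (slot Ks i t u) ≠ 0 ∧
        Pending G (C c).side (C d).side O Q (above n a) w (r.lab n 20 (slot Ks i t u)))) s2
    ⟨c1.den select (by decide) (by decide), by
      rw [h2, (select.den_frame s1).1 30 (by decide), e30], by
      rw [h2, (select.den_frame s1).1 31 (by decide), e31], slots, fun hq O Q w hdem => by
      obtain ⟨i, hi, q, hq, k1, k2⟩ := candC hq.1 hq.2.1 hq.2.2 O Q w hdem
      obtain ⟨t, ht, u, hu, k3⟩ := slotsC O Q w hdem.1 hdem.2.1 hdem.2.2.1 i hi q hq k1 k2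
      exact ⟨i, hi, t, ht, u, hu, k3⟩⟩ (by
      rintro a ha r ⟨k1, k2, k3, k4, k5⟩
      have hs2 : s2.reg 0 = n := (c1.den select (by decide) (by decide)).reg0
      have ha' : a < n := by rwa [hs2] at ha
      have g1 : Ctx n Kc K Ks G C (r.setReg 32 a) := k1.setReg (by norm_num) _
      have g30 : (r.setReg 32 a).reg 30 = c := by rw [Store.setReg_reg, if_neg (by norm_num), k2]
      have g31 : (r.setReg 32 a).reg 31 = d := by rw [Store.setReg_reg, if_neg (by norm_num), k3]
      obtain ⟨st, stC⟩ := step_cands g1 g30 g31 hc hd (a := ⟨a, ha'⟩) (Store.setReg_reg_self _ _ _) k4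
      rw [Stm.den_seq]
      set r1 := step.den (r.setReg 32 a) with hr1
      have m1 : Ctx n Kc K Ks G C r1 := g1.den step (by decide) (by decide)
      have m30 : r1.reg 30 = c := by rw [hr1, (step.den_frame _).1 30 (by decide), g30]
      have m31 : r1.reg 31 = d := by rw [hr1, (step.den_frame _).1 31 (by decide), g31]
      obtain ⟨sl, slC⟩ := select_slots m1 m30 m31 hc hd st
      refine ⟨m1.den select (by decide) (by decide), ?_, ?_, sl, fun hq O Q w hdem => ?_⟩
      · rw [(select.den_frame r1).1 30 (by decide), m30]
      · rw [(select.den_frame r1).1 31 (by decide), m31]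
      · obtain ⟨i, hi, t, ht, u, hu, l1, l2⟩ := k5 hq O Q w hdem
        obtain ⟨q, hq, l3, l4⟩ := stC O Q w hdem.2.1 i hi t ht u hu l1 l2
        obtain ⟨t, ht, u, hu, l5⟩ := slC O Q w hdem.1 hdem.2.1 hdem.2.2.1 i hi q hq l3 l4
        exact ⟨i, hi, t, ht, u, hu, l5⟩)
  rw [(c1.den select (by decide) (by decide)).reg0] at hI
  have eqj : join.den s = collect.den (Stm.den (.comp 21 25 19 ((side (.reg 30)
      ((Tm.reg 25).mod (.reg 0))).or (side (.reg 31) ((Tm.reg 25).mod (.reg 0)))))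
      (Stm.den (.rep 32 0 (.seq step select)) s2)) := rfl
  set s3 := Stm.den (.rep 32 0 (.seq step select)) s2 with h3
  set s4 := Stm.den (.comp 21 25 19 _) s3 with h4
  obtain ⟨k1, k2, k3, k4, k5⟩ := hI
  have hempty : above n n = ∅ := by
    ext x; simp only [above, Set.mem_ofPred_eq, Set.mem_empty_iff_false, iff_false]; omega
  rw [hempty] at k4 k5
  have c4 : Ctx n Kc K Ks G C s4 := k1.den _ (by decide) (by decide)
  have a4 : ∀ b, b ≠ 21 → s4.arr b = s3.arr b := fun b hb => Stm.den_comp_ne hb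
  have v21 : ∀ j < Ks * Ks * Ks, ∀ x : Fin n, s4.arr 21 (j * n + x) =
      if x ∈ (C c).side ∨ x ∈ (C d).side then 1 else 0 := by
    intro j hj x
    rw [h4, Stm.den_comp_self _ _ _ _ _ (by rw [k1.reg19]; exact row_lt hj x.2), eval_or]
    simp only [side, row, T_cell, eval_add, eval_mul, eval_mod, eval_reg, Store.setReg_reg,
      Store.setReg_arr, Nat.reduceEqDiff, if_false, if_true, OfNat.zero_ne_ofNat, k1.reg0,
      row_mod x.2, k2, k3, k1.side _ hc, k1.side _ hd]
  have hR : Ready Ks G ((C c).side ∪ (C d).side) s4 := by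
    refine ⟨fun j hj hf => ?_, fun j hj x => ?_, fun j hj x => ?_⟩
    · obtain ⟨i, hi, t, ht, u, hu, rfl⟩ := exists_slot hj
      rw [lab_congr (a4 20 (by norm_num))]
      rw [a4 19 (by norm_num)] at hf
      exact (k4 i hi t ht u hu hf).2.1
    · rw [v21 j hj]; split_ifs <;> norm_num
    · rw [v21 j hj, Set.mem_union]; split_ifs with hx <;> simp [hx]
  have f17 : ∀ b, b = 17 ∨ b = 18 → s4.arr b = s.arr b := by
    intro b hb
    have e1 := (initial.den_frame s).2 b (by rcases hb with rfl | rfl <;> decide)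
    have e2 := (select.den_frame s1).2 b (by rcases hb with rfl | rfl <;> decide)
    have e3 := ((Stm.rep 32 0 (.seq step select)).den_frame s2).2 b
      (by rcases hb with rfl | rfl <;> decide)
    rw [a4 b (by rcases hb with rfl | rfl <;> norm_num), h3, e3, h2, e2, h1, e1]
  obtain ⟨l1, l2, l3⟩ := collect_inv c4 (hS.congr (f17 17 (Or.inl rfl)) (f17 18 (Or.inr rfl))) hR
  rw [eqj]
  refine ⟨l1, fun c' hc' hC => l2 c' hc' (hC.congr (f17 17 (Or.inl rfl)) (f17 18 (Or.inr rfl))),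
    fun g1 g2 g3 => l3 fun O Q w hdem => ?_⟩
  obtain ⟨i, hi, t, ht, u, hu, m1, m2⟩ := k5 ⟨g1, g2, g3⟩ O Q w hdem
  obtain ⟨m3, m4⟩ := m2.finish
  refine ⟨_, slot_lt hi ht hu, ?_, ?_, ?_⟩
  · rwa [a4 19 (by norm_num)]
  · rwa [lab_congr (a4 20 (by norm_num))]
  · rwa [lab_congr (a4 20 (by norm_num))]

end Code
end EDS

/-! ### Rounds of joins and the final answer. -/

namespace EDS
namespace Code
open Tm

variable {n Kc K Ks : ℕ} {G : SimpleGraph (Fin n)} {C : ℕ → Cut (Fin n)} {s r : Store}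

theorem round_inv (h : Ctx n Kc K Ks G C s) (hS : Sound Kc K Ks G C s) {c : ℕ}
    (h30 : s.reg 30 = c) (hc : c < Kc) :
    Ctx n Kc K Ks G C ((Stm.rep 31 3 join).den s) ∧
    Sound Kc K Ks G C ((Stm.rep 31 3 join).den s) ∧
    (∀ c' < Kc, Complete K Ks G C s c' → Complete K Ks G C ((Stm.rep 31 3 join).den s) c') ∧
    ∀ d < Kc, Disjoint (C c).side (C d).side → Complete K Ks G C s c → Complete K Ks G C s d →
      ∀ c' < Kc, (C c').side = (C c).side ∪ (C d).side →
        Complete K Ks G C ((Stm.rep 31 3 join).den s) c' := by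
  have hI := Stm.den_rep 31 3 join (fun i r => Ctx n Kc K Ks G C r ∧ r.reg 30 = c ∧
    Sound Kc K Ks G C r ∧ (∀ c' < Kc, Complete K Ks G C s c' → Complete K Ks G C r c') ∧
    ∀ d < i, Disjoint (C c).side (C d).side → Complete K Ks G C s c → Complete K Ks G C s d →
      ∀ c' < Kc, (C c').side = (C c).side ∪ (C d).side → Complete K Ks G C r c') s
    ⟨h, h30, hS, fun _ _ h => h, fun d hd => absurd hd (by omega)⟩ (by
    rintro d hd r ⟨k1, k2, k3, k4, k5⟩
    rw [h.reg3] at hd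
    have g1 : Ctx n Kc K Ks G C (r.setReg 31 d) := k1.setReg (by norm_num) _
    have g30 : (r.setReg 31 d).reg 30 = c := by rw [Store.setReg_reg, if_neg (by norm_num), k2]
    obtain ⟨l1, l2, l3⟩ := join_inv g1 (k3.congr rfl rfl) g30 (Store.setReg_reg_self _ _ _) hc hd
    refine ⟨g1.den join (by decide) (by decide), ?_, l1,
      fun c' hc' hC => l2 c' hc' ((k4 c' hc' hC).congr rfl rfl), fun d' hd' m1 m2 m3 c' hc' m4 => ?_⟩
    · rw [(join.den_frame _).1 30 (by decide), g30]
    · rcases Nat.lt_succ_iff_lt_or_eq.1 hd' with hd' | rfl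
      · exact l2 c' hc' ((k5 d' hd' m1 m2 m3 c' hc' m4).congr rfl rfl)
      · exact l3 m1 ((k4 c hc m2).congr rfl rfl) ((k4 d' hd m3).congr rfl rfl) c' hc' m4)
  rw [h.reg3] at hI
  exact ⟨hI.1, hI.2.2.1, hI.2.2.2.1, hI.2.2.2.2⟩

theorem rounds_inv (h : Ctx n Kc K Ks G C s) (hS : Sound Kc K Ks G C s) :
    Ctx n Kc K Ks G C ((Stm.rep 30 3 (.rep 31 3 join)).den s) ∧
    Sound Kc K Ks G C ((Stm.rep 30 3 (.rep 31 3 join)).den s) ∧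
    (∀ c' < Kc, Complete K Ks G C s c' →
      Complete K Ks G C ((Stm.rep 30 3 (.rep 31 3 join)).den s) c') ∧
    ∀ c < Kc, ∀ d < Kc, Disjoint (C c).side (C d).side → Complete K Ks G C s c →
      Complete K Ks G C s d → ∀ c' < Kc, (C c').side = (C c).side ∪ (C d).side →
        Complete K Ks G C ((Stm.rep 30 3 (.rep 31 3 join)).den s) c' := by
  have hI := Stm.den_rep 30 3 (.rep 31 3 join) (fun i r => Ctx n Kc K Ks G C r ∧
    Sound Kc K Ks G C r ∧ (∀ c' < Kc, Complete K Ks G C s c' → Complete K Ks G C r c') ∧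
    ∀ c < i, ∀ d < Kc, Disjoint (C c).side (C d).side → Complete K Ks G C s c →
      Complete K Ks G C s d → ∀ c' < Kc, (C c').side = (C c).side ∪ (C d).side →
        Complete K Ks G C r c') s
    ⟨h, hS, fun _ _ h => h, fun d hd => absurd hd (by omega)⟩ (by
    rintro c hc r ⟨k1, k3, k4, k5⟩
    rw [h.reg3] at hc
    obtain ⟨l0, l1, l2, l3⟩ := round_inv (k1.setReg (v := 30) (by norm_num) c)
      (k3.congr rfl rfl) (Store.setReg_reg_self _ _ _) hc
    refine ⟨l0, l1, fun c' hc' hC => l2 c' hc' ((k4 c' hc' hC).congr rfl rfl),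
      fun b hb d hd m1 m2 m3 c' hc' m4 => ?_⟩
    rcases Nat.lt_succ_iff_lt_or_eq.1 hb with hb | rfl
    · exact l2 c' hc' ((k5 b hb d hd m1 m2 m3 c' hc' m4).congr rfl rfl)
    · exact l3 d hd m1 ((k4 b hc m2).congr rfl rfl) ((k4 d hd m3).congr rfl rfl) c' hc' m4)
  rw [h.reg3] at hI
  exact hI

theorem bases_inv (h : Ctx n Kc K Ks G C s) (hS : Sound Kc K Ks G C s) :
    Ctx n Kc K Ks G C ((Stm.rep 30 3 (.seq base collect)).den s) ∧
    Sound Kc K Ks G C ((Stm.rep 30 3 (.seq base collect)).den s) ∧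
    ∀ c < Kc, (C c).side.ncard ≤ 1 →
      Complete K Ks G C ((Stm.rep 30 3 (.seq base collect)).den s) c := by
  have hI := Stm.den_rep 30 3 (.seq base collect) (fun i r => Ctx n Kc K Ks G C r ∧
    Sound Kc K Ks G C r ∧ ∀ c < i, c < Kc → (C c).side.ncard ≤ 1 → Complete K Ks G C r c) s
    ⟨h, hS, fun d hd => absurd hd (by omega)⟩ (by
    rintro c hc r ⟨k1, k3, k4⟩
    rw [h.reg3] at hc
    have g1 := k1.setReg (v := 30) (by norm_num) c
    obtain ⟨l1, l2⟩ := base_ready g1 (Store.setReg_reg_self _ _ _) hc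
    set r1 := base.den (r.setReg 30 c) with hr1
    have f17 : ∀ b, b = 17 ∨ b = 18 → r1.arr b = r.arr b := fun b hb => by
      rw [hr1, (base.den_frame _).2 b (by rcases hb with rfl | rfl <;> decide)]; rfl
    have g2 : Ctx n Kc K Ks G C r1 := g1.den base (by decide) (by decide)
    obtain ⟨m1, m2, m3⟩ := collect_inv g2
      (k3.congr (f17 17 (Or.inl rfl)) (f17 18 (Or.inr rfl))) l1
    refine ⟨g2.den collect (by decide) (by decide), m1, fun c' hc' hcK hle => ?_⟩
    rcases Nat.lt_succ_iff_lt_or_eq.1 hc' with hc' | rfl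
    · exact m2 c' hcK ((k4 c' hc' hcK hle).congr (f17 17 (Or.inl rfl)) (f17 18 (Or.inr rfl)))
    · exact m3 (l2 hle) c' hcK rfl)
  rw [h.reg3] at hI
  exact ⟨hI.1, hI.2.1, fun c hc => hI.2.2 c hc hc⟩

/-- After `i` rounds the tables of all sides built in `i` rounds are complete. The program need not
know which cuts belong together in the tree: it joins every pair of cuts, and slots enter only the
tables of cuts whose side is the union. -/
theorem tables_spec {W : Type*} (D : BranchDecomposition (Fin n) W)
    (hside : ∀ A, D.IsSide A → ∃ c < Kc, (C c).side = A) (h : Ctx n Kc K Ks G C s)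
    (h17 : ∀ i, s.arr 17 i = 0) :
    Ctx n Kc K Ks G C (tables.den s) ∧ Sound Kc K Ks G C (tables.den s) ∧
    ∀ A, D.Built (s.reg 20) A → ∀ c < Kc, (C c).side = A →
      Complete K Ks G C (tables.den s) c := by
  have hS : Sound Kc K Ks G C s := fun c _ t _ hf => absurd (h17 _) hf
  obtain ⟨k1, k2, k3⟩ := bases_inv h hS
  have eqt : tables.den s = (Stm.rep 33 20 (.rep 30 3 (.rep 31 3 join))).den
    ((Stm.rep 30 3 (.seq base collect)).den s) := rfl
  rw [eqt]
  set s1 := (Stm.rep 30 3 (.seq base collect)).den s with h1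
  have e20 : s1.reg 20 = s.reg 20 := by
    rw [h1, (Stm.den_frame _ _).1 20 (by decide)]
  rw [← e20]
  refine Stm.den_rep 33 20 (.rep 30 3 (.rep 31 3 join)) (fun i r => Ctx n Kc K Ks G C r ∧
    Sound Kc K Ks G C r ∧ ∀ A, D.Built i A → ∀ c < Kc, (C c).side = A → Complete K Ks G C r c) s1
    ⟨k1, k2, fun A hA c hc hcA => ?_⟩ ?_
  · generalize hz : 0 = z at hA
    cases hA with
    | base _ _ _ h2 => exact k3 c hc (hcA ▸ h2)
    | join => omega
  · rintro i - r ⟨l1, l2, l3⟩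
    obtain ⟨m1, m2, m3, m4⟩ := rounds_inv (l1.setReg (v := 33) (by norm_num) i)
      (l2.congr rfl rfl)
    refine ⟨m1, m2, fun A hA c hc hcA => ?_⟩
    have built_side : ∀ {i A}, D.Built i A → D.IsSide A := by
      intro i A hA
      cases hA with
      | base _ _ h1 _ => exact h1
      | join _ _ _ _ _ _ h1 => exact h1
    generalize hz : i + 1 = z at hA
    cases hA with
    | base _ _ g1 g2 => exact m3 c hc ((l3 A (.base i A g1 g2) c hc hcA).congr rfl rfl)
    | join j A B g1 g2 g3 g4 =>
      obtain rfl : i = j := by omega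
      obtain ⟨a, ha, haA⟩ := hside A (built_side g1)
      obtain ⟨b, hb, hbB⟩ := hside B (built_side g2)
      exact m4 a ha b hb (by rw [haA, hbB]; exact g3) ((l3 A g1 a ha haA).congr rfl rfl)
        ((l3 B g2 b hb hbB).congr rfl rfl) c hc (by rw [hcA, haA, hbB])

/-- For the side that contains all vertices there is nothing outside, so the empty demand is the
only one, and the lightest entry has the minimum weight of a labelling of the whole graph. -/
theorem answer_spec (h : Ctx n Kc K Ks G C s) (hS : Sound Kc K Ks G C s) (hc : s.reg 2 < Kc)
    (hside : (C (s.reg 2)).side = Set.univ) (hC : Complete K Ks G C s (s.reg 2)) :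
    IsLeast {b | HasEdgeDominatingSet G b} (answer.eval s) := by
  have hT : ∀ w, (Tm.ex 28 11 ((Tm.cell 17 (entry (.reg 2) (.reg 28))).and
      ((Tm.sum 34 0 (row 18 (entry (.reg 2) (.reg 28)) (.reg 34))).eq (.reg 37)))).eval
      (s.setReg 37 w) ≠ 0 ↔ ∃ t < Ks, s.arr 17 (s.reg 2 * Ks + t) ≠ 0 ∧
        ∑ x, s.lab n 18 (s.reg 2 * Ks + t) x = w := by
    intro w
    refine (T_ex _ _ _ _).trans ?_
    simp only [entry, row, T_and, T_cell, T_eq, eval_add, eval_mul, eval_reg, eval_sum, eval_cell,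
      Store.setReg_reg, Store.setReg_arr, Nat.reduceEqDiff, if_false, if_true, OfNat.zero_ne_ofNat,
      h.reg0, h.reg11, sum_range_lab]
  have opt : ∀ X, IsPartial G Set.univ X → ∃ t < Ks, s.arr 17 (s.reg 2 * Ks + t) ≠ 0 ∧
      ∑ x, s.lab n 18 (s.reg 2 * Ks + t) x ≤ ∑ x, X x := by
    intro X hX
    obtain ⟨t, ht, h1, -, h2⟩ := hC ∅ ∅ _ ⟨Set.empty_subset _, Set.empty_subset _,
      Set.disjoint_empty _, X, hside ▸ hX, ⟨fun o ho => ho.elim, id, Set.injOn_empty _,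
        fun q hq => hq.elim⟩, rfl⟩
    exact ⟨t, ht, h1, h2⟩
  have val : answer.eval s = leastBelow (fun w => (Tm.ex 28 11 ((Tm.cell 17
      (entry (.reg 2) (.reg 28))).and ((Tm.sum 34 0 (row 18 (entry (.reg 2) (.reg 28))
      (.reg 34))).eq (.reg 37)))).eval (s.setReg 37 w)) (2 * n + 1) / 2 := by
    rw [answer, eval_div, eval_least, h.reg5]; rfl
  rw [val]
  set f := fun w => (Tm.ex 28 11 ((Tm.cell 17
      (entry (.reg 2) (.reg 28))).and ((Tm.sum 34 0 (row 18 (entry (.reg 2) (.reg 28))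
      (.reg 34))).eq (.reg 37)))).eval (s.setReg 37 w) with hf
  have hle : ∀ X, IsPartial G Set.univ X → leastBelow f (2 * n + 1) ≤ ∑ x, X x := by
    intro X hX
    obtain ⟨t, ht, h1, h2⟩ := opt X hX
    exact (leastBelow_le_of f _ _ ((hT _).2 ⟨t, ht, h1, rfl⟩)).trans h2
  -- The constant labelling `2` ensures that the search below `2 * n + 1` succeeds.
  have hfull : IsPartial G Set.univ (fun _ : Fin n => 2) :=
    ⟨fun x hx => absurd (Set.mem_univ x) hx, fun _ => le_rfl, fun _ _ _ _ _ => Or.inl (by norm_num),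
      id, fun x hx => by omega⟩
  have hlt : leastBelow f (2 * n + 1) < 2 * n + 1 := Nat.lt_succ_of_le
    ((hle _ hfull).trans hfull.sum_le)
  obtain ⟨t, ht, h1, h2⟩ := (hT _).1 (leastBelow_spec f _ hlt)
  refine ⟨?_, fun b hb => ?_⟩
  · have hp := (hS _ hc t ht h1).1
    rw [hside] at hp
    rw [← h2]
    exact hp.hasEdgeDominatingSet
  · obtain ⟨X, hX, hw⟩ := HasEdgeDominatingSet.exists_isPartial hb
    have := hle X hX
    omega

end Code
end EDS

/-! ### Input arrays, numbered cuts, ranks and bounded walks. -/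

namespace EDS

theorem adjacencyArray_row {n : ℕ} (G : SimpleGraph (Fin n)) (x y : Fin n) [Decidable (G.Adj x y)] :
    adjacencyArray G (x * n + y) = if G.Adj x y then 1 else 0 := by
  unfold adjacencyArray
  have e : (∃ i j : Fin n, x.1 * n + y.1 = i.1 * n + j.1 ∧ G.Adj i j) ↔ G.Adj x y := by
    refine ⟨?_, fun h => ⟨x, y, rfl, h⟩⟩
    rintro ⟨i, j, h, hij⟩
    have h1 : x = i := Fin.ext (by rw [← row_div (c := x.1) y.2, h, row_div j.2])
    have h2 : y = j := Fin.ext (by rw [← row_mod (c := x.1) y.2, h, row_mod j.2])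
    rwa [h1, h2]
  by_cases h : G.Adj x y
  · rw [if_pos (e.2 h), if_pos h]
  · rw [if_neg fun h' => h (e.1 h'), if_neg h]

theorem leafArray_leaf {n m : ℕ} (D : BranchDecomposition (Fin n) (Fin m)) {w : Fin m}
    (h : IsLeaf D.tree w) : leafArray D w = D.leafEquiv ⟨w, h⟩ := by
  unfold leafArray
  rw [dif_pos ⟨w.2, h⟩]

theorem Pairs.ncard {V : Type*} [Finite V] {G : SimpleGraph V} {A : Set V} {g : ℕ} {a b : ℕ → V}
    (h : Pairs G A g a b) : {x | ∃ i < g, x = a i ∨ x = b i}.ncard = 2 * g := by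
  have e : {x | ∃ i < g, x = a i ∨ x = b i} = a '' Set.Iio g ∪ b '' Set.Iio g := by
    ext x
    simp only [Set.mem_ofPred_eq, Set.mem_union, Set.mem_image, Set.mem_Iio]
    constructor
    · rintro ⟨i, hi, rfl | rfl⟩
      · exact Or.inl ⟨i, hi, rfl⟩
      · exact Or.inr ⟨i, hi, rfl⟩
    · rintro (⟨i, hi, rfl⟩ | ⟨i, hi, rfl⟩)
      · exact ⟨i, hi, Or.inl rfl⟩
      · exact ⟨i, hi, Or.inr rfl⟩
  have hc : (Set.Iio g).ncard = g := by
    rw [← Finset.coe_range, Set.ncard_coe_finset, Finset.card_range]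
  rw [e, Set.ncard_union_eq ?_ (Set.toFinite _) (Set.toFinite _),
    (show Set.InjOn a (Set.Iio g) from fun i hi j hj => h.injA i hi j hj).ncard_image,
    (show Set.InjOn b (Set.Iio g) from fun i hi j hj => h.injB i hi j hj).ncard_image, hc]
  · ring
  · rw [Set.disjoint_left]
    rintro _ ⟨i, hi, rfl⟩ ⟨j, hj, hij⟩
    exact h.notMem j hj (hij ▸ h.mem i hi)

section Sides

variable {n m : ℕ} (G : SimpleGraph (Fin n)) (D : BranchDecomposition (Fin n) (Fin m))

/-- The inner side of the cut number `c`. -/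
def cutSide (c : ℕ) : Set (Fin n) :=
  {x | ∀ u v : Fin m, c = u * m + v → D.tree.Adj u v ∧ x ∈ D.side u v}

theorem mem_cutSide_row (u v : Fin m) (x : Fin n) :
    x ∈ cutSide D (u * m + v) ↔ D.tree.Adj u v ∧ x ∈ D.side u v := by
  refine ⟨fun h => h u v rfl, fun h i j hij => ?_⟩
  have h1 : u = i := Fin.ext (by rw [← row_div (c := u.1) v.2, hij, row_div j.2])
  have h2 : v = j := Fin.ext (by rw [← row_mod (c := u.1) v.2, hij, row_mod j.2])
  rwa [← h1, ← h2]

/-- The number `m * m` belongs to no pair of nodes, so the condition is vacuous. -/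
theorem cutSide_top : cutSide D (m * m) = Set.univ := by
  ext x
  simp only [Set.mem_univ, iff_true]
  intro u v h
  have := row_lt u.2 v.2
  omega

theorem exists_row {c : ℕ} (hc : c < m * m) : ∃ u v : Fin m, c = u * m + v := by
  obtain ⟨u, hu, v, hv, rfl⟩ := Code.exists_div_cand hc
  exact ⟨⟨u, hu⟩, ⟨v, hv⟩, rfl⟩

theorem exists_cutSide (A : Set (Fin n)) (hA : D.IsSide A) :
    ∃ c < m * m + 1, cutSide D c = A := by
  rcases hA with rfl | rfl | ⟨u, v, h, rfl⟩
  · exact ⟨m * m, by omega, cutSide_top D⟩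
  -- A node is not adjacent to itself, so the pair `(u, u)` has the empty side.
  · have u : Fin m := D.isTree.connected.nonempty.some
    refine ⟨u * m + u, (row_lt u.2 u.2).trans (by omega), ?_⟩
    ext x
    simp [mem_cutSide_row]
  · refine ⟨u * m + v, (row_lt u.2 v.2).trans (by omega), ?_⟩
    ext x
    simp [mem_cutSide_row, h]

theorem mm_eq_zero {V : Type*} {G : SimpleGraph V} {A : Set V} (h : ∀ a ∈ A, ∀ b ∉ A, ¬ G.Adj a b) :
    mm G A = 0 := by
  have : {k | ∃ M : Finset (Sym2 V), IsMatching (G.between A Aᶜ) M ∧ M.card = k} ⊆ {0} := by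
    rintro k ⟨M, hM, rfl⟩
    rw [Set.mem_singleton_iff, Finset.card_eq_zero]
    refine Finset.eq_empty_of_forall_notMem fun e he => ?_
    have h1 := hM.1 e he
    induction e using Sym2.ind with
    | _ a b =>
    rcases h1 with ⟨h2, ⟨h3, h4⟩ | ⟨h3, h4⟩⟩
    · exact h a h3 b h4 h2
    · exact h b h4 a h3 h2.symm
  exact Nat.le_zero.1 (csSup_le' fun k hk => (this hk).le)

/-- A number that is not a tree edge has the empty side or all vertices as its side, and no edge
crosses such a cut. So the additional cuts do not exceed the width. -/
theorem mm_cutSide_le {c : ℕ} (hc : c < m * m + 1) (hs : ¬ IsSplit G (cutSide D c)) :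
    mm G (cutSide D c) ≤ D.smWidth G := by
  rcases Nat.lt_succ_iff_lt_or_eq.1 hc with hc | rfl
  · obtain ⟨u, v, rfl⟩ := exists_row hc
    by_cases h : D.tree.Adj u v
    · have e : cutSide D (u * m + v) = D.side u v := by
        ext x; simp [mem_cutSide_row, h]
      rw [e] at hs ⊢
      have hfin : {k | ∃ u v, D.tree.Adj u v ∧ k = sm G (D.side u v)}.Finite :=
        (Set.finite_range fun p : Fin m × Fin m => sm G (D.side p.1 p.2)).subset
          (by rintro _ ⟨u, v, -, rfl⟩; exact ⟨(u, v), rfl⟩)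
      refine le_csSup hfin.bddAbove ⟨u, v, h, ?_⟩
      rw [sm, if_neg hs]
    · rw [mm_eq_zero]
      · exact Nat.zero_le _
      · intro a ha
        exact absurd ((mem_cutSide_row D u v a).1 ha).1 h
  · rw [mm_eq_zero]
    · exact Nat.zero_le _
    · intro a _ b hb
      exact absurd (by rw [cutSide_top]; trivial) hb

/-- A tree has a leaf, and leaves correspond to vertices. The vertex serves as a default value in
the numbering of an empty matching. -/
theorem BranchDecomposition.pos (D : BranchDecomposition (Fin n) (Fin m)) : 0 < n := by
  classical
  suffices h : ∃ w, IsLeaf D.tree w by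
    obtain ⟨w, hw⟩ := h
    exact (D.leafEquiv ⟨w, hw⟩).pos
  have hne := D.isTree.connected.nonempty
  rcases subsingleton_or_nontrivial (Fin m) with hm | hm
  · obtain ⟨w⟩ := hne
    exact ⟨w, Set.ncard_le_one_of_subsingleton _⟩
  · obtain ⟨w, hw⟩ := D.isTree.exists_vert_degree_one_of_nontrivial
    refine ⟨w, ?_⟩
    unfold IsLeaf
    rw [← SimpleGraph.coe_neighborFinset, Set.ncard_coe_finset, SimpleGraph.card_neighborFinset_eq_degree, hw]

end Sides

/-- The rank of an element of a set is injective on it. -/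
theorem rank_injOn {n : ℕ} (S : Set (Fin n)) :
    Set.InjOn (fun x : Fin n => {y | y < x ∧ y ∈ S}.ncard) S := by
  have key : ∀ x ∈ S, ∀ y, x < y → {z | z < x ∧ z ∈ S}.ncard < {z | z < y ∧ z ∈ S}.ncard := by
    intro x hx y hxy
    refine Set.ncard_lt_ncard ?_ (Set.toFinite _)
    refine (Set.ssubset_iff_of_subset fun z (hz : z < x ∧ z ∈ S) =>
      show z < y ∧ z ∈ S from ⟨hz.1.trans hxy, hz.2⟩).2
      ⟨x, ⟨hxy, hx⟩, fun h : x < x ∧ x ∈ S => lt_irrefl _ h.1⟩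
  intro x hx y hy e
  rcases lt_trichotomy x y with h | h | h
  · exact absurd e (key x hx y h).ne
  · exact h
  · exact absurd e (key y hy x h).ne'

theorem rank_lt {n : ℕ} (S : Set (Fin n)) {x : Fin n} (hx : x ∈ S) :
    {y | y < x ∧ y ∈ S}.ncard < S.ncard :=
  Set.ncard_lt_ncard ((Set.ssubset_iff_of_subset fun z (hz : z < x ∧ z ∈ S) => hz.2).2
    ⟨x, hx, fun h : x < x ∧ x ∈ S => lt_irrefl _ h.1⟩) (Set.toFinite _)

/-- Walks of bounded length, one edge at a time. -/
theorem exists_walk_le_succ {W : Type*} (T : SimpleGraph W) (u x : W) (t : ℕ) :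
    (∃ p : T.Walk u x, p.length ≤ t + 1) ↔
      (∃ p : T.Walk u x, p.length ≤ t) ∨ ∃ y, (∃ p : T.Walk u y, p.length ≤ t) ∧ T.Adj y x := by
  constructor
  · rintro ⟨p, hp⟩
    by_cases h : p.length ≤ t
    · exact Or.inl ⟨p, h⟩
    · right
      have hr := p.length_reverse
      generalize p.reverse = q at hr
      cases q with
      | nil => simp at hr; omega
      | cons h' q =>
        refine ⟨_, ⟨q.reverse, ?_⟩, h'.symm⟩
        rw [SimpleGraph.Walk.length_reverse]
        rw [SimpleGraph.Walk.length_cons] at hr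
        omega
  · rintro (⟨p, hp⟩ | ⟨y, ⟨p, hp⟩, h⟩)
    · exact ⟨p, by omega⟩
    · exact ⟨p.concat h, by rw [SimpleGraph.Walk.length_concat]; omega⟩

/-- A path visits every node at most once, so `m` rounds of `reachStep` find everything that can be
reached. -/
theorem exists_walk_le_iff {m : ℕ} (T : SimpleGraph (Fin m)) (u x : Fin m) :
    (∃ p : T.Walk u x, p.length ≤ m) ↔ T.Reachable u x := by
  classical
  refine ⟨fun ⟨p, _⟩ => ⟨p⟩, fun ⟨p⟩ => ⟨p.bypass, ?_⟩⟩
  have := p.bypass_isPath.length_lt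
  rw [Fintype.card_fin] at this
  omega

end EDS

/-! ### Computing the sides, their boundaries and the splits. -/

namespace EDS

/-- The store holds the input and the bounds of loops that depend on its size. -/
structure Input {n m : ℕ} (G : SimpleGraph (Fin n)) (D : BranchDecomposition (Fin n) (Fin m))
    (s : Store) : Prop where
  reg0 : s.reg 0 = n
  reg1 : s.reg 1 = m
  reg2 : s.reg 2 = m * m
  reg3 : s.reg 3 = m * m + 1
  reg4 : s.reg 4 = n + 1
  reg5 : s.reg 5 = 2 * n + 1
  reg6 : s.reg 6 = m * m * m
  reg7 : s.reg 7 = (m * m + 1) * n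
  reg8 : s.reg 8 = n * n
  arr0 : s.arr 0 = adjacencyArray G
  arr1 : s.arr 1 = adjacencyArray D.tree
  arr2 : s.arr 2 = leafArray D

namespace Code
open Tm

variable {n m : ℕ} {G : SimpleGraph (Fin n)} {D : BranchDecomposition (Fin n) (Fin m)}
  {s r : Store}

theorem _root_.EDS.Input.congr (h : Input G D s) (hr : ∀ x < 25, r.reg x = s.reg x)
    (ha : ∀ a < 3, r.arr a = s.arr a) : Input G D r := by
  constructor
  all_goals
    first
    | rw [hr _ (by norm_num)]
    | rw [ha _ (by norm_num)]
  exacts [h.reg0, h.reg1, h.reg2, h.reg3, h.reg4, h.reg5, h.reg6, h.reg7, h.reg8, h.arr0, h.arr1,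
    h.arr2]

theorem _root_.EDS.Input.den (h : Input G D s) (p : Stm) (hv : ∀ x ∈ p.vars, 25 ≤ x)
    (hw : ∀ a ∈ p.writes, 3 ≤ a) : Input G D (p.den s) :=
  h.congr (fun x hx => (p.den_frame s).1 x fun hx' => by have := hv x hx'; omega)
    fun a ha => (p.den_frame s).2 a fun ha' => by have := hw a ha'; omega

theorem _root_.EDS.Input.adj (h : Input G D s) (x y : Fin n) :
    s.arr 0 (x * n + y) ≠ 0 ↔ G.Adj x y := by
  classical
  rw [h.arr0, adjacencyArray_row]
  split_ifs <;> simp_all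

theorem _root_.EDS.Input.tree (h : Input G D s) (u v : Fin m) :
    s.arr 1 (u * m + v) ≠ 0 ↔ D.tree.Adj u v := by
  classical
  rw [h.arr1, adjacencyArray_row]
  split_ifs <;> simp_all

theorem powers_spec (h : Input G D s) {j : ℕ} (hj : j ≤ n) : (powers.den s).arr 3 j = 3 ^ j := by
  rw [powers, Stm.den_comp_self _ _ _ _ _ (by rw [h.reg4]; omega), eval_pow, Store.setReg_reg,
    Store.setReg_reg, if_pos rfl, if_neg (by norm_num), h.reg0, min_eq_left hj]

/-- The cells of the array `a` hold the nodes at distance at most `t` from `u`, in the tree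
without the edge `uv`. -/
def Walks (D : BranchDecomposition (Fin n) (Fin m)) (s : Store) (a t : ℕ) : Prop :=
  ∀ u v w : Fin m, s.arr a ((u * m + v) * m + w) ≠ 0 ↔
    ∃ p : (D.tree.deleteEdges {s(u, v)}).Walk u w, p.length ≤ t

theorem reachInit_spec (h : Input G D s) : Walks D (reachInit.den s) 4 0 := by
  intro u v w
  have hlt : (u.1 * m + v) * m + w < m * m * m := row_lt (row_lt u.2 v.2) w.2
  rw [reachInit, Stm.den_comp_self _ _ _ _ _ (by rw [h.reg6]; exact hlt)]
  refine (T_eq _ _ _).trans ?_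
  simp only [eval_mod, eval_div, eval_reg, Store.setReg_reg, OfNat.one_ne_ofNat, if_false, if_true,
    h.reg1, row_div w.2, row_div v.2, row_mod w.2]
  constructor
  · intro e
    obtain rfl : w = u := Fin.ext e
    exact ⟨.nil, le_rfl⟩
  · rintro ⟨p, hp⟩
    rw [SimpleGraph.Walk.eq_of_length_eq_zero (Nat.le_zero.1 hp)]

theorem reachStep_spec (h : Input G D s) {t : ℕ} (ht : Walks D s 4 t) :
    Walks D (reachStep.den s) 4 (t + 1) := by
  intro u v w
  have hlt : (u.1 * m + v) * m + w < m * m * m := row_lt (row_lt u.2 v.2) w.2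
  rw [reachStep, Stm.den_seq, Stm.den_comp_self _ _ _ _ _ (by
    rw [Stm.den_comp_reg, h.reg6]; exact hlt)]
  simp only [eval_cell, eval_reg, Store.setReg_reg, Store.setReg_arr, if_true]
  rw [Stm.den_comp_self _ _ _ _ _ (by rw [h.reg6]; exact hlt), exists_walk_le_succ, ← ht u v w]
  simp only [eval_bind, eval_div, eval_mod, eval_reg, Store.setReg_reg, Nat.reduceEqDiff,
    OfNat.one_ne_ofNat, if_false, if_true, h.reg1, row_div w.2, row_div v.2, row_mod w.2,
    row_mod v.2]
  refine (T_or _ _ _).trans ?_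
  simp only [T_cell, T_ex, T_and, T_or, T_no, T_eq, eval_add, eval_mul, eval_reg, Store.setReg_reg,
    Store.setReg_arr, Nat.reduceEqDiff, OfNat.one_ne_ofNat, if_false, if_true, h.reg1,
    exists_lt_iff]
  refine or_congr Iff.rfl (exists_congr fun y => and_congr (ht u v y) ?_)
  rw [h.tree, SimpleGraph.deleteEdges_adj, Set.mem_singleton_iff, Sym2.eq_iff]
  simp only [Fin.ext_iff]

theorem reach_spec (h : Input G D s) (u v w : Fin m) :
    ((Stm.rep 33 1 reachStep).den (reachInit.den s)).arr 4 ((u * m + v) * m + w) ≠ 0 ↔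
      (D.tree.deleteEdges {s(u, v)}).Reachable u w := by
  have h1 : Input G D (reachInit.den s) := h.den _ (by decide) (by decide)
  have hI := Stm.den_rep 33 1 reachStep (fun t r => Input G D r ∧ Walks D r 4 t) _
    ⟨h1, reachInit_spec h⟩ (by
      rintro t - r ⟨k1, k2⟩
      have k3 : Input G D (r.setReg 33 t) :=
        k1.congr (fun x hx => Store.setReg_reg_ne _ _ (by omega)) fun _ _ => rfl
      exact ⟨k3.den _ (by decide) (by decide), reachStep_spec k3 k2⟩)
  rw [h1.reg1] at hI
  rw [hI.2 u v w, exists_walk_le_iff]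

theorem degree_lt_two_iff (h : Input G D s) (w : Fin m) :
    ∑ i ∈ Finset.range m, s.arr 1 (w * m + i) < 2 ↔ IsLeaf D.tree w := by
  classical
  have e : ∑ i ∈ Finset.range m, s.arr 1 (w * m + i) = (D.tree.neighborSet w).ncard := by
    rw [Finset.sum_range]
    simp only [h.arr1, adjacencyArray_row]
    rw [← Finset.card_filter, ← Set.ncard_coe_finset]
    congr 1
    ext i
    simp
  rw [e, IsLeaf]
  omega

open Classical in
theorem sides_spec (h : Input G D s) (hr : ∀ u v w : Fin m,
      s.arr 4 ((u * m + v) * m + w) ≠ 0 ↔ (D.tree.deleteEdges {s(u, v)}).Reachable u w)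
    {c : ℕ} (hc : c < m * m + 1) (x : Fin n) :
    (sides.den s).arr 6 (c * n + x) = if x ∈ cutSide D c then 1 else 0 := by
  rw [sides, den_unpack (n := n) (N := m * m + 1) _ _ _ _ h.reg0 h.reg7 hc x.2, eval_ite, eval_yes,
    eval_const]
  simp only [T_lt, eval_reg, Store.setReg_reg, Nat.reduceEqDiff,
    if_false, if_true, h.reg2]
  rcases Nat.lt_succ_iff_lt_or_eq.1 hc with hc | rfl
  · rw [if_pos hc]
    obtain ⟨u, v, rfl⟩ := exists_row hc
    refine if_congr ?_ rfl rfl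
    rw [mem_cutSide_row]
    simp only [T_and, T_ex, T_lt, T_eq, T_cell, eval_cell, eval_add, eval_mul, eval_reg, eval_sum,
      eval_const, Store.setReg_reg, Store.setReg_arr, Nat.reduceEqDiff, OfNat.one_ne_ofNat,
      if_false, if_true, h.reg1, exists_lt_iff, h.tree, hr, degree_lt_two_iff h]
    refine and_congr_right fun _ => ?_
    simp only [BranchDecomposition.side, Set.mem_ofPred_eq]
    constructor
    · rintro ⟨w, hw, hx, hreach⟩
      rw [h.arr2, leafArray_leaf D hw] at hx
      rw [← Fin.ext hx, Equiv.symm_apply_apply]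
      exact hreach
    · intro hreach
      refine ⟨_, (D.leafEquiv.symm x).2, ?_, hreach⟩
      rw [h.arr2, leafArray_leaf D (D.leafEquiv.symm x).2]
      simp
  · rw [if_neg (lt_irrefl _), cutSide_top, if_pos (Set.mem_univ x)]

/-- The sides of the cuts have been computed. -/
def HasSides (D : BranchDecomposition (Fin n) (Fin m)) (s : Store) : Prop :=
  ∀ c < m * m + 1, ∀ x : Fin n, s.arr 6 (c * n + x) ≠ 0 ↔ x ∈ cutSide D c

theorem outers_spec (h : Input G D s) (h6 : HasSides D s) {c : ℕ} (hc : c < m * m + 1)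
    (x : Fin n) : (outers.den s).arr 7 (c * n + x) ≠ 0 ↔
      x ∈ cutSide D c ∧ ∃ y ∉ cutSide D c, G.Adj x y := by
  rw [outers, den_unpack (n := n) (N := m * m + 1) _ _ _ _ h.reg0 h.reg7 hc x.2]
  refine (T_ex _ _ _ _).trans ?_
  simp only [cross, side, adj, row, T_and, T_no, T_cell, eval_add, eval_mul, eval_reg,
    Store.setReg_reg, Store.setReg_arr, Nat.reduceEqDiff, OfNat.zero_ne_ofNat, if_false, if_true,
    h.reg0, exists_lt_iff, h6 c hc, h.adj]
  tauto

/-- The term tests only an inclusion of outer neighbourhoods; equality follows because the two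
boundary vertices may be exchanged. -/
theorem splits_spec (h : Input G D s) (h6 : HasSides D s)
    (h7 : ∀ c < m * m + 1, ∀ x : Fin n, s.arr 7 (c * n + x) ≠ 0 ↔
      x ∈ cutSide D c ∧ ∃ y ∉ cutSide D c, G.Adj x y) {c : ℕ} (hc : c < m * m + 1) :
    (splits.den s).arr 8 c ≠ 0 ↔ IsSplit G (cutSide D c) := by
  classical
  rw [splits, Stm.den_comp_self _ _ _ _ _ (by rw [h.reg3]; exact hc)]
  refine (T_and _ _ _).trans ?_
  simp only [cross, side, adj, outer, row, T_and, T_le, T_all, T_imp, T_no, T_cell, eval_add,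
    eval_mul, eval_reg, eval_cnt, eval_const, Store.setReg_reg, Store.setReg_arr,
    Nat.reduceEqDiff, OfNat.zero_ne_ofNat, if_false, if_true, h.reg0, forall_lt_iff,
    card_filter_range, h6 c hc, h7 c hc, h.adj]
  refine and_congr Iff.rfl (and_congr Iff.rfl ⟨fun H => ?_, fun H => ?_⟩)
  · have key : ∀ u ∈ cutSide D c, ∀ v ∈ cutSide D c,
        (G.neighborSet v ∩ (cutSide D c)ᶜ).Nonempty →
        G.neighborSet u ∩ (cutSide D c)ᶜ ⊆ G.neighborSet v ∩ (cutSide D c)ᶜ := by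
      rintro u hu v hv ⟨z, hz, hz'⟩ w ⟨hw, hw'⟩
      have := H u v w ⟨⟨hu, w, hw', hw⟩, ⟨hv, z, hz', hz⟩, hu, hw', hw⟩
      exact ⟨this.2.2, hw'⟩
    exact fun u hu v hv h1 h2 => (key u hu v hv h2).antisymm (key v hv u hu h1)
  · rintro u v w ⟨⟨hu, y, hy, huy⟩, ⟨hv, z, hz, hvz⟩, -, hw, huw⟩
    have e := H u hu v hv ⟨y, huy, hy⟩ ⟨z, hvz, hz⟩
    have : w ∈ G.neighborSet u ∩ (cutSide D c)ᶜ := ⟨huw, hw⟩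
    rw [e] at this
    exact ⟨hv, hw, this.1⟩

end Code
end EDS

/-! ### Greedy matchings across the cuts. -/

namespace EDS

/-- The matching of `Pairs` has the vertices `marked`, and `ord` is the number of their edge. -/
structure Marking {V : Type*} (G : SimpleGraph V) (A : Set V) (marked : V → Prop) (ord : V → ℕ)
    (g : ℕ) (a b : ℕ → V) : Prop extends Pairs G A g a b where
  marked_iff : ∀ x, marked x ↔ ∃ i < g, x = a i ∨ x = b i
  ordA : ∀ i < g, ord (a i) = i
  ordB : ∀ i < g, ord (b i) = i

section

variable {V : Type*} {G : SimpleGraph V} {A : Set V} {marked marked' : V → Prop}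
  {ord ord' : V → ℕ} {g : ℕ} {a b : ℕ → V}

theorem Marking.marked_iff_ord (h : Marking G A marked ord g a b) (x : V) :
    marked x ↔ ∃ i < g, (x = a i ∨ x = b i) ∧ ord x = i := by
  rw [h.marked_iff]
  constructor
  · rintro ⟨i, hi, rfl | rfl⟩
    · exact ⟨i, hi, Or.inl rfl, h.ordA i hi⟩
    · exact ⟨i, hi, Or.inr rfl, h.ordB i hi⟩
  · rintro ⟨i, hi, hx, -⟩
    exact ⟨i, hi, hx⟩

theorem Marking.ncard_marked [Finite V] (h : Marking G A marked ord g a b) :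
    {x | marked x}.ncard = 2 * g := by
  rw [← h.toPairs.ncard]
  congr 1
  ext x
  exact h.marked_iff x

theorem Marking.add (h : Marking G A marked ord g a b) {p q : V} (hp : p ∈ A) (hq : q ∉ A)
    (hpq : G.Adj p q) (hmp : ¬ marked p) (hmq : ¬ marked q)
    (hm : ∀ x, marked' x ↔ (x = p ∨ x = q) ∨ marked x)
    (hnew : ∀ x, x = p ∨ x = q → ord' x = g) (hold : ∀ x, marked x → ord' x = ord x) :
    Marking G A marked' ord' (g + 1) (Function.update a g p) (Function.update b g q) := by
  have hmA : ∀ i < g, marked (a i) := fun i hi => (h.marked_iff _).2 ⟨i, hi, Or.inl rfl⟩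
  have hmB : ∀ i < g, marked (b i) := fun i hi => (h.marked_iff _).2 ⟨i, hi, Or.inr rfl⟩
  have up : ∀ (f : ℕ → V) (v : V) (i : ℕ), i < g + 1 →
      (i < g ∧ Function.update f g v i = f i) ∨ (i = g ∧ Function.update f g v i = v) := by
    intro f v i hi
    rcases Nat.lt_succ_iff_lt_or_eq.1 hi with hi | rfl
    · exact Or.inl ⟨hi, Function.update_of_ne hi.ne _ _⟩
    · exact Or.inr ⟨rfl, Function.update_self _ _ _⟩
  have inj : ∀ (f : ℕ → V) (v : V), (∀ i < g, ∀ j < g, f i = f j → i = j) →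
      (∀ i < g, f i ≠ v) → ∀ i < g + 1, ∀ j < g + 1,
      Function.update f g v i = Function.update f g v j → i = j := by
    intro f v h1 h2 i hi j hj e
    rcases up f v i hi with ⟨hi, ei⟩ | ⟨rfl, ei⟩ <;> rcases up f v j hj with ⟨hj, ej⟩ | ⟨rfl, ej⟩
    · exact h1 i hi j hj (ei.symm.trans (e.trans ej))
    · exact absurd (ei.symm.trans (e.trans ej)) (h2 i hi)
    · exact absurd (ej.symm.trans (e.symm.trans ei)) (h2 j hj)
    · rfl
  refine ⟨⟨fun i hi => ?_, fun i hi => ?_, fun i hi => ?_, inj a p h.injA fun i hi e => hmp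
    (e ▸ hmA i hi), inj b q h.injB fun i hi e => hmq (e ▸ hmB i hi)⟩, fun x => ?_, fun i hi => ?_,
    fun i hi => ?_⟩
  · rcases up a p i hi with ⟨hi, e⟩ | ⟨rfl, e⟩ <;> rw [e]
    exacts [h.mem i hi, hp]
  · rcases up b q i hi with ⟨hi, e⟩ | ⟨rfl, e⟩ <;> rw [e]
    exacts [h.notMem i hi, hq]
  · rcases up a p i hi with ⟨hi, e⟩ | ⟨rfl, e⟩
    · rw [e, Function.update_of_ne hi.ne]; exact h.adj i hi
    · rw [e, Function.update_self]; exact hpq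
  · rw [hm, h.marked_iff]
    constructor
    · rintro (hx | ⟨i, hi, hx⟩)
      · exact ⟨g, by omega, by simpa using hx⟩
      · refine ⟨i, by omega, ?_⟩
        rwa [Function.update_of_ne hi.ne, Function.update_of_ne hi.ne]
    · rintro ⟨i, hi, hx⟩
      rcases Nat.lt_succ_iff_lt_or_eq.1 hi with hi | rfl
      · rw [Function.update_of_ne hi.ne, Function.update_of_ne hi.ne] at hx
        exact Or.inr ⟨i, hi, hx⟩
      · left; simpa using hx
  · rcases up a p i hi with ⟨hi, e⟩ | ⟨rfl, e⟩ <;> rw [e]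
    · rw [hold _ (hmA i hi), h.ordA i hi]
    · exact hnew p (Or.inl rfl)
  · rcases up b q i hi with ⟨hi, e⟩ | ⟨rfl, e⟩ <;> rw [e]
    · rw [hold _ (hmB i hi), h.ordB i hi]
    · exact hnew q (Or.inr rfl)

theorem Marking.congr (h : Marking G A marked ord g a b) (hm : ∀ x, marked' x ↔ marked x)
    (ho : ∀ x, ord' x = ord x) : Marking G A marked' ord' g a b :=
  ⟨h.toPairs, fun x => (hm x).trans (h.marked_iff x), fun i hi => (ho _).trans (h.ordA i hi),
    fun i hi => (ho _).trans (h.ordB i hi)⟩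

end

namespace Code
open Tm

variable {n m : ℕ} {G : SimpleGraph (Fin n)} {D : BranchDecomposition (Fin n) (Fin m)}
  {s r : Store}

/-- The arrays `9` and `11` hold a matching of the edges across the cut `c` that meets all those
edges with a number less than `t`. -/
def Greedy (G : SimpleGraph (Fin n)) (A : Set (Fin n)) (s : Store) (c t : ℕ) : Prop :=
  ∃ g a b, Marking G A (fun x : Fin n => s.arr 9 (c * n + x) ≠ 0)
      (fun x : Fin n => s.arr 11 (c * n + x)) g a b ∧
    ∀ x ∈ A, ∀ y ∉ A, G.Adj x y → x.1 * n + y < t →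
      s.arr 9 (c * n + x) ≠ 0 ∨ s.arr 9 (c * n + y) ≠ 0

/-- The edge `pq` across the cut `c` is added to the matching. -/
def Adds (G : SimpleGraph (Fin n)) (D : BranchDecomposition (Fin n) (Fin m)) (s : Store) (c : ℕ)
    (p q : Fin n) : Prop :=
  (p ∈ cutSide D c ∧ q ∉ cutSide D c ∧ G.Adj p q) ∧
    ¬ s.arr 9 (c * n + p) ≠ 0 ∧ ¬ s.arr 9 (c * n + q) ≠ 0

theorem T_newPair (h : Input G D s) (h6 : HasSides D s) {c : ℕ} (hc : c < m * m + 1)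
    {p q : Fin n} (x : Fin n) (h33 : s.reg 33 = p * n + q) (h26 : s.reg 26 = c)
    (h27 : s.reg 27 = x) : newPair.T s ↔ Adds G D s c p q ∧ (x = p ∨ x = q) := by
  simp only [newPair, cross, side, adj, marked, row, T_and, T_or, T_no, T_eq, T_cell, eval_add,
    eval_mul, eval_div, eval_mod, eval_reg, h.reg0, h33, h26, h27, row_div q.2, row_mod q.2,
    h6 c hc, h.adj, Adds, Fin.ext_iff]

open Classical in
theorem greedyStep_spec (h : Input G D s) (h6 : HasSides D s) {c : ℕ} (hc : c < m * m + 1)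
    {p q : Fin n} (h33 : s.reg 33 = p * n + q) (x : Fin n) :
    ((greedyStep.den s).arr 9 (c * n + x) ≠ 0 ↔
      Adds G D s c p q ∧ (x = p ∨ x = q) ∨ s.arr 9 (c * n + x) ≠ 0) ∧
    (greedyStep.den s).arr 11 (c * n + x) = if Adds G D s c p q ∧ (x = p ∨ x = q) then
      {x : Fin n | s.arr 9 (c * n + x) ≠ 0}.ncard / 2 else s.arr 11 (c * n + x) := by
  have hlt : c * n + x.1 < (m * m + 1) * n := row_lt hc x.2
  rw [greedyStep]
  simp only [Stm.den_seq]
  set s1 := Stm.den _ s with h1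
  set s2 := Stm.den _ s1 with h2
  set s3 := Stm.den _ s2 with h3
  have r1 : ∀ x, s1.reg x = s.reg x := fun _ => rfl
  have r2 : ∀ x, s2.reg x = s.reg x := fun _ => rfl
  have r3 : ∀ x, s3.reg x = s.reg x := fun _ => rfl
  have a1 : ∀ b, b ≠ 10 → s1.arr b = s.arr b := fun b hb => Stm.den_comp_ne hb
  have a2 : ∀ b, b ≠ 12 → s2.arr b = s1.arr b := fun b hb => Stm.den_comp_ne hb
  have a3 : ∀ b, b ≠ 9 → s3.arr b = s2.arr b := fun b hb => Stm.den_comp_ne hb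
  have i1 : Input G D s1 := h.congr (fun _ _ => rfl) fun b hb => a1 b (by omega)
  have j1 : HasSides D s1 := fun c hc x => by rw [a1 _ (by norm_num)]; exact h6 c hc x
  have v10 : s1.arr 10 (c * n + x) ≠ 0 ↔ Adds G D s c p q ∧ (x = p ∨ x = q) ∨
      s.arr 9 (c * n + x) ≠ 0 := by
    rw [h1, den_unpack (n := n) (N := m * m + 1) _ _ _ _ h.reg0 h.reg7 hc x.2]
    refine (T_ite _ _ _ _).trans ?_
    rw [T_newPair (G := G) (D := D) (p := p) (q := q) (x := x) (c := c)]
    · simp only [T_const, T_cell, eval_reg, Store.setReg_reg, Store.setReg_arr, Nat.reduceEqDiff,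
        if_false, if_true]
      have e : Adds G D (((s.setReg 25 (c * n + x)).setReg 26 c).setReg 27 x) c p q ↔
        Adds G D s c p q := Iff.rfl
      rw [e]
      tauto
    · exact h.congr (fun y hy => by simp only [Store.setReg_reg]; split_ifs <;> omega) fun _ _ => rfl
    · exact h6
    · exact hc
    · exact h33
    · rfl
    · rfl
  have v12 : s2.arr 12 (c * n + x) = if Adds G D s c p q ∧ (x = p ∨ x = q) then
      {x : Fin n | s.arr 9 (c * n + x) ≠ 0}.ncard / 2 else s.arr 11 (c * n + x) := by
    rw [h2, den_unpack (n := n) (N := m * m + 1) _ _ _ _ i1.reg0 i1.reg7 hc x.2, eval_ite,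
      T_newPair (G := G) (D := D) (p := p) (q := q) (x := x) (c := c)]
    · have e : Adds G D (((s1.setReg 25 (c * n + x)).setReg 26 c).setReg 27 x) c p q ↔
        Adds G D s c p q := by
        unfold Adds
        simp only [Store.setReg_arr]
        rw [a1 9 (by norm_num)]
      simp only [e, marked, row, T_cell, eval_div, eval_cnt, eval_cell, eval_add, eval_mul,
        eval_reg, eval_const, Store.setReg_reg, Store.setReg_arr, Nat.reduceEqDiff,
        OfNat.zero_ne_ofNat, if_false, if_true, r1, h.reg0, card_filter_range]
      rw [a1 9 (by norm_num), a1 11 (by norm_num)]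
    · exact i1.congr (fun y hy => by simp only [Store.setReg_reg]; split_ifs <;> omega) fun _ _ => rfl
    · exact j1
    · exact hc
    · exact h33
    · rfl
    · rfl
  constructor
  · rw [Stm.den_comp_ne (by norm_num), h3, Stm.den_comp_self _ _ _ _ _ (by
      rw [r2, h.reg7]; exact hlt), ← v10]
    simp only [eval_cell, eval_reg, Store.setReg_reg, Store.setReg_arr, if_true]
    rw [a2 _ (by norm_num)]
  · rw [Stm.den_comp_self _ _ _ _ _ (by rw [r3, h.reg7]; exact hlt), ← v12]
    simp only [eval_cell, eval_reg, Store.setReg_reg, Store.setReg_arr, if_true]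
    rw [a3 _ (by norm_num)]

/-- The pairs of vertices are tried in the order of their numbers. A crossing pair that is not added
has a matched end already, and matched vertices stay matched, so the matching is maximal in the end.
-/
theorem greedy_step (h : Input G D s) (h6 : HasSides D s) {c : ℕ} (hc : c < m * m + 1) {t : ℕ}
    (ht : t < n * n) (h33 : s.reg 33 = t) (hg : Greedy G (cutSide D c) s c t) :
    Greedy G (cutSide D c) (greedyStep.den s) c (t + 1) := by
  classical
  obtain ⟨p, q, rfl⟩ := exists_row ht
  obtain ⟨g, a, b, hM, hmax⟩ := hg
  have spec := greedyStep_spec h h6 hc h33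
  have mono : ∀ x : Fin n, s.arr 9 (c * n + x) ≠ 0 → (greedyStep.den s).arr 9 (c * n + x) ≠ 0 :=
    fun x hx => (spec x).1.2 (Or.inr hx)
  have last : ∀ x y : Fin n, x.1 * n + y < p.1 * n + q + 1 → x.1 * n + y < p.1 * n + q ∨
      x = p ∧ y = q := by
    intro x y hxy
    rcases Nat.lt_succ_iff_lt_or_eq.1 hxy with hlt | e
    · exact Or.inl hlt
    · exact Or.inr ⟨Fin.ext (by rw [← row_div (c := x.1) y.2, e, row_div q.2]),
        Fin.ext (by rw [← row_mod (c := x.1) y.2, e, row_mod q.2])⟩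
  by_cases hadd : Adds G D s c p q
  · simp only [hadd, true_and] at spec
    refine ⟨g + 1, _, _, hM.add hadd.1.1 hadd.1.2.1 hadd.1.2.2 hadd.2.1 hadd.2.2
      (fun x => (spec x).1) (fun x hx => ?_) (fun x hx => ?_), fun x hx y hy hxy hlt => ?_⟩
    · rw [(spec x).2, if_pos hx, hM.ncard_marked]; omega
    · rw [(spec x).2, if_neg]
      rintro (rfl | rfl)
      exacts [hadd.2.1 hx, hadd.2.2 hx]
    · rcases last x y hlt with hlt | ⟨rfl, rfl⟩
      · exact (hmax x hx y hy hxy hlt).imp (mono x) (mono y)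
      · exact Or.inl ((spec x).1.2 (Or.inl (Or.inl rfl)))
  · simp only [hadd, false_and, false_or, if_false] at spec
    refine ⟨g, a, b, hM.congr (fun x => (spec x).1) fun x => (spec x).2,
      fun x hx y hy hxy hlt => ?_⟩
    rcases last x y hlt with hlt | ⟨rfl, rfl⟩
    · exact (hmax x hx y hy hxy hlt).imp (mono x) (mono y)
    · by_contra hcon
      rw [not_or] at hcon
      exact hadd ⟨⟨hx, hy, hxy⟩, fun h' => hcon.1 (mono _ h'), fun h' => hcon.2 (mono _ h')⟩

/-- What `cuts` computes. -/
structure HasCuts (G : SimpleGraph (Fin n)) (D : BranchDecomposition (Fin n) (Fin m)) (s : Store) :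
    Prop extends Input G D s where
  pow : ∀ j ≤ n, s.arr 3 j = 3 ^ j
  side_le : ∀ c < m * m + 1, ∀ x : Fin n, s.arr 6 (c * n + x) ≤ 1
  side : HasSides D s
  outer : ∀ c < m * m + 1, ∀ x : Fin n, s.arr 7 (c * n + x) ≠ 0 ↔
    x ∈ cutSide D c ∧ ∃ y ∉ cutSide D c, G.Adj x y
  split : ∀ c < m * m + 1, s.arr 8 c ≠ 0 ↔ IsSplit G (cutSide D c)
  greedy : ∀ c < m * m + 1, Greedy G (cutSide D c) s c (n * n)

theorem HasCuts.congr (h : HasCuts G D s) (hr : ∀ x < 9, r.reg x = s.reg x)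
    (ha : ∀ a < 13, r.arr a = s.arr a) : HasCuts G D r := by
  refine ⟨⟨?_, ?_, ?_, ?_, ?_, ?_, ?_, ?_, ?_, ?_, ?_, ?_⟩, ?_, ?_, ?_, ?_, ?_, ?_⟩
  case refine_18 =>
    unfold Greedy
    rw [ha 9 (by norm_num), ha 11 (by norm_num)]
    exact h.greedy
  all_goals
    try unfold HasSides
    first
    | rw [hr _ (by norm_num)]
    | rw [ha _ (by norm_num)]
  exacts [h.reg0, h.reg1, h.reg2, h.reg3, h.reg4, h.reg5, h.reg6, h.reg7, h.reg8, h.arr0, h.arr1,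
    h.arr2, h.pow, h.side_le, h.side, h.outer, h.split]

theorem cuts_spec (h : Input G D s) (h9 : ∀ i, s.arr 9 i = 0) : HasCuts G D (cuts.den s) := by
  classical
  unfold cuts
  simp only [Stm.den_seq]
  set s1 := powers.den s with h1
  have i1 : Input G D s1 := h.den _ (by decide) (by decide)
  have p1 : ∀ j ≤ n, s1.arr 3 j = 3 ^ j := fun j hj => powers_spec h hj
  set s2 := Stm.den (.rep 33 1 reachStep) (reachInit.den s1) with h2
  have i2 : Input G D s2 := (i1.den reachInit (by decide) (by decide)).den _ (by decide) (by decide)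
  have a2 : ∀ b, b ∉ [4, 5] → s2.arr b = s1.arr b := fun b hb => by
    rw [h2, (Stm.den_frame _ _).2 b (fun h' => hb (by revert h'; simp [reachStep, Stm.writes]; omega)),
      (Stm.den_frame _ _).2 b (fun h' => hb (by revert h'; simp [reachInit, Stm.writes]; omega))]
  set s3 := sides.den s2 with h3
  have i3 : Input G D s3 := i2.den _ (by decide) (by decide)
  have a3 : ∀ b, b ≠ 6 → s3.arr b = s2.arr b := fun b hb => Stm.den_comp_ne hb
  have v6 : ∀ c < m * m + 1, ∀ x : Fin n, s3.arr 6 (c * n + x) = if x ∈ cutSide D c then 1 else 0 :=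
    fun c hc x => sides_spec i2 (reach_spec i1) hc x
  have S3 : HasSides D s3 := fun c hc x => by rw [v6 c hc x]; split_ifs <;> simp_all
  set s4 := outers.den s3 with h4
  have i4 : Input G D s4 := i3.den _ (by decide) (by decide)
  have a4 : ∀ b, b ≠ 7 → s4.arr b = s3.arr b := fun b hb => Stm.den_comp_ne hb
  have S4 : HasSides D s4 := fun c hc x => by rw [a4 _ (by norm_num)]; exact S3 c hc x
  have v7 : ∀ c < m * m + 1, ∀ x : Fin n, s4.arr 7 (c * n + x) ≠ 0 ↔
      x ∈ cutSide D c ∧ ∃ y ∉ cutSide D c, G.Adj x y := fun c hc x => outers_spec i3 S3 hc x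
  set s5 := splits.den s4 with h5
  have i5 : Input G D s5 := i4.den _ (by decide) (by decide)
  have a5 : ∀ b, b ≠ 8 → s5.arr b = s4.arr b := fun b hb => Stm.den_comp_ne hb
  have v8 : ∀ c < m * m + 1, s5.arr 8 c ≠ 0 ↔ IsSplit G (cutSide D c) :=
    fun c hc => splits_spec i4 S4 v7 hc
  have S5 : HasSides D s5 := fun c hc x => by rw [a5 _ (by norm_num)]; exact S4 c hc x
  have z9 : ∀ i, s5.arr 9 i = 0 := fun i => by
    rw [a5 _ (by norm_num), a4 _ (by norm_num), a3 _ (by norm_num), a2 _ (by decide), h1,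
      (powers.den_frame _).2 9 (by decide), h9]
  have hI := Stm.den_rep 33 8 greedyStep (fun t r => Input G D r ∧ HasSides D r ∧
    ∀ c < m * m + 1, Greedy G (cutSide D c) r c t) s5 ⟨i5, S5, fun c hc => ⟨0,
      fun _ => ⟨0, D.pos⟩, fun _ => ⟨0, D.pos⟩, ⟨⟨by simp, by simp, by simp, by simp, by simp⟩,
        by simp [z9], by simp, by simp⟩, by simp⟩⟩ (by
    rintro t ht r ⟨k1, k2, k3⟩
    rw [i5.reg8] at ht
    have k4 : Input G D (r.setReg 33 t) :=
      k1.congr (fun x hx => Store.setReg_reg_ne _ _ (by omega)) fun _ _ => rfl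
    refine ⟨k4.den _ (by decide) (by decide), ?_, fun c hc =>
      greedy_step k4 k2 hc ht (Store.setReg_reg_self _ _ _) (k3 c hc)⟩
    unfold HasSides
    rw [(greedyStep.den_frame _).2 6 (by decide)]
    exact k2)
  rw [i5.reg8] at hI
  have a6 : ∀ b < 9, ((Stm.rep 33 8 greedyStep).den s5).arr b = s5.arr b := fun b hb =>
    (Stm.den_frame _ _).2 b (fun h' => by revert h'; simp [greedyStep, Stm.writes]; omega)
  refine ⟨hI.1, ?_, ?_, hI.2.1, ?_, ?_, hI.2.2⟩ <;> rw [a6 _ (by norm_num)]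
  · rw [a5 _ (by norm_num), a4 _ (by norm_num), a3 _ (by norm_num), a2 _ (by decide)]
    exact p1
  · rw [a5 _ (by norm_num), a4 _ (by norm_num)]
    intro c hc x
    rw [v6 c hc x]
    split_ifs <;> simp
  · rw [a5 _ (by norm_num)]
    exact v7
  · exact v8

end Code
end EDS

/-! ### Covers of the crossing edges by exhaustive search. -/

namespace EDS

theorem leastBelow_of_lt {f : ℕ → ℕ} {N i : ℕ} (hi : i < N) (h : f i ≠ 0) :
    leastBelow f N ≤ i ∧ f (leastBelow f N) ≠ 0 := by
  have h1 := leastBelow_le_of f N i h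
  exact ⟨h1, leastBelow_spec f N (by omega)⟩

namespace Code
open Tm

variable {n m : ℕ} {G : SimpleGraph (Fin n)} {D : BranchDecomposition (Fin n) (Fin m)}
  {s r : Store}

theorem HasCuts.setReg (h : HasCuts G D s) {v : ℕ} (hv : 9 ≤ v) (i : ℕ) :
    HasCuts G D (s.setReg v i) :=
  h.congr (fun _ _ => Store.setReg_reg_ne _ _ (by omega)) fun _ _ => rfl

/-- The vertices of the matching at the cut `c`. -/
def isMarked (s : Store) (c : ℕ) (x : Fin n) : Prop := s.arr 9 (c * n + x) ≠ 0

/-- The numbers of the edges of the matching at the cut `c`. -/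
def number (s : Store) (c : ℕ) (x : Fin n) : ℕ := s.arr 11 (c * n + x)

theorem HasCuts.marking (h : HasCuts G D s) {c : ℕ} (hc : c < m * m + 1) :
    ∃ g a b, Marking G (cutSide D c) (isMarked s c) (number s c) g a b ∧ g ≤ n ∧
      ∀ x ∈ cutSide D c, ∀ y ∉ cutSide D c, G.Adj x y → isMarked s c x ∨ isMarked s c y := by
  obtain ⟨g, a, b, hM, hmax⟩ := h.greedy c hc
  refine ⟨g, a, b, hM, ?_, fun x hx y hy hxy => hmax x hx y hy hxy (row_lt x.2 y.2)⟩
  have h1 := hM.ncard_marked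
  have h2 := Set.ncard_le_card {x : Fin n | s.arr 9 (c * n + x) ≠ 0}
  rw [Nat.card_eq_fintype_card, Fintype.card_fin] at h2
  omega

/-- The program is not told the width. It takes the least `L` that works for its own matchings, and
these have at most `mm` edges, hence no more than the width at cuts that are no splits. The bound
`n` keeps `3 ^ L` within the table of powers. -/
theorem codeBound_spec (h : HasCuts G D s) : ∃ L ≤ min (D.smWidth G) n, codeBound.eval s = 3 ^ L ∧
    ∀ c < m * m + 1, ¬ IsSplit G (cutSide D c) → {x | isMarked (n := n) s c x}.ncard ≤ 2 * L := by
  have key : ∀ L, (Tm.all 34 3 ((split (.reg 34)).or ((Tm.cnt 35 0 (marked (.reg 34)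
      (.reg 35))).le ((Tm.const 2).mul (.reg 38))))).eval (s.setReg 38 L) ≠ 0 ↔
      ∀ c < m * m + 1, ¬ IsSplit G (cutSide D c) → {x | isMarked (n := n) s c x}.ncard ≤ 2 * L := by
    classical
    intro L
    refine (T_all _ _ _ _).trans ?_
    simp only [split, marked, row, T_or, T_le, T_cell, eval_cnt, eval_add, eval_mul, eval_const,
      eval_reg, Store.setReg_reg, Store.setReg_arr, Nat.reduceEqDiff, OfNat.zero_ne_ofNat,
      if_false, if_true, h.reg0, h.reg3, card_filter_range]
    refine forall_congr' fun c => imp_congr_right fun hc => ?_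
    rw [h.split c hc, or_iff_not_imp_left]
    rfl
  obtain ⟨h1, h2⟩ := leastBelow_of_lt (N := n + 1) (i := min (D.smWidth G) n)
    (f := fun L => (Tm.all 34 3 ((split (.reg 34)).or ((Tm.cnt 35 0 (marked (.reg 34)
      (.reg 35))).le ((Tm.const 2).mul (.reg 38))))).eval (s.setReg 38 L)) (by omega)
    ((key _).2 fun c hc hs => by
      obtain ⟨g, a, b, hM, hg, -⟩ := h.marking hc
      have h1 := hM.ncard_marked
      have h2 := hM.toPairs.le_mm.trans (mm_cutSide_le G D hc hs)
      rw [h1]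
      have := le_min h2 hg
      omega)
  refine ⟨_, h1, ?_, (key _).1 h2⟩
  rw [codeBound, eval_bind, eval_least, eval_cell, eval_reg, Store.setReg_reg, if_pos rfl, h.reg4]
  exact h.pow _ (h1.trans (min_le_right _ _))

theorem T_chosen (h : HasCuts G D s) {y z : ℕ} {c : ℕ} (hc : c < m * m + 1) {x : Fin n}
    (hy : s.reg y = c) (hz : s.reg z = x) (hx : isMarked s c x) :
    (chosen (.reg y) (.reg z)).T s ↔ Chosen (cutSide D c) (number s c) (s.reg 36) x := by
  have hp : s.arr 3 (s.arr 11 (c * n + x)) = 3 ^ number s c x := by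
    obtain ⟨g, a, b, hM, hg, -⟩ := h.marking hc
    obtain ⟨i, hi, -, hx'⟩ := (hM.marked_iff_ord x).1 hx
    exact h.pow _ (show number s c x ≤ n by omega)
  simp only [chosen, Code.side, row, T_ite, T_no, T_eq, T_cell, eval_mod, eval_div, eval_cell,
    eval_add, eval_mul, eval_reg, eval_const, h.reg0, hy, hz, hp, h.side c hc, Chosen, ne_eq]

theorem T_decode (h : HasCuts G D s) {y z : ℕ} (hy38 : y ≠ 38) (hz38 : z ≠ 38) {c : ℕ}
    (hc : c < m * m + 1) {x : Fin n} (hy : s.reg y = c) (hz : s.reg z = x) :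
    (decode (.reg y) (.reg z)).T s ↔
      Decode G (cutSide D c) (isMarked s c) (number s c) (s.reg 36) x := by
  have hm : (marked (.reg y) (.reg z)).T s ↔ isMarked s c x := by
    simp only [marked, row, T_cell, eval_add, eval_mul, eval_reg, h.reg0, hy, hz, isMarked]
  have hex : (Tm.ex 38 0 (((cross (.reg y) (.reg z) (.reg 38)).or
      (cross (.reg y) (.reg 38) (.reg z))).and ((marked (.reg y) (.reg 38)).and
      (chosen (.reg y) (.reg 38)).no))).T s ↔ ∃ w, G.Adj x w ∧
        (x ∈ cutSide D c ↔ w ∉ cutSide D c) ∧ isMarked s c w ∧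
        ¬ Chosen (cutSide D c) (number s c) (s.reg 36) w := by
    rw [T_ex, h.reg0, exists_lt_iff]
    refine exists_congr fun w => ?_
    have h' := h.setReg (v := 38) (by norm_num) w
    have e1 : (s.setReg 38 w).reg y = c := by rw [Store.setReg_reg, if_neg hy38, hy]
    have e2 : (s.setReg 38 w).reg z = x := by rw [Store.setReg_reg, if_neg hz38, hz]
    have e3 : (s.setReg 38 w).reg 38 = w := Store.setReg_reg_self _ _ _
    have hmw : (marked (.reg y) (.reg 38)).T (s.setReg 38 w) ↔ isMarked s c w := by
      simp only [marked, row, T_cell, eval_add, eval_mul, eval_reg, h'.reg0, e1, e3, isMarked]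
      rfl
    rw [T_and, T_and, T_no, hmw]
    have hcr : ((cross (.reg y) (.reg z) (.reg 38)).or (cross (.reg y) (.reg 38) (.reg z))).T
        (s.setReg 38 w) ↔ G.Adj x w ∧ (x ∈ cutSide D c ↔ w ∉ cutSide D c) := by
      simp only [cross, Code.side, Code.adj, row, T_or, T_and, T_no, T_cell, eval_add, eval_mul,
        eval_reg, h'.reg0, e1, e2, e3, h'.side c hc, h'.adj, G.adj_comm w x]
      by_cases hx : x ∈ cutSide D c <;> by_cases hw : w ∈ cutSide D c <;> simp [hx, hw]
    rw [hcr, and_assoc]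
    refine and_congr_right fun _ => and_congr_right fun _ => and_congr_right fun hw => ?_
    rw [T_chosen h' hc e1 e3 hw]
    simp only [Store.setReg_reg, Nat.reduceEqDiff, if_false]
    rfl
  rw [decode, T_ite, hm, hex, Decode]
  exact and_congr (imp_congr_right fun hx => T_chosen h hc hy hz hx) Iff.rfl

/-- The set with code `z` for the cut `c`. -/
def decoded (G : SimpleGraph (Fin n)) (D : BranchDecomposition (Fin n) (Fin m)) (s : Store)
    (c z : ℕ) : Set (Fin n) :=
  {x | Decode G (cutSide D c) (isMarked s c) (number s c) z x}

/-- The set with code `z` covers the edges across the cut `c`. -/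
def IsCode (G : SimpleGraph (Fin n)) (D : BranchDecomposition (Fin n) (Fin m)) (s : Store)
    (c z : ℕ) : Prop :=
  ∀ x ∈ cutSide D c, ∀ y ∉ cutSide D c, G.Adj x y → x ∈ decoded G D s c z ∨ y ∈ decoded G D s c z

theorem decoded_congr (h9 : r.arr 9 = s.arr 9) (h11 : r.arr 11 = s.arr 11) (c z : ℕ) :
    decoded G D r c z = decoded G D s c z := by
  unfold decoded isMarked number
  rw [h9, h11]

theorem T_isCover (h : HasCuts G D s) {c : ℕ} (hc : c < m * m + 1) (h25 : s.reg 25 = c) :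
    (isCover (.reg 25)).T s ↔ IsCode G D s c (s.reg 36) := by
  simp only [isCover, cross, Code.side, Code.adj, row, T_all, T_imp, T_or, T_and, T_no, T_cell,
    eval_add, eval_mul, eval_reg, Store.setReg_reg, Store.setReg_arr, Nat.reduceEqDiff,
    OfNat.zero_ne_ofNat, if_false, if_true, h.reg0, h25, forall_lt_iff, h.side c hc, h.adj]
  refine ⟨fun H x hx y hy hxy => ?_, fun H x y hxy => ?_⟩
  all_goals
    have h' := (h.setReg (v := 34) (by norm_num) x).setReg (v := 35) (by norm_num) y
    have e := T_decode h' (y := 25) (z := 34) (by norm_num) (by norm_num) hc (x := x)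
      (by simp [Store.setReg_reg, h25]) (by simp [Store.setReg_reg])
    have e' := T_decode h' (y := 25) (z := 35) (by norm_num) (by norm_num) hc (x := y)
      (by simp [Store.setReg_reg, h25]) (by simp [Store.setReg_reg])
  · have := H x y ⟨hx, hy, hxy⟩
    rw [e, e'] at this
    exact this
  · rw [e, e']
    exact H x hxy.1 y hxy.2.1 hxy.2.2

theorem eval_coverSize (h : HasCuts G D s) {c : ℕ} (hc : c < m * m + 1) (h25 : s.reg 25 = c) :
    (coverSize (.reg 25)).eval s = (decoded G D s c (s.reg 36)).ncard := by
  classical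
  rw [coverSize, eval_cnt, h.reg0, card_filter_range]
  congr 1
  ext x
  have h' := h.setReg (v := 34) (by norm_num) x
  exact T_decode h' (y := 25) (z := 34) (by norm_num) (by norm_num) hc (x := x)
      (by simp [Store.setReg_reg, h25]) (by simp [Store.setReg_reg])

/-- The cover of the cut `c` that has been computed. -/
def coverSet (n : ℕ) (s : Store) (c : ℕ) : Set (Fin n) := {x | s.arr 15 (c * n + x) ≠ 0}

/-- Trying all `3 ^ L` codes fits into the time bound. Some code gives a cover of size at most `mm`,
so the smallest decoded cover is at most as large, even if it is not proved to be a minimum among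
all covers. -/
theorem covers_spec (h : HasCuts G D s) {L : ℕ} (hL : s.reg 9 = 3 ^ L)
    (hLm : ∀ c < m * m + 1, ¬ IsSplit G (cutSide D c) → {x | isMarked (n := n) s c x}.ncard ≤ 2 * L) :
    HasCuts G D (covers.den s) ∧ ∀ c < m * m + 1,
      (∀ x : Fin n, (covers.den s).arr 16 (c * n + x) =
        {y | y < x ∧ y ∈ coverSet n (covers.den s) c}.ncard) ∧
      (¬ IsSplit G (cutSide D c) →
        (∀ a ∈ cutSide D c, ∀ b ∉ cutSide D c, G.Adj a b →
          a ∈ coverSet n (covers.den s) c ∨ b ∈ coverSet n (covers.den s) c) ∧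
        (covers.den s).arr 13 c = (coverSet n (covers.den s) c).ncard ∧
        (covers.den s).arr 13 c ≤ D.smWidth G) := by
  classical
  have hH : HasCuts G D (covers.den s) := h.congr
    (fun x hx => (covers.den_frame s).1 x (by simp [covers, Stm.vars]))
    fun a ha => (covers.den_frame s).2 a fun h' => by revert h'; simp [covers, Stm.writes]; omega
  refine ⟨hH, fun c hc => ?_⟩
  unfold covers
  simp only [Stm.den_seq]
  set s1 := Stm.den _ s with h1
  set s2 := Stm.den _ s1 with h2
  set s3 := Stm.den _ s2 with h3
  set s4 := Stm.den _ s3 with h4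
  have r1 : ∀ x, s1.reg x = s.reg x := fun _ => rfl
  have r2 : ∀ x, s2.reg x = s.reg x := fun _ => rfl
  have r3 : ∀ x, s3.reg x = s.reg x := fun _ => rfl
  have a1 : ∀ b, b ≠ 13 → s1.arr b = s.arr b := fun b hb => Stm.den_comp_ne hb
  have a2 : ∀ b, b ≠ 14 → s2.arr b = s1.arr b := fun b hb => Stm.den_comp_ne hb
  have a3 : ∀ b, b ≠ 15 → s3.arr b = s2.arr b := fun b hb => Stm.den_comp_ne hb
  have a4 : ∀ b, b ≠ 16 → s4.arr b = s3.arr b := fun b hb => Stm.den_comp_ne hb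
  have c1 : HasCuts G D s1 := h.congr (fun _ _ => rfl) fun b hb => a1 b (by omega)
  have c2 : HasCuts G D s2 := c1.congr (fun _ _ => rfl) fun b hb => a2 b (by omega)
  have c3 : HasCuts G D s3 := c2.congr (fun _ _ => rfl) fun b hb => a3 b (by omega)
  have d1 : ∀ z, decoded G D s1 c z = decoded G D s c z := fun z =>
    decoded_congr (a1 _ (by norm_num)) (a1 _ (by norm_num)) c z
  have d2 : ∀ z, decoded G D s2 c z = decoded G D s c z := fun z =>
    (decoded_congr (a2 _ (by norm_num)) (a2 _ (by norm_num)) c z).trans (d1 z)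
  have v15 : coverSet n s3 c = decoded G D s c (s2.arr 14 c) := by
    ext x
    rw [← d2]
    refine Iff.trans (b := s3.arr 15 (c * n + x) ≠ 0) Iff.rfl ?_
    rw [h3, den_unpack (n := n) (N := m * m + 1) _ _ _ _ (by rw [r2, h.reg0])
      (by rw [r2, h.reg7]) hc x.2, eval_bind]
    refine (T_yes _ _).trans ?_
    rw [T_decode (c := c) (x := x) (G := G) (D := D)
      ((((c2.setReg (by norm_num) _).setReg (by norm_num) _).setReg (by norm_num) _).setReg
        (by norm_num) _) (by norm_num) (by norm_num) hc
        (by simp [Store.setReg_reg]) (by simp [Store.setReg_reg])]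
    simp only [Store.setReg_reg, Nat.reduceEqDiff, if_true, if_false, eval_cell, eval_reg,
      Store.setReg_arr]
    rfl
  have e15 : coverSet n s4 c = coverSet n s3 c := by
    unfold coverSet; rw [a4 _ (by norm_num)]
  constructor
  · intro x
    rw [e15, h4, den_unpack (n := n) (N := m * m + 1) _ _ _ _ (by rw [r3, h.reg0])
      (by rw [r3, h.reg7]) hc x.2]
    simp only [inCover, row, eval_cnt, T_and, T_lt, T_cell, eval_add, eval_mul, eval_reg,
      Store.setReg_reg, Store.setReg_arr, Nat.reduceEqDiff, OfNat.zero_ne_ofNat, if_false, if_true,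
      r3, h.reg0, card_filter_range]
    rfl
  · intro hs
    rw [e15, v15, a4 13 (by norm_num), a3 13 (by norm_num), a2 13 (by norm_num)]
    set f : ℕ → ℕ := fun w => (Tm.ex 36 9 ((isCover (.reg 25)).and
      ((coverSize (.reg 25)).eq (.reg 37)))).eval ((s.setReg 25 c).setReg 37 w) with hf
    set g : ℕ → ℕ := fun z => ((isCover (.reg 25)).and ((coverSize (.reg 25)).eq
      (.cell 13 (.reg 25)))).eval ((s1.setReg 25 c).setReg 36 z) with hg
    have v13 : s1.arr 13 c = leastBelow f (n + 1) := by
      rw [h1, Stm.den_comp_self _ _ _ _ _ (by rw [h.reg3]; exact hc), eval_ite, if_neg, eval_least]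
      · simp only [Store.setReg_reg, Nat.reduceEqDiff, if_false, h.reg4]
        rfl
      · simp only [Code.split, T_cell, eval_reg, Store.setReg_reg, if_true, Store.setReg_arr,
          h.split c hc]
        exact hs
    have v14 : s2.arr 14 c = leastBelow g (3 ^ L) := by
      rw [h2, Stm.den_comp_self _ _ _ _ _ (by rw [r1, h.reg3]; exact hc), eval_least]
      simp only [Store.setReg_reg, Nat.reduceEqDiff, if_false, r1, hL]
      rfl
    obtain ⟨k1, k2, k3⟩ := leastBelow_best (P := IsCode G D s c) (f := f) (g := g)
      (w := fun z => (decoded G D s c z).ncard) (N := 3 ^ L) (B := n + 1)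
      (fun z _ _ => by
        have := Set.ncard_le_card (decoded G D s c z)
        rw [Nat.card_eq_fintype_card, Fintype.card_fin] at this
        omega) (fun w => by
        refine (T_ex _ _ _ _).trans ?_
        simp only [Store.setReg_reg, Nat.reduceEqDiff, if_false, hL, T_and, T_eq, eval_reg]
        refine exists_congr fun z => and_congr Iff.rfl ?_
        have h' := ((h.setReg (v := 25) (by norm_num) c).setReg (v := 37) (by norm_num) w).setReg
          (v := 36) (by norm_num) z
        rw [T_isCover h' hc (by simp [Store.setReg_reg]),
          eval_coverSize h' hc (by simp [Store.setReg_reg])]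
        simp only [Store.setReg_reg, Nat.reduceEqDiff, if_false, if_true]
        rfl) (fun z _ => by
        refine (T_and _ _ _).trans ?_
        have h' := (c1.setReg (v := 25) (by norm_num) c).setReg (v := 36) (by norm_num) z
        rw [T_isCover h' hc (by simp [Store.setReg_reg]), T_eq,
          eval_coverSize h' hc (by simp [Store.setReg_reg]), ← v13]
        simp only [Store.setReg_reg, Nat.reduceEqDiff, if_false, if_true, eval_cell, eval_reg,
          Store.setReg_arr]
        have e1 := d1 z
        unfold IsCode
        rw [← e1]
        rfl)
    rw [← v14] at k1 k2
    rw [← v13] at k2 k3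
    obtain ⟨g', a, b, hM, hg', hmax⟩ := h.marking hc
    obtain ⟨z, hz, S, hS, hcov, hcard⟩ := hM.toPairs.exists_decode hM.marked_iff_ord hmax
    have hgL : g' ≤ L := by
      have e1 := hLm c hc hs
      have e2 := hM.ncard_marked
      omega
    have hzL : z < 3 ^ L := hz.trans_le (Nat.pow_le_pow_right (by norm_num) hgL)
    have hSd : decoded G D s c z = S := by
      ext x
      exact (hS x).symm
    have hcode : IsCode G D s c z := by
      intro x hx y hy hxy
      rw [hSd]
      exact hcov x hx y hy hxy
    obtain ⟨k4, k5⟩ := k2 (k1.2 ⟨z, hzL, hcode⟩)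
    refine ⟨k4, k5.symm, ?_⟩
    have k6 := k3 z hzL hcode
    simp only [hSd, Set.ncard_coe_finset] at k6
    exact k6.trans (hcard.trans (mm_cutSide_le G D hc hs))

/-- What `covers` computes. -/
structure HasCovers (G : SimpleGraph (Fin n)) (D : BranchDecomposition (Fin n) (Fin m))
    (s : Store) : Prop extends HasCuts G D s where
  rank : ∀ c < m * m + 1, ∀ x : Fin n, s.arr 16 (c * n + x) = {y | y < x ∧ y ∈ coverSet n s c}.ncard
  isCover : ∀ c < m * m + 1, ¬ IsSplit G (cutSide D c) → ∀ a ∈ cutSide D c, ∀ b ∉ cutSide D c,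
    G.Adj a b → a ∈ coverSet n s c ∨ b ∈ coverSet n s c
  size : ∀ c < m * m + 1, ¬ IsSplit G (cutSide D c) → s.arr 13 c = (coverSet n s c).ncard
  size_le : ∀ c < m * m + 1, ¬ IsSplit G (cutSide D c) → s.arr 13 c ≤ D.smWidth G

theorem coverBound_spec (h : HasCovers G D s) : ∃ κ ≤ min (D.smWidth G) n,
    coverBound.eval s = 3 ^ κ ∧
    ∀ c < m * m + 1, ¬ IsSplit G (cutSide D c) → (coverSet n s c).ncard ≤ κ := by
  have key : ∀ κ, (Tm.all 34 3 ((split (.reg 34)).or ((Tm.cell 13 (.reg 34)).le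
      (.reg 38)))).eval (s.setReg 38 κ) ≠ 0 ↔
      ∀ c < m * m + 1, ¬ IsSplit G (cutSide D c) → (coverSet n s c).ncard ≤ κ := by
    intro κ
    refine (T_all _ _ _ _).trans ?_
    simp only [split, T_or, T_le, T_cell, eval_cell, eval_reg, Store.setReg_reg,
      Store.setReg_arr, Nat.reduceEqDiff, if_false, if_true, h.reg3]
    refine forall_congr' fun c => imp_congr_right fun hc => ?_
    rw [h.split c hc, or_iff_not_imp_left]
    exact imp_congr_right fun hs => by rw [h.size c hc hs]
  obtain ⟨h1, h2⟩ := leastBelow_of_lt (N := n + 1) (i := min (D.smWidth G) n)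
    (f := fun κ => (Tm.all 34 3 ((split (.reg 34)).or ((Tm.cell 13 (.reg 34)).le
      (.reg 38)))).eval (s.setReg 38 κ)) (by omega)
    ((key _).2 fun c hc hs => by
      have e1 := h.size_le c hc hs
      rw [h.size c hc hs] at e1
      have e2 := Set.ncard_le_card (coverSet n s c)
      rw [Nat.card_eq_fintype_card, Fintype.card_fin] at e2
      exact le_min e1 e2)
  refine ⟨_, h1, ?_, (key _).1 h2⟩
  rw [coverBound, eval_bind, eval_least, eval_cell, eval_reg, Store.setReg_reg, if_pos rfl, h.reg4]
  exact h.pow _ (h1.trans (min_le_right _ _))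

/-- The cut number `c` with its computed cover. -/
def cutAt (G : SimpleGraph (Fin n)) (D : BranchDecomposition (Fin n) (Fin m)) (s : Store) (c : ℕ) :
    Cut (Fin n) :=
  ⟨cutSide D c, IsSplit G (cutSide D c), coverSet n s c, fun x => s.arr 16 (c * n + x)⟩

/-- A cover vertex has its rank as digit position. Ranks are distinct and leave no gaps, so `3 ^ κ`
numbers contain all combinations of digits. -/
theorem HasCovers.valid (h : HasCovers G D s) {κ : ℕ}
    (hκ : ∀ c < m * m + 1, ¬ IsSplit G (cutSide D c) → (coverSet n s c).ncard ≤ κ)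
    {c : ℕ} (hc : c < m * m + 1) : (cutAt G D s c).Valid G (3 ^ κ) where
  pos_K := Nat.one_le_pow _ _ (by norm_num)
  nbr hs u hu v hv w hw huw := by
    obtain ⟨hu, y, hy, huy⟩ := hu
    obtain ⟨hv, z, hz, hvz⟩ := hv
    have e := hs.2.2 u hu v hv ⟨y, huy, hy⟩ ⟨z, hvz, hz⟩
    have : w ∈ G.neighborSet u ∩ (cutSide D c)ᶜ := ⟨huw, hw⟩
    rw [e] at this
    exact this.1
  isCover hs := h.isCover c hc hs
  inj _ x hx y hy e := by
    have e' : s.arr 16 (c * n + x) = s.arr 16 (c * n + y) := e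
    rw [h.rank c hc, h.rank c hc] at e'
    exact rank_injOn _ hx hy e'
  pos_lt _ x hx := by
    have e : (cutAt G D s c).pos x = s.arr 16 (c * n + x) := rfl
    rw [e, h.rank c hc]
    exact rank_lt _ hx
  pow_le hs := Nat.pow_le_pow_right (by norm_num) (hκ c hc hs)

theorem HasCovers.ctx (h : HasCovers G D s) {κ : ℕ}
    (hκ : ∀ c < m * m + 1, ¬ IsSplit G (cutSide D c) → (coverSet n s c).ncard ≤ κ)
    {Ks : ℕ} (hKs : Ks = 3 ^ κ * (2 * n + 2))
    (hr : ∀ x < 9, r.reg x = s.reg x) (ha : r.arr = s.arr) (h10 : r.reg 10 = 3 ^ κ)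
    (h11 : r.reg 11 = Ks) (h12 : r.reg 12 = (m * m + 1) * Ks)
    (h13 : r.reg 13 = (m * m + 1) * Ks * n) (h14 : r.reg 14 = Ks * Ks * (n + 1))
    (h15 : r.reg 15 = Ks * (Ks * Ks * (n + 1))) (h16 : r.reg 16 = Ks * (Ks * Ks * (n + 1)) * n)
    (h17 : r.reg 17 = Ks * (Ks * Ks * (n + 1)) * Ks) (h18 : r.reg 18 = Ks * Ks * Ks)
    (h19 : r.reg 19 = Ks * Ks * Ks * n) : Ctx n (m * m + 1) (3 ^ κ) Ks G (cutAt G D s) r where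
  reg0 := by rw [hr 0 (by norm_num), h.reg0]
  reg3 := by rw [hr 3 (by norm_num), h.reg3]
  reg4 := by rw [hr 4 (by norm_num), h.reg4]
  reg5 := by rw [hr 5 (by norm_num), h.reg5]
  reg10 := h10
  reg11 := h11
  reg12 := h12
  reg13 := h13
  reg14 := h14
  reg15 := h15
  reg16 := h16
  reg17 := h17
  reg18 := h18
  reg19 := h19
  Ks_eq := by rw [Fintype.card_fin, hKs]
  adj := by rw [ha]; exact h.adj
  side_le := by rw [ha]; exact h.side_le
  side := by rw [ha]; exact h.side
  outer := by rw [ha]; exact h.outer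
  split := by rw [ha]; exact h.split
  cover := by rw [ha]; exact fun c hc x => Iff.rfl
  pow_pos := by
    rw [ha]
    intro c hc x
    refine h.pow _ ?_
    rw [h.rank c hc]
    have := Set.ncard_le_card {y : Fin n | y < x ∧ y ∈ coverSet n s c}
    rwa [Nat.card_eq_fintype_card, Fintype.card_fin] at this
  valid c hc := h.valid hκ hc

end Code
end EDS

namespace EDS

/-! ### The whole program -/

/-- Commands: set a register to the value of a term, or run a statement. -/
inductive Cmd
  | set (x : ℕ) (e : Tm)
  | run (p : Stm)

def Cmd.compile : Cmd → Prog
  | .set x e => .seq (e.compile 60) (.assign x (.reg 60))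
  | .run p => p.compile 60

def Cmd.den (s : Store) : Cmd → Store
  | .set x e => s.setReg x (e.eval s)
  | .run p => p.den s

def Cmd.wf : Cmd → Bool
  | .set x e => x < 25 && e.wf
  | .run p => p.wf

def Cmd.co : Cmd → ℕ
  | .set _ e => e.co + (e.deg + 5)
  | .run p => p.co

def Cmd.qd : Cmd → ℕ
  | .set _ e => e.qd
  | .run p => p.qd

def Cmd.hd : Cmd → ℕ
  | .set _ e => e.hd
  | .run p => p.hd

theorem Cmd.runs {Q H M B : ℕ} (hp : Param Q H M B) (hQ : 1 ≤ Q) (hH : 1 ≤ H) (c : Cmd)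
    (hw : c.wf) {s : Store} (hs : Good Q H M s) :
    ∃ r t, Runs c.compile s r t ∧ Agree 60 r (c.den s) ∧ t ≤ c.co * B * Q ^ c.qd * H ^ c.hd := by
  cases c with
  | run p =>
    obtain ⟨r, t, h1, h2, h3⟩ := p.runs hp 60 s le_rfl hw hs
    exact ⟨r, t, h1, h2, h3.trans (p.tm_le hQ hH B)⟩
  | set x e =>
    simp only [Cmd.wf, Bool.and_eq_true, decide_eq_true_eq] at hw
    obtain ⟨r, t, h1, h2, h3, h4, h5⟩ := Tm.runs hp e 60 s le_rfl hw.2 hs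
    refine ⟨_, _, .seq h1 (.assign _ _ _), ⟨fun y hy => ?_, ?_⟩, ?_⟩
    · simp only [Expr.eval, h2, Cmd.den]
      by_cases hyx : y = x
      · subst hyx; rw [Store.setReg_reg_self, Store.setReg_reg_self]
      · rw [Store.setReg_reg_ne _ _ hyx, Store.setReg_reg_ne _ _ hyx, h3 y hy]
    · exact h4
    · have e1 := hp.size_le (Tm.eval_le hp e s hw.2 hs)
      have e2 := hp.one_le
      simp only [Expr.cost, h2, Cmd.co, Cmd.qd, Cmd.hd]
      have e3 : (e.deg + 5) * B ≤ (e.deg + 5) * B * Q ^ e.qd * H ^ e.hd := by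
        rw [mul_assoc]
        exact Nat.le_mul_of_pos_right _ (Nat.mul_pos (Nat.pow_pos hQ) (Nat.pow_pos hH))
      calc t + (1 + (1 + Nat.size (e.eval s))) ≤ e.tm Q H B + (e.deg + 5) * B := by
            rw [add_mul] at e1 ⊢; omega
        _ ≤ e.co * B * Q ^ e.qd * H ^ e.hd + (e.deg + 5) * B * Q ^ e.qd * H ^ e.hd :=
            add_le_add (e.tm_le hQ hH B) e3
        _ = _ := by ring

def Cmd.prog : List Cmd → Prog
  | [] => .skip
  | c :: cs => .seq c.compile (Cmd.prog cs)

def Cmd.total : List Cmd → ℕ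
  | [] => 1
  | c :: cs => c.co + Cmd.total cs

/-- From the store `s` the commands lead to the store `r`; the registers stay within their
bounds. -/
inductive Chain (Q H : ℕ) : List Cmd → Store → Store → Prop
  | nil (s) : Chain Q H [] s s
  | set {x e cs s r} (v : ℕ) : e.eval s = v → v ≤ Q * H ^ cls x → Chain Q H cs (s.setReg x v) r →
      Chain Q H (.set x e :: cs) s r
  | run {p cs s r} : Chain Q H cs (p.den s) r → Chain Q H (.run p :: cs) s r

theorem Chain.runs {Q H M B q d : ℕ} (hp : Param Q H M B) (hQ : 1 ≤ Q) (hH : 1 ≤ H)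
    (hM : Q * H ^ 4 ≤ M) {cs : List Cmd} {s r : Store} (h : Chain Q H cs s r)
    (hw : ∀ c ∈ cs, c.wf = true) (hq : ∀ c ∈ cs, c.qd ≤ q) (hd : ∀ c ∈ cs, c.hd ≤ d)
    (hs : Good Q H M s) {s' : Store} (hss : Agree 60 s' s) :
    ∃ r' t, Runs (Cmd.prog cs) s' r' t ∧ Agree 60 r' r ∧
      t ≤ Cmd.total cs * (B * Q ^ q * H ^ d) := by
  have pos : 1 ≤ B * Q ^ q * H ^ d :=
    Nat.mul_pos (Nat.mul_pos hp.one_le (Nat.pow_pos hQ)) (Nat.pow_pos hH)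
  have single : ∀ (c : Cmd) (s s' : Store), c.wf = true → c.qd ≤ q → c.hd ≤ d → Good Q H M s →
      Agree 60 s' s → ∃ r' t, Runs c.compile s' r' t ∧ Agree 60 r' (c.den s) ∧
        t ≤ c.co * (B * Q ^ q * H ^ d) := by
    intro c s s' hw hq hd hs hss
    obtain ⟨r', t, h1, h2, h3⟩ := c.runs hp hQ hH hw (hs.agree hss le_rfl)
    refine ⟨r', t, h1, h2.trans ?_, h3.trans ?_⟩
    · cases c with
      | run p => exact p.den_agree hw hss le_rfl
      | set x e =>
        simp only [Cmd.wf, Bool.and_eq_true, decide_eq_true_eq] at hw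
        simp only [Cmd.den, Tm.eval_agree hw.2 hss le_rfl]
        exact hss.setReg x _
    · rw [mul_assoc, mul_assoc, ← mul_assoc B]
      exact Nat.mul_le_mul_left _ (Nat.mul_le_mul (Nat.mul_le_mul_left _
        (Nat.pow_le_pow_right hQ hq)) (Nat.pow_le_pow_right hH hd))
  induction h generalizing s' with
  | nil s => exact ⟨s', 1, .skip _, hss, by simpa [Cmd.total] using pos⟩
  | @set x e cs s r v hv hle _ ih =>
    have hw1 := hw _ (List.mem_cons_self ..)
    obtain ⟨r1, t1, h1, h2, h3⟩ := single _ s s' hw1 (hq _ (List.mem_cons_self ..))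
      (hd _ (List.mem_cons_self ..)) hs hss
    simp only [Cmd.wf, Bool.and_eq_true, decide_eq_true_eq] at hw1
    have hvM : v ≤ M := hle.trans ((Nat.mul_le_mul_left _
      (Nat.pow_le_pow_right hH (cls_le x))).trans hM)
    have hg : Good Q H M (s.setReg x v) := by
      refine ⟨fun y hy => ?_, fun y hy => ?_, hs.arr_le⟩ <;> rw [Store.setReg_reg] <;> split_ifs with hyx
      · rw [hyx]; exact hle
      · exact hs.bound y hy
      · exact hvM
      · exact hs.reg_le y hy
    simp only [Cmd.den, hv] at h2
    obtain ⟨r2, t2, h4, h5, h6⟩ := ih (fun c hc => hw c (List.mem_cons_of_mem _ hc))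
      (fun c hc => hq c (List.mem_cons_of_mem _ hc)) (fun c hc => hd c (List.mem_cons_of_mem _ hc))
      hg h2
    exact ⟨r2, _, .seq h1 h4, h5, by rw [Cmd.total, add_mul]; exact add_le_add h3 h6⟩
  | @run p cs s r _ ih =>
    obtain ⟨r1, t1, h1, h2, h3⟩ := single _ s s' (hw _ (List.mem_cons_self ..))
      (hq _ (List.mem_cons_self ..)) (hd _ (List.mem_cons_self ..)) hs hss
    obtain ⟨r2, t2, h4, h5, h6⟩ := ih (fun c hc => hw c (List.mem_cons_of_mem _ hc))
      (fun c hc => hq c (List.mem_cons_of_mem _ hc)) (fun c hc => hd c (List.mem_cons_of_mem _ hc))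
      (p.den_good hp s (hw _ (List.mem_cons_self ..)) hs).1 h2
    exact ⟨r2, _, .seq h1 h4, h5, by rw [Cmd.total, add_mul]; exact add_le_add h3 h6⟩

theorem Chain.append {Q H : ℕ} {cs ds : List Cmd} {s r w : Store} (h : Chain Q H cs s r)
    (h' : Chain Q H ds r w) : Chain Q H (cs ++ ds) s w := by
  induction h with
  | nil => exact h'
  | set v hv hle _ ih => exact .set v hv hle (ih h')
  | run _ ih => exact .run (ih h')

namespace Code
open Tm

/-- The bounds of loops that depend on the size of the input. -/
def sizes : List Cmd :=
  [.set 2 ((Tm.reg 1).mul (.reg 1)), .set 3 ((Tm.reg 2).add (.const 1)),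
    .set 4 ((Tm.reg 0).add (.const 1)), .set 5 (((Tm.const 2).mul (.reg 0)).add (.const 1)),
    .set 6 ((Tm.reg 2).mul (.reg 1)), .set 7 ((Tm.reg 3).mul (.reg 0)),
    .set 8 ((Tm.reg 0).mul (.reg 0)), .set 20 ((Tm.reg 1).add (.const 1))]

/-- The bounds of loops that depend on the sizes of the covers. -/
def tableSizes : List Cmd :=
  [.set 10 coverBound, .set 11 ((Tm.reg 10).mul (((Tm.const 2).mul (.reg 0)).add (.const 2))),
    .set 12 ((Tm.reg 3).mul (.reg 11)), .set 13 ((Tm.reg 12).mul (.reg 0)),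
    .set 14 (((Tm.reg 11).mul (.reg 11)).mul (.reg 4)), .set 15 ((Tm.reg 11).mul (.reg 14)),
    .set 16 ((Tm.reg 15).mul (.reg 0)), .set 17 ((Tm.reg 15).mul (.reg 11)),
    .set 18 (((Tm.reg 11).mul (.reg 11)).mul (.reg 11)), .set 19 ((Tm.reg 18).mul (.reg 0))]

def solver : List Cmd :=
  sizes ++ ([.run cuts, .set 9 codeBound, .run covers] ++
    (tableSizes ++ [.run tables, .set 0 answer]))

theorem solver_wf : ∀ c ∈ solver, c.wf = true := by decide

/-- The source of the exponent in the theorem. The bound is attained by `select`, where slots count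
three and candidates two, and by `collect`, where entries count one, slots three and the subsets in
Hall's condition one. -/
theorem solver_hd : ∀ c ∈ solver, c.hd ≤ 5 := by decide

def solverDepth : ℕ := (solver.map Cmd.qd).sum

theorem solver_qd : ∀ c ∈ solver, c.qd ≤ solverDepth := fun _ hc =>
  List.single_le_sum (fun _ _ => Nat.zero_le _) _ (List.mem_map_of_mem hc)

variable {n m : ℕ} {G : SimpleGraph (Fin n)} {D : BranchDecomposition (Fin n) (Fin m)}
  {s r : Store}

theorem sizes_chain {a H : ℕ} (ha : 2 * n + 2 * m + 2 ≤ a) (G : SimpleGraph (Fin n))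
    (D : BranchDecomposition (Fin n) (Fin m)) :
    ∃ r, Chain (a ^ 5) H sizes (inputStore G D) r ∧ Input G D r ∧ r.reg 20 = m + 1 ∧
      r.arr = (inputStore G D).arr := by
  have hb : ∀ {x v i : ℕ}, v ≤ a ^ i → i ≤ 5 → cls x = 0 → v ≤ a ^ 5 * H ^ cls x := by
    intro x v i h1 h2 h3
    rw [h3, pow_zero, mul_one]
    exact h1.trans (Nat.pow_le_pow_right (by omega) h2)
  have h2 : m * m ≤ a ^ 2 := by rw [pow_two]; exact Nat.mul_le_mul (by omega) (by omega)
  have h3 : m * m + 1 ≤ a ^ 2 := by nlinarith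
  refine ⟨_, .set (m * m) rfl (hb h2 (by norm_num) rfl)
    (.set (m * m + 1) rfl (hb h3 (by norm_num) rfl)
    (.set (n + 1) rfl (hb (i := 1) (by rw [pow_one]; omega) (by norm_num) rfl)
    (.set (2 * n + 1) rfl (hb (i := 1) (by rw [pow_one]; omega) (by norm_num) rfl)
    (.set (m * m * m) rfl (hb (i := 3) ?_ (by norm_num) rfl)
    (.set ((m * m + 1) * n) rfl (hb (i := 3) ?_ (by norm_num) rfl)
    (.set (n * n) rfl (hb (i := 2) ?_ (by norm_num) rfl)
    (.set (m + 1) rfl (hb (i := 1) (by rw [pow_one]; omega) (by norm_num) rfl) (.nil _)))))))), ?_, rfl, rfl⟩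
  · rw [pow_succ]; exact Nat.mul_le_mul h2 (by omega)
  · rw [pow_succ]; exact Nat.mul_le_mul h3 (by omega)
  · rw [pow_two]; exact Nat.mul_le_mul (by omega) (by omega)
  · constructor <;> rfl

/-- Every bound is a product of factors `a` and `Ks ≤ a * H`. At most five factors `a` occur, which
is why `Q` is chosen as `a ^ 5`; the factors `H` are those counted by `cls`. -/
theorem tableSizes_chain {a H κ : ℕ} (ha : 2 * n + 2 * m + 2 ≤ a) (hH : 3 ^ κ ≤ H)
    (h : HasCovers G D s) (hb : coverBound.eval s = 3 ^ κ)
    (hκ : ∀ c < m * m + 1, ¬ IsSplit G (cutSide D c) → (coverSet n s c).ncard ≤ κ) :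
    ∃ r, Chain (a ^ 5) H tableSizes s r ∧ Ctx n (m * m + 1) (3 ^ κ) (3 ^ κ * (2 * n + 2)) G
      (cutAt G D s) r ∧ r.reg 20 = s.reg 20 ∧ r.reg 2 = m * m ∧ r.arr = s.arr := by
  set Ks := 3 ^ κ * (2 * n + 2) with hKs
  have hK : Ks ≤ a * H := by rw [hKs, mul_comm]; exact Nat.mul_le_mul (by omega) hH
  have bound : ∀ {x v i j : ℕ}, v ≤ a ^ i * H ^ j → i ≤ 5 → cls x = j →
      v ≤ a ^ 5 * H ^ cls x := by
    rintro x v i j h1 h2 rfl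
    exact h1.trans (Nat.mul_le_mul_right _ (Nat.pow_le_pow_right (by omega) h2))
  have h3 : m * m + 1 ≤ a ^ 2 := by nlinarith
  have hn : n ≤ a := by omega
  have hn1 : n + 1 ≤ a := by omega
  have e0 := h.reg0
  have e3 := h.reg3
  have e4 := h.reg4
  refine ⟨_, .set (3 ^ κ) hb (bound (i := 0) (j := 1) (by simpa using hH) (by norm_num) rfl)
    (.set Ks (by simp only [eval_mul, eval_add, eval_reg, eval_const, Store.setReg_reg,
      OfNat.zero_ne_ofNat, if_true, if_false, e0]; rfl)
      (bound (i := 1) (j := 1) (by simpa using hK) (by norm_num) rfl)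
    (.set ((m * m + 1) * Ks) (by simp [eval_mul, eval_reg, Store.setReg_reg, e3])
      (bound (i := 3) (j := 1) ?_ (by norm_num) rfl)
    (.set ((m * m + 1) * Ks * n) (by simp [eval_mul, eval_reg, Store.setReg_reg, e0])
      (bound (i := 4) (j := 1) ?_ (by norm_num) rfl)
    (.set (Ks * Ks * (n + 1)) (by simp [eval_mul, eval_reg, Store.setReg_reg, e4])
      (bound (i := 3) (j := 2) ?_ (by norm_num) rfl)
    (.set (Ks * (Ks * Ks * (n + 1))) (by simp [eval_mul, eval_reg, Store.setReg_reg])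
      (bound (i := 4) (j := 3) ?_ (by norm_num) rfl)
    (.set (Ks * (Ks * Ks * (n + 1)) * n) (by simp [eval_mul, eval_reg, Store.setReg_reg, e0])
      (bound (i := 5) (j := 3) ?_ (by norm_num) rfl)
    (.set (Ks * (Ks * Ks * (n + 1)) * Ks) (by simp [eval_mul, eval_reg, Store.setReg_reg])
      (bound (i := 5) (j := 4) ?_ (by norm_num) rfl)
    (.set (Ks * Ks * Ks) (by simp [eval_mul, eval_reg, Store.setReg_reg])
      (bound (i := 3) (j := 3) ?_ (by norm_num) rfl)
    (.set (Ks * Ks * Ks * n) (by simp [eval_mul, eval_reg, Store.setReg_reg, e0])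
      (bound (i := 4) (j := 3) ?_ (by norm_num) rfl) (.nil _)))))))))), ?_, rfl, h.reg2, rfl⟩
  · calc _ ≤ a ^ 2 * (a * H) := by gcongr
      _ = _ := by ring
  · calc _ ≤ a ^ 2 * (a * H) * a := by gcongr
      _ = _ := by ring
  · calc _ ≤ a * H * (a * H) * a := by gcongr
      _ = _ := by ring
  · calc _ ≤ a * H * (a * H * (a * H) * a) := by gcongr
      _ = _ := by ring
  · calc _ ≤ a * H * (a * H * (a * H) * a) * a := by gcongr
      _ = _ := by ring
  · calc _ ≤ a * H * (a * H * (a * H) * a) * (a * H) := by gcongr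
      _ = _ := by ring
  · calc _ ≤ a * H * (a * H) * (a * H) := by gcongr
      _ = _ := by ring
  · calc _ ≤ a * H * (a * H) * (a * H) * a := by gcongr
      _ = _ := by ring
  · apply h.ctx hκ hKs
    case hr =>
      intro x hx
      iterate 10 rw [Store.setReg_reg_ne _ _ (by omega)]
    case ha => rfl
    all_goals simp only [Store.setReg_reg, Nat.reduceEqDiff, if_true, if_false]

theorem solver_chain {a : ℕ} (ha : 2 * n + 2 * m + 2 ≤ a) (G : SimpleGraph (Fin n))
    (D : BranchDecomposition (Fin n) (Fin m)) :
    ∃ r, Chain (a ^ 5) (3 ^ min (D.smWidth G) n) solver (inputStore G D) r ∧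
      IsLeast {b | HasEdgeDominatingSet G b} (r.reg 0) := by
  obtain ⟨s1, c1, h1, e1, f1⟩ := sizes_chain (H := 3 ^ min (D.smWidth G) n) ha G D
  have h2 : HasCuts G D (cuts.den s1) := cuts_spec h1 fun i => by rw [f1]; rfl
  have e2 : (cuts.den s1).reg 20 = m + 1 := by rw [(cuts.den_frame s1).1 20 (by decide), e1]
  have z2 : ∀ i, (cuts.den s1).arr 17 i = 0 := fun i => by
    rw [(cuts.den_frame s1).2 17 (by decide), f1]; rfl
  obtain ⟨L, hL, hcode, hLm⟩ := codeBound_spec h2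
  have h3 : HasCuts G D ((cuts.den s1).setReg 9 (3 ^ L)) := h2.setReg le_rfl _
  obtain ⟨h4, h5⟩ := covers_spec h3 (Store.setReg_reg_self _ _ _) hLm
  set s2 := covers.den ((cuts.den s1).setReg 9 (3 ^ L)) with hs2
  have h6 : HasCovers G D s2 := ⟨h4, fun c hc => (h5 c hc).1, fun c hc hs => ((h5 c hc).2 hs).1,
    fun c hc hs => ((h5 c hc).2 hs).2.1, fun c hc hs => ((h5 c hc).2 hs).2.2⟩
  have e3 : s2.reg 20 = m + 1 := by
    rw [hs2, (covers.den_frame _).1 20 (by decide), Store.setReg_reg, if_neg (by norm_num), e2]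
  have z3 : ∀ i, s2.arr 17 i = 0 := fun i => by
    rw [hs2, (covers.den_frame _).2 17 (by decide)]; exact z2 i
  obtain ⟨κ, hκ, hcover, hκm⟩ := coverBound_spec h6
  obtain ⟨s3, c3, h7, e4, g3, f3⟩ := tableSizes_chain ha
    (Nat.pow_le_pow_right (by norm_num) hκ) h6 hcover hκm
  obtain ⟨t1, t2, t3⟩ := tables_spec D (fun A hA => exists_cutSide D A hA) h7
    fun i => by rw [f3, z3]
  have g4 : (tables.den s3).reg 2 = m * m := by rw [(tables.den_frame s3).1 2 (by decide), g3]
  have hu : cutSide D (m * m) = Set.univ := cutSide_top D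
  have hans := answer_spec t1 t2 (by rw [g4]; omega) (by rw [g4]; exact hu) (by
    rw [g4]
    refine t3 Set.univ ?_ (m * m) (by omega) hu
    have hbu := D.built_univ
    rwa [Nat.card_eq_fintype_card, Fintype.card_fin, ← e3, ← e4] at hbu)
  refine ⟨_, c1.append ((Chain.run (.set (3 ^ L) hcode ?_ (.run (.nil _)))).append
    (c3.append (.run (.set _ rfl ?_ (.nil _))))), hans⟩
  · rw [show cls 9 = 1 from rfl, pow_one]
    exact (Nat.pow_le_pow_right (by norm_num) hL).trans
      (Nat.le_mul_of_pos_left _ (Nat.pow_pos (by omega)))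
  · rw [show cls 0 = 0 from rfl, pow_zero, mul_one]
    have b1 : answer.eval (tables.den s3) ≤ 2 * n + 1 := by
      rw [answer, eval_div, eval_least, t1.reg5]
      exact (Nat.div_le_self _ _).trans (leastBelow_le _ _)
    calc _ ≤ a ^ 1 := by rw [pow_one]; omega
      _ ≤ a ^ 5 := Nat.pow_le_pow_right (by omega) (by norm_num)

theorem good_inputStore {Q H M : ℕ} (hn : n ≤ Q) (hm : m ≤ Q) (h1 : 1 ≤ Q) (hM : Q ≤ M)
    (G : SimpleGraph (Fin n)) (D : BranchDecomposition (Fin n) (Fin m)) :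
    Good Q H M (inputStore G D) := by
  have hadj : ∀ {k : ℕ} (T : SimpleGraph (Fin k)) (i : ℕ), adjacencyArray T i ≤ M := by
    intro k T i
    unfold adjacencyArray
    split_ifs <;> omega
  refine ⟨fun x _ => ?_, fun x _ => ?_, fun a i => ?_⟩
  · simp only [inputStore]
    split_ifs with h0 h1
    · subst h0; simpa [cls] using hn
    · subst h1; simpa [cls] using hm
    · exact Nat.zero_le _
  · simp only [inputStore]
    split_ifs <;> omega
  · simp only [inputStore]
    split_ifs
    · exact hadj _ _
    · exact hadj _ _
    · unfold leafArray
      split_ifs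
      · exact (Fin.is_lt _).le.trans (hn.trans hM)
      · exact Nat.zero_le _
    · exact Nat.zero_le _

end Code
end EDS

/-! ### The bound on the running time. -/

theorem mainTheorem5 :
    ∃ (P : EDS.Prog) (poly : Polynomial ℕ),
      ∀ (n m k : ℕ) (G : SimpleGraph (Fin n)) (D : EDS.BranchDecomposition (Fin n) (Fin m)),
        D.smWidth G = k →
        ∃ (r : EDS.Store) (t : ℕ),
          EDS.Runs P (EDS.inputStore G D) r t ∧
          IsLeast {b : ℕ | EDS.HasEdgeDominatingSet G b} (r.reg 0) ∧
          t ≤ 3 ^ (5 * k) * poly.eval (n + m) := by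
  -- Its value at `n + m` is `a ^ 5`, the polynomial factor `Q` in the loop bounds.
  let q : Polynomial ℕ := (2 * Polynomial.X + 2) ^ 5
  refine ⟨EDS.Cmd.prog EDS.Code.solver, Polynomial.C (EDS.Cmd.total EDS.Code.solver) *
    ((12 * q + 1) * q ^ EDS.Code.solverDepth), ?_⟩
  rintro n m k G D rfl
  set a := 2 * n + 2 * m + 2 with ha
  set Q := a ^ 5 with hQ
  -- The minimum with `n` makes the bit lengths of all loop bounds polynomial in the input; the
  -- other half of the minimum gives the factor `3 ^ (5 * k)`.
  set H := 3 ^ min (D.smWidth G) n with hH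
  have haQ : a ≤ Q := Nat.le_self_pow (by norm_num) a
  have hH1 : 1 ≤ H := Nat.one_le_pow _ _ (by norm_num)
  have hHQ : H ≤ 3 ^ Q := Nat.pow_le_pow_right (by norm_num) ((min_le_right _ _).trans (by omega))
  have hM : Q * H ^ 4 ≤ 3 ^ (6 * Q) := by
    calc Q * H ^ 4 ≤ 3 ^ Q * (3 ^ Q) ^ 4 :=
          Nat.mul_le_mul (Nat.lt_pow_self (by norm_num)).le (Nat.pow_le_pow_left hHQ 4)
      _ = 3 ^ (5 * Q) := by ring
      _ ≤ _ := Nat.pow_le_pow_right (by norm_num) (by omega)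
  -- Registers are at most `Q * H ^ 4 ≤ 3 ^ (5 * Q)`, so the bound `3 ^ (6 * Q)` has room to spare.
  -- It is less than `4 ^ (6 * Q)` and so has at most `12 * Q` bits.
  have hp : EDS.Param Q H (3 ^ (6 * Q)) (12 * Q + 1) := by
    refine ⟨?_, Nat.pow_le_pow_right (by norm_num) (by omega), Nat.lt_succ_of_le (Nat.size_le.2 ?_)⟩
    · calc 2 ≤ 3 ^ 1 := by norm_num
        _ ≤ _ := Nat.pow_le_pow_right (by norm_num) (by omega)
    · calc 3 ^ (6 * Q) < 4 ^ (6 * Q) := Nat.pow_lt_pow_left (by norm_num) (by omega)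
        _ = 2 ^ (12 * Q) := by rw [show (4 : ℕ) = 2 ^ 2 by norm_num, ← pow_mul]; ring_nf
  obtain ⟨w, hw, hleast⟩ := EDS.Code.solver_chain ha.ge G D
  obtain ⟨r, t, h1, h2, h3⟩ := hw.runs hp (by omega) hH1 hM EDS.Code.solver_wf
    EDS.Code.solver_qd EDS.Code.solver_hd (EDS.Code.good_inputStore (by omega) (by omega) (by omega)
      ((Nat.le_mul_of_pos_right _ (Nat.pow_pos hH1)).trans hM) G D) (EDS.Agree.refl 60 _)
  refine ⟨r, t, h1, by rw [h2.reg 0 (by norm_num)]; exact hleast, h3.trans ?_⟩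
  have hq : q.eval (n + m) = Q := by
    simp only [q, Polynomial.eval_pow, Polynomial.eval_add, Polynomial.eval_mul,
      Polynomial.eval_X, Polynomial.eval_ofNat, hQ, ha]
    ring
  have hH5 : H ^ 5 ≤ 3 ^ (5 * D.smWidth G) := by
    rw [hH, ← pow_mul]
    exact Nat.pow_le_pow_right (by norm_num) (by have := min_le_left (D.smWidth G) n; omega)
  simp only [Polynomial.eval_mul, Polynomial.eval_add, Polynomial.eval_pow, Polynomial.eval_C,
    Polynomial.eval_ofNat, Polynomial.eval_one, hq]
  calc _ = H ^ 5 * (EDS.Cmd.total EDS.Code.solver *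
        ((12 * Q + 1) * Q ^ EDS.Code.solverDepth)) := by ring
    _ ≤ _ := Nat.mul_le_mul_right _ hH5
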